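/- Let $G$ be a finite connected simple graph with a rotation system, i.e. a cyclic (counterclockwise) order of the neighbours of each vertex; it determines a cellular embedding of $G$ on an orientable surface $\mathcal S$ of genus $g$, where $|V|-|E|+|F|=2-2g$ and $F$ is the set of faces. Assume $g\ge 1$ and put $n=|V|+|E|+|F|$. A polygonal schema of $G$ with common vertex $p$ is a set of $2g$ closed walks of positive length in $G$ from $p$ to $p$, together with an order of the strands that run along each edge. Walks may repeat and share vertices and edges, but, drawn in a thin neighbourhood of $G$ with the prescribed orders of parallel strands, they must not cross and must be disjoint except at the base point $p$; and cutting $\mathcal S$ along them must give a topological disk. This disk is a polygon with $4g$ sides, two copies of each walk. The schema is canonical if its walks can be paired up and oriented as $a_1,b_1,\dots,a_g,b_g$ so that the sides of the polygon in counterclockwise order are $a_1b_1a_1^{-1}b_1^{-1}\cdots a_gb_ga_g^{-1}b_g^{-1}$. Let $G^*$ be the graph obtained from $G$ by the cutting: an edge carrying $k$ strands becomes $k+1$ parallel edges, and a vertex becomes one vertex for each region into which the walks cut a small disk around it (at the base point, the walks start and end at the centre of this disk). The schema is chord-free if no edge of $G^*$ joins two vertices on the same side of the polygon that are not consecutive on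 this side. **Theorem.** There is an algorithm that, given such an embedded graph $G$ and a canonical polygonal schema $\mathcal P$ of $G$ with common vertex $p$, finds a chord-free polygonal schema $\mathcal P^*$ of $G$ with the same common vertex $p$ in $O(gn)$ time (on a unit-cost random access machine with addition and subtraction, with words of $O(\log L)$ bits, where $L\ge 2$ is the length of the input; the implied constants are absolute). -/

import Mathlib

/-! ## Random access machines with a step count -/

namespace RAM

/-- Instructions of a random access machine with unit cost per instruction. The machine has registers
`R 0, R 1, …`, an indirectly addressed work memory `M`, a read-only random-access input `x` and a
write-only output list. The only arithmetic is addition and truncated subtraction. -/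
inductive Instr : Type
  /-- `R d := c` -/
  | const (d c : ℕ)
  /-- `R d := R a + R b` -/
  | add (d a b : ℕ)
  /-- `R d := R a - R b`, truncated at `0` -/
  | sub (d a b : ℕ)
  /-- `R d := M[R a]` -/
  | load (d a : ℕ)
  /-- `M[R a] := R b` -/
  | store (a b : ℕ)
  /-- `R d := x[R a]`, and `0` beyond the end of the input -/
  | input (d a : ℕ)
  /-- append `R a` to the output -/
  | output (a : ℕ)
  /-- if `R a = 0`, continue at instruction number `t` -/
  | jumpZero (a t : ℕ)

/-- A program is a finite list of instructions; it halts when the program counter leaves the list. -/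
abbrev Program : Type := List Instr

structure Config : Type where
  pc : ℕ
  reg : ℕ → ℕ
  mem : ℕ → ℕ
  out : List ℕ

def Config.init : Config := ⟨0, fun _ => 0, fun _ => 0, []⟩

/-- The effect of one instruction. -/
def Instr.exec (x : List ℕ) (s : Config) : Instr → Config
  | .const d c => { s with pc := s.pc + 1, reg := Function.update s.reg d c }
  | .add d a b => { s with pc := s.pc + 1, reg := Function.update s.reg d (s.reg a + s.reg b) }
  | .sub d a b => { s with pc := s.pc + 1, reg := Function.update s.reg d (s.reg a - s.reg b) }
  | .load d a => { s with pc := s.pc + 1, reg := Function.update s.reg d (s.mem (s.reg a)) }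
  | .store a b => { s with pc := s.pc + 1, mem := Function.update s.mem (s.reg a) (s.reg b) }
  | .input d a => { s with pc := s.pc + 1, reg := Function.update s.reg d (x.getD (s.reg a) 0) }
  | .output a => { s with pc := s.pc + 1, out := s.out ++ [s.reg a] }
  | .jumpZero a t => { s with pc := if s.reg a = 0 then t else s.pc + 1 }

/-- One step of the machine; a halted machine stays as it is. -/
def step (prog : Program) (x : List ℕ) (s : Config) : Config :=
  match prog[s.pc]? with
  | none => s
  | some ins => ins.exec x s

/-- The configuration after `t` steps on input `x`. -/
def run (prog : Program) (x : List ℕ) (t : ℕ) : Config := (step prog x)^[t] Config.init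

/-- On input `x` the program halts after at most `T` steps with output `y`, and no register or
memory cell ever holds a number larger than `W`. -/
def Computes (prog : Program) (x y : List ℕ) (T W : ℕ) : Prop :=
  ∃ t ≤ T, prog.length ≤ (run prog x t).pc ∧ (run prog x t).out = y ∧
    ∀ s ≤ t, ∀ r, (run prog x s).reg r ≤ W ∧ (run prog x s).mem r ≤ W

end RAM

/-! ## Combinatorial embeddings -/

/-- A rotation system: for every vertex, the counterclockwise cyclic order of its neighbours, written
as a list that starts at an arbitrary neighbour. -/
structure RotationSystem {N : ℕ} (G : SimpleGraph (Fin N)) where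
  nbrs : Fin N → List (Fin N)
  nodup : ∀ v, (nbrs v).Nodup
  mem_iff : ∀ v w, w ∈ nbrs v ↔ G.Adj v w

namespace RotationSystem

variable {N : ℕ} {G : SimpleGraph (Fin N)} (R : RotationSystem G)

/-- The dart that follows `d` counterclockwise around its origin. -/
def next (d : G.Dart) : G.Dart :=
  ⟨(d.fst, (R.nbrs d.fst).next d.snd ((R.mem_iff _ _).2 d.adj)),
    (R.mem_iff _ _).1 (List.next_mem _ _ ((R.mem_iff _ _).2 d.adj))⟩

/-- The faces of the embedding: the cycles of darts that are obtained by arriving at a vertex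
along one dart and leaving it along the next dart of the rotation. -/
def Face : Type := Quot fun d d' : G.Dart => d' = R.next d.symm

/-- For a connected graph: the embedding is on the orientable surface of genus `g`. -/
def HasGenus (g : ℕ) : Prop :=
  (N : ℤ) - (Nat.card G.edgeSet : ℤ) + (Nat.card R.Face : ℤ) = 2 - 2 * (g : ℤ)

/-- The combinatorial complexity: the number of vertices, edges and faces. -/
noncomputable def size : ℕ := N + Nat.card G.edgeSet + Nat.card R.Face

/-- The number of vertices, followed by the degree and the rotation of each vertex. -/
def encode : List ℕ :=
  N :: (List.finRange N).flatMap fun v => (R.nbrs v).length :: (R.nbrs v).map Fin.val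

end RotationSystem

/-! ## Systems of loops drawn along the edges of an embedded graph -/

/-- The steps of `c` closed walks: the pairs of a walk and a position of a dart on it. -/
abbrev LoopStep {N : ℕ} {G : SimpleGraph (Fin N)} {p : Fin N} {c : ℕ}
    (loop : Fin c → G.Walk p p) : Type :=
  Σ i : Fin c, Fin (loop i).length

namespace LoopStep

variable {N : ℕ} {G : SimpleGraph (Fin N)} {p : Fin N} {c : ℕ}

/-- The dart that a step traverses. -/
def dart {loop : Fin c → G.Walk p p} (s : LoopStep loop) : G.Dart :=
  (loop s.1).darts[s.2.1]'(by rw [SimpleGraph.Walk.length_darts]; exact s.2.2)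

/-- The number of times the walks traverse the edge `e`, in either direction. -/
def load (loop : Fin c → G.Walk p p) (e : Sym2 (Fin N)) : ℕ :=
  (Finset.univ.filter fun s : LoopStep loop => s.dart.edge = e).card

end LoopStep

/-- A system of `c` closed walks in `G` from `p` to `p`. Walks may repeat vertices and edges, and
different walks may share them; the walks are thought of as drawn in a thin neighbourhood of `G`,
where the strands that run along one edge are parallel and numbered by consecutive lanes. Lanes are
counted from `0` in counterclockwise order as seen from the smaller endpoint of the edge. -/
structure LoopSystem {N : ℕ} (G : SimpleGraph (Fin N)) (p : Fin N) (c : ℕ) where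
  loop : Fin c → G.Walk p p
  lane : LoopStep loop → ℕ
  lane_lt : ∀ s, lane s < LoopStep.load loop s.dart.edge
  lane_inj : ∀ s t, s.dart.edge = t.dart.edge → lane s = lane t → s = t

namespace LoopSystem

variable {N : ℕ} {G : SimpleGraph (Fin N)} {p : Fin N} {c : ℕ} (P : LoopSystem G p c)

abbrev Step : Type := LoopStep P.loop

/-- The number of strands along an edge. -/
def load (e : Sym2 (Fin N)) : ℕ := LoopStep.load P.loop e

/-- The number of walks, followed for each walk by its length and, for each of its steps, the vertex
at which the step starts and its lane. -/
def encode : List ℕ :=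
  c :: (List.finRange c).flatMap fun i =>
    (P.loop i).length :: (List.finRange (P.loop i).length).flatMap fun k =>
      [((LoopStep.dart (⟨i, k⟩ : P.Step)).fst : ℕ), P.lane ⟨i, k⟩]

/-- The counterclockwise index, seen from the origin of `d`, of the strand in lane `l` of the edge
of `d`. -/
def index (d : G.Dart) (l : ℕ) : ℕ :=
  if d.fst < d.snd then l else P.load d.edge - 1 - l

theorem index_lt (d : G.Dart) {l : ℕ} (h : l < P.load d.edge) : P.index d l < P.load d.edge := by
  unfold index
  split_ifs <;> omega

/-! ### Non-crossing -/

/-- The two ends of the strand of a step: `(s, true)` is at the origin of the step, and `(s, false)`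
is at its target. -/
abbrev End : Type := P.Step × Bool

/-- The dart along which a strand leaves the vertex at one of its ends. -/
def endDart (a : P.End) : G.Dart :=
  if a.2 then LoopStep.dart a.1 else (LoopStep.dart a.1).symm

/-- The position of a strand end in the counterclockwise order around its vertex (cut open at the
beginning of the list of neighbours): first by the edge, then by the index on the edge. -/
def endPos (R : RotationSystem G) (a : P.End) : ℕ ×ₗ ℕ :=
  toLex ((R.nbrs (P.endDart a).fst).idxOf (P.endDart a).snd, P.index (P.endDart a) (P.lane a.1))

/-- A walk passes through a vertex from the end `a` of a strand to the end `b` of the next one. -/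
def Pass (a b : P.End) : Prop :=
  ∃ (i : Fin c) (k : ℕ) (hk : k + 1 < (P.loop i).length),
    a = (⟨i, ⟨k, by omega⟩⟩, false) ∧ b = (⟨i, ⟨k + 1, hk⟩⟩, true)

/-- The ends of strands at which a walk starts or finishes at the base point. -/
def Terminal (a : P.End) : Prop :=
  (a.2 = true ∧ a.1.2.1 = 0) ∨ (a.2 = false ∧ a.1.2.1 + 1 = (P.loop a.1.1).length)

/-- `x` lies strictly between `a` and `b` in the order around their vertex. -/
def Between (R : RotationSystem G) (a b x : P.End) : Prop :=
  min (P.endPos R a) (P.endPos R b) < P.endPos R x ∧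
    P.endPos R x < max (P.endPos R a) (P.endPos R b)

/-- The walks can be drawn without crossings and disjoint except at the base point: inside a small
disk around a vertex, two passes do not interleave, and a pass does not separate two of the strand
ends that run to the base point. -/
def NonCrossing (R : RotationSystem G) : Prop :=
  ∀ a b x y : P.End, P.Pass a b → P.Pass x y ∨ (P.Terminal x ∧ P.Terminal y) →
    (P.endDart x).fst = (P.endDart a).fst → (P.Between R a b x ↔ P.Between R a b y)

/-! ### Cutting the surface along the loops

An edge with `k` strands is cut into `k + 1` parallel copies, one in each gap between consecutive
strands or outside the outermost ones. A small disk around a vertex is cut by the passes, and at the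
base point also by the strands that end there, into regions; each region is a vertex of the
cut graph, a copy of the vertex of `G`. The faces are not affected. -/

/-- A directed copy of an edge after cutting: a dart with the number of one of its gaps, counted
counterclockwise as seen from the origin of the dart; gap `j` comes just before strand `j`. -/
structure Gap where
  dart : G.Dart
  num : ℕ
  num_le : num ≤ P.load dart.edge

variable {P}

/-- The same copy of the edge in the other direction. -/
def Gap.rev (γ : P.Gap) : P.Gap :=
  ⟨γ.dart.symm, P.load γ.dart.edge - γ.num, by
    rw [SimpleGraph.Dart.edge_symm]; exact Nat.sub_le _ _⟩

variable (P)

/-- The copy of the edge that lies along a step, on its left (`true`) or on its right (`false`),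
directed as the step. -/
def stepGap (s : P.Step) : Bool → P.Gap
  | true => ⟨LoopStep.dart s, P.index (LoopStep.dart s) (P.lane s) + 1,
      P.index_lt _ (P.lane_lt s)⟩
  | false => ⟨LoopStep.dart s, P.index (LoopStep.dart s) (P.lane s),
      (P.index_lt _ (P.lane_lt s)).le⟩

/-- Two directed edge copies leave the same region of a vertex: they bound the same corner of a face,
or a walk that passes through the vertex has both of them on its left, or both on its right. -/
inductive RegionStep (R : RotationSystem G) : P.Gap → P.Gap → Prop
  | corner (d : G.Dart) :
      RegionStep R ⟨d, P.load d.edge, le_rfl⟩ ⟨R.next d, 0, Nat.zero_le _⟩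
  | pass (i : Fin c) (k : ℕ) (hk : k + 1 < (P.loop i).length) (left : Bool) :
      RegionStep R (P.stepGap ⟨i, ⟨k, by omega⟩⟩ left).rev (P.stepGap ⟨i, ⟨k + 1, hk⟩⟩ left)

/-- The vertices of the graph that is cut open along the loops. -/
def Region (R : RotationSystem G) : Type := Quot (P.RegionStep R)

/-- The region from which a directed edge copy leaves. -/
def region (R : RotationSystem G) (γ : P.Gap) : P.Region R := Quot.mk _ γ

/-- The edges of the graph that is cut open along the loops. -/
abbrev CutEdge : Type := Σ e : G.edgeSet, Fin (P.load e + 1)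

/-- The graph that is cut open along the loops. -/
def cutGraph (R : RotationSystem G) : SimpleGraph (P.Region R) :=
  SimpleGraph.fromRel fun r s => ∃ γ : P.Gap, P.region R γ = r ∧ P.region R γ.rev = s

/-- Cutting the surface along the loops gives a disk. The regions, edge copies and faces are
the cells of the surface after cutting (which has a nonempty boundary as soon as there is a loop of
positive length), and a compact connected surface with nonempty boundary and Euler characteristic
`1` is a disk. -/
def CutsToDisk (R : RotationSystem G) : Prop :=
  (P.cutGraph R).Connected ∧
    (Nat.card (P.Region R) : ℤ) - (Nat.card P.CutEdge : ℤ) + (Nat.card R.Face : ℤ) = 1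

/-- A polygonal schema with common vertex `p`: non-crossing closed walks of positive length through
`p` such that cutting along them gives a disk. -/
structure IsPolygonalSchema (R : RotationSystem G) : Prop where
  length_pos : ∀ i, 0 < (P.loop i).length
  nonCrossing : P.NonCrossing R
  cutsToDisk : P.CutsToDisk R

/-! ### The sides of the polygon -/

/-- The `k`-th vertex, in the direction of the walk, on the left (`true`) or right (`false`) copy of
the `i`-th walk in the cut graph. -/
def sideVertex (R : RotationSystem G) (h : ∀ i, 0 < (P.loop i).length) (i : Fin c) (left : Bool)
    (k : ℕ) : P.Region R :=
  if hk : k < (P.loop i).length then P.region R (P.stepGap ⟨i, ⟨k, hk⟩⟩ left)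
  else P.region R
    (P.stepGap ⟨i, ⟨(P.loop i).length - 1, Nat.sub_lt (h i) Nat.one_pos⟩⟩ left).rev

/-- No side of the polygon has a chord: in the cut graph, two vertices of the same copy of a walk
are joined by an edge only if they are consecutive on it. -/
def ChordFree (R : RotationSystem G) (h : ∀ i, 0 < (P.loop i).length) : Prop :=
  ∀ (i : Fin c) (left : Bool) (k l : ℕ), k ≤ (P.loop i).length → l ≤ (P.loop i).length →
    (P.cutGraph R).Adj (P.sideVertex R h i left k) (P.sideVertex R h i left l) →
    l = k + 1 ∨ k = l + 1

/-- The polygon corner at which a side starts, when the boundary of the disk is traversed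
counterclockwise. The side `(i, true)` is the left copy of the `i`-th walk in the direction of the
walk, and `(i, false)` is its right copy in the opposite direction. -/
def sideStart (R : RotationSystem G) (h : ∀ i, 0 < (P.loop i).length) (s : Fin c × Bool) :
    P.Region R :=
  P.sideVertex R h s.1 s.2 (if s.2 then 0 else (P.loop s.1).length)

/-- The polygon corner at which a side finishes. -/
def sideFinish (R : RotationSystem G) (h : ∀ i, 0 < (P.loop i).length) (s : Fin c × Bool) :
    P.Region R :=
  P.sideVertex R h s.1 s.2 (if s.2 then (P.loop s.1).length else 0)

/-- The other copy of the same walk, which is traversed in the opposite direction. -/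
def sideInv (s : Fin c × Bool) : Fin c × Bool := (s.1, !s.2)

end LoopSystem

/-- A canonical polygonal schema: the `2 g` loops can be paired up and oriented so that the sides of
the polygon in counterclockwise order are
`a₁ b₁ a₁⁻¹ b₁⁻¹ a₂ b₂ a₂⁻¹ b₂⁻¹ … a_g b_g a_g⁻¹ b_g⁻¹`. -/
structure LoopSystem.IsCanonicalSchema {N : ℕ} {G : SimpleGraph (Fin N)} {p : Fin N} {g : ℕ}
    (P : LoopSystem G p (2 * g)) (R : RotationSystem G) : Prop where
  isPolygonalSchema : P.IsPolygonalSchema R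
  sides : ∃ a b : Fin g → Fin (2 * g) × Bool,
    Function.Bijective (Sum.elim (fun j => (a j).1) (fun j => (b j).1)) ∧
    ∀ j,
      P.sideFinish R isPolygonalSchema.length_pos (a j) =
        P.sideStart R isPolygonalSchema.length_pos (b j) ∧
      P.sideFinish R isPolygonalSchema.length_pos (b j) =
        P.sideStart R isPolygonalSchema.length_pos (sideInv (a j)) ∧
      P.sideFinish R isPolygonalSchema.length_pos (sideInv (a j)) =
        P.sideStart R isPolygonalSchema.length_pos (sideInv (b j)) ∧
      P.sideFinish R isPolygonalSchema.length_pos (sideInv (b j)) =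
        P.sideStart R isPolygonalSchema.length_pos (a (finRotate g j))

/-! The algorithm ignores the schema that it is given and constructs a system of loops from the embedded
graph alone. It is a variant of the tree-cotree construction.

Let `T` be a breadth-first spanning tree of `G` with root `p`, so that the levels of the endpoints of any
edge differ by at most `1`. The edges outside of `T` connect all faces of the embedding
(`TreeLoops.linked_not_inTree`). They contain a spanning tree `C` of the dual graph, and by Euler's formula
`2 * g` edges `x i` are left over (`TreeLoops.length_outside`). The loop `i` runs from `p` through `T` to
`x i`, along `x i`, and back through `T`. All strands along an edge of the tree run from a vertex to its
parent, and numbering the ends of the loops counterclockwise around the tree orders the strands such that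
the loops do not cross (`TreeLoops.Slots`, `TreeLoops.Drawn.nonCrossing`).

Cutting along the loops gives a disk: the surface that is cut open is connected, and the order of the
strands gives a lower bound for the number of its vertices (`TreeLoops.Drawn.sum_par_le_card_region`), by
which its Euler characteristic is at least `1`. It is at most `1` by linear algebra over the field with two
elements (`LoopSystem.euler_le`): the coboundary map on functions on the vertices has a kernel of
dimension at most `1`, its range lies in the kernel of the summation around the faces, and this summation
is surjective. If the Euler characteristic is `1`, it follows also that every dual cycle of the cut graph
is a coboundary.

For the chords, weigh an edge by the total level of its endpoints. For each `i` in turn, `x i` is exchanged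
for an edge of minimal weight on the cycle that it closes with `C` in the dual graph
(`Structured.Cotree.exchange`). Afterwards each `x i` lies on a dual cycle that otherwise uses only edges of
`C`, all of at least the weight of `x i`; this is not destroyed by later exchanges. A chord of a side of the
polygon has to join the two halves of the side, because the level is monotone on each half and changes by
at most `1` along the chord; and its weight is smaller than that of `x i`. The dual cycle
of `x i` is not cut by the loops except at `x i`, hence it separates the disk, with the two halves of the
side in different parts. So the chord belongs to this cycle, which contradicts its weight
(`TreeLoops.Drawn.chordFree`).

The searches are linear, there are `2 * g` exchanges with one search each, and each loop has at most linear
length; the total time is `O(gn)`. The program is written in a small structured language with registers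
and arrays, whose statements are verified by a calculus of weakest preconditions (`Structured.WP`). It is
compiled to the random access machine with a constant slowdown (`Structured.computes_of_WP`). -/

/-! ### A structured language over random access machines -/

namespace Structured

/-- A state of the structured language: registers, a family of arrays, the output, and the number of
ticks that have been spent. -/
structure St : Type where
  reg : ℕ → ℕ
  arr : ℕ → ℕ → ℕ
  out : List ℕ
  time : ℕ

/-- The initial state, in which everything is zero. -/
def St.init : St := ⟨fun _ => 0, fun _ _ => 0, [], 0⟩

/-- One tick passes. -/
def St.tick (σ : St) : St := { σ with time := σ.time + 1 }

/-- The basic operations. `inc` adds a constant of the program; it is separated from `plus` because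
it makes numbers grow only by a constant per tick. -/
inductive Op : Type
  | const (d c : ℕ)
  | inc (d a c : ℕ)
  | plus (d a b : ℕ)
  | minus (d a b : ℕ)
  | get (d k a : ℕ)
  | put (k a b : ℕ)
  | inp (d a : ℕ)
  | emit (a : ℕ)

/-- The effect of an operation, which takes one tick. The entries of the arrays and of the input `x` are
addressed by registers. -/
def Op.eval (x : List ℕ) : Op → St → St
  | .const d c, σ => ⟨Function.update σ.reg d c, σ.arr, σ.out, σ.time + 1⟩
  | .inc d a c, σ => ⟨Function.update σ.reg d (σ.reg a + c), σ.arr, σ.out, σ.time + 1⟩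
  | .plus d a b, σ => ⟨Function.update σ.reg d (σ.reg a + σ.reg b), σ.arr, σ.out, σ.time + 1⟩
  | .minus d a b, σ => ⟨Function.update σ.reg d (σ.reg a - σ.reg b), σ.arr, σ.out, σ.time + 1⟩
  | .get d k a, σ => ⟨Function.update σ.reg d (σ.arr k (σ.reg a)), σ.arr, σ.out, σ.time + 1⟩
  | .put k a b, σ => ⟨σ.reg, Function.update σ.arr k
      (Function.update (σ.arr k) (σ.reg a) (σ.reg b)), σ.out, σ.time + 1⟩
  | .inp d a, σ => ⟨Function.update σ.reg d (x.getD (σ.reg a) 0), σ.arr, σ.out, σ.time + 1⟩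
  | .emit a, σ => ⟨σ.reg, σ.arr, σ.out ++ [σ.reg a], σ.time + 1⟩

/-- The results of sums and the numbers read from the input must not exceed `V`. -/
def Op.Fits (x : List ℕ) (V : ℕ) : Op → St → Prop
  | .plus _ a b, σ => σ.reg a + σ.reg b ≤ V
  | .inp _ a, σ => x.getD (σ.reg a) 0 ≤ V
  | _, _ => True

/-- Structured statements: blocks of operations, sequencing, a test for zero and a loop that runs
while a register is not zero. -/
inductive Stmt : Type
  | ops (l : List Op)
  | seq (s₁ s₂ : Stmt)
  | ifz (a : ℕ) (s₁ s₂ : Stmt)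
  | loop (a : ℕ) (s : Stmt)

infixr:60 " ;; " => Stmt.seq

def evalOps (x : List ℕ) : List Op → St → St
  | [], σ => σ
  | o :: l, σ => evalOps x l (o.eval x σ)

def FitsOps (x : List ℕ) (V : ℕ) : List Op → St → Prop
  | [], _ => True
  | o :: l, σ => o.Fits x V σ ∧ FitsOps x V l (o.eval x σ)

/-- Big-step semantics: the statement terminates when started in the first state, with the second state
as a result, and all numbers fit. Every operation, test and pass through a loop takes a tick. -/
inductive Exec (x : List ℕ) (V : ℕ) : Stmt → St → St → Prop
  | ops {l σ} : FitsOps x V l σ → Exec x V (.ops l) σ (evalOps x l σ)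
  | seq {s₁ s₂ σ₁ σ₂ σ₃} : Exec x V s₁ σ₁ σ₂ → Exec x V s₂ σ₂ σ₃ → Exec x V (s₁ ;; s₂) σ₁ σ₃
  | ifz_zero {a s₁ s₂ σ σ'} : σ.reg a = 0 → Exec x V s₁ σ.tick σ' → Exec x V (.ifz a s₁ s₂) σ σ'
  | ifz_pos {a s₁ s₂ σ σ'} : σ.reg a ≠ 0 → Exec x V s₂ σ.tick σ' → Exec x V (.ifz a s₁ s₂) σ σ'
  | loop_zero {a s σ} : σ.reg a = 0 → Exec x V (.loop a s) σ σ.tick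
  | loop_pos {a s σ₁ σ₂ σ₃} : σ₁.reg a ≠ 0 → Exec x V s σ₁.tick σ₂ →
      Exec x V (.loop a s) σ₂ σ₃ → Exec x V (.loop a s) σ₁ σ₃

/-! ### Frames: what a statement does not touch -/

def Op.wr (r : ℕ) : Op → Bool
  | .const d _ | .inc d _ _ | .plus d _ _ | .minus d _ _ | .get d _ _ | .inp d _ => d == r
  | _ => false

def Op.wa (k : ℕ) : Op → Bool
  | .put k' _ _ => k' == k
  | _ => false

def Op.wo : Op → Bool
  | .emit _ => true
  | _ => false

/-- The statement may write to register `r`. -/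
def Stmt.wr (r : ℕ) : Stmt → Bool
  | .ops l => l.any (Op.wr r)
  | .seq s t | .ifz _ s t => s.wr r || t.wr r
  | .loop _ s => s.wr r

/-- The statement may write to array `k`. -/
def Stmt.wa (k : ℕ) : Stmt → Bool
  | .ops l => l.any (Op.wa k)
  | .seq s t | .ifz _ s t => s.wa k || t.wa k
  | .loop _ s => s.wa k

/-- The statement may write to the output. -/
def Stmt.wo : Stmt → Bool
  | .ops l => l.any Op.wo
  | .seq s t | .ifz _ s t => s.wo || t.wo
  | .loop _ s => s.wo

/-- The states agree on everything that the statement does not write to. -/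
structure Frame (s : Stmt) (σ σ' : St) : Prop where
  reg : ∀ r, s.wr r = false → σ'.reg r = σ.reg r
  arr : ∀ k, s.wa k = false → σ'.arr k = σ.arr k
  out : s.wo = false → σ'.out = σ.out

theorem Frame.refl (s : Stmt) (σ : St) : Frame s σ σ := ⟨fun _ _ => rfl, fun _ _ => rfl, fun _ => rfl⟩

theorem Frame.tick (s : Stmt) (σ : St) : Frame s σ σ.tick :=
  ⟨fun _ _ => rfl, fun _ _ => rfl, fun _ => rfl⟩

theorem Frame.trans {s : Stmt} {σ₁ σ₂ σ₃ : St} (h : Frame s σ₁ σ₂) (h' : Frame s σ₂ σ₃) :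
    Frame s σ₁ σ₃ :=
  ⟨fun r hr => (h'.reg r hr).trans (h.reg r hr), fun k hk => (h'.arr k hk).trans (h.arr k hk),
    fun ho => (h'.out ho).trans (h.out ho)⟩

theorem Frame.mono {s t : Stmt} {σ σ' : St} (h : Frame s σ σ')
    (hr : ∀ r, t.wr r = false → s.wr r = false) (ha : ∀ r, t.wa r = false → s.wa r = false)
    (ho : t.wo = false → s.wo = false) : Frame t σ σ' :=
  ⟨fun r h' => h.reg r (hr r h'), fun r h' => h.arr r (ha r h'), fun h' => h.out (ho h')⟩

theorem Frame.op (x : List ℕ) (o : Op) (σ : St) : Frame (.ops [o]) σ (o.eval x σ) := by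
  refine ⟨fun r hr => ?_, fun k hk => ?_, fun ho => ?_⟩ <;> cases o <;>
    simp_all [Stmt.wr, Stmt.wa, Stmt.wo, Op.wr, Op.wa, Op.wo, Op.eval] <;>
    exact Function.update_of_ne (Ne.symm ‹_›) _ _

theorem frame_ops (x : List ℕ) (l : List Op) (σ : St) : Frame (.ops l) σ (evalOps x l σ) := by
  induction l generalizing σ with
  | nil => exact Frame.refl _ _
  | cons o l ih =>
    refine Frame.trans ((Frame.op x o σ).mono ?_ ?_ ?_) ((ih (o.eval x σ)).mono ?_ ?_ ?_) <;>
      simp +contextual [Stmt.wr, Stmt.wa, Stmt.wo]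

theorem Exec.frame {x : List ℕ} {V : ℕ} {s : Stmt} {σ σ' : St} (h : Exec x V s σ σ') :
    Frame s σ σ' := by
  induction h with
  | ops _ => exact frame_ops _ _ _
  | seq _ _ ih₁ ih₂ =>
    refine Frame.trans (ih₁.mono ?_ ?_ ?_) (ih₂.mono ?_ ?_ ?_) <;>
      simp +contextual [Stmt.wr, Stmt.wa, Stmt.wo]
  | ifz_zero _ _ ih | ifz_pos _ _ ih =>
    refine Frame.trans (Frame.tick _ _) (ih.mono ?_ ?_ ?_) <;>
      simp +contextual [Stmt.wr, Stmt.wa, Stmt.wo]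
  | loop_zero _ => exact Frame.tick _ _
  | loop_pos _ _ _ ih₁ ih₂ =>
    refine Frame.trans (Frame.tick _ _) (Frame.trans (ih₁.mono ?_ ?_ ?_) ih₂) <;>
      simp +contextual [Stmt.wr, Stmt.wa, Stmt.wo]

/-! ### Weakest preconditions -/

/-- The statement can be executed from `σ`, and the final state satisfies `Q`. -/
def WP (x : List ℕ) (V : ℕ) (s : Stmt) (Q : St → Prop) (σ : St) : Prop :=
  ∃ σ', Exec x V s σ σ' ∧ Q σ'

section WP

variable {x : List ℕ} {V : ℕ} {s s₁ s₂ : Stmt} {Q Q' : St → Prop} {σ : St}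

theorem WP.mono (h : WP x V s Q σ) (hQ : ∀ σ', Frame s σ σ' → Q σ' → Q' σ') : WP x V s Q' σ := by
  obtain ⟨σ', h, h'⟩ := h
  exact ⟨σ', h, hQ _ h.frame h'⟩

theorem WP.seq (h : WP x V s₁ (fun σ' => WP x V s₂ Q σ') σ) : WP x V (s₁ ;; s₂) Q σ := by
  obtain ⟨σ', h, σ'', h', hQ⟩ := h
  exact ⟨_, .seq h h', hQ⟩

/-- The precondition of a block, computed operation by operation. -/
def pre (x : List ℕ) (V : ℕ) (Q : St → Prop) : List Op → St → Prop
  | [], σ => Q σ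
  | o :: l, σ => o.Fits x V σ ∧ pre x V Q l (o.eval x σ)

theorem WP.ops {l : List Op} (h : pre x V Q l σ) : WP x V (.ops l) Q σ := by
  suffices h' : FitsOps x V l σ ∧ Q (evalOps x l σ) from ⟨_, .ops h'.1, h'.2⟩
  induction l generalizing σ with
  | nil => exact ⟨trivial, h⟩
  | cons o l ih => exact ⟨⟨h.1, (ih h.2).1⟩, (ih h.2).2⟩

theorem WP.ifz {a : ℕ} (h₀ : σ.reg a = 0 → WP x V s₁ Q σ.tick)
    (h₁ : σ.reg a ≠ 0 → WP x V s₂ Q σ.tick) : WP x V (.ifz a s₁ s₂) Q σ := by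
  by_cases h : σ.reg a = 0
  · obtain ⟨σ', h', hQ⟩ := h₀ h
    exact ⟨σ', .ifz_zero h h', hQ⟩
  · obtain ⟨σ', h', hQ⟩ := h₁ h
    exact ⟨σ', .ifz_pos h h', hQ⟩

/-- The rule for loops. The invariant `I` carries a number that decreases with every iteration. -/
theorem WP.loop {a : ℕ} (I : ℕ → St → Prop) {n : ℕ} (h₀ : I n σ)
    (hstep : ∀ m τ, Frame s σ τ → I m τ → τ.reg a ≠ 0 →
      WP x V s (fun τ' => ∃ m' < m, I m' τ') τ.tick)
    (hend : ∀ m τ, Frame s σ τ → I m τ → τ.reg a = 0 → Q τ.tick) :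
    WP x V (.loop a s) Q σ := by
  suffices ∀ m τ, Frame s σ τ → I m τ → WP x V (.loop a s) Q τ from this n σ (Frame.refl _ _) h₀
  intro m
  induction m using Nat.strong_induction_on with
  | _ m ih =>
    intro τ hF hI
    by_cases h : τ.reg a = 0
    · exact ⟨_, .loop_zero h, hend m τ hF hI h⟩
    · obtain ⟨τ', h', m', hm, hI'⟩ := hstep m τ hF hI h
      obtain ⟨τ'', h'', hQ⟩ := ih m' hm τ' (hF.trans ((Frame.tick _ _).trans h'.frame)) hI'
      exact ⟨τ'', .loop_pos h h' h'', hQ⟩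

end WP

/-! ### Compilation to the random access machine -/

open RAM

/-- Register `r` is register `r + 2` of the machine; `0` and `1` are used for addresses. Entry `i`
of array `k` is kept at the address `32 * i + k`, which this code puts into register `0`. -/
def addrCode (k a : ℕ) : List Instr :=
  [.add 0 (a + 2) (a + 2), .add 0 0 0, .add 0 0 0, .add 0 0 0, .add 0 0 0, .const 1 k, .add 0 0 1]

/-- The compiled code of an operation: at most eight instructions. Register `0` of the machine serves
also for the constant in `inc`. -/
def Op.code : Op → List Instr
  | .const d c => [.const (d + 2) c]
  | .inc d a c => [.const 0 c, .add (d + 2) (a + 2) 0]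
  | .plus d a b => [.add (d + 2) (a + 2) (b + 2)]
  | .minus d a b => [.sub (d + 2) (a + 2) (b + 2)]
  | .get d k a => addrCode k a ++ [.load (d + 2) 0]
  | .put k a b => addrCode k a ++ [.store 0 (b + 2)]
  | .inp d a => [.input (d + 2) (a + 2)]
  | .emit a => [.output (a + 2)]

def codeOps : List Op → List Instr
  | [] => []
  | o :: l => o.code ++ codeOps l

/-- The number of instructions of the compiled code. -/
def Stmt.size : Stmt → ℕ
  | .ops l => (codeOps l).length
  | .seq s t => s.size + t.size
  | .ifz _ s t => t.size + s.size + 3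
  | .loop _ s => s.size + 3

/-- The compiled code, for a start at instruction number `o`. -/
def Stmt.code : Stmt → ℕ → List Instr
  | .ops l, _ => codeOps l
  | .seq s t, o => s.code o ++ t.code (o + s.size)
  | .ifz a s t, o => .jumpZero (a + 2) (o + 1 + t.size + 2) :: (t.code (o + 1) ++
      ([.const 0 0, .jumpZero 0 (o + 1 + t.size + 2 + s.size)] ++ s.code (o + 1 + t.size + 2)))
  | .loop a s, o => .jumpZero (a + 2) (o + 1 + s.size + 2) :: (s.code (o + 1) ++
      [.const 0 0, .jumpZero 0 o])

theorem Stmt.length_code (s : Stmt) (o : ℕ) : (s.code o).length = s.size := by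
  induction s generalizing o with
  | ops l => rfl
  | seq s t ihs iht => simp [code, size, ihs, iht]
  | ifz a s t ihs iht => simp [code, size, ihs, iht]; omega
  | loop a s ih => simp [code, size, ih]

/-- The constant is at most `cm`, and the array is one of the first `32`. -/
def Op.ok (cm : ℕ) : Op → Bool
  | .const _ c | .inc _ _ c => c ≤ cm
  | .get _ k _ | .put k _ _ => k < 32
  | _ => true

/-- The constants of the statement are at most `cm`, and at most `32` arrays are used. -/
def Stmt.ok (cm : ℕ) : Stmt → Bool
  | .ops l => l.all (Op.ok cm)
  | .seq s t | .ifz _ s t => s.ok cm && t.ok cm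
  | .loop _ s => s.ok cm

/-- No number in the configuration exceeds `B`. -/
def Bdd (B : ℕ) (c : Config) : Prop := ∀ r, c.reg r ≤ B ∧ c.mem r ≤ B

/-- The machine configuration `c` represents the state `σ`, and the numbers in it are bounded: in
`t` ticks they exceed `V` by at most `t * cm`. -/
structure Match (V cm : ℕ) (σ : St) (c : Config) : Prop where
  reg : ∀ r, c.reg (r + 2) = σ.reg r
  mem : ∀ k < 32, ∀ i, c.mem (32 * i + k) = σ.arr k i
  out : c.out = σ.out
  reg_le : ∀ r, σ.reg r ≤ V + cm * (σ.time + 1)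
  arr_le : ∀ k < 32, ∀ i, σ.arr k i ≤ V + cm * (σ.time + 1)
  zero_le : c.reg 0 ≤ 32 * (V + cm * (σ.time + 1)) + 32
  one_le : c.reg 1 ≤ 32 * (V + cm * (σ.time + 1)) + 32

theorem Match.bdd {V cm : ℕ} {σ : St} {c : Config} (h : Match V cm σ c) :
    Bdd (32 * (V + cm * (σ.time + 1)) + 32) c := by
  intro r
  constructor
  · match r with
    | 0 => exact h.zero_le
    | 1 => exact h.one_le
    | r + 2 => rw [h.reg]; have := h.reg_le r; omega
  · have := h.mem (r % 32) (Nat.mod_lt _ (by norm_num)) (r / 32)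
    rw [Nat.div_add_mod] at this
    rw [this]
    have := h.arr_le (r % 32) (Nat.mod_lt _ (by norm_num)) (r / 32)
    omega

/-- In `n` steps the machine gets from `c` to `c'`, and all numbers on the way are at most `B`. -/
def Reaches (prog : Program) (x : List ℕ) (B : ℕ) (c : Config) (n : ℕ) (c' : Config) : Prop :=
  (step prog x)^[n] c = c' ∧ ∀ m ≤ n, Bdd B ((step prog x)^[m] c)

section Reaches

variable {prog : Program} {x : List ℕ} {B B' n m : ℕ} {c c' c'' : Config}

theorem Reaches.refl (h : Bdd B c) : Reaches prog x B c 0 c :=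
  ⟨rfl, fun m hm => by rw [Nat.le_zero.1 hm]; exact h⟩

theorem Reaches.trans (h : Reaches prog x B c n c') (h' : Reaches prog x B c' m c'') :
    Reaches prog x B c (n + m) c'' := by
  refine ⟨by rw [Nat.add_comm, Function.iterate_add_apply, h.1, h'.1], fun k hk => ?_⟩
  by_cases hkn : k ≤ n
  · exact h.2 k hkn
  · obtain ⟨j, rfl⟩ := Nat.exists_eq_add_of_le (Nat.le_of_not_le hkn)
    rw [Nat.add_comm, Function.iterate_add_apply, h.1]
    exact h'.2 j (by omega)

theorem Reaches.mono (h : Reaches prog x B c n c') (hB : B ≤ B') : Reaches prog x B' c n c' :=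
  ⟨h.1, fun m hm r => ⟨((h.2 m hm) r).1.trans hB, ((h.2 m hm) r).2.trans hB⟩⟩

theorem Reaches.head {ins : Instr} (hc : Bdd B c) (hi : prog[c.pc]? = some ins)
    (h : Reaches prog x B (ins.exec x c) n c') : Reaches prog x B c (n + 1) c' := by
  have hs : step prog x c = ins.exec x c := by simp [step, hi]
  rw [Nat.add_comm]
  refine Reaches.trans ⟨hs, fun m hm => ?_⟩ h
  interval_cases m
  · exact hc
  · simpa [hs] using h.2 0 (Nat.zero_le _)

end Reaches

/-- The program contains the code `l` from instruction number `o` on. -/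
def CodeAt (prog : Program) (o : ℕ) (l : List Instr) : Prop :=
  ∀ i (h : i < l.length), prog[o + i]? = some l[i]

theorem CodeAt.left {prog : Program} {o : ℕ} {l l' : List Instr} (h : CodeAt prog o (l ++ l')) :
    CodeAt prog o l := fun i hi => by
  rw [h i (by simp; omega), List.getElem_append_left hi]

theorem CodeAt.right {prog : Program} {o : ℕ} {l l' : List Instr} (h : CodeAt prog o (l ++ l')) :
    CodeAt prog (o + l.length) l' := fun i hi => by
  rw [Nat.add_assoc, h (l.length + i) (by simp; omega)]
  simp

theorem CodeAt.head {prog : Program} {o : ℕ} {i : Instr} {l : List Instr}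
    (h : CodeAt prog o (i :: l)) : prog[o]? = some i := h 0 (by simp)

theorem CodeAt.tail {prog : Program} {o : ℕ} {i : Instr} {l : List Instr}
    (h : CodeAt prog o (i :: l)) : CodeAt prog (o + 1) l := fun j hj => by
  rw [Nat.add_assoc, Nat.add_comm 1 j, h (j + 1) (by simpa using hj)]
  simp

theorem Bdd.update_reg {B : ℕ} {c : Config} (h : Bdd B c) {v : ℕ} (hv : v ≤ B) (d pc : ℕ) :
    Bdd B { c with pc := pc, reg := Function.update c.reg d v } := fun r => by
  refine ⟨?_, (h r).2⟩
  show Function.update c.reg d v r ≤ B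
  by_cases hr : r = d
  · subst hr; simpa using hv
  · simpa [hr] using (h r).1

/-- The address code writes the address to register `0`. -/
theorem reaches_addr {prog : Program} {x : List ℕ} {c : Config} {k a B : ℕ}
    (hp : CodeAt prog c.pc (addrCode k a)) (hc : Bdd B c) (hB : 32 * c.reg (a + 2) + k ≤ B) :
    Reaches prog x B c 7 ⟨c.pc + 7, Function.update (Function.update c.reg 1 k) 0
      (32 * c.reg (a + 2) + k), c.mem, c.out⟩ := by
  obtain ⟨pc, reg, mem, out⟩ := c
  simp only at hp hB ⊢
  have h0 := hp.head
  have h1 := hp.tail.head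
  have h2 := hp.tail.tail.head
  have h3 := hp.tail.tail.tail.head
  have h4 := hp.tail.tail.tail.tail.head
  have h5 := hp.tail.tail.tail.tail.tail.head
  have h6 := hp.tail.tail.tail.tail.tail.tail.head
  have key : ∀ n v, v ≤ B → Bdd B ⟨n, Function.update reg 0 v, mem, out⟩ := fun n v hv =>
    Bdd.update_reg hc hv 0 n
  refine Reaches.head hc h0 ?_
  simp only [Instr.exec]
  refine Reaches.head (key _ _ (by omega)) h1 ?_
  simp only [Instr.exec, Function.update_self, Function.update_idem]
  refine Reaches.head (key _ _ (by omega)) h2 ?_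
  simp only [Instr.exec, Function.update_self, Function.update_idem]
  refine Reaches.head (key _ _ (by omega)) h3 ?_
  simp only [Instr.exec, Function.update_self, Function.update_idem]
  refine Reaches.head (key _ _ (by omega)) h4 ?_
  simp only [Instr.exec, Function.update_self, Function.update_idem]
  refine Reaches.head (key _ _ (by omega)) h5 ?_
  simp only [Instr.exec, Function.update_self, Function.update_idem]
  refine Reaches.head (Bdd.update_reg (key 0 _ (by omega)) (by omega) 1 _) h6 ?_
  suffices hEq : ∀ c₁ c₂ : Config, Bdd B c₂ → c₁ = c₂ → Reaches prog x B c₁ 0 c₂ by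
    refine hEq _ _ (Bdd.update_reg (Bdd.update_reg hc (by omega) 1 0) (by omega) 0 _) ?_
    simp only [Instr.exec, Config.mk.injEq, true_and, and_true]
    funext r
    match r with
    | 0 => simp; omega
    | 1 => simp
    | r + 2 => simp
  rintro c₁ _ h rfl
  exact Reaches.refl h

/-- The code of one operation simulates it, in at most eight steps. -/
theorem reaches_op {prog : Program} {x : List ℕ} {V cm : ℕ} {c : Config} {σ : St} (o : Op)
    (hp : CodeAt prog c.pc o.code) (ho : o.ok cm = true) (hf : o.Fits x V σ) (h : Match V cm σ c) :
    ∃ n c', n ≤ 8 ∧ c'.pc = c.pc + o.code.length ∧ Match V cm (o.eval x σ) c' ∧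
      Reaches prog x (32 * (V + cm * ((o.eval x σ).time + 1)) + 32) c n c' := by
  have hB := h.bdd
  have ht : (o.eval x σ).time = σ.time + 1 := by cases o <;> rfl
  have hlt : V + cm * (σ.time + 1) + cm = V + cm * (σ.time + 1 + 1) := by ring
  have hc : Bdd (32 * (V + cm * ((o.eval x σ).time + 1)) + 32) c := fun r => by
    have := hB r
    rw [ht]
    omega
  -- Operations that compile to a single instruction.
  have one : ∀ (i : Instr) (c' : Config), prog[c.pc]? = some i → i.exec x c = c' →
      Match V cm (o.eval x σ) c' →
      Reaches prog x (32 * (V + cm * ((o.eval x σ).time + 1)) + 32) c 1 c' := by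
    rintro i _ hi rfl hm
    exact Reaches.head hc hi (Reaches.refl hm.bdd)
  have hreg : ∀ (d v : ℕ) (r₀ r₁ : ℕ), v ≤ V + cm * (σ.time + 1 + 1) →
      r₀ ≤ 32 * (V + cm * (σ.time + 1 + 1)) + 32 → r₁ ≤ 32 * (V + cm * (σ.time + 1 + 1)) + 32 → ∀ pc,
      Match V cm ⟨Function.update σ.reg d v, σ.arr, σ.out, σ.time + 1⟩
        ⟨pc, Function.update (Function.update (Function.update c.reg 1 r₁) 0 r₀) (d + 2) v,
          c.mem, c.out⟩ := by
    intro d v r₀ r₁ hv h₀ h₁ pc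
    refine ⟨fun r => ?_, h.mem, h.out, fun r => ?_, fun k hk i => ?_, ?_, ?_⟩
    · by_cases hr : r = d
      · subst hr; simp
      · simp [Function.update_of_ne, hr, h.reg]
    · by_cases hr : r = d
      · subst hr; simpa using hv
      · simp only [Function.update_of_ne hr]
        have := h.reg_le r
        omega
    · have := h.arr_le k hk i
      simp only
      omega
    · simpa using h₀
    · simpa using h₁
  have hz : c.reg 0 ≤ 32 * (V + cm * (σ.time + 1 + 1)) + 32 := by have := h.zero_le; omega
  have ho' : c.reg 1 ≤ 32 * (V + cm * (σ.time + 1 + 1)) + 32 := by have := h.one_le; omega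
  have hself : ∀ d v, Function.update c.reg d v = Function.update (Function.update
      (Function.update c.reg 1 (c.reg 1)) 0 (c.reg 0)) d v := by
    intro d v; simp
  cases o with
  | const d k =>
    simp only [Op.ok, decide_eq_true_eq] at ho
    refine ⟨1, _, by norm_num, ?_, ?_, one _ _ hp.head rfl ?_⟩
    · rfl
    all_goals
      simp only [Instr.exec, Op.eval]
      rw [hself]
      exact hreg _ _ _ _ (by nlinarith) hz ho' _
  | inc d a k =>
    simp only [Op.ok, decide_eq_true_eq] at ho
    have hv : σ.reg a + k ≤ V + cm * (σ.time + 1 + 1) := by have := h.reg_le a; omega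
    have hm := hreg d (σ.reg a + k) k (c.reg 1) hv (by nlinarith) ho' (c.pc + 1 + 1)
    refine ⟨2, _, by norm_num, ?_, hm, Reaches.head hc hp.head (Reaches.head ?_ hp.tail.head ?_)⟩
    · rfl
    · exact Bdd.update_reg hc (by rw [ht]; nlinarith) _ _
    · simp only [Instr.exec, Function.update_self]
      rw [Function.update_of_ne (by omega), h.reg]
      simp only [Function.update_eq_self] at hm ⊢
      exact Reaches.refl hm.bdd
  | plus d a b =>
    refine ⟨1, _, by norm_num, ?_, ?_, one _ _ hp.head rfl ?_⟩
    · rfl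
    all_goals
      simp only [Instr.exec, Op.eval, h.reg]
      rw [hself]
      exact hreg _ _ _ _ (by simp only [Op.Fits] at hf; omega) hz ho' _
  | minus d a b =>
    refine ⟨1, _, by norm_num, ?_, ?_, one _ _ hp.head rfl ?_⟩
    · rfl
    all_goals
      simp only [Instr.exec, Op.eval, h.reg]
      rw [hself]
      exact hreg _ _ _ _ (by have := h.reg_le a; omega) hz ho' _
  | inp d a =>
    refine ⟨1, _, by norm_num, ?_, ?_, one _ _ hp.head rfl ?_⟩
    · rfl
    all_goals
      simp only [Instr.exec, Op.eval, h.reg]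
      rw [hself]
      exact hreg _ _ _ _ (by simp only [Op.Fits] at hf; omega) hz ho' _
  | emit a =>
    have hm : Match V cm ((Op.emit a).eval x σ) ((Instr.output (a + 2)).exec x c) := by
      refine ⟨h.reg, h.mem, ?_, fun r => ?_, fun k hk i => ?_, hz, ho'⟩
      · simp [Instr.exec, Op.eval, h.reg, h.out]
      · have := h.reg_le r
        simp only [Op.eval]
        omega
      · have := h.arr_le k hk i
        simp only [Op.eval]
        omega
    exact ⟨1, _, by norm_num, rfl, hm, one _ _ hp.head rfl hm⟩
  | get d k a =>
    simp only [Op.ok, decide_eq_true_eq] at ho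
    have hra := h.reg_le a
    have h1 := reaches_addr (x := x) hp.left hc (by rw [h.reg, ht]; omega)
    have hm := hreg d (σ.arr k (σ.reg a)) (32 * σ.reg a + k) k
      (by have := h.arr_le k ho (σ.reg a); omega) (by omega) (by omega) (c.pc + 7 + 1)
    refine ⟨8, _, by norm_num, ?_, hm, h1.trans (m := 1) (Reaches.head ?_ hp.right.head ?_)⟩
    · rfl
    · exact h1.1 ▸ h1.2 7 le_rfl
    · simp only [Instr.exec, Function.update_self, h.reg, h.mem k ho]
      exact Reaches.refl hm.bdd
  | put k a b =>
    simp only [Op.ok, decide_eq_true_eq] at ho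
    have hra := h.reg_le a
    have h1 := reaches_addr (x := x) hp.left hc (by rw [h.reg, ht]; omega)
    have hm : Match V cm ((Op.put k a b).eval x σ) ⟨c.pc + 7 + 1, Function.update (Function.update
        c.reg 1 k) 0 (32 * c.reg (a + 2) + k), Function.update c.mem (32 * σ.reg a + k) (σ.reg b),
        c.out⟩ := by
      refine ⟨fun r => ?_, fun k' hk' i => ?_, h.out, fun r => ?_, fun k' hk' i => ?_, ?_, ?_⟩
      · simp [Function.update_of_ne, h.reg, Op.eval]
      · simp only [Op.eval, Function.update_apply]
        by_cases hkk : k' = k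
        · subst hkk
          by_cases hi : i = σ.reg a
          · simp [hi]
          · rw [if_neg (by omega), if_pos rfl, Function.update_of_ne hi, h.mem _ hk']
        · rw [if_neg (by omega), if_neg hkk, h.mem _ hk']
      · have := h.reg_le r
        simp only [Op.eval]
        omega
      · simp only [Op.eval, Function.update_apply]
        have := h.arr_le k' hk' i
        have := h.reg_le b
        split_ifs
        · simp only [Function.update_apply]; split_ifs <;> subst_vars <;> omega
        · omega
      · simp only [Function.update_self, Op.eval, h.reg]
        omega
      · simp only [ne_eq, one_ne_zero, not_false_eq_true, Function.update_of_ne,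
          Function.update_self, Op.eval]
        omega
    refine ⟨8, _, by norm_num, ?_, hm, h1.trans (m := 1) (Reaches.head ?_ hp.right.head ?_)⟩
    · rfl
    · exact h1.1 ▸ h1.2 7 le_rfl
    · have h2 : Function.update (Function.update c.reg 1 k) 0 (32 * c.reg (a + 2) + k) (b + 2) =
          σ.reg b := by simp [Function.update_of_ne, h.reg]
      simp only [Instr.exec, Function.update_self, h2]
      rw [h.reg a]
      rw [h.reg a] at hm
      exact Reaches.refl hm.bdd

theorem time_evalOps (x : List ℕ) (l : List Op) (σ : St) :
    (evalOps x l σ).time = σ.time + l.length := by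
  induction l generalizing σ with
  | nil => rfl
  | cons o l ih =>
    have : (o.eval x σ).time = σ.time + 1 := by cases o <;> rfl
    simp [evalOps, ih, this]
    omega

theorem Exec.time_le {x : List ℕ} {V : ℕ} {s : Stmt} {σ σ' : St} (h : Exec x V s σ σ') :
    σ.time ≤ σ'.time := by
  induction h with
  | ops _ => rw [time_evalOps]; omega
  | seq => omega
  | ifz_zero _ _ ih | ifz_pos _ _ ih => simp only [St.tick] at ih; omega
  | loop_zero => simp [St.tick]
  | loop_pos _ _ _ ih₁ ih₂ => simp only [St.tick] at ih₁; omega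

theorem bound_mono {V cm t t' : ℕ} (h : t ≤ t') :
    32 * (V + cm * (t + 1)) + 32 ≤ 32 * (V + cm * (t' + 1)) + 32 := by
  gcongr

theorem reaches_ops {prog : Program} {x : List ℕ} {V cm : ℕ} (l : List Op) {c : Config} {σ : St}
    (hp : CodeAt prog c.pc (codeOps l)) (ho : l.all (Op.ok cm) = true) (hf : FitsOps x V l σ)
    (h : Match V cm σ c) :
    ∃ n c', n + 8 * σ.time ≤ 8 * (evalOps x l σ).time ∧ c'.pc = c.pc + (codeOps l).length ∧
      Match V cm (evalOps x l σ) c' ∧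
      Reaches prog x (32 * (V + cm * ((evalOps x l σ).time + 1)) + 32) c n c' := by
  induction l generalizing c σ with
  | nil => exact ⟨0, c, by simp [evalOps], rfl, h, Reaches.refl h.bdd⟩
  | cons o l ih =>
    simp only [List.all_cons, Bool.and_eq_true] at ho
    obtain ⟨n, c', hn, hpc, hm, hr⟩ := reaches_op o hp.left ho.1 hf.1 h
    obtain ⟨n', c'', hn', hpc', hm', hr'⟩ := ih (hpc ▸ hp.right) ho.2 hf.2 hm
    have ht : (o.eval x σ).time = σ.time + 1 := by cases o <;> rfl
    refine ⟨n + n', c'', ?_, ?_, hm', (hr.mono (bound_mono ?_)).trans hr'⟩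
    · simp only [evalOps]; omega
    · simp only [codeOps, List.length_append]; omega
    · rw [evalOps, time_evalOps]; omega

/-- A jump of the compiled code does not change the represented state. -/
theorem Match.jump {V cm : ℕ} {σ : St} {c : Config} (h : Match V cm σ c) (pc : ℕ) :
    Match V cm σ.tick { c with pc := pc } := by
  have hlt : V + cm * (σ.time + 1) ≤ V + cm * (σ.time + 1 + 1) := by gcongr; omega
  refine ⟨h.reg, h.mem, h.out, fun r => (h.reg_le r).trans hlt,
    fun k hk i => (h.arr_le k hk i).trans hlt, ?_, ?_⟩
  · have := h.zero_le; simp only [St.tick]; omega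
  · have := h.one_le; simp only [St.tick]; omega

/-- The unconditional jump that closes a branch or an iteration. -/
theorem reaches_goto {prog : Program} {x : List ℕ} {V cm t : ℕ} {c : Config} {σ : St}
    (hp : CodeAt prog c.pc [.const 0 0, .jumpZero 0 t]) (h : Match V cm σ c) :
    ∃ c', c'.pc = t ∧ Match V cm σ c' ∧
      Reaches prog x (32 * (V + cm * (σ.time + 1)) + 32) c 2 c' := by
  have hm : Match V cm σ ⟨t, Function.update c.reg 0 0, c.mem, c.out⟩ :=
    ⟨fun r => by simpa using h.reg r, h.mem, h.out, h.reg_le, h.arr_le, by simp,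
      by simpa using h.one_le⟩
  refine ⟨_, rfl, hm, Reaches.head h.bdd hp.head (Reaches.head
    (Bdd.update_reg h.bdd (Nat.zero_le _) _ _) hp.tail.head ?_)⟩
  simp only [Instr.exec, Function.update_self, if_true]
  exact Reaches.refl hm.bdd

/-- The compiled code simulates the big-step semantics, with at most eight steps per tick. -/
theorem Exec.reaches {prog : Program} {x : List ℕ} {V cm : ℕ} {s : Stmt} {σ σ' : St}
    (hx : Exec x V s σ σ') {c : Config} (hp : CodeAt prog c.pc (s.code c.pc))
    (ho : s.ok cm = true) (h : Match V cm σ c) :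
    ∃ n c', n + 8 * σ.time ≤ 8 * σ'.time ∧ c'.pc = c.pc + s.size ∧ Match V cm σ' c' ∧
      Reaches prog x (32 * (V + cm * (σ'.time + 1)) + 32) c n c' := by
  induction hx generalizing c with
  | ops hf => exact reaches_ops _ hp ho hf h
  | @seq s₁ s₂ σ₁ σ₂ σ₃ h₁ h₂ ih₁ ih₂ =>
    simp only [Stmt.ok, Bool.and_eq_true] at ho
    obtain ⟨n, c', hn, hpc, hm, hr⟩ := ih₁ hp.left ho.1 h
    have hp' := hp.right
    rw [Stmt.length_code, ← hpc] at hp'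
    obtain ⟨n', c'', hn', hpc', hm', hr'⟩ := ih₂ hp' ho.2 hm
    refine ⟨n + n', c'', by omega, ?_, hm', (hr.mono (bound_mono h₂.time_le)).trans hr'⟩
    simp only [Stmt.size]
    omega
  | @ifz_zero a s₁ s₂ σ σ' ha h₁ ih =>
    simp only [Stmt.ok, Bool.and_eq_true] at ho
    have hp' := hp.tail.right.right
    rw [Stmt.length_code] at hp'
    obtain ⟨n, c', hn, hpc, hm, hr⟩ := ih (c := { c with pc := c.pc + 1 + s₂.size + 2 })
      hp' ho.1 (h.jump _)
    refine ⟨n + 1, c', by simp only [St.tick] at hn; omega, ?_, hm, Reaches.head ?_ hp.head ?_⟩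
    · simp only [Stmt.size, hpc]; omega
    · intro r
      have := h.bdd r
      have := bound_mono (V := V) (cm := cm) ((Nat.le_succ _).trans h₁.time_le)
      omega
    · simpa [Instr.exec, h.reg, ha] using hr
  | @ifz_pos a s₁ s₂ σ σ' ha h₁ ih =>
    simp only [Stmt.ok, Bool.and_eq_true] at ho
    obtain ⟨n, c', hn, hpc, hm, hr⟩ := ih (c := { c with pc := c.pc + 1 })
      hp.tail.left ho.2 (h.jump _)
    have hp' := hp.tail.right.left
    rw [Stmt.length_code] at hp'
    simp only at hpc
    rw [← hpc] at hp'
    obtain ⟨c'', hpc', hm', hr'⟩ := reaches_goto (x := x) hp' hm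
    refine ⟨n + 2 + 1, c'', by simp only [St.tick] at hn; omega, ?_, hm',
      Reaches.head ?_ hp.head ?_⟩
    · simp only [Stmt.size, hpc']; omega
    · intro r
      have := h.bdd r
      have := bound_mono (V := V) (cm := cm) ((Nat.le_succ _).trans h₁.time_le)
      omega
    · have := hr.trans hr'
      simpa [Instr.exec, h.reg, ha] using this
  | @loop_zero a s σ ha =>
    have hm := h.jump (c.pc + 1 + s.size + 2)
    refine ⟨0 + 1, _, by simp [St.tick]; omega, ?_, hm, Reaches.head ?_ hp.head ?_⟩
    · simp only [Stmt.size]; omega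
    · intro r
      have := h.bdd r
      have := bound_mono (V := V) (cm := cm) (Nat.le_add_right σ.time 1)
      simp only [St.tick]
      omega
    · simp only [Instr.exec, h.reg, ha, if_true]
      exact Reaches.refl hm.bdd
  | @loop_pos a s σ₁ σ₂ σ₃ ha h₁ h₂ ih₁ ih₂ =>
    have ho' := ho
    simp only [Stmt.ok] at ho'
    obtain ⟨n, c', hn, hpc, hm, hr⟩ := ih₁ (c := { c with pc := c.pc + 1 })
      hp.tail.left ho' (h.jump _)
    have hp' := hp.tail.right
    rw [Stmt.length_code] at hp'
    simp only at hpc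
    rw [← hpc] at hp'
    obtain ⟨c'', hpc', hm', hr'⟩ := reaches_goto (x := x) hp' hm
    obtain ⟨n₃, c₃, hn₃, hpc₃, hm₃, hr₃⟩ := ih₂ (c := c'') (hpc' ▸ hp) ho hm'
    have ht := h₂.time_le
    refine ⟨n + 2 + n₃ + 1, c₃, by simp only [St.tick] at hn; omega, ?_, hm₃,
      Reaches.head ?_ hp.head ?_⟩
    · rw [hpc₃, hpc']
    · intro r
      have := h.bdd r
      have := bound_mono (V := V) (cm := cm) ((Nat.le_succ _).trans (h₁.time_le.trans h₂.time_le))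
      omega
    · have := ((hr.trans hr').mono (bound_mono ht)).trans hr₃
      simpa [Instr.exec, h.reg, ha] using this

/-- A statement that runs in time `T` compiles to a program that runs in time `8 T`. -/
theorem computes_of_WP {x y : List ℕ} {V cm T : ℕ} {s : Stmt} (ho : s.ok cm = true)
    (h : WP x V s (fun σ => σ.out = y ∧ σ.time ≤ T) St.init) :
    RAM.Computes (s.code 0) x y (8 * T) (32 * (V + cm * (T + 1)) + 32) := by
  obtain ⟨σ', hx, rfl, hT⟩ := h
  have hm : Match V cm St.init Config.init :=
    ⟨fun _ => rfl, fun _ _ _ => rfl, rfl, fun _ => Nat.zero_le _, fun _ _ _ => Nat.zero_le _,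
      Nat.zero_le _, Nat.zero_le _⟩
  obtain ⟨n, c', hn, hpc, hm', hr⟩ := hx.reaches (prog := s.code 0) (c := Config.init)
    (fun i hi => by rw [show Config.init.pc + i = i from Nat.zero_add i]; simp [Config.init]) ho hm
  refine ⟨n, ?_, ?_, ?_, fun k hk r => ?_⟩
  · simp only [St.init] at hn; omega
  · rw [RAM.run, hr.1, hpc, Stmt.length_code]; omega
  · rw [RAM.run, hr.1, hm'.out]
  · have h1 := (hr.mono (bound_mono hT)).2 k hk r
    exact h1

end Structured

namespace Structured

/-! ### Breadth-first search over the orbits of a permutation -/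

/-- Registers `14` and `16` hold a dart and `15` a level. All darts on the orbit of this dart under
the permutation in array `c` are appended to the queue (array `k + 2`, with its length in register
`12`); the dart at which the orbit was entered is stored in array `k`, the level in array `k + 1`. -/
def visit (c k : ℕ) : Stmt :=
  .ops [.const 17 1] ;;
  .loop 17 (.ops [.put k 16 14, .put (k + 1) 16 15, .put (k + 2) 12 16, .inc 12 12 1,
    .get 16 c 16, .get 18 k 16, .const 17 1, .minus 17 17 18])

variable {α : Type*}

theorem minimalPeriod_pos_of_injective [Finite α] {π : α → α} (hπ : Function.Injective π) (s : α) :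
    0 < Function.minimalPeriod π s :=
  Function.minimalPeriod_pos_of_mem_periodicPts (hπ.mem_periodicPts s)

/-- The time that `visit` takes is linear in the length of the orbit. -/
theorem wp_visit [Finite α] {x : List ℕ} {V c k : ℕ} {π : α → α} (hπ : Function.Injective π) {code : α → ℕ}
    (hcode : Function.Injective code) (hpos : ∀ d, 1 ≤ code d)
    (hc : c ≠ k ∧ c ≠ k + 1 ∧ c ≠ k + 2) {σ : St} {s : α} (h14 : σ.reg 14 = code s)
    (h16 : σ.reg 16 = code s) (hperm : ∀ d, σ.arr c (code d) = code (π d))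
    (h0 : ∀ j, σ.arr k (code (π^[j] s)) = 0) :
    WP x V (visit c k) (fun σ' => σ'.reg 12 = σ.reg 12 + Function.minimalPeriod π s ∧
      (∀ j, σ'.arr k (code (π^[j] s)) = code s) ∧
      (∀ j, σ'.arr (k + 1) (code (π^[j] s)) = σ.reg 15) ∧
      (∀ d, (∀ j, π^[j] s ≠ d) → σ'.arr k (code d) = σ.arr k (code d) ∧
        σ'.arr (k + 1) (code d) = σ.arr (k + 1) (code d)) ∧
      (∀ i < σ.reg 12, σ'.arr (k + 2) i = σ.arr (k + 2) i) ∧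
      (∀ j < Function.minimalPeriod π s, σ'.arr (k + 2) (σ.reg 12 + j) = code (π^[j] s)) ∧
      σ'.time = σ.time + (9 * Function.minimalPeriod π s + 2)) σ := by
  obtain ⟨hc0, hc1, hc2⟩ := hc
  set n := Function.minimalPeriod π s with hn
  have hnpos : 0 < n := minimalPeriod_pos_of_injective hπ s
  refine WP.seq (WP.ops ?_)
  simp only [pre, Op.eval, Op.Fits, true_and]
  refine WP.loop (n := n) (fun m τ => ∃ j, j + m = n ∧ τ.reg 16 = code (π^[j] s) ∧
    τ.reg 17 = (if m = 0 then 0 else 1) ∧ τ.reg 12 = σ.reg 12 + j ∧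
    (∀ i < j, τ.arr k (code (π^[i] s)) = code s) ∧
    (∀ i < j, τ.arr (k + 1) (code (π^[i] s)) = σ.reg 15) ∧
    (∀ d, (∀ i < j, π^[i] s ≠ d) → τ.arr k (code d) = σ.arr k (code d) ∧
        τ.arr (k + 1) (code d) = σ.arr (k + 1) (code d)) ∧
    (∀ i < σ.reg 12, τ.arr (k + 2) i = σ.arr (k + 2) i) ∧
    (∀ i < j, τ.arr (k + 2) (σ.reg 12 + i) = code (π^[i] s)) ∧
    τ.time = σ.time + 1 + 9 * j) ?_ ?_ ?_
  · refine ⟨0, by omega, by simp [h16], by simp [hnpos.ne'], ?_⟩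
    simp
  · rintro m τ hF ⟨j, hjm, h16', h17, h12, hE, hL, hne, hQ0, hQ, ht⟩ hreg
    have hm : m ≠ 0 := by rintro rfl; simp [h17] at hreg
    have hF14 : τ.reg 14 = code s := by rw [hF.reg 14 rfl]; simpa using h14
    have hF15 : τ.reg 15 = σ.reg 15 := by rw [hF.reg 15 rfl]; simp
    have hFc : τ.arr c = σ.arr c := hF.arr c (by simp [Stmt.wa, Op.wa, Ne.symm hc0, Ne.symm hc1, Ne.symm hc2])
    refine WP.ops ?_
    have hinj : ∀ i < j, code (π^[i] s) ≠ code (π^[j] s) := fun i hi h => by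
      have := Function.iterate_injOn_Iio_minimalPeriod (f := π) (x := s) (by simp; omega)
        (by simp; omega) (hcode h)
      omega
    have hiter : π (π^[j] s) = π^[j + 1] s := (Function.iterate_succ_apply' π j s).symm
    simp [-Function.iterate_succ, pre, Op.eval, Op.Fits, St.tick, h16', hF14, hF15, hFc, hc0, hc1, hc2, h12, hperm, hiter]
    refine ⟨m - 1, by omega, j + 1, by omega, rfl, ?_, by omega, ?_, ?_, ?_, ?_, ?_, by omega⟩
    · by_cases hlast : j + 1 = n
      · rw [hlast, Function.iterate_minimalPeriod]
        have : Function.update (τ.arr k) (code (π^[j] s)) (code s) (code s) = code s := by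
          by_cases hj : j = 0
          · subst hj; simp
          · have h1 := hinj 0 (by omega)
            have h2 := hE 0 (by omega)
            simp only [Function.iterate_zero, id] at h1 h2
            rw [Function.update_of_ne h1, h2]
        rw [this, if_pos (by omega)]
        have := hpos s
        omega
      · have hnew : ∀ i < j + 1, π^[i] s ≠ π^[j + 1] s := fun i hi h => by
          have := Function.iterate_injOn_Iio_minimalPeriod (f := π) (x := s) (by simp; omega)
            (by simp; omega) h
          omega
        rw [Function.update_of_ne (fun h => hnew j (by omega) (hcode h).symm),
          (hne _ fun i hi => hnew i (by omega)).1, h0, if_neg (by omega)]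
    · intro i hi
      by_cases hij : i = j
      · subst hij; simp
      · rw [Function.update_of_ne (hinj i (by omega)), hE i (by omega)]
    · intro i hi
      by_cases hij : i = j
      · subst hij; simp
      · rw [Function.update_of_ne (hinj i (by omega)), hL i (by omega)]
    · intro d hd
      have hdj : code d ≠ code (π^[j] s) := fun h => hd j (by omega) (hcode h).symm
      rw [Function.update_of_ne hdj, Function.update_of_ne hdj]
      exact hne d fun i hi => hd i (by omega)
    · intro i hi
      rw [Function.update_of_ne (by omega), hQ0 i hi]
    · intro i hi
      by_cases hij : i = j
      · subst hij; simp
      · rw [Function.update_of_ne (by omega), hQ i (by omega)]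
  · rintro m τ hF ⟨j, hjm, h16', h17, h12, hE, hL, hne, hQ0, hQ, ht⟩ hreg
    have hm : m = 0 := by by_contra h; simp [h17, h] at hreg
    obtain rfl : j = n := by omega
    have hall : ∀ P : α → Prop, (∀ i < n, P (π^[i] s)) → ∀ i, P (π^[i] s) := fun P h i => by
      rw [← Function.iterate_mod_minimalPeriod_eq]
      exact h _ (Nat.mod_lt _ hnpos)
    refine ⟨h12, hall (fun d => τ.tick.arr k (code d) = code s) hE,
      hall (fun d => τ.tick.arr (k + 1) (code d) = σ.reg 15) hL,
      fun d hd => hne d fun i _ => hd i, hQ0, hQ, ?_⟩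
    simp only [St.tick, ht]
    omega

/-- The orbit of `s` under `π`, listed from `s` on. -/
noncomputable def orbitList (π : α → α) (s : α) : List α :=
  (List.range (Function.minimalPeriod π s)).map fun j => π^[j] s

theorem mem_orbitList [Finite α] {π : α → α} (hπ : Function.Injective π) {s d : α} : d ∈ orbitList π s ↔ ∃ j, π^[j] s = d := by
  constructor
  · intro h
    obtain ⟨j, -, rfl⟩ := List.mem_map.1 h
    exact ⟨j, rfl⟩
  · rintro ⟨j, rfl⟩
    refine List.mem_map.2 ⟨j % Function.minimalPeriod π s, ?_, Function.iterate_mod_minimalPeriod_eq⟩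
    exact List.mem_range.2 (Nat.mod_lt _ (minimalPeriod_pos_of_injective hπ s))

theorem nodup_orbitList (π : α → α) (s : α) : (orbitList π s).Nodup := by
  refine List.Nodup.map_on (fun i hi j hj h => ?_) List.nodup_range
  exact Function.iterate_injOn_Iio_minimalPeriod (by simpa using hi) (by simpa using hj) h

theorem orbitList_eq_cons [Finite α] {π : α → α} (hπ : Function.Injective π) (s : α) : ∃ t, orbitList π s = s :: t := by
  obtain ⟨n, hn⟩ := Nat.exists_eq_succ_of_ne_zero (minimalPeriod_pos_of_injective hπ s).ne'
  rw [orbitList, hn, List.range_succ_eq_map]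
  exact ⟨_, rfl⟩

theorem mem_of_iterate_mem [Finite α] {π : α → α} (hπ : Function.Injective π) {l : List α} (hl : ∀ d ∈ l, π d ∈ l) {s : α} {j : ℕ}
    (h : π^[j] s ∈ l) : s ∈ l := by
  have hit : ∀ i d, d ∈ l → π^[i] d ∈ l := fun i => by
    induction i with
    | zero => simp
    | succ i ih => intro d hd; rw [Function.iterate_succ_apply]; exact ih _ (hl d hd)
  set n := Function.minimalPeriod π s
  have hn : 0 < n := minimalPeriod_pos_of_injective hπ s
  have := hit (n * j - j) _ h
  rw [← Function.iterate_add_apply, Nat.sub_add_cancel (Nat.le_mul_of_pos_left j hn)] at this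
  rwa [Function.IsPeriodicPt.mul_const (Function.isPeriodicPt_minimalPeriod π s) j] at this

/-- A breadth-first search in progress. The search moves between elements of `α`: all elements of
an orbit of `π` are visited together, and the search crosses from `d` to `ι d` if `al d` holds. The
list `l` is the queue of all elements visited so far, of which the first `h` are processed; `ent d`
is the element at which the orbit of `d` was entered, and `lev d` is the level of this orbit. By
`order`, `last` and `parents`, each orbit is listed cyclically from its entrance on, after the orbit from
which it was entered. -/
structure PartialSearch (π ι : α → α) (al : α → Prop) (s : α) (l : List α) (ent : α → α)
    (lev : α → ℕ) (h : ℕ) : Prop where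
  nodup : l.Nodup
  le_length : h ≤ l.length
  head : ∀ d ∈ l.head?, d = s
  closed : ∀ d ∈ l, π d ∈ l
  ent_mem : ∀ d ∈ l, ent d ∈ l
  ent_perm : ∀ d ∈ l, ent (π d) = ent d
  lev_perm : ∀ d ∈ l, lev (π d) = lev d
  ent_ent : ∀ d ∈ l, ent (ent d) = ent d
  lev_ent : ∀ d ∈ l, lev (ent d) = lev d
  orbit : ∀ d ∈ l, ∃ j, π^[j] (ent d) = d
  up : ∀ d ∈ l, ent d = s ∧ lev d = 0 ∨ ent d ≠ s ∧ al (ι (ent d)) ∧ ι (ent d) ∈ l ∧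
    lev (ι (ent d)) + 1 = lev d
  down : ∀ d ∈ l.take h, al d → ι d ∈ l ∧ lev (ι d) ≤ lev d + 1
  sorted : l.Pairwise fun a b => lev a ≤ lev b
  front : ∀ c ∈ l.drop h, ∀ d ∈ l, lev d ≤ lev c + 1
  order : l.IsChain fun a b => b = π a ∧ ent b ≠ b ∨ ent b = b ∧ π a = ent a
  last : ∀ a ∈ l.getLast?, π a = ent a
  parents : ∀ pre e post, l = pre ++ e :: post → ent e = e → e ≠ s → ι e ∈ pre

variable {π ι : α → α} {al : α → Prop} {s : α} {l : List α} {ent : α → α} {lev : α → ℕ} {h : ℕ}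

theorem PartialSearch.nil (π ι : α → α) (al : α → Prop) (s : α) (ent : α → α) (lev : α → ℕ) :
    PartialSearch π ι al s [] ent lev 0 := by
  constructor <;> simp

theorem PartialSearch.start_mem (hS : PartialSearch π ι al s l ent lev h) (hl : l ≠ []) : s ∈ l := by
  obtain ⟨d, t, rfl⟩ := List.exists_cons_of_ne_nil hl
  have := hS.head d rfl
  subst this
  exact List.mem_cons_self

theorem PartialSearch.advance (hS : PartialSearch π ι al s l ent lev h) (hh : h < l.length)
    (hd : al l[h] → ι l[h] ∈ l) : PartialSearch π ι al s l ent lev (h + 1) := by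
  refine { hS with le_length := hh, down := fun d hdm had => ?_, front := fun c hc d hd => ?_ }
  · rw [List.take_succ_eq_append_getElem hh, List.mem_append, List.mem_singleton] at hdm
    obtain hdm | rfl := hdm
    · exact hS.down d hdm had
    · refine ⟨hd had, hS.front l[h] ?_ _ (hd had)⟩
      rw [← List.cons_getElem_drop_succ]
      exact List.mem_cons_self
  · refine hS.front c ?_ d hd
    rw [← List.cons_getElem_drop_succ (h := hh)]
    exact List.mem_cons_of_mem _ hc

theorem left_unique_of_nodup {l₁ l₂ m₁ m₂ : List α} {a : α} (hn : (l₁ ++ a :: l₂).Nodup)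
    (h : l₁ ++ a :: l₂ = m₁ ++ a :: m₂) : l₁ = m₁ := by
  classical
  have h1 : a ∉ l₁ := fun ha => (List.nodup_append.1 hn).2.2 a ha a (by simp) rfl
  have h2 : a ∉ m₁ := fun ha => (List.nodup_append.1 (h ▸ hn)).2.2 a ha a (by simp) rfl
  have := congrArg (List.idxOf a) h
  rw [List.idxOf_append_of_notMem h1, List.idxOf_append_of_notMem h2] at this
  simp at this
  exact List.append_inj_left h this

open Classical in
/-- A new orbit is visited. -/
theorem PartialSearch.visit [Finite α] (hπ : Function.Injective π)
    (hS : PartialSearch π ι al s l ent lev h) {c : α} {v : ℕ} (hc : c ∉ l)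
    (hup : l = [] ∧ c = s ∧ v = 0 ∨ al (ι c) ∧ ι c ∈ l ∧ lev (ι c) + 1 = v)
    (hv : ∀ d ∈ l, lev d ≤ v) (hf : ∀ d ∈ l.drop h, v ≤ lev d + 1) :
    PartialSearch π ι al s (l ++ orbitList π c)
      (fun d => if d ∈ orbitList π c then c else ent d)
      (fun d => if d ∈ orbitList π c then v else lev d) h := by
  have hdisj : ∀ d ∈ l, d ∉ orbitList π c := fun d hd hd' => by
    obtain ⟨j, rfl⟩ := (mem_orbitList hπ).1 hd'
    exact hc (mem_of_iterate_mem hπ hS.closed hd)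
  have hcm : c ∈ orbitList π c := (mem_orbitList hπ).2 ⟨0, rfl⟩
  have hclosed : ∀ d ∈ orbitList π c, π d ∈ orbitList π c := fun d hd => by
    obtain ⟨j, rfl⟩ := (mem_orbitList hπ).1 hd
    exact (mem_orbitList hπ).2 ⟨j + 1, Function.iterate_succ_apply' _ _ _⟩
  have hcs : l ≠ [] → c ≠ s := fun hl h => hc (h ▸ hS.start_mem hl)
  have hup' : c = s ∧ v = 0 ∨ c ≠ s ∧ al (ι c) ∧ ι c ∈ l ∧ lev (ι c) + 1 = v := by
    obtain ⟨-, h1, h2⟩ | ⟨h1, h2, h3⟩ := hup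
    · exact Or.inl ⟨h1, h2⟩
    · exact Or.inr ⟨hcs (List.ne_nil_of_mem h2), h1, h2, h3⟩
  have htake : (l ++ orbitList π c).take h = l.take h :=
    List.take_append_of_le_length hS.le_length
  have hdrop : (l ++ orbitList π c).drop h = l.drop h ++ orbitList π c :=
    List.drop_append_of_le_length hS.le_length
  have hil : ∀ {d}, d ∈ l → (if d ∈ orbitList π c then c else ent d) = ent d :=
    fun hd => if_neg (hdisj _ hd)
  have hll : ∀ {d}, d ∈ l → (if d ∈ orbitList π c then v else lev d) = lev d :=
    fun hd => if_neg (hdisj _ hd)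
  have hio : ∀ {d}, d ∈ orbitList π c → (if d ∈ orbitList π c then c else ent d) = c :=
    fun hd => if_pos hd
  have hlo : ∀ {d}, d ∈ orbitList π c → (if d ∈ orbitList π c then v else lev d) = v :=
    fun hd => if_pos hd
  refine ⟨?_, ?_, ?_, ?_, ?_, ?_, ?_, ?_, ?_, ?_, ?_, ?_, ?_, ?_, ?_, ?_, ?_⟩
  · exact hS.nodup.append (nodup_orbitList π c) fun d hd hd' => hdisj d hd hd'
  · rw [List.length_append]; have := hS.le_length; omega
  · obtain ⟨t, ht⟩ := orbitList_eq_cons hπ c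
    intro d hd
    by_cases hl : l = []
    · obtain ⟨-, h1, -⟩ | ⟨-, h2, -⟩ := hup
      · simp [hl, ht] at hd; rw [← hd, h1]
      · simp [hl] at h2
    · rw [List.head?_append_of_ne_nil _ hl] at hd
      exact hS.head d hd
  · intro d hd
    rw [List.mem_append] at hd ⊢
    exact hd.imp (hS.closed d) (hclosed d)
  · intro d hd
    rw [List.mem_append] at hd ⊢
    obtain hd | hd := hd
    · simp only [hil hd]; exact Or.inl (hS.ent_mem d hd)
    · simp only [hio hd]; exact Or.inr hcm
  · intro d hd
    obtain hd | hd := List.mem_append.1 hd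
    · simp only [hil hd, hil (hS.closed d hd)]; exact hS.ent_perm d hd
    · simp only [hio hd, hio (hclosed d hd)]
  · intro d hd
    obtain hd | hd := List.mem_append.1 hd
    · simp only [hll hd, hll (hS.closed d hd)]; exact hS.lev_perm d hd
    · simp only [hlo hd, hlo (hclosed d hd)]
  · intro d hd
    obtain hd | hd := List.mem_append.1 hd
    · simp only [hil hd, hil (hS.ent_mem d hd)]; exact hS.ent_ent d hd
    · simp only [hio hd, hio hcm]
  · intro d hd
    obtain hd | hd := List.mem_append.1 hd
    · simp only [hil hd, hll hd, hll (hS.ent_mem d hd)]; exact hS.lev_ent d hd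
    · simp only [hio hd, hlo hd, hlo hcm]
  · intro d hd
    obtain hd | hd := List.mem_append.1 hd
    · simp only [hil hd]; exact hS.orbit d hd
    · simp only [hio hd]; exact (mem_orbitList hπ).1 hd
  · intro d hd
    obtain hd | hd := List.mem_append.1 hd
    · simp only [hil hd, hll hd]
      refine (hS.up d hd).imp id fun h => ⟨h.1, h.2.1, List.mem_append_left _ h.2.2.1, ?_⟩
      rw [hll h.2.2.1]; exact h.2.2.2
    · simp only [hio hd, hlo hd]
      refine hup'.imp id fun h => ⟨h.1, h.2.1, List.mem_append_left _ h.2.2.1, ?_⟩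
      rw [hll h.2.2.1]; exact h.2.2.2
  · intro d hd had
    rw [htake] at hd
    have := hS.down d hd had
    simp only [hll this.1, hll (List.mem_of_mem_take hd)]
    exact ⟨List.mem_append_left _ this.1, this.2⟩
  · rw [List.pairwise_append]
    refine ⟨?_, ?_, ?_⟩
    · refine hS.sorted.imp_of_mem fun ha hb h => ?_
      rwa [hll ha, hll hb]
    · refine List.pairwise_of_forall_mem_list fun a ha b hb => ?_
      rw [hlo ha, hlo hb]
    · intro a ha b hb
      rw [hll ha, hlo hb]
      exact hv a ha
  · intro a ha d hd
    rw [hdrop] at ha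
    obtain ha | ha := List.mem_append.1 ha <;> obtain hd | hd := List.mem_append.1 hd
    · rw [hll hd, hll (List.mem_of_mem_drop ha)]; exact hS.front a ha d hd
    · rw [hlo hd, hll (List.mem_of_mem_drop ha)]; exact hf a ha
    · rw [hll hd, hlo ha]; have := hv d hd; omega
    · rw [hlo hd, hlo ha]; omega
  · rw [List.isChain_append]
    refine ⟨?_, ?_, ?_⟩
    · have := hS.order
      rw [List.isChain_iff_getElem] at this ⊢
      intro i hi
      rw [hil (List.getElem_mem _), hil (List.getElem_mem _)]
      exact this i hi
    · rw [List.isChain_iff_getElem]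
      intro i hi
      rw [hio (List.getElem_mem _), hio (List.getElem_mem _)]
      simp only [orbitList, List.length_map, List.length_range] at hi
      left
      simp only [orbitList, List.getElem_map, List.getElem_range]
      refine ⟨Function.iterate_succ_apply' _ _ _, fun h => ?_⟩
      have := Function.iterate_injOn_Iio_minimalPeriod (f := π) (x := c) (x₁ := 0) (x₂ := i + 1)
        (by simp; omega) (by simp; omega)
        (show π^[0] c = π^[i + 1] c from h)
      omega
    · intro a ha b hb
      have ha' := List.mem_of_getLast? ha
      obtain ⟨t, ht⟩ := orbitList_eq_cons hπ c
      simp [ht] at hb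
      subst hb
      rw [hio hcm, hil ha']
      exact Or.inr ⟨rfl, hS.last a ha⟩
  · intro a ha
    have hn := minimalPeriod_pos_of_injective hπ c
    have hne : orbitList π c ≠ [] := by
      obtain ⟨t, ht⟩ := orbitList_eq_cons hπ c
      simp [ht]
    rw [List.getLast?_append_of_ne_nil _ hne] at ha
    rw [hio (List.mem_of_getLast? ha)]
    obtain ⟨n, hn'⟩ := Nat.exists_eq_succ_of_ne_zero hn.ne'
    rw [orbitList, hn', List.range_succ, List.map_append] at ha
    simp at ha
    subst ha
    rw [← Function.iterate_succ_apply' π, ← hn', Function.iterate_minimalPeriod]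
  · intro pre e post he hent hes
    have hel : e ∈ l ++ orbitList π c := he ▸ by simp
    obtain hel | hel := List.mem_append.1 hel
    · rw [hil hel] at hent
      obtain ⟨pre', post', rfl⟩ := List.append_of_mem hel
      have hnd : (pre' ++ e :: post' ++ orbitList π c).Nodup :=
        hS.nodup.append (nodup_orbitList π c) fun d hd hd' => hdisj d hd hd'
      have : pre' = pre := by
        rw [List.append_assoc, List.cons_append] at he
        rw [List.append_assoc, List.cons_append] at hnd
        exact left_unique_of_nodup hnd he
      exact this ▸ hS.parents pre' e post' rfl hent hes
    · rw [hio hel] at hent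
      subst hent
      obtain ⟨h1, -⟩ | ⟨-, -, h2, -⟩ := hup'
      · exact (hes h1).elim
      · have : l <+: pre := by
          rcases List.append_eq_append_iff.1 he with ⟨as, h3, h4⟩ | ⟨bs, h3, h4⟩
          · exact ⟨as, h3.symm⟩
          · cases bs with
            | nil => simp at h3; exact ⟨[], by simp [h3]⟩
            | cons b bs =>
              simp at h4
              exact (hc (by rw [h3, h4.1]; simp)).elim
        exact this.subset h2

end Structured

namespace Structured

variable {α : Type*}

/-- The breadth-first search from the dart in register `10`, along the orbits of the permutation in
array `c` and across the darts `d` with a nonzero entry in array `a`, where array `5` holds the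
reversals. Arrays `k`, `k + 1` and `k + 2` are those of `visit`; both directions of a crossing are
marked in array `m`. Register `2` is an upper bound for the numbers of the darts. -/
def search (c a k m : ℕ) : Stmt :=
  .ops [.const 16 0, .const 18 0, .inc 17 2 0] ;;
  .loop 17 (.ops [.put k 16 18, .inc 16 16 1, .minus 17 2 16]) ;;
  .ops [.const 11 0, .const 12 0, .const 15 0, .inc 14 10 0, .inc 16 10 0] ;;
  visit c k ;;
  .ops [.minus 19 12 11] ;;
  .loop 19 (.ops [.get 13 (k + 2) 11, .inc 11 11 1, .get 18 a 13] ;;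
    .ifz 18 (.ops []) (.ops [.get 14 5 13, .get 18 k 14] ;;
      .ifz 18 (.ops [.get 15 (k + 1) 13, .inc 15 15 1, .const 18 1, .put m 13 18, .put m 14 18,
        .inc 16 14 0] ;; visit c k) (.ops [])) ;;
    .ops [.minus 19 12 11])

/-- The arrays `k`, `k + 1` and `k + 2` hold the search tree with queue `l`. -/
structure Holds (code : α → ℕ) (l : List α) (ent : α → α) (lev : α → ℕ) (k : ℕ) (σ : St) : Prop where
  queue : ∀ i (hi : i < l.length), σ.arr (k + 2) i = code l[i]
  ent : ∀ d ∈ l, σ.arr k (code d) = code (ent d)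
  lev : ∀ d ∈ l, σ.arr (k + 1) (code d) = lev d
  unvisited : ∀ d ∉ l, σ.arr k (code d) = 0

open Classical in
theorem wp_visit_holds [Finite α] {x : List ℕ} {V c k : ℕ} {π : α → α} (hπ : Function.Injective π)
    {code : α → ℕ} (hcode : Function.Injective code) (hpos : ∀ d, 1 ≤ code d)
    (hc : c ≠ k ∧ c ≠ k + 1 ∧ c ≠ k + 2) {σ : St} {s : α} (h14 : σ.reg 14 = code s)
    (h16 : σ.reg 16 = code s) (hperm : ∀ d, σ.arr c (code d) = code (π d)) {l : List α}
    {ent : α → α} {lev : α → ℕ} {v : ℕ} (h15 : σ.reg 15 = v) (h12 : σ.reg 12 = l.length)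
    (hH : Holds code l ent lev k σ) (hl : ∀ d ∈ l, π d ∈ l) (hs : s ∉ l) :
    WP x V (visit c k) (fun σ' => σ'.reg 12 = (l ++ orbitList π s).length ∧
      Holds code (l ++ orbitList π s) (fun d => if d ∈ orbitList π s then s else ent d)
        (fun d => if d ∈ orbitList π s then v else lev d) k σ' ∧
      σ'.time + 9 * l.length = σ.time + (9 * (l ++ orbitList π s).length + 2)) σ := by
  have hdisj : ∀ d ∈ l, d ∉ orbitList π s := fun d hd hd' => by
    obtain ⟨j, rfl⟩ := (mem_orbitList hπ).1 hd'
    exact hs (mem_of_iterate_mem hπ hl hd)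
  have hlen : (orbitList π s).length = Function.minimalPeriod π s := by simp [orbitList]
  refine (wp_visit hπ hcode hpos hc h14 h16 hperm fun j => hH.unvisited _ fun h =>
    hs (mem_of_iterate_mem hπ hl h)).mono fun σ' hF ⟨h12', hE, hL, hne, hQ0, hQ, ht⟩ => ?_
  have hne' : ∀ d ∉ orbitList π s, ∀ j, π^[j] s ≠ d := fun d hd j h =>
    hd ((mem_orbitList hπ).2 ⟨j, h⟩)
  refine ⟨by rw [List.length_append, hlen, h12', h12], ⟨?_, ?_, ?_, ?_⟩, ?_⟩
  · intro i hi
    by_cases hil : i < l.length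
    · rw [hQ0 i (h12 ▸ hil), List.getElem_append_left hil, hH.queue i hil]
    · obtain ⟨j, rfl⟩ := Nat.exists_eq_add_of_le (Nat.le_of_not_lt hil)
      have := hQ j (by simp [hlen] at hi; omega)
      rw [h12] at this
      rw [List.getElem_append_right (by omega), this]
      simp [orbitList]
  · intro d hd
    by_cases hd' : d ∈ orbitList π s
    · obtain ⟨j, rfl⟩ := (mem_orbitList hπ).1 hd'
      rw [hE j, if_pos hd']
    · rw [(hne d (hne' d hd')).1, if_neg hd', hH.ent d (by simpa [hd'] using hd)]
  · intro d hd
    by_cases hd' : d ∈ orbitList π s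
    · obtain ⟨j, rfl⟩ := (mem_orbitList hπ).1 hd'
      rw [hL j, if_pos hd', h15]
    · rw [(hne d (hne' d hd')).2, if_neg hd', hH.lev d (by simpa [hd'] using hd)]
  · intro d hd
    rw [List.mem_append, not_or] at hd
    rw [(hne d (hne' d hd.2)).1, hH.unvisited d hd.1]
  · rw [ht, List.length_append, hlen]
    ring

/-- The search crossed between the orbits of `d` and `ι d`, in one of the two directions. -/
def Crossed (ι : α → α) (s : α) (l : List α) (ent : α → α) (d : α) : Prop :=
  (d ∈ l ∧ ent d = d ∧ d ≠ s) ∨ (ι d ∈ l ∧ ent (ι d) = ι d ∧ ι d ≠ s)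

open Classical in
theorem crossed_append [Finite α] {π ι : α → α} (hπ : Function.Injective π)
    (hι : Function.Involutive ι) {l : List α} (hl : ∀ d ∈ l, π d ∈ l) {s d : α} (hsl : s ∈ l)
    {ent : α → α} (hd : ι d ∉ l) (e : α) :
    Crossed ι s (l ++ orbitList π (ι d)) (fun e => if e ∈ orbitList π (ι d) then ι d else ent e) e ↔
      Crossed ι s l ent e ∨ e = ι d ∨ e = d := by
  have hιo : ι d ∈ orbitList π (ι d) := (mem_orbitList hπ).2 ⟨0, rfl⟩
  have hil : ∀ e ∈ l, e ∉ orbitList π (ι d) := fun e he h => by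
    obtain ⟨j, hj⟩ := (mem_orbitList hπ).1 h
    exact hd (mem_of_iterate_mem hπ hl (hj ▸ he))
  have key : ∀ e, (e ∈ l ++ orbitList π (ι d) ∧
      (if e ∈ orbitList π (ι d) then ι d else ent e) = e ∧ e ≠ s) ↔
      (e ∈ l ∧ ent e = e ∧ e ≠ s) ∨ e = ι d := by
    intro e
    by_cases he : e ∈ orbitList π (ι d)
    · have hel : e ∉ l := fun h => hil e h he
      simp only [List.mem_append, he, or_true, if_true, true_and, hel, false_and, false_or]
      exact ⟨fun h => h.1.symm, fun h => ⟨h.symm, by rintro rfl; exact hel hsl⟩⟩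
    · have : e ≠ ι d := by rintro rfl; exact he hιo
      simp [he, this]
  simp only [Crossed, key]
  have : ι e = ι d ↔ e = d := hι.injective.eq_iff
  rw [this]
  tauto

open Classical in
/-- The search is complete when all elements of the queue have been processed. Each element is visited
and processed once, so that the time is linear in the bound for the numbers of the elements. -/
theorem wp_search [Finite α] {x : List ℕ} {V c a k m : ℕ} {π ι : α → α} {al : α → Prop}
    (hπ : Function.Injective π) (hι : Function.Involutive ι)
    {code : α → ℕ} (hcode : Function.Injective code) (hpos : ∀ d, 1 ≤ code d)
    (hc : c ≠ k ∧ c ≠ k + 1 ∧ c ≠ k + 2 ∧ c ≠ m) (ha : a ≠ k ∧ a ≠ k + 1 ∧ a ≠ k + 2 ∧ a ≠ m)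
    (h5 : 5 ≠ k ∧ 5 ≠ k + 1 ∧ 5 ≠ k + 2 ∧ 5 ≠ m) (hm : m ≠ k ∧ m ≠ k + 1 ∧ m ≠ k + 2)
    {σ : St} {s : α} (h10 : σ.reg 10 = code s) (hcard : Nat.card α ≤ σ.reg 2)
    (hlt : ∀ d, code d < σ.reg 2) (hperm : ∀ d, σ.arr c (code d) = code (π d))
    (hsym : ∀ d, σ.arr 5 (code d) = code (ι d))
    (hall : ∀ d, σ.arr a (code d) ≠ 0 ↔ al d) :
    WP x V (search c a k m) (fun σ' => ∃ l ent lev, PartialSearch π ι al s l ent lev l.length ∧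
      l ≠ [] ∧ σ'.reg 12 = l.length ∧ Holds code l ent lev k σ' ∧
      (∀ d, σ'.arr m (code d) = if Crossed ι s l ent d then 1 else σ.arr m (code d)) ∧
      σ'.time ≤ σ.time + (30 * σ.reg 2 + 20)) σ := by
  obtain ⟨hc0, hc1, hc2, hcm⟩ := hc
  obtain ⟨ha0, ha1, ha2, ham⟩ := ha
  obtain ⟨h50, h51, h52, h5m⟩ := h5
  obtain ⟨hm0, hm1, hm2⟩ := hm
  have hwr : ∀ n, (n ≠ k ∧ n ≠ k + 1 ∧ n ≠ k + 2) → (visit c k).wa n = false := fun n hn => by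
    simp [visit, Stmt.wa, Op.wa, Ne.symm hn.1, Ne.symm hn.2.1, Ne.symm hn.2.2]
  have hlenle : ∀ {l : List α}, l.Nodup → l.length ≤ σ.reg 2 := fun {l} hl => by
    have := Fintype.ofFinite α
    exact (List.Nodup.length_le_card hl).trans ((Nat.card_eq_fintype_card (α := α)) ▸ hcard)
  -- Clearing the array of entrances.
  refine WP.seq (WP.ops ?_)
  simp only [pre, Op.eval, Op.Fits, true_and]
  refine WP.seq (WP.loop (n := σ.reg 2) (fun n τ => n + τ.reg 16 = σ.reg 2 ∧ τ.reg 17 = n ∧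
    (∀ i < τ.reg 16, τ.arr k i = 0) ∧ τ.time + 4 * n = σ.time + 3 + 4 * σ.reg 2) ?_ ?_ ?_)
  · simp
  · rintro n τ hF ⟨h1, h2, h3, h4⟩ hr
    refine WP.ops ?_
    have hF2 : τ.reg 2 = σ.reg 2 := by rw [hF.reg 2 rfl]; simp
    have hF18 : τ.reg 18 = 0 := by rw [hF.reg 18 rfl]; simp
    simp only [pre, Op.eval, Op.Fits, true_and]
    refine ⟨n - 1, by omega, ?_, ?_, fun i hi => ?_, ?_⟩
    · simp [St.tick]; omega
    · simp [St.tick, hF2]; omega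
    · simp [St.tick, hF18] at hi ⊢
      by_cases hi' : i = τ.reg 16
      · subst hi'; simp
      · rw [Function.update_of_ne hi', h3 i (by omega)]
    · simp [St.tick]; omega
  rintro n τ hF ⟨h1, h2, h3, h4⟩ hr
  have hF2 : τ.reg 2 = σ.reg 2 := by rw [hF.reg 2 rfl]; simp
  have hF10 : τ.reg 10 = σ.reg 10 := by rw [hF.reg 10 rfl]; simp
  have hFa : ∀ n, n ≠ k → τ.arr n = σ.arr n := fun n hn => by
    rw [hF.arr n (by simp [Stmt.wa, Op.wa, Ne.symm hn])]
  obtain rfl : n = 0 := by omega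
  clear hF
  -- The root orbit.
  refine WP.seq (WP.ops ?_)
  simp only [pre, Op.eval, Op.Fits, true_and]
  refine WP.seq ((wp_visit_holds hπ hcode hpos ⟨hc0, hc1, hc2⟩ (s := s) (l := []) (ent := id)
    (lev := fun _ => 0) (v := 0) ?_ ?_ ?_ ?_ ?_ ?_ ?_ ?_).mono ?_)
  · simp [St.tick, hF10, h10]
  · simp [St.tick, hF10, h10]
  · simpa [St.tick, hFa c hc0] using hperm
  · simp
  · simp
  · refine ⟨by simp, by simp, by simp, fun d _ => ?_⟩
    simp only [St.tick]
    have := hlt d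
    exact h3 _ (by omega)
  · simp
  · simp
  rintro σ₁ hF₁ ⟨h12, hH, ht⟩
  have hS₁ : PartialSearch π ι al s ([] ++ orbitList π s)
      (fun d => if d ∈ orbitList π s then s else id d)
      (fun d => if d ∈ orbitList π s then 0 else (fun _ => 0) d) 0 :=
    (PartialSearch.nil π ι al s id fun _ => 0).visit hπ (by simp) (Or.inl ⟨rfl, rfl, rfl⟩)
      (by simp) (by simp)
  have hne : [] ++ orbitList π s ≠ [] := by
    obtain ⟨t, ht⟩ := orbitList_eq_cons hπ s
    simp [ht]
  have hmk : ∀ d, σ₁.arr m (code d) = if Crossed ι s ([] ++ orbitList π s)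
      (fun d => if d ∈ orbitList π s then s else id d) d then 1 else σ.arr m (code d) := fun d => by
    rw [hF₁.arr m (hwr m ⟨hm0, hm1, hm2⟩), if_neg]
    · simp [St.tick, hFa m hm0]
    · rintro (⟨h, h', h''⟩ | ⟨h, h', h''⟩) <;> simp only [List.nil_append] at h <;>
        simp only [if_pos h] at h' <;> exact h'' h'.symm
  have ht₁ : σ₁.time + 9 * 0 ≤ σ.time + 4 * σ.reg 2 + 11 + 9 * ([] ++ orbitList π s).length := by
    simp [St.tick] at ht h4 ⊢
    omega
  have hF₁' : ∀ n, n ≠ k → n ≠ k + 1 → n ≠ k + 2 → σ₁.arr n = σ.arr n := fun n h h' h'' => by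
    rw [hF₁.arr n (hwr n ⟨h, h', h''⟩)]; simp [St.tick, hFa n h]
  have hr2 : σ₁.reg 2 = σ.reg 2 := by rw [hF₁.reg 2 rfl]; simp [St.tick, hF2]
  have hr11 : σ₁.reg 11 = 0 := by rw [hF₁.reg 11 rfl]; simp [St.tick]
  generalize [] ++ orbitList π s = l₁ at *
  generalize (fun d => if d ∈ orbitList π s then s else id d) = ent₁ at *
  generalize (fun d => if d ∈ orbitList π s then 0 else (fun _ => 0) d) = lev₁ at *
  clear hF₁ ht h1 h2 h3 h4 hF2 hF10 hFa hr τ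
  -- The main loop.
  refine WP.seq (WP.ops ?_)
  simp only [pre, Op.eval, Op.Fits, true_and]
  refine WP.loop (n := σ.reg 2) (fun n τ => ∃ l ent lev, PartialSearch π ι al s l ent lev (τ.reg 11) ∧
      l ≠ [] ∧ τ.reg 12 = l.length ∧ Holds code l ent lev k τ ∧
      (∀ d, τ.arr m (code d) = if Crossed ι s l ent d then 1 else σ.arr m (code d)) ∧
      τ.reg 19 = l.length - τ.reg 11 ∧ n + τ.reg 11 = σ.reg 2 ∧
      τ.time + 17 * n ≤ σ.time + 12 + 21 * σ.reg 2 + 9 * l.length) ?_ ?_ ?_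
  · refine ⟨l₁, ent₁, lev₁, ?_, hne, ?_, ⟨hH.queue, hH.ent, hH.lev, hH.unvisited⟩, hmk, ?_, ?_, ?_⟩
    · simpa [hr11] using hS₁
    · simpa using h12
    · simp [h12]
    · simp [hr11]
    · simp only; omega
  · rintro n τ hF ⟨l, ent, lev, hS, hl, h12', hH', hmk', h19, hn, htime⟩ hr
    have hFr2 : τ.reg 2 = σ.reg 2 := by rw [hF.reg 2 rfl]; simpa using hr2
    have hFc : τ.arr c = σ.arr c := by
      rw [hF.arr c ?_]
      · exact hF₁' c hc0 hc1 hc2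
      · simp [Stmt.wa, Op.wa, hwr c ⟨hc0, hc1, hc2⟩, Ne.symm hcm]
    have hFA : τ.arr a = σ.arr a := by
      rw [hF.arr a ?_]
      · exact hF₁' a ha0 ha1 ha2
      · simp [Stmt.wa, Op.wa, hwr a ⟨ha0, ha1, ha2⟩, Ne.symm ham]
    have hF5 : τ.arr 5 = σ.arr 5 := by
      rw [hF.arr 5 ?_]
      · exact hF₁' 5 h50 h51 h52
      · simp [Stmt.wa, Op.wa, hwr 5 ⟨h50, h51, h52⟩, Ne.symm h5m]
    have hhl : τ.reg 11 < l.length := by omega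
    obtain ⟨h, hh⟩ : ∃ h, τ.reg 11 = h := ⟨_, rfl⟩
    rw [hh] at hS hhl hn h19
    obtain ⟨d, hd⟩ : ∃ d, d = l[h] := ⟨_, rfl⟩
    have hdl : d ∈ l := hd ▸ List.getElem_mem hhl
    have hdq : τ.arr (k + 2) h = code d := hd ▸ hH'.queue h hhl
    have hadv : (al d → ι d ∈ l) → PartialSearch π ι al s l ent lev (h + 1) := fun h =>
      hS.advance hhl (hd ▸ h)
    have hlen := hlenle hS.nodup
    have hclose : ∀ τ' : St, ∀ l' ent' lev', PartialSearch π ι al s l' ent' lev' (h + 1) → l' ≠ [] →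
        τ'.reg 12 = l'.length → Holds code l' ent' lev' k τ' →
        (∀ d, τ'.arr m (code d) = if Crossed ι s l' ent' d then 1 else σ.arr m (code d)) →
        τ'.reg 11 = h + 1 → τ'.time + 9 * l.length ≤ τ.time + 16 + 9 * l'.length →
        WP x V (.ops [.minus 19 12 11]) (fun τ' => ∃ m' < n, ∃ l ent lev,
          PartialSearch π ι al s l ent lev (τ'.reg 11) ∧ l ≠ [] ∧ τ'.reg 12 = l.length ∧
          Holds code l ent lev k τ' ∧
          (∀ d, τ'.arr m (code d) = if Crossed ι s l ent d then 1 else σ.arr m (code d)) ∧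
          τ'.reg 19 = l.length - τ'.reg 11 ∧ m' + τ'.reg 11 = σ.reg 2 ∧
          τ'.time + 17 * m' ≤ σ.time + 12 + 21 * σ.reg 2 + 9 * l.length) τ' := by
      intro τ' l' ent' lev' hS' hl' h12 hH hmk h11 htm
      refine WP.ops ?_
      simp only [pre, Op.eval, Op.Fits, true_and]
      refine ⟨n - 1, by omega, l', ent', lev', ?_, hl', ?_, ⟨hH.queue, hH.ent, hH.lev, hH.unvisited⟩,
        hmk, ?_, ?_, ?_⟩
      · simpa [h11] using hS'
      · simpa using h12
      · simp [h12, h11]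
      · simp [h11]; omega
      · omega
    refine WP.seq (WP.ops ?_)
    simp [pre, Op.eval, Op.Fits, St.tick, hh, hdq, hFA]
    refine WP.seq (WP.ifz (fun h0 => ?_) fun h0 => ?_)
    · simp at h0
      refine WP.ops (hclose _ l ent lev (hadv fun h => ?_) hl ?_
        ⟨hH'.queue, hH'.ent, hH'.lev, hH'.unvisited⟩ hmk' ?_ ?_)
      · exact absurd h0 ((hall d).2 h)
      · simpa [St.tick] using h12'
      · simp [St.tick]
      · simp [St.tick]
    · simp at h0
      have hald := (hall d).1 h0
      refine WP.seq (WP.ops ?_)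
      simp [pre, Op.eval, Op.Fits, St.tick, hF5, hsym]
      refine WP.ifz (fun h1 => ?_) fun h1 => ?_
      · simp at h1
        have hιd : ι d ∉ l := fun h => by
          rw [hH'.ent _ h] at h1
          have := hpos (ent (ι d))
          omega
        have hlev : ∀ c ∈ l, lev c ≤ lev d + 1 := hS.front d (by
          rw [hd, ← List.cons_getElem_drop_succ (h := hhl)]; exact List.mem_cons_self)
        have hsl := hS.start_mem hl
        refine WP.seq (WP.ops ?_)
        simp [pre, Op.eval, Op.Fits, St.tick, hH'.lev d hdl]
        refine (wp_visit_holds hπ hcode hpos ⟨hc0, hc1, hc2⟩ (s := ι d) (l := l) (ent := ent)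
          (lev := lev) (v := lev d + 1) ?_ ?_ ?_ ?_ ?_ ?_ hS.closed hιd).mono
          fun τ₂ hF₂ ⟨h12₂, hH₂, ht₂⟩ => ?_
        · simp
        · simp
        · simpa [hcm, hFc] using hperm
        · simp
        · simpa using h12'
        · refine ⟨?_, ?_, ?_, ?_⟩
          · simpa [Ne.symm hm2] using hH'.queue
          · simpa [Ne.symm hm0] using hH'.ent
          · simpa [Ne.symm hm1] using hH'.lev
          · simpa [Ne.symm hm0] using hH'.unvisited
        · have hS₂ := hS.visit hπ hιd (v := lev d + 1)
            (Or.inr ⟨by rwa [hι], by rwa [hι], by rw [hι]⟩) hlev (fun c hc => by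
              have := hS.sorted
              rw [← List.take_append_drop h l, List.pairwise_append] at this
              rw [← List.cons_getElem_drop_succ (h := hhl)] at this hc
              rw [← hd] at this hc
              rcases List.mem_cons.1 hc with rfl | hc
              · omega
              · have := (List.pairwise_cons.1 this.2.1).1 c hc
                omega)
          have hιo : ι d ∈ orbitList π (ι d) := (mem_orbitList hπ).2 ⟨0, rfl⟩
          have hlt' : h < (l ++ orbitList π (ι d)).length := by simp; omega
          have hget : (l ++ orbitList π (ι d))[h] = d := 
            (List.getElem_append_left hhl).trans hd.symm
          refine hclose _ _ _ _ (hS₂.advance hlt' fun _ => ?_) (by simp [hl]) h12₂ hH₂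
            (fun e => ?_) ?_ ?_
          · rw [hget]
            exact List.mem_append_right _ hιo
          · rw [hF₂.arr m (hwr m ⟨hm0, hm1, hm2⟩)]
            have hcr := crossed_append (ent := ent) hπ hι hS.closed hsl hιd e
            simp only [hcr]
            by_cases he1 : e = ι d
            · simp [he1]
            · by_cases he2 : e = d
              · simp [he2, Function.update_apply]
              · have h1 : code e ≠ code (ι d) := fun h => he1 (hcode h)
                have h2 : code e ≠ code d := fun h => he2 (hcode h)
                simp [he1, he2, Function.update_of_ne h1, Function.update_of_ne h2, hmk' e]
          · rw [hF₂.reg 11 rfl]; simp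
          · simp at ht₂ ⊢; omega
      · simp at h1
        have hιd : ι d ∈ l := by
          by_contra h
          exact h1 (hH'.unvisited _ h)
        refine WP.ops (hclose _ l ent lev (hadv fun _ => hιd) hl ?_
          ⟨hH'.queue, hH'.ent, hH'.lev, hH'.unvisited⟩ hmk' ?_ ?_)
        · simpa [St.tick] using h12'
        · simp [St.tick]
        · simp [St.tick]
  · rintro n τ hF ⟨l, ent, lev, hS, hl, h12', hH', hmk', h19, hn, htime⟩ hr
    have := hS.le_length
    have hh : τ.reg 11 = l.length := by omega
    have hlen := hlenle hS.nodup
    refine ⟨l, ent, lev, hh ▸ hS, hl, h12', ⟨hH'.queue, hH'.ent, hH'.lev, hH'.unvisited⟩, hmk', ?_⟩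
    simp only [St.tick]
    omega

end Structured

namespace Structured

variable {α : Type*} {π ι : α → α} {al : α → Prop} {s : α} {l : List α} {ent : α → α} {lev : α → ℕ}

/-! ### Completed searches -/

/-- The equivalence relation generated by moving along `π`, and from `d` to `ι d` if `al d`. For the
faces of an embedding: the faces of two darts are linked by crossing edges that satisfy `al`. -/
abbrev Linked (π ι : α → α) (al : α → Prop) : α → α → Prop :=
  Relation.EqvGen fun a b => b = π a ∨ al a ∧ b = ι a

theorem Linked.of_step {R : α → α → Prop} (hR : Equivalence R) (h1 : ∀ a, R a (π a))
    (h2 : ∀ a, al a → R a (ι a)) {a b : α} (h : Linked π ι al a b) : R a b := by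
  induction h with
  | rel a b h =>
    obtain rfl | ⟨h, rfl⟩ := h
    · exact h1 a
    · exact h2 a h
  | refl a => exact hR.refl a
  | symm a b _ ih => exact hR.symm ih
  | trans a b c _ _ ih₁ ih₂ => exact hR.trans ih₁ ih₂

theorem Linked.mono {al' : α → Prop} (h : ∀ d, al d → al' d) {a b : α} (hab : Linked π ι al a b) :
    Linked π ι al' a b :=
  hab.of_step (R := Linked π ι al') (Relation.EqvGen.is_equivalence _) (fun _ => .rel _ _ (Or.inl rfl))
    fun a ha => .rel _ _ (Or.inr ⟨h a ha, rfl⟩)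

theorem Linked.iterate (al : α → Prop) (j : ℕ) (a : α) : Linked π ι al a (π^[j] a) := by
  induction j with
  | zero => exact .refl _
  | succ j ih =>
    rw [Function.iterate_succ_apply']
    exact ih.trans _ _ _ (.rel _ _ (Or.inl rfl))

theorem PartialSearch.mem_of_linked [Finite α] (hS : PartialSearch π ι al s l ent lev l.length)
    (hπ : Function.Injective π) (hι : Function.Involutive ι) (hal : ∀ d, al (ι d) ↔ al d)
    (hl : l ≠ []) {d : α} (h : Linked π ι al s d) : d ∈ l := by
  suffices s ∈ l ↔ d ∈ l from this.1 (hS.start_mem hl)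
  refine h.of_step (R := fun a b => a ∈ l ↔ b ∈ l) ⟨fun _ => Iff.rfl, Iff.symm, Iff.trans⟩
    (fun a => ⟨hS.closed a, fun h => mem_of_iterate_mem hπ hS.closed (j := 1) h⟩) fun a ha => ?_
  have hd := hS.down
  rw [List.take_length] at hd
  exact ⟨fun h => (hd a h ha).1, fun h => by simpa [hι a] using (hd _ h ((hal a).2 ha)).1⟩

/-- The crossings on the way from `d` to the root of the search, at most `n` of them: the elements at
which the orbits on the way were entered. -/
def climbN (ι ent : α → α) : ℕ → α → List α
  | 0, _ => []
  | n + 1, d => ent d :: climbN ι ent n (ι (ent d))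

theorem getElem_climbN (ι ent : α → α) (n : ℕ) (d : α) (k : ℕ) (hk : k < (climbN ι ent n d).length) :
    (climbN ι ent n d)[k] = ent ((fun d => ι (ent d))^[k] d) := by
  induction n generalizing d k with
  | zero => simp [climbN] at hk
  | succ n ih =>
    cases k with
    | zero => rfl
    | succ k =>
      simp only [climbN, List.getElem_cons_succ, Function.iterate_succ_apply]
      exact ih _ _ _

/-- All crossings on the way from `d` to the root of the search. -/
def climb (ι ent : α → α) (lev : α → ℕ) (d : α) : List α := climbN ι ent (lev d) d

/-- A search that has visited everything. -/
structure SearchTree (π ι : α → α) (al : α → Prop) (s : α) (ent : α → α) (lev : α → ℕ) : Prop where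
  ent_perm : ∀ d, ent (π d) = ent d
  lev_perm : ∀ d, lev (π d) = lev d
  ent_ent : ∀ d, ent (ent d) = ent d
  lev_ent : ∀ d, lev (ent d) = lev d
  orbit : ∀ d, ∃ j, π^[j] (ent d) = d
  up : ∀ d, ent d = s ∧ lev d = 0 ∨ ent d ≠ s ∧ al (ι (ent d)) ∧ lev (ι (ent d)) + 1 = lev d
  down : ∀ d, al d → lev (ι d) ≤ lev d + 1

theorem PartialSearch.searchTree (hS : PartialSearch π ι al s l ent lev l.length)
    (hl : ∀ d, d ∈ l) : SearchTree π ι al s ent lev where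
  ent_perm d := hS.ent_perm d (hl d)
  lev_perm d := hS.lev_perm d (hl d)
  ent_ent d := hS.ent_ent d (hl d)
  lev_ent d := hS.lev_ent d (hl d)
  orbit d := hS.orbit d (hl d)
  up d := (hS.up d (hl d)).imp id fun h => ⟨h.1, h.2.1, h.2.2.2⟩
  down d h := (hS.down d (by rw [List.take_length]; exact hl d) h).2

namespace SearchTree

variable (hS : SearchTree π ι al s ent lev)
include hS

theorem lev_eq_zero_iff {d : α} : lev d = 0 ↔ ent d = s := by
  rcases hS.up d with h | h
  · simp [h]
  · simp only [h.1, iff_false]; omega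

theorem lev_up {d : α} (h : lev d ≠ 0) : lev (ι (ent d)) + 1 = lev d := by
  rcases hS.up d with h' | h'
  · exact absurd h'.2 h
  · exact h'.2.2

omit hS in
theorem climb_of_eq_zero {d : α} (h : lev d = 0) : climb ι ent lev d = [] := by
  rw [climb, h]; rfl

theorem climb_of_ne_zero {d : α} (h : lev d ≠ 0) :
    climb ι ent lev d = ent d :: climb ι ent lev (ι (ent d)) := by
  rw [climb, ← hS.lev_up h]; rfl

omit hS in
theorem length_climb (d : α) : (climb ι ent lev d).length = lev d := by
  unfold climb
  generalize lev d = n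
  induction n generalizing d with
  | zero => rfl
  | succ n ih => simp [climbN, ih]

/-- Induction along the way to the root. -/
theorem climb_induction {P : α → Prop} (h0 : ∀ d, lev d = 0 → P d)
    (h1 : ∀ d, lev d ≠ 0 → P (ι (ent d)) → P d) (d : α) : P d := by
  obtain ⟨n, hn⟩ : ∃ n, lev d = n := ⟨_, rfl⟩
  induction n generalizing d with
  | zero => exact h0 d hn
  | succ n ih => exact h1 d (by omega) (ih _ (by have := hS.lev_up (d := d) (by omega); omega))

theorem mem_climb {d e : α} (h : e ∈ climb ι ent lev d) : ent e = e ∧ lev e ≠ 0 ∧ lev e ≤ lev d := by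
  induction d using hS.climb_induction with
  | h0 d hd => simp [climb_of_eq_zero hd] at h
  | h1 d hd ih =>
    rw [hS.climb_of_ne_zero hd, List.mem_cons] at h
    obtain rfl | h := h
    · rw [hS.ent_ent, hS.lev_ent]
      exact ⟨rfl, hd, le_rfl⟩
    · have := ih h
      have := hS.lev_up hd
      exact ⟨(ih h).1, (ih h).2.1, by omega⟩

theorem nodup_climb (d : α) : (climb ι ent lev d).Nodup := by
  induction d using hS.climb_induction with
  | h0 d hd => simp [climb_of_eq_zero hd]
  | h1 d hd ih =>
    rw [hS.climb_of_ne_zero hd, List.nodup_cons]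
    refine ⟨fun h => ?_, ih⟩
    have := (hS.mem_climb h).2.2
    rw [hS.lev_ent] at this
    have := hS.lev_up hd
    omega

theorem ent_root : ent s = s := by
  refine hS.climb_induction (P := fun _ => ent s = s) (fun d hd => ?_) (fun _ _ h => h) s
  rw [← hS.lev_eq_zero_iff.1 hd, hS.ent_ent]

/-- An edge is not crossed in both directions. -/
theorem ne_of_entrance (hι : Function.Involutive ι) {e e' : α} (h : ent e = e) (h0 : lev e ≠ 0)
    (h' : ent e' = e') (h0' : lev e' ≠ 0) : e ≠ ι e' := by
  rintro rfl
  have h1 := hS.lev_up h0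
  have h2 := hS.lev_up h0'
  rw [h, hι] at h1
  rw [h'] at h2
  omega

theorem entrance_al {e : α} (h : ent e = e) (h0 : lev e ≠ 0) : al (ι e) := by
  rcases hS.up e with h' | h'
  · exact absurd h'.2 h0
  · exact h ▸ h'.2.1

theorem linked_ent (al' : α → Prop) (d : α) : Linked π ι al' d (ent d) := by
  obtain ⟨j, hj⟩ := hS.orbit d
  have := Linked.iterate (π := π) (ι := ι) al' j (ent d)
  rw [hj] at this
  exact this.symm _ _

theorem linked_root {al' : α → Prop} {d : α} (h : ∀ e ∈ climb ι ent lev d, al' e) :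
    Linked π ι al' d s := by
  induction d using hS.climb_induction with
  | h0 d hd => rw [← hS.lev_eq_zero_iff.1 hd]; exact hS.linked_ent al' d
  | h1 d hd ih =>
    rw [hS.climb_of_ne_zero hd] at h
    refine (hS.linked_ent al' d).trans _ _ _ (.trans _ _ _ (.rel _ _ (Or.inr ⟨h _ ?_, rfl⟩)) (ih ?_))
    · exact List.mem_cons_self
    · exact fun e he => h e (List.mem_cons_of_mem _ he)

theorem linked_of_climb_eq {al' : α → Prop} {d m : α} {pre post : List α}
    (hd : climb ι ent lev d = pre ++ m :: post) (h : ∀ e ∈ pre, al' e) (h' : ∀ e ∈ post, al' e) :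
    Linked π ι al' d m ∧ Linked π ι al' (ι m) s := by
  induction d using hS.climb_induction generalizing pre with
  | h0 d h0 => simp [climb_of_eq_zero h0] at hd
  | h1 d h0 ih =>
    rw [hS.climb_of_ne_zero h0] at hd
    cases pre with
    | nil =>
      obtain ⟨rfl, rfl⟩ := List.cons.inj hd
      exact ⟨hS.linked_ent al' d, hS.linked_root h'⟩
    | cons e pre =>
      obtain ⟨rfl, hd'⟩ := List.cons.inj hd
      have := ih hd' fun e he => h e (List.mem_cons_of_mem _ he)
      exact ⟨(hS.linked_ent al' d).trans _ _ _ (.trans _ _ _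
        (.rel _ _ (Or.inr ⟨h _ List.mem_cons_self, rfl⟩)) this.1), this.2⟩

/-- The exchange step: `m` has minimal weight on the cycle that `x` closes with the tree of a search
from `x`. If `x` is exchanged for `m`, then the two sides of `m` are linked by crossings that weigh
at least as much as `m`. -/
theorem linked_exchange (hι : Function.Involutive ι) (hal : ∀ d, al (ι d) ↔ al d) {w : α → ℕ}
    (hx : ¬ al s) {m : α} (hm : m = s ∨ m ∈ climb ι ent lev (ι s)) (hms : w m ≤ w s)
    (hmw : ∀ e ∈ climb ι ent lev (ι s), w m ≤ w e) :
    Linked π ι (fun d => ((al d ∨ d = s ∨ d = ι s) ∧ d ≠ m ∧ d ≠ ι m) ∧ w m ≤ w d) m (ι m) := by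
  have halc : ∀ e ∈ climb ι ent lev (ι s), al e := fun e he =>
    (hal e).1 (hS.entrance_al (hS.mem_climb he).1 (hS.mem_climb he).2.1)
  have hxi : ¬ al (ι s) := fun h => hx ((hal s).1 h)
  obtain rfl | hmc := hm
  · refine (hS.linked_root fun e he => ⟨⟨Or.inl (halc e he), ?_, ?_⟩, hmw e he⟩).symm
    · rintro rfl; exact hx (halc _ he)
    · rintro rfl; exact hxi (halc _ he)
  · obtain ⟨pre, post, hpp⟩ := List.append_of_mem hmc
    have hnd := hS.nodup_climb (ι s)
    have hmem : ∀ e, e ∈ pre ∨ e ∈ post → e ∈ climb ι ent lev (ι s) := fun e he => by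
      rw [hpp]; simp; tauto
    have hB : ∀ e, e ∈ pre ∨ e ∈ post →
        ((al e ∨ e = s ∨ e = ι s) ∧ e ≠ m ∧ e ≠ ι m) ∧ w m ≤ w e := fun e he => by
      have hec := hmem e he
      refine ⟨⟨Or.inl (halc e hec), ?_, ?_⟩, hmw e hec⟩
      · rintro rfl
        rw [hpp, List.nodup_append] at hnd
        obtain he | he := he
        · exact hnd.2.2 e he e List.mem_cons_self rfl
        · exact (List.nodup_cons.1 hnd.2.1).1 he
      · exact hS.ne_of_entrance hι (hS.mem_climb hec).1 (hS.mem_climb hec).2.1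
          (hS.mem_climb hmc).1 (hS.mem_climb hmc).2.1
    obtain ⟨h1, h2⟩ := hS.linked_of_climb_eq hpp (fun e he => hB e (Or.inl he))
      fun e he => hB e (Or.inr he)
    refine (h1.symm.trans _ _ _ (.trans _ _ _ (.symm _ _ (.rel _ _ (Or.inr ⟨⟨⟨?_, ?_, ?_⟩, ?_⟩, rfl⟩)))
      h2.symm))
    · exact Or.inr (Or.inl rfl)
    · rintro rfl; exact hx (halc _ hmc)
    · intro h; exact hxi (by rw [h, hι]; exact halc _ hmc)
    · exact hms

end SearchTree

/-! ### Exchanging edges of the cotree -/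

/-- `al` is a connected set of crossings and `xs` lists, up to `ι`, the elements of `A` that are not
in it. For the first `j` elements `x` of `xs`, the two sides of `x` are linked by crossings that
weigh at least as much as `x`. -/
structure Cotree (π ι : α → α) (A : α → Prop) (w : α → ℕ) (al : α → Prop) (xs : List α) (j : ℕ) :
    Prop where
  symm : ∀ d, al (ι d) ↔ al d
  cover : ∀ d, A d ↔ al d ∨ d ∈ xs ∨ ι d ∈ xs
  not_mem : ∀ d ∈ xs, ¬ al d
  nodup : xs.Nodup
  inv_not_mem : ∀ d ∈ xs, ι d ∉ xs
  linked : ∀ d d', Linked π ι al d d'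
  heavy : ∀ i (hi : i < xs.length), i < j →
    Linked π ι (fun d => al d ∧ w xs[i] ≤ w d) xs[i] (ι xs[i])

/-- The propositional part of the fact that an exchange keeps the edges that are covered. -/
theorem exchange_cover {p q q' r r' u u' : Prop} (f1 : q → u) (f2 : q' → u') (f3 : r → q ∨ p)
    (f4 : r' → q' ∨ p) : (p ∨ u ∨ u') ↔
      ((p ∨ q ∨ q') ∧ ¬r ∧ ¬r') ∨ (r ∨ u ∧ ¬q) ∨ (r' ∨ u' ∧ ¬q') := by
  by_cases r <;> by_cases r' <;> by_cases q <;> by_cases q' <;> simp_all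

/-- The exchange step keeps the cotree connected, and makes the next edge heavy. The edges that were
heavy before remain so: a link by edges of weight at least `B` that used `m` has `B ≤ w m`, and can be
rerouted along the rest of the cycle, on which `m` has minimal weight. -/
theorem Cotree.exchange {A : α → Prop} {w : α → ℕ} {xs : List α} {j : ℕ}
    (hC : Cotree π ι A w al xs j) (hι : Function.Involutive ι) (hw : ∀ d, w (ι d) = w d)
    (hfix : ∀ d, ι d ≠ d) (hj : j < xs.length) {x : α} (hx : x = xs[j])
    (hS : SearchTree π ι al x ent lev) {m : α}
    (hm : m = x ∨ m ∈ climb ι ent lev (ι x)) (hms : w m ≤ w x)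
    (hmw : ∀ e ∈ climb ι ent lev (ι x), w m ≤ w e) :
    Cotree π ι A w (fun d => (al d ∨ d = x ∨ d = ι x) ∧ d ≠ m ∧ d ≠ ι m) (xs.set j m)
      (j + 1) := by
  have hxm : x ∈ xs := hx ▸ List.getElem_mem hj
  have hlink := hS.linked_exchange hι hC.symm (hC.not_mem _ hxm) hm hms hmw
  have halm : m = x ∨ al m := hm.imp id fun h =>
    (hC.symm m).1 (hS.entrance_al (hS.mem_climb h).1 (hS.mem_climb h).2.1)
  have hii : ∀ d d', ι d = ι d' ↔ d = d' := fun d d' => hι.injective.eq_iff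
  have hswap : ∀ d d', ι d = d' ↔ d = ι d' := fun d d' => by
    constructor <;> rintro rfl <;> simp [hι _]
  have hmx : ∀ d, d ∈ xs.set j m ↔ d = m ∨ d ∈ xs ∧ d ≠ x := by
    intro d
    rw [List.mem_iff_getElem]
    constructor
    · rintro ⟨i, hi, rfl⟩
      rw [List.getElem_set]
      split_ifs with hij
      · exact Or.inl rfl
      · refine Or.inr ⟨List.getElem_mem _, fun h => hij ?_⟩
        rw [hx] at h
        exact ((List.Nodup.getElem_inj_iff hC.nodup).1 h).symm
    · rintro (rfl | ⟨h, hd⟩)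
      · exact ⟨j, by simpa using hj, by simp⟩
      · obtain ⟨i, hi, rfl⟩ := List.mem_iff_getElem.1 h
        refine ⟨i, by simpa using hi, ?_⟩
        rw [List.getElem_set_ne]
        rintro rfl
        exact hd hx.symm
  have hmi : m ≠ x → m ∉ xs ∧ ι m ∉ xs := fun h =>
    have h' := halm.resolve_left h
    ⟨fun h2 => hC.not_mem _ h2 h', fun h2 => hC.not_mem _ h2 ((hC.symm m).2 h')⟩
  have hlift : ∀ (B : ℕ) {a b : α}, B ≤ w m ∨ B = 0 → Linked π ι (fun d => al d ∧ B ≤ w d) a b →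
      Linked π ι (fun d => ((al d ∨ d = x ∨ d = ι x) ∧ d ≠ m ∧ d ≠ ι m) ∧ B ≤ w d) a b := by
    intro B a b hB h
    have hl' := hlink.mono (al' := fun d => ((al d ∨ d = x ∨ d = ι x) ∧ d ≠ m ∧ d ≠ ι m) ∧ B ≤ w d)
      fun d hd => ⟨hd.1, by omega⟩
    refine h.of_step (R := Linked π ι _) (Relation.EqvGen.is_equivalence _) (fun a => .rel _ _ (Or.inl rfl)) fun a ha => ?_
    by_cases ham : a = m
    · subst ham; exact hl'
    by_cases ham' : a = ι m
    · subst ham'; rw [hι]; exact hl'.symm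
    · exact .rel _ _ (Or.inr ⟨⟨⟨Or.inl ha.1, ham, ham'⟩, ha.2⟩, rfl⟩)
  have hlow : ∀ B {a b : α}, w m < B → Linked π ι (fun d => al d ∧ B ≤ w d) a b →
      Linked π ι (fun d => ((al d ∨ d = x ∨ d = ι x) ∧ d ≠ m ∧ d ≠ ι m) ∧ B ≤ w d) a b := by
    intro B a b hB h
    refine h.mono fun d hd => ⟨⟨Or.inl hd.1, ?_, ?_⟩, hd.2⟩
    · rintro rfl; omega
    · rintro rfl; have := hw m; omega
  have hall : ∀ B {a b : α}, Linked π ι (fun d => al d ∧ B ≤ w d) a b →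
      Linked π ι (fun d => ((al d ∨ d = x ∨ d = ι x) ∧ d ≠ m ∧ d ≠ ι m) ∧ B ≤ w d) a b := by
    intro B a b h
    by_cases hB : B ≤ w m
    · exact hlift B (Or.inl hB) h
    · exact hlow B (by omega) h
  refine ⟨fun d => ?_, fun d => ?_, fun d hd => ?_, ?_, fun d hd => ?_, fun d d' => ?_, ?_⟩
  · simp only [ne_eq, hC.symm, hii, hswap d x, hswap d m]
    exact and_congr (or_congr Iff.rfl or_comm) and_comm
  · simp only [ne_eq, hC.cover, hmx, hswap d x, hswap d m]
    exact exchange_cover (fun h => h ▸ hxm) (fun h => by rwa [h, hι]) (fun h => h ▸ halm)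
      fun h => by rw [h, hii, hC.symm]; exact halm
  · rw [hmx] at hd
    rintro ⟨h | h | h, h1, h2⟩
    · obtain hd | hd := hd
      · exact h1 hd
      · exact hC.not_mem d hd.1 h
    · obtain hd | hd := hd
      · exact h1 hd
      · exact hd.2 h
    · obtain hd | hd := hd
      · exact h1 hd
      · exact hC.inv_not_mem x hxm (h ▸ hd.1)
  · by_cases h : m = x
    · rw [h, hx, List.set_getElem_self]
      exact hC.nodup
    · exact hC.nodup.set (hmi h).1
  · rw [hmx] at hd
    rw [hmx, hswap]
    rintro (h | ⟨h, h'⟩)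
    · obtain hd | hd := hd
      · exact hfix m (by rw [← h, hd])
      · by_cases hmx' : m = x
        · exact hC.inv_not_mem x hxm (by rw [← hmx', ← h]; exact hd.1)
        · exact (hmi hmx').2 (h ▸ hd.1)
    · obtain rfl | hd := hd
      · by_cases hmx' : d = x
        · exact hC.inv_not_mem x hxm (hmx' ▸ h)
        · exact (hmi hmx').2 h
      · exact hC.inv_not_mem d hd.1 h
  · exact (hall 0 ((hC.linked d d').mono fun d h => ⟨h, Nat.zero_le _⟩)).mono fun d h => h.1
  · intro i hi hij
    by_cases hij' : i = j
    · subst hij'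
      simp only [List.getElem_set_self]
      exact hlink
    · rw [List.getElem_set_ne (Ne.symm hij')]
      exact hall _ (hC.heavy i (by simpa using hi) (by omega))

end Structured

/-! ### Rotation systems -/

namespace RotationSystem

variable {N : ℕ} {G : SimpleGraph (Fin N)} (R : RotationSystem G)

instance : Finite G.Dart :=
  Finite.of_injective (fun d => d.toProd) fun _ _ h => SimpleGraph.Dart.ext _ _ h

/-- The position of a dart in the rotation around its origin. -/
def idx (d : G.Dart) : ℕ := (R.nbrs d.fst).idxOf d.snd

theorem idx_lt (d : G.Dart) : R.idx d < (R.nbrs d.fst).length :=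
  List.idxOf_lt_length_iff.2 ((R.mem_iff _ _).2 d.adj)

theorem nbrs_idx (d : G.Dart) : (R.nbrs d.fst)[R.idx d]'(R.idx_lt d) = d.snd :=
  List.getElem_idxOf (R.idx_lt d)

theorem ext_idx {d d' : G.Dart} (h : d.fst = d'.fst) (hi : R.idx d = R.idx d') : d = d' := by
  refine SimpleGraph.Dart.ext _ _ (Prod.ext h ?_)
  have h1 := R.nbrs_idx d
  have h2 := R.nbrs_idx d'
  simp only [h, hi] at h1
  exact h1.symm.trans h2

@[simp] theorem next_fst (d : G.Dart) : (R.next d).fst = d.fst := rfl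

theorem idx_next (d : G.Dart) : R.idx (R.next d) = (R.idx d + 1) % (R.nbrs d.fst).length := by
  have hlt := R.idx_lt d
  have hlt' : (R.idx d + 1) % (R.nbrs d.fst).length < (R.nbrs d.fst).length :=
    Nat.mod_lt _ (by omega)
  have h2 : (R.next d).snd = (R.nbrs d.fst)[(R.idx d + 1) % (R.nbrs d.fst).length] := by
    have := List.next_getElem (R.nbrs d.fst) (R.nodup _) (R.idx d) hlt
    simp only [R.nbrs_idx] at this
    exact this
  unfold idx at *
  rw [next_fst, h2, List.Nodup.idxOf_getElem (R.nodup _)]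

theorem idx_iterate_next (d : G.Dart) (j : ℕ) : (R.next^[j] d).fst = d.fst ∧
    R.idx (R.next^[j] d) = (R.idx d + j) % (R.nbrs d.fst).length := by
  induction j with
  | zero => exact ⟨rfl, (Nat.mod_eq_of_lt (R.idx_lt d)).symm⟩
  | succ j ih =>
    rw [Function.iterate_succ_apply', R.idx_next, next_fst, ih.1, ih.2]
    exact ⟨rfl, by simp [Nat.add_assoc]⟩

theorem exists_iterate_next {d d' : G.Dart} (h : d.fst = d'.fst) : ∃ j, R.next^[j] d = d' := by
  have hit := R.idx_iterate_next d
  have h1 := R.idx_lt d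
  have h2 := R.idx_lt d'
  rw [← h] at h2
  refine ⟨R.idx d' + (R.nbrs d.fst).length - R.idx d, R.ext_idx ((hit _).1.trans h) ?_⟩
  rw [(hit _).2, show R.idx d + (R.idx d' + (R.nbrs d.fst).length - R.idx d) =
    R.idx d' + (R.nbrs d.fst).length by omega, Nat.add_mod_right, Nat.mod_eq_of_lt h2]

theorem next_surjective : Function.Surjective R.next := by
  intro d
  obtain ⟨j, hj⟩ := R.exists_iterate_next (d := R.next d) (d' := d) rfl
  rw [← Function.iterate_succ_apply, Function.iterate_succ_apply'] at hj
  exact ⟨_, hj⟩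

theorem next_injective : Function.Injective R.next :=
  Finite.injective_iff_surjective.2 R.next_surjective

/-- Along a face: arrive along `d` and leave along the next dart. -/
def faceNext (d : G.Dart) : G.Dart := R.next d.symm

theorem faceNext_injective : Function.Injective R.faceNext := fun _ _ h =>
  SimpleGraph.Dart.symm_involutive.injective (R.next_injective h)

/-- The face whose boundary contains `d`. -/
def face (d : G.Dart) : R.Face := Quot.mk _ d

theorem face_faceNext (d : G.Dart) : R.face (R.faceNext d) = R.face d :=
  (Quot.sound (r := fun d d' : G.Dart => d' = R.next d.symm) rfl).symm

instance : Finite R.Face := inferInstanceAs (Finite (Quot _))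

end RotationSystem

/-! ### Cellular cochains of the surface that is cut open -/

namespace LoopSystem

variable {N : ℕ} {G : SimpleGraph (Fin N)} {p : Fin N} {c : ℕ} (P : LoopSystem G p c)

theorem Gap.ext' {P : LoopSystem G p c} {γ γ' : P.Gap} (h : γ.dart = γ'.dart) (h' : γ.num = γ'.num) :
    γ = γ' := by
  cases γ; cases γ'; simp only at h h'; subst h; subst h'; rfl

@[simp] theorem Gap.rev_rev {P : LoopSystem G p c} (γ : P.Gap) : γ.rev.rev = γ := by
  refine Gap.ext' ?_ ?_
  · simp [Gap.rev]
  · simp only [Gap.rev, SimpleGraph.Dart.edge_symm]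
    have := γ.num_le
    omega

instance : Finite P.Gap := by
  refine Finite.of_injective (β := Σ d : G.Dart, Fin (P.load d.edge + 1))
    (fun γ => ⟨γ.dart, γ.num, Nat.lt_succ_of_le γ.num_le⟩) fun γ γ' h => ?_
  obtain ⟨d, n, hn⟩ := γ
  obtain ⟨d', n', hn'⟩ := γ'
  simp only [Sigma.mk.injEq] at h
  obtain ⟨rfl, h⟩ := h
  simp only [heq_eq_eq, Fin.mk.injEq] at h
  exact Gap.ext' rfl h

variable (R : RotationSystem G)

instance : Finite (P.Region R) := inferInstanceAs (Finite (Quot _))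

/-- The copy of an edge that is first on the counterclockwise side of a dart. -/
def firstGap (d : G.Dart) : P.Gap := ⟨d, 0, Nat.zero_le _⟩

theorem region_corner (d : G.Dart) :
    P.region R ⟨d, P.load d.edge, le_rfl⟩ = P.region R (P.firstGap (R.next d)) :=
  Quot.sound (.corner d)

theorem region_firstGap_rev (d : G.Dart) :
    P.region R (P.firstGap d).rev = P.region R (P.firstGap (R.faceNext d)) := by
  rw [RotationSystem.faceNext, ← region_corner]
  congr 1
  exact Gap.ext' rfl (by simp [Gap.rev, firstGap])

theorem adj_or_eq (γ : P.Gap) : P.region R γ = P.region R γ.rev ∨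
    (P.cutGraph R).Adj (P.region R γ) (P.region R γ.rev) := by
  by_cases h : P.region R γ = P.region R γ.rev
  · exact Or.inl h
  · refine Or.inr ?_
    rw [cutGraph, SimpleGraph.fromRel_adj]
    exact ⟨h, Or.inl ⟨γ, rfl, rfl⟩⟩

theorem reachable_rev (γ : P.Gap) :
    (P.cutGraph R).Reachable (P.region R γ) (P.region R γ.rev) := by
  obtain h | h := P.adj_or_eq R γ
  · rw [h]
  · exact h.reachable

/-- A dart along a given edge. -/
noncomputable def edgeDart (e : G.edgeSet) : G.Dart :=
  ⟨(Quot.out e.1), by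
    have h : e.1 ∈ G.edgeSet := e.2
    rw [← Quot.out_eq e.1] at h
    exact h⟩

theorem edge_edgeDart (e : G.edgeSet) : (edgeDart e).edge = e.1 := Quot.out_eq e.1

/-- The undirected copy of an edge that belongs to a directed one. -/
noncomputable def cutEdge (γ : P.Gap) : P.CutEdge :=
  ⟨⟨γ.dart.edge, γ.dart.edge_mem⟩, if γ.dart = edgeDart ⟨γ.dart.edge, γ.dart.edge_mem⟩ then
    ⟨γ.num, Nat.lt_succ_of_le γ.num_le⟩ else
    ⟨P.load γ.dart.edge - γ.num, Nat.lt_succ_of_le (Nat.sub_le _ _)⟩⟩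

theorem cutEdge_rev (γ : P.Gap) : P.cutEdge γ.rev = P.cutEdge γ := by
  obtain ⟨d, n, hn⟩ := γ
  have he : edgeDart ⟨d.edge, d.edge_mem⟩ = d ∨ edgeDart ⟨d.edge, d.edge_mem⟩ = d.symm :=
    (SimpleGraph.dart_edge_eq_iff _ _).1 (edge_edgeDart _)
  have hs : (⟨d.symm.edge, d.symm.edge_mem⟩ : G.edgeSet) = ⟨d.edge, d.edge_mem⟩ := by
    simp
  have hne : d.symm ≠ d := SimpleGraph.Dart.symm_ne d
  unfold cutEdge
  simp only [Gap.rev]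
  refine Sigma.ext hs ?_
  have key : ∀ (e e' : G.edgeSet) (h : e = e') (a : Fin (P.load e + 1)) (b : Fin (P.load e' + 1)),
      (a : ℕ) = b → HEq a b := by
    rintro e _ rfl a b h
    exact heq_of_eq (Fin.ext h)
  refine key _ _ hs _ _ ?_
  simp only [hs]
  obtain he | he := he
  · rw [he, if_neg hne, if_pos rfl]
    simp only [SimpleGraph.Dart.edge_symm]
    omega
  · rw [he, if_pos rfl, if_neg hne.symm]

theorem exists_cutEdge_eq (ε : P.CutEdge) : ∃ γ : P.Gap, P.cutEdge γ = ε := by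
  obtain ⟨⟨e, he⟩, n, hn⟩ := ε
  have hd := edge_edgeDart ⟨e, he⟩
  simp only at hd
  have : ∀ (d : G.Dart), d = edgeDart ⟨e, he⟩ → d.edge = e → ∃ γ : P.Gap, P.cutEdge γ = ⟨⟨e, he⟩, n, hn⟩ := by
    rintro d hd rfl
    refine ⟨⟨d, n, Nat.le_of_lt_succ hn⟩, ?_⟩
    simp only [cutEdge]
    rw [if_pos hd]
  exact this _ rfl hd

theorem cutEdge_eq_iff {γ γ' : P.Gap} (h : P.cutEdge γ = P.cutEdge γ') : γ = γ' ∨ γ = γ'.rev := by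
  have he : γ.dart.edge = γ'.dart.edge := congrArg (fun ε : P.CutEdge => ε.1.1) h
  wlog hd : γ.dart = γ'.dart generalizing γ'
  · have hd' : γ.dart = γ'.rev.dart := ((SimpleGraph.dart_edge_eq_iff _ _).1 he).resolve_left hd
    have := this (γ' := γ'.rev) (by rw [h, cutEdge_rev]) (by rw [he]; simp [Gap.rev]) hd'
    rw [Gap.rev_rev] at this
    exact this.symm
  · obtain ⟨d, n, hn⟩ := γ
    obtain ⟨d', n', hn'⟩ := γ'
    simp only at hd
    subst hd
    unfold cutEdge at h
    simp only [Sigma.mk.injEq, heq_eq_eq, true_and] at h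
    refine Or.inl (Gap.ext' rfl ?_)
    simp only
    split_ifs at h <;> simp at h <;> omega

/-- Two different darts have their first copies on the same undirected copy of an edge only if the
edge carries no strand. -/
theorem cutEdge_firstGap_inj {d d' : G.Dart} (h : P.cutEdge (P.firstGap d) = P.cutEdge (P.firstGap d')) :
    d = d' ∨ d = d'.symm ∧ P.load d'.edge = 0 := by
  have he : d.edge = d'.edge := congrArg (fun ε : P.CutEdge => ε.1.1) h
  obtain rfl | rfl := (SimpleGraph.dart_edge_eq_iff _ _).1 he
  · exact Or.inl rfl
  obtain h | h := P.cutEdge_eq_iff h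
  · exact absurd (congrArg Gap.dart h) (SimpleGraph.Dart.symm_ne d')
  · exact Or.inr ⟨rfl, by simpa [Gap.rev, firstGap, eq_comm] using congrArg Gap.num h⟩

section Cochains

/-- The coboundary of a function on the regions. -/
noncomputable def coboundary : (P.Region R → ZMod 2) →ₗ[ZMod 2] (P.CutEdge → ZMod 2) where
  toFun h ε := h (P.region R (P.exists_cutEdge_eq ε).choose) +
    h (P.region R (P.exists_cutEdge_eq ε).choose.rev)
  map_add' h h' := by funext ε; simp only [Pi.add_apply]; ring
  map_smul' a h := by funext ε; simp only [Pi.smul_apply, smul_eq_mul, RingHom.id_apply]; ring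

theorem coboundary_apply (h : P.Region R → ZMod 2) (γ : P.Gap) :
    P.coboundary R h (P.cutEdge γ) = h (P.region R γ) + h (P.region R γ.rev) := by
  have hc := (P.exists_cutEdge_eq (P.cutEdge γ)).choose_spec
  obtain hc | hc := P.cutEdge_eq_iff hc
  · simp only [coboundary, LinearMap.coe_mk, AddHom.coe_mk]
    rw [hc]
  · simp only [coboundary, LinearMap.coe_mk, AddHom.coe_mk]
    rw [hc, Gap.rev_rev, add_comm]

/-- On a connected graph only the constant functions have coboundary zero. -/
theorem ker_coboundary_le (hc : (P.cutGraph R).Connected) :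
    LinearMap.ker (P.coboundary R) ≤ Submodule.span (ZMod 2) {fun _ => 1} := by
  intro h hh
  rw [LinearMap.mem_ker] at hh
  rw [Submodule.mem_span_singleton]
  obtain ⟨r₀⟩ := hc.nonempty
  refine ⟨h r₀, funext fun r => ?_⟩
  have hadj : ∀ γ : P.Gap, h (P.region R γ) = h (P.region R γ.rev) := fun γ => by
    have := congrFun hh (P.cutEdge γ)
    rw [coboundary_apply] at this
    exact CharTwo.add_eq_zero.1 this
  have : ∀ r s, (P.cutGraph R).Reachable r s → h r = h s := by
    rintro r s ⟨w⟩
    induction w with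
    | nil => rfl
    | cons ha _ ih =>
      rw [← ih]
      rw [cutGraph, SimpleGraph.fromRel_adj] at ha
      obtain ⟨-, ⟨γ, rfl, rfl⟩ | ⟨γ, rfl, rfl⟩⟩ := ha
      · exact hadj γ
      · exact (hadj γ).symm
  simpa using this r₀ r (hc.preconnected _ _)

open Classical in
/-- The sum of a function on the copies of edges around each face. -/
noncomputable def faceSum [Fintype G.Dart] : (P.CutEdge → ZMod 2) →ₗ[ZMod 2] (R.Face → ZMod 2) where
  toFun z f := ∑ d : G.Dart with R.face d = f, z (P.cutEdge (P.firstGap d))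
  map_add' h h' := by funext f; simp [Finset.sum_add_distrib]
  map_smul' a h := by funext f; simp [Finset.mul_sum]

variable [Fintype G.Dart]

/-- Each region on the boundary of a face is counted twice, once for each of two consecutive edges. -/
theorem faceSum_coboundary (h : P.Region R → ZMod 2) : P.faceSum R (P.coboundary R h) = 0 := by
  classical
  funext f
  simp only [faceSum, LinearMap.coe_mk, AddHom.coe_mk, coboundary_apply, region_firstGap_rev,
    Finset.sum_add_distrib, Pi.zero_apply]
  have : ∑ d : G.Dart with R.face d = f, h (P.region R (P.firstGap (R.faceNext d))) =
      ∑ d : G.Dart with R.face d = f, h (P.region R (P.firstGap d)) := by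
    refine Finset.sum_bijective R.faceNext (Finite.injective_iff_bijective.1 R.faceNext_injective)
      (fun d => ?_) fun d _ => rfl
    simp [R.face_faceNext]
  rw [this]
  exact CharTwo.add_self_eq_zero _

/-- Faces that are linked by edges without strands form one component, on which any two faces can be
joined by a path of such edges. The first copy of an edge that carries a strand lies on one face only,
so that the sum over all faces is not constrained. -/
theorem faceSum_surjective
    (hC : ∀ d d', Structured.Linked R.faceNext SimpleGraph.Dart.symm (fun d => P.load d.edge = 0) d d')
    {d₀ : G.Dart} (hd₀ : P.load d₀.edge ≠ 0) : Function.Surjective (P.faceSum R) := by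
  classical
  rw [← LinearMap.range_eq_top]
  have hbase : Pi.single (R.face d₀) 1 ∈ LinearMap.range (P.faceSum R) := by
    refine ⟨Pi.single (P.cutEdge (P.firstGap d₀)) 1, funext fun f => ?_⟩
    have : ∀ d, (Pi.single (P.cutEdge (P.firstGap d₀)) 1 : P.CutEdge → ZMod 2)
        (P.cutEdge (P.firstGap d)) = if d = d₀ then 1 else 0 := fun d => by
      rw [Pi.single_apply]
      refine if_congr ⟨fun h => ?_, fun h => by rw [h]⟩ rfl rfl
      obtain h | h := P.cutEdge_firstGap_inj h
      · exact h
      · exact absurd h.2 hd₀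
    simp only [faceSum, LinearMap.coe_mk, AddHom.coe_mk, this, Finset.sum_ite_eq', Finset.mem_filter,
      Finset.mem_univ, true_and, Pi.single_apply]
    exact if_congr eq_comm rfl rfl
  have hstep : ∀ d d', (Pi.single (R.face d) 1 - Pi.single (R.face d') 1 : R.Face → ZMod 2) ∈
      LinearMap.range (P.faceSum R) := fun d d' => by
    refine (hC d d').of_step (R := fun d d' => (Pi.single (R.face d) 1 - Pi.single (R.face d') 1 :
      R.Face → ZMod 2) ∈ LinearMap.range (P.faceSum R)) ⟨fun d => ?_, fun h => ?_, fun h h' => ?_⟩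
      (fun d => ?_) fun d hd => ?_
    · rw [sub_self]; exact Submodule.zero_mem _
    · rw [← neg_sub]; exact Submodule.neg_mem _ h
    · have := Submodule.add_mem _ h h'
      rwa [sub_add_sub_cancel] at this
    · rw [R.face_faceNext, sub_self]; exact Submodule.zero_mem _
    · refine ⟨Pi.single (P.cutEdge (P.firstGap d)) 1, funext fun f => ?_⟩
      have : ∀ d', (Pi.single (P.cutEdge (P.firstGap d)) 1 : P.CutEdge → ZMod 2)
          (P.cutEdge (P.firstGap d')) = (if d' = d then 1 else 0) + (if d' = d.symm then 1 else 0) := by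
        intro d'
        have hne : d.symm ≠ d := SimpleGraph.Dart.symm_ne d
        rw [Pi.single_apply]
        by_cases h1 : d' = d
        · subst h1; simp [hne.symm]
        by_cases h2 : d' = d.symm
        · subst h2
          rw [if_neg h1, if_pos rfl, if_pos]
          · simp
          · rw [← cutEdge_rev]
            congr 1
            exact Gap.ext' (by simp [Gap.rev, firstGap]) (by simp [Gap.rev, firstGap, hd])
        · rw [if_neg h1, if_neg h2, if_neg]
          · simp
          · intro h
            obtain h | h := P.cutEdge_firstGap_inj h
            · exact h1 h
            · exact h2 h.1
      simp only [faceSum, LinearMap.coe_mk, AddHom.coe_mk, this, Finset.sum_add_distrib,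
        Finset.sum_ite_eq', Finset.mem_filter, Finset.mem_univ, true_and, Pi.sub_apply,
        Pi.single_apply, CharTwo.sub_eq_add]
      exact congrArg₂ _ (if_congr eq_comm rfl rfl) (if_congr eq_comm rfl rfl)
  have hall : ∀ f, (Pi.single f 1 : R.Face → ZMod 2) ∈ LinearMap.range (P.faceSum R) := by
    rintro ⟨d⟩
    have := Submodule.add_mem _ (hstep d d₀) hbase
    rwa [sub_add_cancel] at this
  have := Fintype.ofFinite R.Face
  rw [eq_top_iff]
  intro v _
  rw [pi_eq_sum_univ v]
  refine Submodule.sum_mem _ fun f _ => Submodule.smul_mem _ _ ?_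
  convert hall f using 1
  funext g
  simp [Pi.single_apply, eq_comm]

/-- The Euler characteristic of the surface that is cut open along the loops is at most `1`, and if
it is `1`, then every function on the edges with vanishing sums around all faces is a coboundary. -/
theorem euler_le (hc : (P.cutGraph R).Connected)
    (hC : ∀ d d', Structured.Linked R.faceNext SimpleGraph.Dart.symm (fun d => P.load d.edge = 0) d d')
    {d₀ : G.Dart} (hd₀ : P.load d₀.edge ≠ 0) :
    Nat.card (P.Region R) + Nat.card R.Face ≤ Nat.card P.CutEdge + 1 ∧
    (Nat.card (P.Region R) + Nat.card R.Face = Nat.card P.CutEdge + 1 →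
      ∀ z, P.faceSum R z = 0 → ∃ h, P.coboundary R h = z) := by
  have := Fintype.ofFinite R.Face
  have := Fintype.ofFinite (P.Region R)
  have := Fintype.ofFinite P.CutEdge
  have h1 := LinearMap.finrank_range_add_finrank_ker (P.coboundary R)
  have h2 := LinearMap.finrank_range_add_finrank_ker (P.faceSum R)
  rw [LinearMap.range_eq_top.2 (P.faceSum_surjective R hC hd₀), finrank_top] at h2
  simp only [Module.finrank_fintype_fun_eq_card] at h1 h2
  have h3 : Module.finrank (ZMod 2) (LinearMap.ker (P.coboundary R)) ≤ 1 :=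
    (Submodule.finrank_mono (P.ker_coboundary_le R hc)).trans
      ((finrank_span_le_card _).trans (by simp))
  have h4 : LinearMap.range (P.coboundary R) ≤ LinearMap.ker (P.faceSum R) := by
    rintro _ ⟨h, rfl⟩
    exact P.faceSum_coboundary R h
  have h5 := Submodule.finrank_mono h4
  simp only [Nat.card_eq_fintype_card]
  refine ⟨by omega, fun he z hz => ?_⟩
  have h6 := Submodule.eq_of_le_of_finrank_le h4 (by omega)
  have : z ∈ LinearMap.ker (P.faceSum R) := hz
  rw [← h6] at this
  exact this

end Cochains

end LoopSystem

/-! ### Loops through a spanning tree -/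

/-- A spanning tree of an embedded graph, given by a search, and `c` edges outside of it. -/
structure TreeLoops {N : ℕ} {G : SimpleGraph (Fin N)} (R : RotationSystem G) (p : Fin N) (c : ℕ) where
  root : G.Dart
  ent : G.Dart → G.Dart
  lev : G.Dart → ℕ
  tree : Structured.SearchTree R.next SimpleGraph.Dart.symm (fun _ => True) root ent lev
  root_fst : root.fst = p
  x : Fin c → G.Dart
  edge_inj : ∀ i j, (x i).edge = (x j).edge → i = j
  x_not_par : ∀ i, ¬ (ent (x i) = x i ∧ lev (x i) ≠ 0)
  x_symm_not_par : ∀ i, ¬ (ent (x i).symm = (x i).symm ∧ lev (x i).symm ≠ 0)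

namespace TreeLoops

variable {N : ℕ} {G : SimpleGraph (Fin N)} {R : RotationSystem G} {p : Fin N} {c : ℕ}
  (T : TreeLoops R p c)

/-- The dart leads from a vertex to its parent in the tree. -/
def Par (d : G.Dart) : Prop := T.ent d = d ∧ T.lev d ≠ 0

theorem ent_iterate (d : G.Dart) (j : ℕ) :
    T.ent (R.next^[j] d) = T.ent d ∧ T.lev (R.next^[j] d) = T.lev d := by
  induction j with
  | zero => exact ⟨rfl, rfl⟩
  | succ j ih => rw [Function.iterate_succ_apply', T.tree.ent_perm, T.tree.lev_perm]; exact ih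

theorem ent_congr {d d' : G.Dart} (h : d.fst = d'.fst) : T.ent d = T.ent d' := by
  obtain ⟨j, rfl⟩ := R.exists_iterate_next h
  exact (T.ent_iterate d j).1.symm

theorem lev_congr {d d' : G.Dart} (h : d.fst = d'.fst) : T.lev d = T.lev d' := by
  obtain ⟨j, rfl⟩ := R.exists_iterate_next h
  exact (T.ent_iterate d j).2.symm

theorem ent_fst (d : G.Dart) : (T.ent d).fst = d.fst := by
  obtain ⟨j, hj⟩ := T.tree.orbit d
  conv_rhs => rw [← hj]
  exact (R.idx_iterate_next _ j).1.symm

theorem lev_eq_zero (d : G.Dart) : T.lev d = 0 ↔ d.fst = p := by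
  rw [T.tree.lev_eq_zero_iff]
  constructor
  · intro h
    rw [← T.ent_fst, h, T.root_fst]
  · intro h
    rw [T.ent_congr (h.trans T.root_fst.symm), T.tree.ent_root]

/-- The dart that enters a vertex of the tree from its parent, reached from any dart at a child. -/
def up (d : G.Dart) : G.Dart := (T.ent d).symm

theorem lev_up {d : G.Dart} (h : T.lev d ≠ 0) : T.lev (T.up d) + 1 = T.lev d := T.tree.lev_up h

theorem par_ent {d : G.Dart} (h : T.lev d ≠ 0) : T.Par (T.ent d) :=
  ⟨T.tree.ent_ent d, by rwa [T.tree.lev_ent]⟩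

theorem par_symm_up {d : G.Dart} (h : T.lev d ≠ 0) : T.Par (T.up d).symm := by
  rw [up, SimpleGraph.Dart.symm_symm]
  exact T.par_ent h

theorem Par.symm_not {T : TreeLoops R p c} {d : G.Dart} (h : T.Par d) : ¬ T.Par d.symm := fun h' =>
  T.tree.ne_of_entrance SimpleGraph.Dart.symm_involutive h'.1 h'.2 h.1 h.2 rfl

theorem not_par_up {d : G.Dart} (h : T.lev d ≠ 0) : ¬ T.Par (T.up d) := (T.par_ent h).symm_not

/-- The loop through `x i` has two ends, each of which runs to the root: `(i, true)` starts at the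
origin of `x i` and `(i, false)` at its target. -/
def tip (y : Fin c × Bool) : G.Dart := if y.2 then T.x y.1 else (T.x y.1).symm

theorem tip_not_par (y : Fin c × Bool) : ¬ T.Par (T.tip y) := by
  unfold tip
  split_ifs
  · exact T.x_not_par _
  · exact T.x_symm_not_par _

theorem tip_symm_not_par (y : Fin c × Bool) : ¬ T.Par (T.tip y).symm := by
  unfold tip
  split_ifs
  · exact T.x_symm_not_par _
  · rw [SimpleGraph.Dart.symm_symm]; exact T.x_not_par _

theorem tip_injective : Function.Injective T.tip := by
  rintro ⟨i, b⟩ ⟨j, b'⟩ h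
  have hij : i = j := T.edge_inj i j <| by
    have := congrArg SimpleGraph.Dart.edge h
    unfold tip at this
    split_ifs at this <;> simpa using this
  subst hij
  have hne := SimpleGraph.Dart.symm_ne (T.x i)
  cases b <;> cases b'
  · rfl
  · exact absurd h hne
  · exact absurd h.symm hne
  · rfl

/-- The dart along which the end `y` of a loop leaves the vertex of level `j`, going away from the
root. -/
def out (y : Fin c × Bool) (j : ℕ) : G.Dart := T.up^[T.lev (T.tip y) - j] (T.tip y)

theorem lev_iterate_up (d : G.Dart) (t : ℕ) (h : t ≤ T.lev d) : T.lev (T.up^[t] d) + t = T.lev d := by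
  induction t with
  | zero => rfl
  | succ t ih =>
    have h1 := ih (by omega)
    have h2 := T.lev_up (d := T.up^[t] d) (by omega)
    rw [Function.iterate_succ_apply']
    omega

theorem lev_out {y : Fin c × Bool} {j : ℕ} (h : j ≤ T.lev (T.tip y)) : T.lev (T.out y j) = j := by
  have := T.lev_iterate_up (T.tip y) (T.lev (T.tip y) - j) (by omega)
  unfold out
  omega

theorem out_top (y : Fin c × Bool) : T.out y (T.lev (T.tip y)) = T.tip y := by simp [out]

theorem out_pred {y : Fin c × Bool} {j : ℕ} (h : j < T.lev (T.tip y)) :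
    T.out y j = T.up (T.out y (j + 1)) := by
  unfold out
  rw [← Function.iterate_succ_apply' T.up]
  congr 1
  omega

theorem par_symm_out {y : Fin c × Bool} {j : ℕ} (h : j < T.lev (T.tip y)) : T.Par (T.out y j).symm := by
  rw [T.out_pred h]
  exact T.par_symm_up (by rw [T.lev_out h]; omega)

theorem out_not_par {y : Fin c × Bool} {j : ℕ} (h : j ≤ T.lev (T.tip y)) : ¬ T.Par (T.out y j) := by
  obtain h | rfl := h.lt_or_eq
  · rw [T.out_pred h]
    exact T.not_par_up (by rw [T.lev_out h]; omega)
  · rw [out_top]; exact T.tip_not_par y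

theorem symm_out_eq_ent {y : Fin c × Bool} {j : ℕ} (h : j < T.lev (T.tip y)) :
    (T.out y j).symm = T.ent (T.out y (j + 1)) := by
  rw [T.out_pred h, up, SimpleGraph.Dart.symm_symm]

/-- An end of a loop runs along the dart outside of the tree of another end only if the two are equal. -/
theorem eq_of_out_tip {y y' : Fin c × Bool} {j : ℕ} (h : j ≤ T.lev (T.tip y))
    (he : T.out y j = T.tip y') : y = y' ∧ j = T.lev (T.tip y) := by
  obtain h | rfl := h.lt_or_eq
  · exact absurd (he ▸ T.par_symm_out h) (T.tip_symm_not_par y')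
  · rw [out_top] at he
    exact ⟨T.tip_injective he, rfl⟩

/-! ### The loops as walks -/

/-- The crossings of the tree on the way from the origin of a dart to the root. -/
def climb (d : G.Dart) : List G.Dart := Structured.climb SimpleGraph.Dart.symm T.ent T.lev d

theorem length_climb (d : G.Dart) : (T.climb d).length = T.lev d :=
  Structured.SearchTree.length_climb d

theorem getElem_climb (d : G.Dart) (k : ℕ) (hk : k < (T.climb d).length) :
    (T.climb d)[k] = T.ent (T.up^[k] d) := Structured.getElem_climbN _ _ _ _ _ hk

theorem exists_walk (d : G.Dart) {v : Fin N} (hv : d.fst = v) :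
    ∃ W : G.Walk v p, W.darts = T.climb d := by
  induction d using T.tree.climb_induction generalizing v with
  | h0 d hd =>
    have := (T.lev_eq_zero d).1 hd
    refine ⟨SimpleGraph.Walk.nil.copy (hv.symm.trans this).symm rfl, ?_⟩
    rw [SimpleGraph.Walk.darts_copy, climb, Structured.SearchTree.climb_of_eq_zero hd]
    rfl
  | h1 d hd ih =>
    obtain ⟨W, hW⟩ := ih (v := (T.ent d).snd) rfl
    refine ⟨(SimpleGraph.Walk.cons (T.ent d).adj W).copy ((T.ent_fst d).trans hv) rfl, ?_⟩
    rw [SimpleGraph.Walk.darts_copy, climb, T.tree.climb_of_ne_zero hd, SimpleGraph.Walk.darts_cons, hW]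
    rfl

theorem exists_loop (i : Fin c) : ∃ W : G.Walk p p, W.darts =
    ((T.climb (T.x i)).map SimpleGraph.Dart.symm).reverse ++ T.x i :: T.climb (T.x i).symm := by
  obtain ⟨W₁, h₁⟩ := T.exists_walk (T.x i) rfl
  obtain ⟨W₂, h₂⟩ := T.exists_walk (T.x i).symm (v := (T.x i).snd) rfl
  refine ⟨W₁.reverse.append (.cons (T.x i).adj W₂), ?_⟩
  rw [SimpleGraph.Walk.darts_append, SimpleGraph.Walk.darts_reverse, SimpleGraph.Walk.darts_cons, h₁,
    ← h₂]

/-- The loop that runs from the root to `x i` through the tree, along `x i`, and back. -/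
noncomputable def loop (i : Fin c) : G.Walk p p := (T.exists_loop i).choose

theorem darts_loop (i : Fin c) : (T.loop i).darts =
    ((T.climb (T.x i)).map SimpleGraph.Dart.symm).reverse ++ T.x i :: T.climb (T.x i).symm :=
  (T.exists_loop i).choose_spec

theorem length_loop (i : Fin c) : (T.loop i).length = T.lev (T.x i) + T.lev (T.x i).symm + 1 := by
  rw [← SimpleGraph.Walk.length_darts, darts_loop]
  simp [length_climb]
  omega

theorem tip_true (i : Fin c) : T.tip (i, true) = T.x i := rfl

theorem tip_false (i : Fin c) : T.tip (i, false) = (T.x i).symm := rfl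

theorem dart_step_le (i : Fin c) (k : Fin (T.loop i).length) (h : (k : ℕ) ≤ T.lev (T.x i)) :
    LoopStep.dart (⟨i, k⟩ : LoopStep T.loop) = T.out (i, true) k := by
  unfold LoopStep.dart
  simp only [darts_loop]
  obtain h' | h' := h.lt_or_eq
  · rw [List.getElem_append_left (by simpa [length_climb] using h'), List.getElem_reverse,
      List.getElem_map, getElem_climb, T.out_pred (by simpa [tip_true] using h')]
    simp only [List.length_map, length_climb, up, out, tip_true]
    congr 3
    omega
  · rw [List.getElem_append_right (by simp [length_climb, h'])]
    simp [length_climb, h', ← tip_true, out_top]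

theorem dart_step_ge (i : Fin c) (k : Fin (T.loop i).length) (h : T.lev (T.x i) ≤ (k : ℕ)) :
    LoopStep.dart (⟨i, k⟩ : LoopStep T.loop) =
      (T.out (i, false) (T.lev (T.x i) + T.lev (T.x i).symm - k)).symm := by
  obtain h' | h' := h.lt_or_eq
  · have hk := k.2.trans_eq (T.length_loop i)
    unfold LoopStep.dart
    simp only [darts_loop]
    rw [List.getElem_append_right (by simpa [length_climb] using h), List.getElem_cons,
      dif_neg (by simp [length_climb]; omega), getElem_climb,
      T.out_pred (by rw [tip_false]; omega)]
    simp only [List.length_map, List.length_reverse, length_climb, up, out, tip_false,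
      SimpleGraph.Dart.symm_symm]
    congr 2
    omega
  · rw [dart_step_le _ _ _ h'.ge, ← h', ← tip_true, out_top, tip_true]
    have := T.out_top (i, false)
    rw [tip_false] at this
    rw [Nat.add_sub_cancel_left, this, SimpleGraph.Dart.symm_symm]

end TreeLoops

namespace TreeLoops

variable {N : ℕ} {G : SimpleGraph (Fin N)} {R : RotationSystem G} {p : Fin N} {c : ℕ}
  (T : TreeLoops R p c)

/-! ### Strands along an edge -/

/-- The number of strands along the edge of a dart. -/
noncomputable def ld (d : G.Dart) : ℕ := LoopStep.load T.loop d.edge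

theorem ld_symm (d : G.Dart) : T.ld d.symm = T.ld d := by rw [ld, SimpleGraph.Dart.edge_symm, ld]

/-- The end of a loop to which a step belongs; the step along `x i` is attributed to `(i, true)`. -/
def wire (s : LoopStep T.loop) : Fin c × Bool := (s.1, decide ((s.2 : ℕ) ≤ T.lev (T.x s.1)))

/-- The level of the end of a step that is closer to the root. -/
def depth (s : LoopStep T.loop) : ℕ :=
  if (s.2 : ℕ) ≤ T.lev (T.x s.1) then s.2 else T.lev (T.x s.1) + T.lev (T.x s.1).symm - s.2

theorem depth_le (s : LoopStep T.loop) : T.depth s ≤ T.lev (T.tip (T.wire s)) := by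
  obtain ⟨i, k⟩ := s
  have hk := k.2.trans_eq (T.length_loop i)
  unfold depth wire tip
  by_cases h : (k : ℕ) ≤ T.lev (T.x i)
  · simp [h]
  · simp only [h, decide_false, if_false, Bool.false_eq_true]
    omega

theorem dart_eq (s : LoopStep T.loop) : s.dart =
    if (T.wire s).2 then T.out (T.wire s) (T.depth s) else (T.out (T.wire s) (T.depth s)).symm := by
  obtain ⟨i, k⟩ := s
  by_cases h : (k : ℕ) ≤ T.lev (T.x i)
  · rw [T.dart_step_le i k h]
    simp [wire, depth, h]
  · rw [T.dart_step_ge i k (by omega)]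
    simp [wire, depth, h]

theorem edge_step (s : LoopStep T.loop) : s.dart.edge = (T.out (T.wire s) (T.depth s)).edge := by
  rw [dart_eq]
  split_ifs
  · rfl
  · rw [SimpleGraph.Dart.edge_symm]

/-- The step of an end of a loop between the levels `j` and `j + 1`. -/
def stepAt (y : Fin c × Bool) (j : ℕ) : LoopStep T.loop :=
  ⟨y.1, if y.2 then min j (T.lev (T.x y.1)) else T.lev (T.x y.1) + T.lev (T.x y.1).symm - j, by
    rw [length_loop]
    split_ifs <;> omega⟩

theorem edge_stepAt {y : Fin c × Bool} {j : ℕ} (h : j ≤ T.lev (T.tip y)) :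
    (T.stepAt y j).dart.edge = (T.out y j).edge := by
  obtain ⟨i, b⟩ := y
  cases b
  · rw [tip_false] at h
    rw [stepAt, dart_step_ge _ _ _ (by simp; omega)]
    simp only [Bool.false_eq_true, if_false, SimpleGraph.Dart.edge_symm]
    congr 2
    omega
  · rw [tip_true] at h
    rw [stepAt, dart_step_le _ _ _ (by simp)]
    simp [h]

open Classical in
/-- The strands along an edge belong to the ends of loops that leave a vertex along it. -/
theorem ld_eq_card {d : G.Dart} (hd : ¬ T.Par d) : T.ld d =
    (Finset.univ.filter fun y => T.lev d ≤ T.lev (T.tip y) ∧ T.out y (T.lev d) = d).card := by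
  symm
  unfold ld LoopStep.load
  refine Finset.card_bij (fun y _ => T.stepAt y (T.lev d)) (fun y hy => ?_) (fun y hy y' hy' h => ?_)
    fun s hs => ?_
  · rw [Finset.mem_filter] at hy ⊢
    exact ⟨Finset.mem_univ _, (T.edge_stepAt hy.2.1).trans (congrArg _ hy.2.2)⟩
  · rw [Finset.mem_filter] at hy hy'
    obtain ⟨-, hy1, hy2⟩ := hy
    obtain ⟨-, hy1', hy2'⟩ := hy'
    have h1 : y.1 = y'.1 := congrArg Sigma.fst h
    obtain ⟨i, b⟩ := y
    obtain ⟨i', b'⟩ := y'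
    simp only at h1
    subst h1
    have h2 := congrArg (fun s : LoopStep T.loop => (s.2 : ℕ)) h
    have hne := SimpleGraph.Dart.symm_ne (T.x i)
    have hl : ∀ b : Bool, T.lev d = T.lev (T.tip (i, b)) → T.out (i, b) (T.lev d) = d →
        d = T.tip (i, b) := fun b h h' => by rw [← h', h, out_top]
    have key : T.lev d ≤ T.lev (T.x i) → T.lev d ≤ T.lev (T.x i).symm →
        min (T.lev d) (T.lev (T.x i)) = T.lev (T.x i) + T.lev (T.x i).symm - T.lev d →
        T.out (i, true) (T.lev d) = d → T.out (i, false) (T.lev d) = d → False := by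
      intro a1 a2 a3 a4 a5
      have e1 := hl true (by rw [tip_true]; omega) a4
      have e2 := hl false (by rw [tip_false]; omega) a5
      exact hne ((tip_false T i ▸ e2).symm.trans e1)
    cases b <;> cases b' <;> simp [stepAt, tip] at h2 hy1 hy1' ⊢
    · exact key hy1' hy1 h2.symm hy2' hy2
    · exact key hy1 hy1' h2 hy2 hy2'
  · rw [Finset.mem_filter] at hs
    have hs := hs.2
    have hle := T.depth_le s
    rw [edge_step] at hs
    obtain h | h := (SimpleGraph.dart_edge_eq_iff _ _).1 hs
    · have hl : T.lev d = T.depth s := by rw [← h, T.lev_out hle]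
      refine ⟨T.wire s, by simp [hl, hle, h], ?_⟩
      obtain ⟨i, k⟩ := s
      have hk := k.2.trans_eq (T.length_loop i)
      refine Sigma.ext rfl (heq_of_eq (Fin.ext ?_))
      simp only [hl, stepAt, wire, depth, decide_eq_true_eq]
      split_ifs with h' <;> omega
    · obtain hlt | heq := hle.lt_or_eq
      · exact absurd (by rw [← SimpleGraph.Dart.symm_symm d, ← h]; exact T.par_symm_out hlt) hd
      rw [heq, out_top] at h
      obtain ⟨i, k⟩ := s
      have hk := k.2.trans_eq (T.length_loop i)
      by_cases h' : (k : ℕ) ≤ T.lev (T.x i)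
      · have hw : T.wire ⟨i, k⟩ = (i, true) := by simp [wire, h']
        rw [hw, tip_true] at h
        have hd' : d = T.tip (i, false) := by rw [tip_false, h, SimpleGraph.Dart.symm_symm]
        rw [hw, tip_true] at heq
        refine ⟨(i, false), by simp [hd', out_top], ?_⟩
        refine Sigma.ext rfl (heq_of_eq (Fin.ext ?_))
        simp only [depth, h', if_true] at heq
        simp only [stepAt, hd', tip_false, Bool.false_eq_true, if_false]
        omega
      · have hw : T.wire ⟨i, k⟩ = (i, false) := by simp [wire, h']
        rw [hw, tip_false] at heq
        simp only [depth, h', if_false] at heq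
        omega

open Classical in
theorem ld_tip (y : Fin c × Bool) : T.ld (T.tip y) = 1 := by
  rw [T.ld_eq_card (T.tip_not_par y), Finset.card_eq_one]
  refine ⟨y, Finset.ext fun y' => ?_⟩
  simp only [Finset.mem_filter, Finset.mem_univ, true_and, Finset.mem_singleton]
  refine ⟨fun h => (T.eq_of_out_tip h.1 h.2).1, fun h => ?_⟩
  subst h
  exact ⟨le_rfl, T.out_top _⟩

theorem ld_out_pos {y : Fin c × Bool} {j : ℕ} (h : j ≤ T.lev (T.tip y)) : 0 < T.ld (T.out y j) := by
  classical
  rw [T.ld_eq_card (T.out_not_par h), Finset.card_pos]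
  exact ⟨y, by simp [T.lev_out h, h]⟩

theorem eq_or_par_of_ld_ne_zero {d : G.Dart} (h : T.ld d ≠ 0) :
    T.Par d ∨ T.Par d.symm ∨ ∃ y, d = T.tip y := by
  classical
  by_contra! hc
  rw [T.ld_eq_card hc.1, Finset.card_ne_zero] at h
  obtain ⟨y, hy⟩ := h
  simp only [Finset.mem_filter, Finset.mem_univ, true_and] at hy
  obtain hlt | heq := hy.1.lt_or_eq
  · exact hc.2.1 (hy.2 ▸ T.par_symm_out hlt)
  · rw [heq, out_top] at hy
    exact hc.2.2 y hy.2.symm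

/-! ### The order around a vertex -/

/-- The number of darts around the origin of a dart. -/
def deg (_ : TreeLoops R p c) (d : G.Dart) : ℕ := (R.nbrs d.fst).length

/-- The position of a dart in the counterclockwise order that starts with the dart to the parent. -/
def pos (d : G.Dart) : ℕ := (R.idx d + T.deg d - R.idx (T.ent d)) % T.deg d

theorem idx_lt (d : G.Dart) : R.idx d < T.deg d := R.idx_lt d

theorem idx_ent_lt (d : G.Dart) : R.idx (T.ent d) < T.deg d := by
  have := R.idx_lt (T.ent d)
  rwa [T.ent_fst] at this

theorem pos_lt (d : G.Dart) : T.pos d < T.deg d :=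
  Nat.mod_lt _ (by have := T.idx_lt d; omega)

theorem iterate_pos (d : G.Dart) : R.next^[T.pos d] (T.ent d) = d := by
  have h1 := T.idx_lt d
  have h2 := T.idx_ent_lt d
  have h3 := R.idx_iterate_next (T.ent d) (T.pos d)
  refine R.ext_idx (h3.1.trans (T.ent_fst d)) ?_
  rw [h3.2, T.ent_fst]
  change (_ + _ % T.deg d) % T.deg d = _
  rw [Nat.add_mod_mod, show R.idx (T.ent d) + (R.idx d + T.deg d - R.idx (T.ent d)) =
    R.idx d + T.deg d by omega, Nat.add_mod_right, Nat.mod_eq_of_lt h1]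

theorem pos_eq (d : G.Dart) : T.pos d = if R.idx (T.ent d) ≤ R.idx d then R.idx d - R.idx (T.ent d)
    else R.idx d + T.deg d - R.idx (T.ent d) := by
  have h1 := T.idx_lt d
  have h2 := T.idx_ent_lt d
  unfold pos
  split_ifs
  · rw [show R.idx d + T.deg d - R.idx (T.ent d) = R.idx d - R.idx (T.ent d) + T.deg d by omega,
      Nat.add_mod_right, Nat.mod_eq_of_lt (by omega)]
  · exact Nat.mod_eq_of_lt (by omega)

theorem deg_congr {d d' : G.Dart} (h : d.fst = d'.fst) : T.deg d = T.deg d' := by rw [deg, h, deg]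

theorem pos_injective {d d' : G.Dart} (h : d.fst = d'.fst) (hp : T.pos d = T.pos d') : d = d' := by
  rw [← T.iterate_pos d, ← T.iterate_pos d', hp, T.ent_congr h]

theorem pos_iterate {e : G.Dart} (he : T.ent e = e) {t : ℕ} (ht : t < T.deg e) :
    T.pos (R.next^[t] e) = t := by
  have h1 := T.idx_lt e
  have h3 := R.idx_iterate_next e t
  rw [pos_eq, (T.ent_iterate e t).1, he, h3.2, T.deg_congr h3.1]
  change (if _ ≤ (_ + t) % T.deg e then (_ + t) % T.deg e - _ else (_ + t) % T.deg e + _ - _) = _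
  by_cases h : R.idx e + t < T.deg e
  · rw [Nat.mod_eq_of_lt h]
    split_ifs <;> omega
  · rw [Nat.mod_eq_sub_mod (by omega), Nat.mod_eq_of_lt (by omega)]
    split_ifs <;> omega

theorem pos_ent (d : G.Dart) : T.pos (T.ent d) = 0 :=
  T.pos_iterate (T.tree.ent_ent d) (t := 0) (by have := T.idx_lt (T.ent d); omega)

theorem pos_last {d : G.Dart} (h : R.next d = T.ent d) : T.pos d + 1 = T.deg d := by
  have h1 := T.pos_lt d
  by_contra h2
  have := T.pos_iterate (T.tree.ent_ent d) (t := T.pos d + 1)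
    (by rw [T.deg_congr (T.ent_fst d)]; omega)
  rw [Function.iterate_succ_apply', T.iterate_pos, h, pos_ent] at this
  omega

/-! ### Ranks -/

open Classical in
/-- The number of strands along a dart, not counted if the dart leads to the parent. -/
noncomputable def ldOut (d : G.Dart) : ℕ := if T.Par d then 0 else T.ld d

theorem ldOut_of_not_par {d : G.Dart} (h : ¬ T.Par d) : T.ldOut d = T.ld d := by simp [ldOut, h]

theorem ldOut_of_par {d : G.Dart} (h : T.Par d) : T.ldOut d = 0 := by simp [ldOut, h]

/-- The strands that leave a vertex away from the root are those that enter it from the parent; at the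
root they are all `2 * c` ends of the loops. -/
theorem sum_ldOut {e : G.Dart} (he : T.ent e = e) :
    ∑ u ∈ Finset.range (T.deg e), T.ldOut (R.next^[u] e) = if T.lev e = 0 then 2 * c else T.ld e := by
  classical
  have h1 : ∀ u ∈ Finset.range (T.deg e), T.ldOut (R.next^[u] e) =
      ((Finset.univ.filter fun y => T.lev e ≤ T.lev (T.tip y) ∧
        (T.out y (T.lev e)).fst = e.fst).filter fun y => T.pos (T.out y (T.lev e)) = u).card := by
    intro u hu
    rw [Finset.mem_range] at hu
    have h2 : ∀ y, ((T.out y (T.lev e)).fst = e.fst ∧ T.pos (T.out y (T.lev e)) = u) ↔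
        T.out y (T.lev e) = R.next^[u] e := by
      intro y
      constructor
      · rintro ⟨h3, h4⟩
        rw [← h4]
        conv_lhs => rw [← T.iterate_pos (T.out y (T.lev e)), T.ent_congr h3, he]
      · intro h3
        rw [h3, T.pos_iterate he hu]
        exact ⟨(R.idx_iterate_next e u).1, rfl⟩
    simp only [Finset.filter_filter, and_assoc, h2]
    by_cases hp : T.Par (R.next^[u] e)
    · rw [T.ldOut_of_par hp, eq_comm, Finset.card_eq_zero, Finset.filter_eq_empty_iff]
      rintro y - ⟨h3, h4⟩
      exact T.out_not_par h3 (h4 ▸ hp)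
    · rw [T.ldOut_of_not_par hp, T.ld_eq_card hp, (T.ent_iterate e u).2]
  rw [Finset.sum_congr rfl h1, ← Finset.card_eq_sum_card_fiberwise]
  · split_ifs with h0
    · rw [h0, Finset.filter_true_of_mem, Finset.card_univ]
      · simp [Nat.mul_comm]
      · intro y _
        refine ⟨Nat.zero_le _, ?_⟩
        rw [(T.lev_eq_zero _).1 h0, ← T.lev_eq_zero, T.lev_out (Nat.zero_le _)]
    · have hup : T.up e = e.symm := by rw [up, he]
      have hlev := T.lev_up h0
      have hpar : T.Par e := ⟨he, h0⟩
      rw [← ld_symm, T.ld_eq_card hpar.symm_not]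
      congr 1
      ext y
      simp only [Finset.mem_filter, Finset.mem_univ, true_and]
      constructor
      · rintro ⟨h3, h4⟩
        have h5 : T.lev e = T.lev e.symm + 1 := by rw [← hup, hlev]
        refine ⟨by omega, ?_⟩
        rw [T.out_pred (by omega), ← h5, up, T.ent_congr h4, he]
      · rintro ⟨h3, h4⟩
        have h5 : T.lev e = T.lev e.symm + 1 := by rw [← hup, hlev]
        obtain h6 | h6 := h3.lt_or_eq
        · refine ⟨by omega, ?_⟩
          rw [T.out_pred h6, ← h5] at h4
          have h7 := congrArg SimpleGraph.Dart.symm h4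
          rw [up, SimpleGraph.Dart.symm_symm, SimpleGraph.Dart.symm_symm] at h7
          rw [← T.ent_fst, h7]
        · rw [h6, out_top] at h4
          exact absurd (by rw [h4, SimpleGraph.Dart.symm_symm]; exact hpar) (T.tip_symm_not_par y)
  · intro y hy
    simp only [Finset.coe_filter, Finset.mem_univ, true_and, Set.mem_ofPred_eq] at hy
    simp only [Finset.coe_range, Set.mem_Iio]
    rw [← T.deg_congr hy.2]
    exact T.pos_lt _

/-- The strands that leave a vertex away from the root are numbered counterclockwise, starting after
the dart to the parent with the first number on the edge to the parent; `lo d` is the first number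
along the dart `d`. -/
structure Slots (lo : G.Dart → ℕ) : Prop where
  root : lo T.root = 0
  next : ∀ d, ¬ T.Par d → R.next d ≠ T.ent d → lo (R.next d) = lo d + T.ld d
  par : ∀ d, T.Par d → R.next d ≠ d → lo (R.next d) = lo d.symm

variable {lo : G.Dart → ℕ} (S : T.Slots lo)

/-- The first number that is available around a vertex. -/
def base (lo : G.Dart → ℕ) (e : G.Dart) : ℕ := if T.lev e = 0 then 0 else lo e.symm

include S

/-- The recurrence for the first numbers, solved around a vertex. -/
theorem lo_iterate {e : G.Dart} (he : T.ent e = e) {t : ℕ} (ht : t < T.deg e)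
    (hp : ¬ T.Par (R.next^[t] e)) :
    lo (R.next^[t] e) = T.base lo e + ∑ u ∈ Finset.range t, T.ldOut (R.next^[u] e) := by
  induction t with
  | zero =>
    have h0 : T.lev e = 0 := by
      by_contra h
      exact hp ⟨he, h⟩
    have : e = T.root := by rw [← he, T.tree.lev_eq_zero_iff.1 h0]
    simp only [Function.iterate_zero, id_eq, Finset.range_zero, Finset.sum_empty, base, h0, if_true]
    rw [this, S.root]; rfl
  | succ t ih =>
    have hpos := T.pos_iterate he ht
    have hne : R.next (R.next^[t] e) ≠ e := by
      intro h
      rw [Function.iterate_succ_apply', h] at hpos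
      have := T.pos_ent e
      rw [he, hpos] at this
      omega
    rw [Function.iterate_succ_apply', Finset.sum_range_succ]
    by_cases hq : T.Par (R.next^[t] e)
    · have h1 : R.next^[t] e = e := by rw [← hq.1, (T.ent_iterate e t).1, he]
      have ht0 : t = 0 := by
        have := T.pos_iterate he (t := t) (by omega)
        rw [h1, ← he, T.pos_ent] at this
        exact this.symm
      subst ht0
      simp only [Function.iterate_zero, id_eq] at hq hne ⊢
      rw [S.par e hq hne, T.ldOut_of_par hq, base, if_neg hq.2]
      simp
    · rw [S.next _ hq (by rwa [(T.ent_iterate e t).1, he]), ih (by omega) hq, T.ldOut_of_not_par hq]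
      omega

theorem lo_eq {d : G.Dart} (hd : ¬ T.Par d) : lo d = T.base lo (T.ent d) +
    ∑ u ∈ Finset.range (T.pos d), T.ldOut (R.next^[u] (T.ent d)) := by
  have h1 := T.iterate_pos d
  have := T.lo_iterate S (T.tree.ent_ent d) (t := T.pos d)
    (by rw [T.deg_congr (T.ent_fst d)]; exact T.pos_lt d) (by rwa [h1])
  rwa [h1] at this

theorem lo_add_ld {d : G.Dart} (hd : ¬ T.Par d) : lo d + T.ld d = T.base lo (T.ent d) +
    ∑ u ∈ Finset.range (T.pos d + 1), T.ldOut (R.next^[u] (T.ent d)) := by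
  rw [Finset.sum_range_succ, T.iterate_pos, T.ldOut_of_not_par hd, T.lo_eq S hd]
  omega

/-- The numbers along different darts around a vertex are ordered as the darts. -/
theorem lo_mono {d d' : G.Dart} (hd : ¬ T.Par d) (hd' : ¬ T.Par d') (h : d.fst = d'.fst)
    (hp : T.pos d < T.pos d') : lo d + T.ld d ≤ lo d' := by
  rw [T.lo_add_ld S hd, T.lo_eq S hd', T.ent_congr h]
  exact Nat.add_le_add_left (Finset.sum_le_sum_of_subset (Finset.range_mono hp)) _

theorem lo_add_ld_le {d : G.Dart} (hd : ¬ T.Par d) : lo d + T.ld d ≤ T.base lo (T.ent d) +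
    if T.lev (T.ent d) = 0 then 2 * c else T.ld (T.ent d) := by
  rw [T.lo_add_ld S hd, ← T.sum_ldOut (T.tree.ent_ent d)]
  refine Nat.add_le_add_left (Finset.sum_le_sum_of_subset (Finset.range_mono ?_)) _
  rw [T.deg_congr (T.ent_fst d)]
  exact T.pos_lt d

theorem base_le {d : G.Dart} (hd : ¬ T.Par d) : T.base lo (T.ent d) ≤ lo d := by
  rw [T.lo_eq S hd]
  exact Nat.le_add_right _ _

/-- The numbers around a vertex exhaust the numbers on the edge to the parent. -/
theorem lo_add_ld_last {d : G.Dart} (hd : ¬ T.Par d) (hn : R.next d = T.ent d) :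
    lo d + T.ld d = T.base lo (T.ent d) +
      if T.lev (T.ent d) = 0 then 2 * c else T.ld (T.ent d) := by
  rw [T.lo_add_ld S hd, ← T.sum_ldOut (T.tree.ent_ent d), T.pos_last hn, T.deg_congr (T.ent_fst d)]

theorem eq_of_mem_slots {d d' : G.Dart} (hd : ¬ T.Par d) (hd' : ¬ T.Par d') (h : d.fst = d'.fst)
    {r : ℕ} (h1 : lo d ≤ r) (h2 : r < lo d + T.ld d) (h3 : lo d' ≤ r) (h4 : r < lo d' + T.ld d') :
    d = d' := by
  refine T.pos_injective h ?_
  rcases lt_trichotomy (T.pos d) (T.pos d') with hl | hl | hl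
  · have := T.lo_mono S hd hd' h hl; omega
  · exact hl
  · have := T.lo_mono S hd' hd h.symm hl; omega

omit S in
/-- The number of an end of a loop. -/
def rank (T : TreeLoops R p c) (lo : G.Dart → ℕ) (y : Fin c × Bool) : ℕ := lo (T.tip y)

/-- An end of a loop keeps its number along all edges of the tree. -/
theorem rank_mem {y : Fin c × Bool} {j : ℕ} (h : j ≤ T.lev (T.tip y)) :
    lo (T.out y j) ≤ T.rank lo y ∧ T.rank lo y < lo (T.out y j) + T.ld (T.out y j) := by
  obtain ⟨t, ht⟩ := Nat.exists_eq_add_of_le h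
  induction t generalizing j with
  | zero =>
    obtain rfl : j = T.lev (T.tip y) := by omega
    rw [out_top, ld_tip, rank]
    omega
  | succ t ih =>
    obtain ⟨h1, h2⟩ := ih (j := j + 1) (by omega) (by omega)
    have hnp := T.out_not_par (y := y) (j := j + 1) (by omega)
    have hl : T.lev (T.ent (T.out y (j + 1))) ≠ 0 := by
      rw [T.tree.lev_ent, T.lev_out (by omega)]; omega
    have h3 := T.base_le S hnp
    have h4 := T.lo_add_ld_le S hnp
    rw [base, if_neg hl] at h3 h4
    rw [if_neg hl, ← T.ld_symm (T.ent _)] at h4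
    rw [T.out_pred (by omega), up]
    omega

theorem rank_lt (y : Fin c × Bool) : T.rank lo y < 2 * c := by
  have h1 := (T.rank_mem S (Nat.zero_le (T.lev (T.tip y)))).2
  have hl : T.lev (T.ent (T.out y 0)) = 0 := by
    rw [T.tree.lev_ent, T.lev_out (Nat.zero_le _)]
  have h4 := T.lo_add_ld_le S (T.out_not_par (Nat.zero_le (T.lev (T.tip y))))
  rw [base, if_pos hl, if_pos hl] at h4
  omega

theorem out_eq_of_rank_eq {y y' : Fin c × Bool} (h : T.rank lo y = T.rank lo y') {j : ℕ}
    (hj : j ≤ T.lev (T.tip y)) (hj' : j ≤ T.lev (T.tip y')) : T.out y j = T.out y' j := by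
  have key : ∀ j, j ≤ T.lev (T.tip y) → j ≤ T.lev (T.tip y') → (T.out y j).fst = (T.out y' j).fst →
      T.out y j = T.out y' j := fun j hj hj' hf => by
    have h1 := T.rank_mem S hj
    have h2 := T.rank_mem S hj'
    exact T.eq_of_mem_slots S (T.out_not_par hj) (T.out_not_par hj') hf h1.1 h1.2 (h ▸ h2.1)
      (h ▸ h2.2)
  induction j with
  | zero =>
    refine key 0 hj hj' ?_
    rw [(T.lev_eq_zero _).1 (T.lev_out hj), (T.lev_eq_zero _).1 (T.lev_out hj')]
  | succ j ih =>
    refine key _ hj hj' ?_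
    have := ih (by omega) (by omega)
    rw [← T.ent_fst, ← T.symm_out_eq_ent hj, this, T.symm_out_eq_ent hj', T.ent_fst]

theorem rank_injective : Function.Injective (T.rank lo) := by
  intro y y' h
  obtain hl | hl := le_total (T.lev (T.tip y)) (T.lev (T.tip y'))
  · have := T.out_eq_of_rank_eq S h le_rfl hl
    rw [out_top] at this
    exact (T.eq_of_out_tip hl this.symm).1.symm
  · have := T.out_eq_of_rank_eq S h hl le_rfl
    rw [out_top] at this
    exact (T.eq_of_out_tip hl this).1

end TreeLoops

namespace TreeLoops

variable {N : ℕ} {G : SimpleGraph (Fin N)} {R : RotationSystem G} {p : Fin N} {c : ℕ}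
  (T : TreeLoops R p c) {lo : G.Dart → ℕ} (S : T.Slots lo)

/-! ### The loops as a system of parallel strands -/

theorem step_ext {s t : LoopStep T.loop} (hw : T.wire s = T.wire t) (hd : T.depth s = T.depth t) :
    s = t := by
  obtain ⟨i, k⟩ := s
  obtain ⟨j, l⟩ := t
  obtain rfl : i = j := congrArg Prod.fst hw
  have h1 := congrArg Prod.snd hw
  have hk := k.2.trans_eq (T.length_loop i)
  have hl := l.2.trans_eq (T.length_loop i)
  simp only [wire, decide_eq_decide] at h1
  refine Sigma.ext rfl (heq_of_eq (Fin.ext ?_))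
  simp only [depth] at hd
  by_cases h : (k : ℕ) ≤ T.lev (T.x i)
  · simpa [h, h1.1 h] using hd
  · have h' : ¬ (l : ℕ) ≤ T.lev (T.x i) := fun h' => h (h1.2 h')
    simp only [h, h', if_false] at hd
    simp only
    omega

/-- The lane, counted from the smaller endpoint, of the strand with number `r` along `d`. -/
def laneAt (_ : TreeLoops R p c) (lo : G.Dart → ℕ) (d : G.Dart) (r : ℕ) (n : ℕ) : ℕ :=
  if d.fst < d.snd then r - lo d else n - 1 - (r - lo d)

include S in
theorem laneAt_lt {y : Fin c × Bool} {j : ℕ} (h : j ≤ T.lev (T.tip y)) :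
    T.laneAt lo (T.out y j) (T.rank lo y) (T.ld (T.out y j)) < T.ld (T.out y j) := by
  have := T.rank_mem S h
  unfold laneAt
  split_ifs <;> omega

/-- The loops, drawn such that the strands along an edge are ordered by their numbers. -/
noncomputable def system : LoopSystem G p c where
  loop := T.loop
  lane s := T.laneAt lo (T.out (T.wire s) (T.depth s)) (T.rank lo (T.wire s))
    (T.ld (T.out (T.wire s) (T.depth s)))
  lane_lt s := by
    rw [T.edge_step s]
    exact T.laneAt_lt S (T.depth_le s)
  lane_inj s t h hl := by
    rw [T.edge_step, T.edge_step] at h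
    have hs := T.depth_le s
    have ht := T.depth_le t
    have hfalse : ∀ s : LoopStep T.loop, T.depth s = T.lev (T.tip (T.wire s)) →
        T.tip (T.wire s) = T.x s.1 := by
      rintro ⟨i, k⟩ h
      have hk := k.2.trans_eq (T.length_loop i)
      by_cases h' : (k : ℕ) ≤ T.lev (T.x i)
      · simp [wire, tip, h']
      · simp only [depth, h', if_false, wire, decide_false, tip_false] at h
        omega
    obtain he | he := (SimpleGraph.dart_edge_eq_iff _ _).1 h
    · have h1 := T.rank_mem S hs
      have h2 := T.rank_mem S ht
      have hd : T.depth s = T.depth t := by rw [← T.lev_out hs, he, T.lev_out ht]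
      refine T.step_ext (T.rank_injective S ?_) hd
      rw [he] at hl h1
      unfold laneAt at hl
      split_ifs at hl <;> omega
    · exfalso
      obtain hlt | hs' := hs.lt_or_eq
      · refine T.out_not_par ht ?_
        rw [← SimpleGraph.Dart.symm_symm (T.out _ _), ← he]
        exact T.par_symm_out hlt
      obtain hlt | ht' := ht.lt_or_eq
      · refine T.out_not_par hs ?_
        rw [he]
        exact T.par_symm_out hlt
      rw [hs', ht', out_top, out_top, hfalse s hs', hfalse t ht'] at he
      have hi := T.edge_inj s.1 t.1 (by rw [he, SimpleGraph.Dart.edge_symm])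
      rw [hi] at he
      exact SimpleGraph.Dart.symm_ne _ he.symm

/-- The properties of the drawing that matter: each loop runs away from the root along one of its ends
and back along the other one, and around each vertex the strands appear in the order of their
numbers. -/
structure Drawn (T : TreeLoops R p c) (lo : G.Dart → ℕ) (P : LoopSystem G p c) : Prop where
  length : ∀ i, (P.loop i).length = T.lev (T.x i) + T.lev (T.x i).symm + 1
  dart_le : ∀ i (k : Fin (P.loop i).length), (k : ℕ) ≤ T.lev (T.x i) →
    LoopStep.dart (⟨i, k⟩ : P.Step) = T.out (i, true) k
  dart_ge : ∀ i (k : Fin (P.loop i).length), T.lev (T.x i) ≤ (k : ℕ) →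
    LoopStep.dart (⟨i, k⟩ : P.Step) =
      (T.out (i, false) (T.lev (T.x i) + T.lev (T.x i).symm - k)).symm
  load : ∀ d : G.Dart, P.load d.edge = T.ld d
  index_le : ∀ i (k : Fin (P.loop i).length), (k : ℕ) ≤ T.lev (T.x i) →
    P.index (T.out (i, true) k) (P.lane ⟨i, k⟩) = T.rank lo (i, true) - lo (T.out (i, true) k)
  index_ge : ∀ i (k : Fin (P.loop i).length), T.lev (T.x i) ≤ (k : ℕ) →
    P.index (T.out (i, false) (T.lev (T.x i) + T.lev (T.x i).symm - k)) (P.lane ⟨i, k⟩) =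
      T.rank lo (i, false) - lo (T.out (i, false) (T.lev (T.x i) + T.lev (T.x i).symm - k))

theorem index_out (s : LoopStep T.loop) :
    (T.system S).index (T.out (T.wire s) (T.depth s)) ((T.system S).lane s) =
      T.rank lo (T.wire s) - lo (T.out (T.wire s) (T.depth s)) := by
  have h1 := T.rank_mem S (T.depth_le s)
  have h2 : (T.system S).load (T.out (T.wire s) (T.depth s)).edge =
    T.ld (T.out (T.wire s) (T.depth s)) := rfl
  have h3 : (T.system S).lane s = T.laneAt lo (T.out (T.wire s) (T.depth s)) (T.rank lo (T.wire s))
    (T.ld (T.out (T.wire s) (T.depth s))) := rfl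
  unfold LoopSystem.index
  rw [h2, h3]
  unfold laneAt
  split_ifs <;> omega

theorem drawn_system : T.Drawn lo (T.system S) where
  length := T.length_loop
  dart_le := T.dart_step_le
  dart_ge := T.dart_step_ge
  load _ := rfl
  index_le i k h := by
    have hw : T.wire ⟨i, k⟩ = (i, true) := by
      unfold wire
      exact congrArg _ (decide_eq_true h)
    have hd : T.depth ⟨i, k⟩ = k := if_pos h
    have := T.index_out S ⟨i, k⟩
    rwa [hw, hd] at this
  index_ge i k h := by
    obtain h' | h' := h.lt_or_eq
    · have hw : T.wire ⟨i, k⟩ = (i, false) := by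
        unfold wire
        exact congrArg _ (decide_eq_false h'.not_ge)
      have hd : T.depth ⟨i, k⟩ = T.lev (T.x i) + T.lev (T.x i).symm - k := if_neg h'.not_ge
      have := T.index_out S ⟨i, k⟩
      rwa [hw, hd] at this
    · have h1 : T.out (i, false) (T.lev (T.x i) + T.lev (T.x i).symm - k) = T.tip (i, false) := by
        rw [← h', Nat.add_sub_cancel_left, ← T.tip_false, out_top]
      have h2 : (T.system S).lane ⟨i, k⟩ < T.ld (T.tip (i, false)) := by
        have := (T.system S).lane_lt ⟨i, k⟩
        have h3 : (LoopStep.dart (⟨i, k⟩ : LoopStep T.loop)).edge = (T.tip (i, false)).edge := by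
          rw [T.dart_step_ge i k h, h1, SimpleGraph.Dart.edge_symm]
        exact this.trans_eq (congrArg (LoopStep.load T.loop) h3)
      rw [h1, rank]
      have h4 := (T.system S).index_lt (T.tip (i, false)) h2
      change _ < T.ld _ at h4
      rw [ld_tip] at h4
      omega

end TreeLoops

theorem LoopSystem.index_symm {N : ℕ} {G : SimpleGraph (Fin N)} {p : Fin N} {c : ℕ}
    (P : LoopSystem G p c) (d : G.Dart) {l : ℕ} (h : l < P.load d.edge) :
    P.index d.symm l = P.load d.edge - 1 - P.index d l := by
  have hne : d.fst ≠ d.snd := d.adj.ne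
  unfold LoopSystem.index
  rw [SimpleGraph.Dart.edge_symm]
  change (if d.snd < d.fst then _ else _) = _
  rcases lt_or_gt_of_ne hne with h1 | h1
  · rw [if_neg h1.not_gt, if_pos h1]
  · rw [if_pos h1, if_neg h1.not_gt]; omega

namespace TreeLoops

variable {N : ℕ} {G : SimpleGraph (Fin N)} {R : RotationSystem G} {p : Fin N} {c : ℕ}
  {T : TreeLoops R p c} {lo : G.Dart → ℕ} (S : T.Slots lo) {P : LoopSystem G p c} (D : T.Drawn lo P)

namespace Drawn

/-! ### The regions around the vertices -/

include D S

omit S in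
theorem lane_lt_le {i : Fin c} (k : Fin (P.loop i).length) (h : (k : ℕ) ≤ T.lev (T.x i)) :
    P.lane ⟨i, k⟩ < P.load (T.out (i, true) k).edge := by
  have := P.lane_lt ⟨i, k⟩
  rwa [D.dart_le i k h] at this

omit S in
theorem lane_lt_ge {i : Fin c} (k : Fin (P.loop i).length) (h : T.lev (T.x i) ≤ (k : ℕ)) :
    P.lane ⟨i, k⟩ < P.load (T.out (i, false) (T.lev (T.x i) + T.lev (T.x i).symm - k)).edge := by
  have := P.lane_lt ⟨i, k⟩
  rwa [D.dart_ge i k h, SimpleGraph.Dart.edge_symm] at this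

omit S D in
open Classical in
/-- The number of a gap between strands: the number of the strand after it in the order around the
vertex, or, if the dart leads to the parent, in the opposite order. -/
noncomputable def slot (T : TreeLoops R p c) (lo : G.Dart → ℕ) {P : LoopSystem G p c} (γ : P.Gap) : ℕ :=
  if T.Par γ.dart then lo γ.dart.symm + T.ld γ.dart - γ.num else lo γ.dart + γ.num

omit S D in
open Classical in
theorem slot_rev (γ : P.Gap) : slot T lo γ.rev = if T.Par γ.dart.symm then
    lo γ.dart.symm.symm + T.ld γ.dart.symm - (P.load γ.dart.edge - γ.num)
    else lo γ.dart.symm + (P.load γ.dart.edge - γ.num) := rfl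

omit S D in
/-- The copies of its edge along a step are the gaps just after and just before its strand. -/
theorem stepGap_eq (s : P.Step) (left : Bool) : (P.stepGap s left).dart = s.dart ∧
    (P.stepGap s left).num = P.index s.dart (P.lane s) + if left then 1 else 0 := by
  cases left <;> exact ⟨rfl, rfl⟩

/-- The number of the gap along a step, at the origin of the step, is determined by the number of the
strand and by the side on which the gap lies; it does not depend on the position along the end of the
loop. -/
theorem slot_stepGap {i : Fin c} (k : Fin (P.loop i).length) (left : Bool) :
    slot T lo (P.stepGap ⟨i, k⟩ left) = T.rank lo (i, decide ((k : ℕ) ≤ T.lev (T.x i))) +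
      if left = decide ((k : ℕ) ≤ T.lev (T.x i)) then 1 else 0 := by
  have hk := k.2.trans_eq (D.length i)
  obtain ⟨e1, e2⟩ := stepGap_eq (P := P) ⟨i, k⟩ left
  rw [slot, e2, e1]
  by_cases h : (k : ℕ) ≤ T.lev (T.x i)
  · have h3 := T.rank_mem S (y := (i, true)) (j := k) h
    rw [D.dart_le i k h, if_neg (T.out_not_par (y := (i, true)) (j := k) h), D.index_le i k h]
    simp only [h, decide_true]
    omega
  · have hj : T.lev (T.x i) + T.lev (T.x i).symm - k < T.lev (T.tip (i, false)) := by
      rw [tip_false]; omega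
    have h3 := T.rank_mem S hj.le
    have hl := D.lane_lt_ge k (by omega)
    rw [D.dart_ge i k (by omega), if_pos (T.par_symm_out hj), P.index_symm _ hl, D.load, ld_symm,
      SimpleGraph.Dart.symm_symm, D.index_ge i k (by omega)]
    simp only [h, decide_false]
    cases left
    · simp; omega
    · simp; omega

theorem slot_stepGap_rev {i : Fin c} (k : Fin (P.loop i).length) (left : Bool) :
    slot T lo (P.stepGap ⟨i, k⟩ left).rev = T.rank lo (i, decide ((k : ℕ) < T.lev (T.x i))) +
      if left = decide ((k : ℕ) < T.lev (T.x i)) then 1 else 0 := by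
  have hk := k.2.trans_eq (D.length i)
  obtain ⟨e1, e2⟩ := stepGap_eq (P := P) ⟨i, k⟩ left
  rw [slot_rev, e2, e1]
  by_cases h : (k : ℕ) < T.lev (T.x i)
  · have h3 := T.rank_mem S (y := (i, true)) (j := k) h.le
    rw [D.dart_le i k h.le, if_pos (T.par_symm_out (y := (i, true)) (j := k) h), D.index_le i k h.le,
      SimpleGraph.Dart.symm_symm, ld_symm, D.load]
    simp only [h, decide_true]
    split_ifs <;> omega
  · have hj : T.lev (T.x i) + T.lev (T.x i).symm - k ≤ T.lev (T.tip (i, false)) := by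
      rw [tip_false]; omega
    have h3 := T.rank_mem S hj
    have hl := D.lane_lt_ge k (by omega)
    rw [D.dart_ge i k (by omega), SimpleGraph.Dart.symm_symm, if_neg (T.out_not_par hj),
      P.index_symm _ hl, SimpleGraph.Dart.edge_symm, D.load, D.index_ge i k (by omega)]
    simp only [h, decide_false]
    cases left
    · simp; omega
    · simp; omega

omit S in
/-- A step of a loop begins where the step before it ends. -/
theorem pass_darts {i : Fin c} {k : ℕ} (hk : k + 1 < (P.loop i).length) :
    ((LoopStep.dart (⟨i, ⟨k, by omega⟩⟩ : P.Step)).symm).fst =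
      (LoopStep.dart (⟨i, ⟨k + 1, hk⟩⟩ : P.Step)).fst := by
  have hk' := hk.trans_eq (D.length i)
  by_cases h : k + 1 ≤ T.lev (T.x i)
  · rw [D.dart_le i ⟨k, _⟩ (by simp only; omega), D.dart_le i ⟨k + 1, _⟩ h,
      T.symm_out_eq_ent (by rw [tip_true]; exact h), ent_fst]
  · rw [D.dart_ge i ⟨k, _⟩ (by simp only; omega), D.dart_ge i ⟨k + 1, _⟩ (by simp only; omega),
      SimpleGraph.Dart.symm_symm,
      T.symm_out_eq_ent (by rw [tip_false]; simp only; omega), ent_fst]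
    simp only
    rw [show T.lev (T.x i) + T.lev (T.x i).symm - (k + 1) + 1 =
      T.lev (T.x i) + T.lev (T.x i).symm - k by omega]

omit S D in
open Classical in
/-- The vertex of a gap and its number, at the base point up to multiples of `2 * c`. -/
noncomputable def key (T : TreeLoops R p c) (lo : G.Dart → ℕ) {P : LoopSystem G p c} (γ : P.Gap) :
    Fin N × ℕ :=
  (γ.dart.fst, if γ.dart.fst = p then slot T lo γ % (2 * c) else slot T lo γ)

omit S D in
theorem key_eq {γ γ' : P.Gap} (h : γ.dart.fst = γ'.dart.fst) (hs : slot T lo γ = slot T lo γ') :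
    key T lo γ = key T lo γ' := by rw [key, key, h, hs]

/-- The key is constant on the regions: at a corner of a face, the last gap of a dart and the first gap
of the next one have the same number by the definition of `lo`; at a pass, the gaps lie on the same side
of a strand with a fixed number. At the base point the numbers are cyclic. -/
theorem key_regionStep {γ γ' : P.Gap} (h : P.RegionStep R γ γ') : key T lo γ = key T lo γ' := by
  cases h with
  | corner d =>
    have hpar : ∀ {d}, T.Par d → T.Par (R.next d) → R.next d = d := fun {d} h h' => by
      rw [← h'.1, T.tree.ent_perm, h.1]
    by_cases hd : T.Par d
    · refine key_eq (by simp) ?_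
      have h1 : slot T lo (⟨d, P.load d.edge, le_rfl⟩ : P.Gap) = lo d.symm := by
        simp [slot, hd, D.load]
      rw [h1]
      by_cases hn : R.next d = d
      · have h2 : T.ld d = 0 := by
          have h3 := T.sum_ldOut hd.1
          have h4 := T.pos_last (hn.trans hd.1.symm)
          rw [← h4, if_neg hd.2, ← hd.1, T.pos_ent, hd.1] at h3
          simpa [T.ldOut_of_par hd] using h3.symm
        simp [slot, hn, hd, h2]
      · rw [slot, if_neg fun h => hn (hpar hd h), S.par d hd hn]
        rfl
    · have h1 : slot T lo (⟨d, P.load d.edge, le_rfl⟩ : P.Gap) = lo d + T.ld d := by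
        simp [slot, hd, D.load]
      by_cases hn : R.next d = T.ent d
      · have h2 := T.lo_add_ld_last S hd hn
        rw [← h1] at h2
        by_cases h0 : T.lev (T.ent d) = 0
        · have h3 : d.fst = p := by rw [← T.ent_fst, (T.lev_eq_zero _).1 h0]
          have h4 : T.ent d = T.root := by rw [← T.tree.ent_ent, T.tree.lev_eq_zero_iff.1 h0]
          have h5 : ¬ T.Par (R.next d) := fun h => h.2 (by rw [hn, h0])
          rw [key, key, h2, slot]
          simp only [RotationSystem.next_fst, h3, if_true, h0, base, if_neg h5]
          rw [hn, h4, S.root]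
          simp
        · refine key_eq (by simp) ?_
          rw [base, if_neg h0, if_neg h0] at h2
          rw [h2, slot, if_pos (show T.Par (R.next d) by rw [hn]; exact ⟨T.tree.ent_ent d, h0⟩)]
          simp only
          rw [hn]
          rfl
      · refine key_eq (by simp) ?_
        have h2 : ¬ T.Par (R.next d) := fun h => hn (by rw [← h.1, T.tree.ent_perm])
        rw [h1, slot, if_neg h2, S.next d hd hn]
        rfl
  | pass i k hk left =>
    refine key_eq ?_ ?_
    · rw [(stepGap_eq _ left).1, LoopSystem.Gap.rev]
      simp only
      rw [(stepGap_eq _ left).1]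
      exact D.pass_darts hk
    · rw [D.slot_stepGap_rev S, D.slot_stepGap S]
      rfl

end Drawn

end TreeLoops

namespace TreeLoops

variable {N : ℕ} {G : SimpleGraph (Fin N)} {R : RotationSystem G} {p : Fin N} {c : ℕ}
  {T : TreeLoops R p c} {lo : G.Dart → ℕ} (S : T.Slots lo) {P : LoopSystem G p c} (D : T.Drawn lo P)

/-- Each vertex other than the base point has a dart to its parent. -/
theorem card_vertex_le (hG : G.Connected) : N ≤ Nat.card {e : G.Dart // T.Par e} + 1 := by
  classical
  have h : ∀ v : {v : Fin N // v ≠ p}, ∃ e : {e : G.Dart // T.Par e}, e.1.fst = v.1 := by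
    rintro ⟨v, hv⟩
    obtain ⟨W⟩ := hG.preconnected v p
    cases W with
    | nil => exact absurd rfl hv
    | cons ha _ =>
      have h0 : T.lev ⟨(v, _), ha⟩ ≠ 0 := fun h => hv ((T.lev_eq_zero _).1 h)
      exact ⟨⟨_, T.par_ent h0⟩, T.ent_fst _⟩
  choose f hf using h
  have hinj : Function.Injective f := fun v v' h => Subtype.ext (by rw [← hf, h, hf])
  have := Nat.card_le_card_of_injective f hinj
  simp only [Nat.card_eq_fintype_card (α := {v : Fin N // v ≠ p}), ne_eq, Fintype.card_subtype_compl,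
    Fintype.card_fin, Fintype.card_subtype_eq] at this
  omega

namespace Drawn

/-! ### The Euler characteristic -/

omit S in
include D in
/-- Only the edges of the tree and the `c` edges outside of it carry strands, the latter one each. -/
theorem card_cutEdge_le [Fintype {e : G.Dart // T.Par e}] : Nat.card P.CutEdge ≤
    Nat.card G.edgeSet + (∑ e : {e : G.Dart // T.Par e}, T.ld e) + c := by
  classical
  have := Fintype.ofFinite G.edgeSet
  rw [Nat.card_sigma]
  simp only [Nat.card_fin, Finset.sum_add_distrib, Finset.sum_const, Finset.card_univ, smul_eq_mul,
    mul_one, ← Nat.card_eq_fintype_card]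
  have h1 : ∀ e : G.edgeSet, P.load e ≤ (∑ d : {e : G.Dart // T.Par e},
      if (⟨d.1.edge, d.1.edge_mem⟩ : G.edgeSet) = e then T.ld d else 0) +
      ∑ i : Fin c, if (⟨(T.x i).edge, (T.x i).edge_mem⟩ : G.edgeSet) = e then 1 else 0 := by
    intro e
    obtain ⟨d, rfl⟩ : ∃ d : G.Dart, (⟨d.edge, d.edge_mem⟩ : G.edgeSet) = e :=
      ⟨LoopSystem.edgeDart e, Subtype.ext (LoopSystem.edge_edgeDart e)⟩
    simp only
    rw [D.load]
    by_cases h0 : T.ld d = 0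
    · rw [h0]; exact Nat.zero_le _
    obtain h | h | ⟨⟨i, b⟩, h⟩ := T.eq_or_par_of_ld_ne_zero h0
    · refine le_add_right ?_
      refine le_trans ?_ (Finset.single_le_sum (fun _ _ => Nat.zero_le _)
        (Finset.mem_univ (⟨d, h⟩ : {e : G.Dart // T.Par e})))
      simp
    · refine le_add_right ?_
      refine le_trans ?_ (Finset.single_le_sum (fun _ _ => Nat.zero_le _)
        (Finset.mem_univ (⟨d.symm, h⟩ : {e : G.Dart // T.Par e})))
      simp [ld_symm]
    · refine le_add_left ?_
      refine le_trans ?_ (Finset.single_le_sum (fun _ _ => Nat.zero_le _) (Finset.mem_univ i))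
      rw [if_pos, h, ld_tip]
      rw [h, tip]
      cases b <;> simp
  have h2 := Finset.sum_le_sum fun e (_ : e ∈ Finset.univ) => h1 e
  rw [Finset.sum_add_distrib, Finset.sum_comm, Finset.sum_comm (s := Finset.univ (α := G.edgeSet))] at h2
  simp only [Finset.sum_ite_eq, Finset.mem_univ, if_true, Finset.sum_const, Finset.card_univ,
    Fintype.card_fin, smul_eq_mul, mul_one] at h2
  omega

include S D

/-- Lower bound for the number of regions by the number of keys: around a vertex with `k` strands to its
parent there are at least `k + 1` regions, and around the base point at least `2 * c`. -/
theorem sum_par_le_card_region [Fintype {e : G.Dart // T.Par e}] :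
    (∑ e : {e : G.Dart // T.Par e}, (T.ld e + 1)) + 2 * c ≤ Nat.card (P.Region R) := by
  classical
  let κ : P.Region R → Fin N × ℕ := Quot.lift (key T lo) fun _ _ h => D.key_regionStep S h
  let f : (Σ e : {e : G.Dart // T.Par e}, Fin (T.ld e + 1)) ⊕ (Fin c × Bool) → P.Region R :=
    Sum.elim (fun a => P.region R ⟨a.1.1, a.2, by rw [D.load]; exact Nat.le_of_lt_succ a.2.2⟩)
      fun y => P.region R ⟨T.out y 0, T.rank lo y - lo (T.out y 0), by
        have := T.rank_mem S (Nat.zero_le (T.lev (T.tip y)))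
        rw [D.load]; omega⟩
  have h1 : ∀ a, κ (f (.inl a)) = (a.1.1.fst, lo a.1.1.symm + T.ld a.1.1 - a.2) := by
    intro a
    have hp : a.1.1.fst ≠ p := fun h => a.1.2.2 ((T.lev_eq_zero _).2 h)
    change key T lo _ = _
    simp [key, slot, hp, a.1.2]
  have h2 : ∀ y, κ (f (.inr y)) = (p, T.rank lo y) := by
    intro y
    have h3 := T.rank_mem S (Nat.zero_le (T.lev (T.tip y)))
    have hp : (T.out y 0).fst = p := by rw [← T.lev_eq_zero, T.lev_out (Nat.zero_le _)]
    change key T lo _ = _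
    simp only [key, hp, slot, T.out_not_par (Nat.zero_le (T.lev (T.tip y))), if_true, if_false]
    rw [show lo (T.out y 0) + (T.rank lo y - lo (T.out y 0)) = T.rank lo y by omega,
      Nat.mod_eq_of_lt (T.rank_lt S y)]
  have hinj : Function.Injective f := by
    rintro (a | y) (a' | y') h <;> have h := congrArg κ h
    · rw [h1, h1, Prod.mk.injEq] at h
      obtain ⟨e, j⟩ := a
      obtain ⟨e', j'⟩ := a'
      obtain rfl : e = e' := Subtype.ext (by rw [← e.2.1, ← e'.2.1]; exact T.ent_congr h.1)
      have h3 := j.2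
      have h4 := j'.2
      have h5 := h.2
      simp only at h3 h4 h5
      obtain rfl : j = j' := Fin.ext (by omega)
      rfl
    · rw [h1, h2, Prod.mk.injEq] at h
      exact absurd ((T.lev_eq_zero _).2 h.1) a.1.2.2
    · rw [h1, h2, Prod.mk.injEq] at h
      exact absurd ((T.lev_eq_zero _).2 h.1.symm) a'.1.2.2
    · rw [h2, h2, Prod.mk.injEq] at h
      rw [T.rank_injective S h.2]
  have h3 := Nat.card_le_card_of_injective f hinj
  rw [Nat.card_sum, Nat.card_sigma] at h3
  simpa [Nat.mul_comm] using h3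

/-! ### The surface that is cut open is a disk -/

theorem region_lev {γ γ' : P.Gap} (h : P.region R γ = P.region R γ') : γ.dart.fst = γ'.dart.fst := by
  let κ : P.Region R → Fin N × ℕ := Quot.lift (key T lo) fun _ _ h => D.key_regionStep S h
  exact congrArg (fun r => (κ r).1) h

omit S D in
/-- The lanes of an edge are all occupied, by counting. -/
theorem exists_lane {P : LoopSystem G p c} (e : Sym2 (Fin N)) {l : ℕ} (hl : l < P.load e) :
    ∃ s : P.Step, s.dart.edge = e ∧ P.lane s = l := by
  classical
  have h1 : ((Finset.univ.filter fun s : P.Step => s.dart.edge = e).image P.lane) =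
      Finset.range (P.load e) := by
    refine Finset.eq_of_subset_of_card_le (fun a ha => ?_) ?_
    · rw [Finset.mem_image] at ha
      obtain ⟨s, hs, rfl⟩ := ha
      rw [Finset.mem_filter] at hs
      rw [Finset.mem_range]
      have := P.lane_lt s
      rwa [hs.2] at this
    · rw [Finset.card_range, Finset.card_image_of_injOn]
      · rfl
      · intro s hs t ht h
        simp only [Finset.coe_filter, Finset.mem_univ, true_and, Set.mem_ofPred_eq] at hs ht
        exact P.lane_inj s t (hs.trans ht.symm) h
  have h2 : l ∈ Finset.range (P.load e) := Finset.mem_range.2 hl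
  rw [← h1, Finset.mem_image] at h2
  obtain ⟨s, hs, rfl⟩ := h2
  exact ⟨s, (Finset.mem_filter.1 hs).2, rfl⟩

omit S in
theorem lev_lt_length (i : Fin c) : T.lev (T.x i) < (P.loop i).length := by
  rw [D.length]; omega

omit S D in
theorem reachable_step (i : Fin c) (left : Bool) (k : ℕ) (hk : k < (P.loop i).length) :
    (P.cutGraph R).Reachable (P.region R (P.stepGap ⟨i, ⟨0, by omega⟩⟩ left))
      (P.region R (P.stepGap ⟨i, ⟨k, hk⟩⟩ left)) := by
  induction k with
  | zero => exact .refl _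
  | succ k ih =>
    refine (ih (by omega)).trans ((P.reachable_rev R _).trans ?_)
    rw [show P.region R (P.stepGap ⟨i, ⟨k, by omega⟩⟩ left).rev =
      P.region R (P.stepGap ⟨i, ⟨k + 1, hk⟩⟩ left) from Quot.sound (.pass i k hk left)]

omit S in
theorem dart_middle (i : Fin c) :
    LoopStep.dart (⟨i, ⟨T.lev (T.x i), D.lev_lt_length i⟩⟩ : P.Step) = T.x i := by
  rw [D.dart_le i _ le_rfl]
  exact T.out_top (i, true)

omit S in
theorem load_x (i : Fin c) : P.load (T.x i).edge = 1 := by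
  rw [D.load, ← tip_true, ld_tip]

omit S in
/-- From any region one can walk along a loop to its edge outside of the tree. This edge carries a single
strand, so that both of its copies lie on faces as a first copy; and all faces are linked by edges
without strands. -/
theorem cutGraph_connected (hc : 0 < c)
    (hC : ∀ d d', Structured.Linked R.faceNext SimpleGraph.Dart.symm (fun d => P.load d.edge = 0) d d') :
    (P.cutGraph R).Connected := by
  have hfirst : ∀ d d', (P.cutGraph R).Reachable (P.region R (P.firstGap d))
      (P.region R (P.firstGap d')) := fun d d' => by
    refine (hC d d').of_step (R := fun d d' => (P.cutGraph R).Reachable (P.region R (P.firstGap d))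
      (P.region R (P.firstGap d'))) ⟨fun _ => .refl _, fun h => h.symm, fun h h' => h.trans h'⟩
      (fun d => ?_) fun d hd => ?_
    · rw [← P.region_firstGap_rev]
      exact P.reachable_rev R _
    · have : P.firstGap d.symm = (P.firstGap d).rev :=
        LoopSystem.Gap.ext' rfl (by simp [LoopSystem.Gap.rev, LoopSystem.firstGap, hd])
      rw [this]
      exact P.reachable_rev R _
  have hstep : ∀ (s : P.Step) (left : Bool), ∃ d, (P.cutGraph R).Reachable
      (P.region R (P.stepGap s left)) (P.region R (P.firstGap d)) := by
    rintro ⟨i, k⟩ left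
    have h1 := (reachable_step (R := R) i left k k.2).symm.trans
      (reachable_step (R := R) i left _ (D.lev_lt_length i))
    obtain ⟨e1, e2⟩ := stepGap_eq (P := P) ⟨i, ⟨_, D.lev_lt_length i⟩⟩ left
    have h3 := P.index_lt _ (P.lane_lt ⟨i, ⟨_, D.lev_lt_length i⟩⟩)
    rw [D.dart_middle] at e1
    change P.index (LoopStep.dart (⟨i, ⟨_, D.lev_lt_length i⟩⟩ : P.Step)) _ < P.load
      (LoopStep.dart (⟨i, ⟨_, D.lev_lt_length i⟩⟩ : P.Step)).edge at h3
    rw [D.dart_middle] at e2 h3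
    rw [D.load_x] at h3
    cases left with
    | false =>
      refine ⟨T.x i, ?_⟩
      rwa [show P.stepGap ⟨i, ⟨_, D.lev_lt_length i⟩⟩ false = P.firstGap (T.x i) from
        LoopSystem.Gap.ext' e1 (by rw [e2]; simp [LoopSystem.firstGap]; omega)] at h1
    | true =>
      refine ⟨(T.x i).symm, h1.trans ?_⟩
      rw [show P.firstGap (T.x i).symm = (P.stepGap ⟨i, ⟨_, D.lev_lt_length i⟩⟩ true).rev from
        LoopSystem.Gap.ext' (congrArg SimpleGraph.Dart.symm e1).symm (by
          simp [LoopSystem.firstGap, LoopSystem.Gap.rev, e1, e2, D.load_x])]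
      exact P.reachable_rev R _
  have hall : ∀ r : P.Region R, ∃ d, (P.cutGraph R).Reachable r (P.region R (P.firstGap d)) := by
    rintro ⟨d, j, hj⟩
    change ∃ d', (P.cutGraph R).Reachable (P.region R ⟨d, j, hj⟩) _
    cases j with
    | zero => exact ⟨d, .refl _⟩
    | succ j =>
      obtain ⟨l, hl, hlj⟩ : ∃ l < P.load d.edge, P.index d l = j := by
        refine ⟨P.index d j, P.index_lt d hj, ?_⟩
        unfold LoopSystem.index
        split_ifs <;> omega
      obtain ⟨s, hs, rfl⟩ := exists_lane d.edge hl
      obtain h | h := (SimpleGraph.dart_edge_eq_iff _ _).1 hs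
      · obtain ⟨e1, e2⟩ := stepGap_eq s true
        obtain ⟨d', hd'⟩ := hstep s true
        rw [show P.stepGap s true = ⟨d, j + 1, hj⟩ from
          LoopSystem.Gap.ext' (e1.trans h) (by rw [e2, h, hlj]; simp)] at hd'
        exact ⟨d', hd'⟩
      · obtain ⟨e1, e2⟩ := stepGap_eq s false
        obtain ⟨d', hd'⟩ := hstep s false
        rw [show P.stepGap s false = (⟨d, j + 1, hj⟩ : P.Gap).rev from
          LoopSystem.Gap.ext' (e1.trans h) (by
            rw [e2, h, P.index_symm d hl, hlj]; simp [LoopSystem.Gap.rev]; omega)] at hd'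
        exact ⟨d', (P.reachable_rev R _).trans hd'⟩
  have : Nonempty (P.Region R) := ⟨P.region R (P.firstGap (T.x ⟨0, hc⟩))⟩
  refine ⟨fun r s => ?_⟩
  obtain ⟨d, hd⟩ := hall r
  obtain ⟨d', hd'⟩ := hall s
  exact hd.trans ((hfirst d d').trans hd'.symm)

/-- The counts of the regions and of the copies of the edges bound the Euler characteristic from below
by `1`, and `euler_le` bounds it from above. -/
theorem cutsToDisk (hG : G.Connected) (hc : 0 < c)
    (hE : N + Nat.card R.Face + c = Nat.card G.edgeSet + 2)
    (hC : ∀ d d', Structured.Linked R.faceNext SimpleGraph.Dart.symm (fun d => P.load d.edge = 0) d d') :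
    Nat.card (P.Region R) + Nat.card R.Face = Nat.card P.CutEdge + 1 := by
  have := Fintype.ofFinite G.Dart
  have := Fintype.ofFinite {e : G.Dart // T.Par e}
  have h1 := D.card_cutEdge_le
  have h2 := D.sum_par_le_card_region S
  have h3 := card_vertex_le (T := T) hG
  have h4 := (P.euler_le R (D.cutGraph_connected hc hC) hC (d₀ := T.x ⟨0, hc⟩)
    (by rw [D.load_x]; exact one_ne_zero)).1
  rw [Finset.sum_add_distrib] at h2
  simp only [Finset.sum_const, Finset.card_univ, smul_eq_mul, mul_one, ← Nat.card_eq_fintype_card] at h2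
  omega

end Drawn

end TreeLoops

namespace TreeLoops

variable {N : ℕ} {G : SimpleGraph (Fin N)} {R : RotationSystem G} {p : Fin N} {c : ℕ}
  {T : TreeLoops R p c} {lo : G.Dart → ℕ} (S : T.Slots lo) {P : LoopSystem G p c} (D : T.Drawn lo P)

namespace Drawn

/-! ### The loops do not cross -/

theorem between_iff (a b x : P.End) : P.Between R a b x ↔
    (P.endPos R a < P.endPos R x ∧ P.endPos R x < P.endPos R b) ∨
    (P.endPos R b < P.endPos R x ∧ P.endPos R x < P.endPos R a) := by
  unfold LoopSystem.Between
  rcases le_total (P.endPos R a) (P.endPos R b) with h | h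
  · rw [min_eq_left h, max_eq_right h]
    exact ⟨Or.inl, fun h' => h'.elim id fun h' => absurd (h'.1.trans h'.2) h.not_gt⟩
  · rw [min_eq_right h, max_eq_left h]
    exact ⟨Or.inr, fun h' => h'.elim (fun h' => absurd (h'.1.trans h'.2) h.not_gt) id⟩

/-- The end `u` of a strand lies along the edge from a vertex of level `j + 1` to its parent, and the
end `v` lies along another edge at this vertex; both belong to the end `y` of a loop. -/
structure Ends (T : TreeLoops R p c) (lo : G.Dart → ℕ) (u v : P.End) (y : Fin c × Bool) (j : ℕ) :
    Prop where
  lt : j < T.lev (T.tip y)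
  dart_par : P.endDart u = (T.out y j).symm
  dart_out : P.endDart v = T.out y (j + 1)
  index_par : P.index (P.endDart u) (P.lane u.1) =
    T.ld (T.out y j) - 1 - (T.rank lo y - lo (T.out y j))
  index_out : P.index (P.endDart v) (P.lane v.1) = T.rank lo y - lo (T.out y (j + 1))

theorem endPos_lt_iff {a b : P.End} : P.endPos R a < P.endPos R b ↔
    R.idx (P.endDart a) < R.idx (P.endDart b) ∨ R.idx (P.endDart a) = R.idx (P.endDart b) ∧
      P.index (P.endDart a) (P.lane a.1) < P.index (P.endDart b) (P.lane b.1) :=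
  Prod.Lex.toLex_lt_toLex

include S

/-- Two passes at a vertex do not interleave: the strands appear on the edge to the parent in the order
opposite to the one in which they leave along the other edges. -/
theorem Ends.between {u v u' v' : P.End} {y y' : Fin c × Bool} {j j' : ℕ} (h : Ends T lo u v y j)
    (h' : Ends T lo u' v' y' j') (hv : (P.endDart v).fst = (P.endDart v').fst) :
    P.Between R u v u' ↔ P.Between R u v v' := by
  have hj : j = j' := by
    have := T.lev_congr hv
    rw [h.dart_out, h'.dart_out, T.lev_out (by have := h.lt; omega),
      T.lev_out (by have := h'.lt; omega)] at this
    omega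
  subst hj
  have l1 := h.lt
  have l2 := h'.lt
  rw [h.dart_out, h'.dart_out] at hv
  have he := T.ent_congr hv
  have hlow : T.out y' j = T.out y j := by rw [T.out_pred l1, T.out_pred l2, up, up, he]
  have p1 := T.out_not_par (y := y) (j := j + 1) l1
  have p2 := T.out_not_par (y := y') (j := j + 1) l2
  have r1 := T.rank_mem S (y := y) (j := j + 1) l1
  have r2 := T.rank_mem S (y := y') (j := j + 1) l2
  have r3 := T.rank_mem S (y := y) (j := j) l1.le
  have r4 := T.rank_mem S (y := y') (j := j) l2.le
  rw [hlow] at r4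
  have m1 := T.lo_mono S p1 p2 hv
  have m2 := T.lo_mono S p2 p1 hv.symm
  have q1 := T.pos_eq (T.out y (j + 1))
  have q2 := T.pos_eq (T.out y' (j + 1))
  have i1 := T.idx_lt (T.out y (j + 1))
  have i2 := T.idx_lt (T.out y' (j + 1))
  have i3 := T.idx_ent_lt (T.out y (j + 1))
  rw [← he, ← T.deg_congr hv] at q2
  rw [← T.deg_congr hv] at i2
  have hq : ∀ {y}, j < T.lev (T.tip y) → R.idx (T.ent (T.out y (j + 1))) ≠ R.idx (T.out y (j + 1)) :=
    fun {y} hl h => T.out_not_par (y := y) (j := j + 1) hl ⟨R.ext_idx (T.ent_fst _) h, by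
      rw [T.lev_out hl]; omega⟩
  have n1 := hq l1
  have n2 := hq l2
  rw [← he] at n2
  have s1 : R.idx (T.out y (j + 1)) = R.idx (T.out y' (j + 1)) →
      lo (T.out y (j + 1)) = lo (T.out y' (j + 1)) := fun h => by rw [R.ext_idx hv h]
  simp only [between_iff, endPos_lt_iff]
  simp only [h.index_par, h.index_out, h'.index_par, h'.index_out]
  simp only [h.dart_par, h.dart_out, h'.dart_par, h'.dart_out, hlow, T.symm_out_eq_ent l1]
  clear h h' hq hlow hv he p1 p2
  simp only [true_and]
  split_ifs at q1 q2 <;> omega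

omit S in
include D in
/-- At each pass, one of the two strands lies on the edge to the parent. -/
theorem ends_of_pass {a b : P.End} (h : P.Pass a b) :
    ∃ y j, Ends T lo a b y j ∨ Ends T lo b a y j := by
  obtain ⟨i, k, hk, rfl, rfl⟩ := h
  have hk' := hk.trans_eq (D.length i)
  by_cases hle : k + 1 ≤ T.lev (T.x i)
  · have h1 := D.lane_lt_le (i := i) ⟨k, by omega⟩ (show k ≤ _ by omega)
    have h2 := D.dart_le i ⟨k, by omega⟩ (show k ≤ _ by omega)
    have h3 := D.dart_le i ⟨k + 1, hk⟩ hle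
    have h4 := D.index_le i ⟨k, by omega⟩ (show k ≤ _ by omega)
    have h5 := D.index_le i ⟨k + 1, hk⟩ hle
    refine ⟨(i, true), k, Or.inl ⟨hle, congrArg SimpleGraph.Dart.symm h2, h3, ?_, ?_⟩⟩
    · rw [show P.endDart (⟨i, ⟨k, by omega⟩⟩, false) = (T.out (i, true) k).symm from
        congrArg SimpleGraph.Dart.symm h2,
        P.index_symm _ h1, D.load, h4]
    · rw [show P.endDart (⟨i, ⟨k + 1, hk⟩⟩, true) = T.out (i, true) (k + 1) from h3, h5]
  · have h1 := D.lane_lt_ge (i := i) ⟨k + 1, hk⟩ (show _ ≤ k + 1 by omega)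
    have h2 := D.dart_ge i ⟨k, by omega⟩ (show _ ≤ k by omega)
    have h3 := D.dart_ge i ⟨k + 1, hk⟩ (show _ ≤ k + 1 by omega)
    have h4 := D.index_ge i ⟨k, by omega⟩ (show _ ≤ k by omega)
    have h5 := D.index_ge i ⟨k + 1, hk⟩ (show _ ≤ k + 1 by omega)
    have e1 : T.lev (T.x i) + T.lev (T.x i).symm - k =
      T.lev (T.x i) + T.lev (T.x i).symm - (k + 1) + 1 := by omega
    simp only at h1 h2 h3 h4 h5
    rw [e1] at h2 h4
    have h6 : P.endDart (⟨i, ⟨k, by omega⟩⟩, false) =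
        T.out (i, false) (T.lev (T.x i) + T.lev (T.x i).symm - (k + 1) + 1) := by
      rw [← SimpleGraph.Dart.symm_symm (T.out _ _), ← h2]
      rfl
    refine ⟨(i, false), T.lev (T.x i) + T.lev (T.x i).symm - (k + 1), Or.inr ⟨?_, h3, h6, ?_, ?_⟩⟩
    · rw [tip_false]; omega
    · rw [show P.endDart (⟨i, ⟨k + 1, hk⟩⟩, true) = _ from h3, P.index_symm _ h1, D.load, h5]
    · rw [h6, h4]

omit S in
include D in
theorem terminal_fst {a : P.End} (h : P.Terminal a) : (P.endDart a).fst = p := by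
  obtain ⟨⟨i, k⟩, b⟩ := a
  rw [← T.lev_eq_zero]
  obtain ⟨hb, hk⟩ | ⟨hb, hk⟩ := h
  · simp only at hb hk
    subst hb
    rw [show P.endDart (⟨i, k⟩, true) = _ from D.dart_le i k (by omega), T.lev_out (by rw [tip_true]; omega),
      hk]
  · simp only at hb hk
    subst hb
    have hk := hk.trans (D.length i)
    rw [show P.endDart (⟨i, k⟩, false) = _ from congrArg SimpleGraph.Dart.symm (D.dart_ge i k (by omega)),
      SimpleGraph.Dart.symm_symm, T.lev_out (by rw [tip_false]; omega)]
    omega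

include D

/-- No walk passes through the base point, so that there is nothing to show for terminal strand ends. -/
theorem nonCrossing : P.NonCrossing R := by
  have hcomm : ∀ a b x, P.Between R a b x ↔ P.Between R b a x := fun a b x => by
    rw [LoopSystem.Between, min_comm, max_comm, LoopSystem.Between]
  have hfst : ∀ {u v y j}, Ends T lo (P := P) u v y j → (P.endDart u).fst = (P.endDart v).fst :=
    fun h => by rw [h.dart_par, h.dart_out, T.symm_out_eq_ent h.lt, ent_fst]
  have hlev : ∀ {u v y j}, Ends T lo (P := P) u v y j → (P.endDart u).fst ≠ p := fun h hp => by
    rw [hfst h, h.dart_out, ← T.lev_eq_zero, T.lev_out h.lt] at hp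
    omega
  have hpass : ∀ a b, P.Pass a b → ∃ u v y j, Ends T lo u v y j ∧ (P.endDart a).fst = (P.endDart u).fst ∧
      (∀ x, P.Between R a b x ↔ P.Between R u v x) ∧ (a = u ∧ b = v ∨ a = v ∧ b = u) := by
    intro a b h
    obtain ⟨y, j, h | h⟩ := D.ends_of_pass h
    · exact ⟨a, b, y, j, h, rfl, fun _ => Iff.rfl, Or.inl ⟨rfl, rfl⟩⟩
    · exact ⟨b, a, y, j, h, (hfst h).symm, fun _ => hcomm _ _ _, Or.inr ⟨rfl, rfl⟩⟩
  intro a b x x' hab hx hf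
  obtain ⟨u, v, y, j, h1, h2, h3, -⟩ := hpass a b hab
  rw [h3, h3]
  obtain hx | hx := hx
  · obtain ⟨u', v', y', j', h4, h5, -, h6⟩ := hpass x x' hx
    have h7 := h1.between S h4 (by rw [← hfst h1, ← h2, ← hf, h5, hfst h4])
    obtain ⟨rfl, rfl⟩ | ⟨rfl, rfl⟩ := h6
    · exact h7
    · exact h7.symm
  · exfalso
    refine hlev h1 ?_
    rw [← h2, ← hf]
    exact D.terminal_fst hx.1

end Drawn

end TreeLoops

/-! ### Dual cycles -/

namespace RotationSystem

variable {N : ℕ} {G : SimpleGraph (Fin N)} (R : RotationSystem G)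

open Classical in
/-- If the two sides of `d` are linked by crossings of darts with the property `al`, then there is a
set of edges that consists of the edge of `d` and of edges of such darts, and that contains an even
number of the edges of each face. -/
theorem exists_dual_cycle [Fintype G.Dart] {al : G.Dart → Prop} {d : G.Dart}
    (h : Structured.Linked R.faceNext SimpleGraph.Dart.symm al d d.symm)
    (hd : ∀ d', al d' → d'.edge ≠ d.edge) :
    ∃ z : Sym2 (Fin N) → ZMod 2, z d.edge = 1 ∧
      (∀ e, z e ≠ 0 → e = d.edge ∨ ∃ d', al d' ∧ d'.edge = e) ∧
      ∀ f, ∑ d' : G.Dart with R.face d' = f, z d'.edge = 0 := by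
  have hsingle : ∀ (d : G.Dart) f, (∑ d' : G.Dart with R.face d' = f,
      (Pi.single d.edge 1 : Sym2 (Fin N) → ZMod 2) d'.edge) =
      (Pi.single (R.face d) 1 : R.Face → ZMod 2) f + (Pi.single (R.face d.symm) 1 : R.Face → ZMod 2) f := by
    intro d f
    have : ∀ d' : G.Dart, (Pi.single d.edge 1 : Sym2 (Fin N) → ZMod 2) d'.edge =
        (if d' = d then 1 else 0) + (if d' = d.symm then 1 else 0) := by
      intro d'
      have hne : d.symm ≠ d := SimpleGraph.Dart.symm_ne d
      rw [Pi.single_apply, if_congr (SimpleGraph.dart_edge_eq_iff d' d) rfl rfl]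
      by_cases h1 : d' = d
      · subst h1; simp [hne.symm]
      · simp [h1]
    simp only [this, Finset.sum_add_distrib, Finset.sum_ite_eq', Finset.mem_filter, Finset.mem_univ,
      true_and, Pi.single_apply]
    exact congrArg₂ _ (if_congr eq_comm rfl rfl) (if_congr eq_comm rfl rfl)
  have key : ∀ a b, Structured.Linked R.faceNext SimpleGraph.Dart.symm al a b →
      ∃ z : Sym2 (Fin N) → ZMod 2, (∀ e, z e ≠ 0 → ∃ d', al d' ∧ d'.edge = e) ∧
      ∀ f, ∑ d' : G.Dart with R.face d' = f, z d'.edge =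
        (Pi.single (R.face a) 1 : R.Face → ZMod 2) f + (Pi.single (R.face b) 1 : R.Face → ZMod 2) f := by
    intro a b hab
    refine hab.of_step (R := fun a b => ∃ z : Sym2 (Fin N) → ZMod 2,
      (∀ e, z e ≠ 0 → ∃ d', al d' ∧ d'.edge = e) ∧
      ∀ f, ∑ d' : G.Dart with R.face d' = f, z d'.edge =
        (Pi.single (R.face a) 1 : R.Face → ZMod 2) f + (Pi.single (R.face b) 1 : R.Face → ZMod 2) f) ⟨fun a => ?_, ?_, ?_⟩ (fun a => ?_)
      fun a ha => ?_
    · exact ⟨0, by simp, fun f => by simp [CharTwo.add_self_eq_zero]⟩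
    · rintro a b ⟨z, h1, h2⟩
      exact ⟨z, h1, fun f => by rw [h2, add_comm]⟩
    · rintro a b c ⟨z, h1, h2⟩ ⟨z', h1', h2'⟩
      refine ⟨z + z', fun e he => ?_, fun f => ?_⟩
      · by_cases h0 : z e = 0
        · exact h1' e fun h0' => he (by simp [h0, h0'])
        · exact h1 e h0
      · simp only [Pi.add_apply, Finset.sum_add_distrib, h2, h2']
        rw [add_assoc, ← add_assoc ((Pi.single (R.face b) 1 : R.Face → ZMod 2) f), CharTwo.add_self_eq_zero, zero_add]
    · exact ⟨0, by simp, fun f => by simp [R.face_faceNext, CharTwo.add_self_eq_zero]⟩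
    · refine ⟨Pi.single a.edge 1, fun e he => ⟨a, ha, ?_⟩, hsingle a⟩
      by_contra hne
      exact he (Pi.single_eq_of_ne (Ne.symm hne) _)
  obtain ⟨z, h1, h2⟩ := key _ _ h
  have h0 : z d.edge = 0 := by
    by_contra h0
    obtain ⟨d', h3, h4⟩ := h1 _ h0
    exact hd d' h3 h4
  refine ⟨z + Pi.single d.edge 1, by simp [h0], fun e he => ?_, fun f => ?_⟩
  · by_cases h3 : z e = 0
    · left
      by_contra hne
      exact he (by simp [h3, hne])
    · exact Or.inr (h1 e h3)
  · simp only [Pi.add_apply, Finset.sum_add_distrib, h2, hsingle]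
    exact CharTwo.add_self_eq_zero _

end RotationSystem

namespace TreeLoops

variable {N : ℕ} {G : SimpleGraph (Fin N)} {R : RotationSystem G} {p : Fin N} {c : ℕ}
  {T : TreeLoops R p c} {lo : G.Dart → ℕ} (S : T.Slots lo) {P : LoopSystem G p c} (D : T.Drawn lo P)

/-- The edges that are neither in the tree nor on the list link all faces, and the two sides of each
edge on the list are linked by such edges whose endpoints have at least the same total level. -/
structure Complement (T : TreeLoops R p c) (al : G.Dart → Prop) : Prop where
  ld_eq_zero : ∀ d, al d → T.ld d = 0
  linked : ∀ d d', Structured.Linked R.faceNext SimpleGraph.Dart.symm al d d'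
  heavy : ∀ i, Structured.Linked R.faceNext SimpleGraph.Dart.symm
    (fun d => al d ∧ T.lev (T.x i) + T.lev (T.x i).symm ≤ T.lev d + T.lev d.symm) (T.x i) (T.x i).symm

namespace Drawn

/-! ### No side has a chord -/

include D

theorem edge_step_of_ne {i : Fin c} (k : Fin (P.loop i).length) (hk : (k : ℕ) ≠ T.lev (T.x i)) :
    ∃ y j, j < T.lev (T.tip y) ∧ (LoopStep.dart (⟨i, k⟩ : P.Step)).edge = (T.out y j).edge := by
  have := k.2.trans_eq (D.length i)
  obtain h | h := lt_or_gt_of_ne hk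
  · exact ⟨(i, true), k, h, by rw [D.dart_le i k h.le]⟩
  · exact ⟨(i, false), T.lev (T.x i) + T.lev (T.x i).symm - k, by rw [tip_false]; omega, by
      rw [D.dart_ge i k h.le, SimpleGraph.Dart.edge_symm]⟩

theorem length_pos (i : Fin c) : 0 < (P.loop i).length := by
  rw [D.length]; omega

omit D in
theorem sideVertex_lt (h : ∀ i, 0 < (P.loop i).length) (i : Fin c) (left : Bool) {k : ℕ}
    (hk : k < (P.loop i).length) :
    P.sideVertex R h i left k = P.region R (P.stepGap ⟨i, ⟨k, hk⟩⟩ left) := by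
  rw [LoopSystem.sideVertex, dif_pos hk]

omit D in
theorem sideVertex_succ (h : ∀ i, 0 < (P.loop i).length) (i : Fin c) (left : Bool) {k : ℕ}
    (hk : k < (P.loop i).length) :
    P.sideVertex R h i left (k + 1) = P.region R (P.stepGap ⟨i, ⟨k, hk⟩⟩ left).rev := by
  rw [LoopSystem.sideVertex]
  split_ifs with hk'
  · exact (Quot.sound (.pass i k hk' left)).symm
  · have : (P.loop i).length - 1 = k := by omega
    simp only [this]

/-- The level of the `k`-th vertex of a loop. -/
theorem sideVertex_lev (h : ∀ i, 0 < (P.loop i).length) (i : Fin c) (left : Bool) {k : ℕ}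
    (hk : k ≤ (P.loop i).length) : ∃ γ : P.Gap, P.sideVertex R h i left k = P.region R γ ∧
      T.lev γ.dart = if k ≤ T.lev (T.x i) then k else (P.loop i).length - k := by
  have hl := D.length i
  obtain hk' | rfl := hk.lt_or_eq
  · refine ⟨_, sideVertex_lt h i left hk', ?_⟩
    rw [(stepGap_eq _ left).1]
    split_ifs with ha
    · rw [D.dart_le i ⟨k, hk'⟩ ha, T.lev_out ha]
    · rw [D.dart_ge i ⟨k, hk'⟩ (by simp only; omega), T.symm_out_eq_ent (by rw [tip_false]; simp only; omega),
        T.tree.lev_ent, T.lev_out (by rw [tip_false]; simp only; omega)]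
      simp only
      omega
  · obtain ⟨m, hm⟩ : ∃ m, (P.loop i).length = m + 1 := ⟨_, hl⟩
    have hm' : m < (P.loop i).length := by omega
    refine ⟨(P.stepGap ⟨i, ⟨m, hm'⟩⟩ left).rev, ?_, ?_⟩
    · rw [← sideVertex_succ h i left hm', ← hm]
    · rw [LoopSystem.Gap.rev]
      simp only
      rw [(stepGap_eq _ left).1, D.dart_ge i ⟨m, hm'⟩ (by simp only; omega), SimpleGraph.Dart.symm_symm,
        T.lev_out (by rw [tip_false]; simp only; omega), if_neg (by omega)]
      simp only
      omega

/-- A function on the regions whose coboundary vanishes on the tree and is `1` on `x i` takes one value on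
the first half of each side of loop `i`, and the other value on the second half. -/
theorem sideVertex_jump (h : ∀ i, 0 < (P.loop i).length) (i : Fin c) (left : Bool)
    {η : P.Region R → ZMod 2} {z : Sym2 (Fin N) → ZMod 2}
    (hη : ∀ γ : P.Gap, η (P.region R γ) + η (P.region R γ.rev) = z γ.dart.edge)
    (hx : z (T.x i).edge = 1) (ht : ∀ y j, j < T.lev (T.tip y) → z (T.out y j).edge = 0)
    {k : ℕ} (hk : k ≤ (P.loop i).length) : η (P.sideVertex R h i left k) =
      η (P.sideVertex R h i left 0) + if k ≤ T.lev (T.x i) then 0 else 1 := by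
  induction k with
  | zero => simp
  | succ k ih =>
    have hk' : k < (P.loop i).length := by omega
    have h1 := hη (P.stepGap ⟨i, ⟨k, hk'⟩⟩ left)
    rw [← sideVertex_lt h i left hk', ← sideVertex_succ h i left hk', (stepGap_eq _ left).1,
      ih hk'.le] at h1
    have h2 : η (P.sideVertex R h i left (k + 1)) = z (LoopStep.dart (⟨i, ⟨k, hk'⟩⟩ : P.Step)).edge +
        (η (P.sideVertex R h i left 0) + if k ≤ T.lev (T.x i) then 0 else 1) := by
      rw [← h1, add_comm _ (η (P.sideVertex R h i left (k + 1))), add_assoc, CharTwo.add_self_eq_zero,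
        add_zero]
    rw [h2]
    by_cases hm : k = T.lev (T.x i)
    · subst hm
      rw [D.dart_middle, hx]
      simp [add_comm]
    · obtain ⟨y, j, hj, he⟩ := D.edge_step_of_ne ⟨k, hk'⟩ hm
      rw [he, ht y j hj, zero_add]
      congr 1
      exact if_congr (by omega) rfl rfl

include S

/-- Levels along an edge differ by at most `1`, so that a chord would join a vertex on the first half of
a side to one on the second half, with a smaller total level than `x i` has. The edge `x i` lies on a
dual cycle of edges without strands of at least the total level of `x i`. The surface that is cut open
is a disk, so that this cycle is a coboundary; it separates the two halves of the side, so that the chord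
belongs to it, a contradiction. -/
theorem chordFree (hG : G.Connected) (hE : N + Nat.card R.Face + c = Nat.card G.edgeSet + 2)
    {al : G.Dart → Prop} (hal : T.Complement al) (h : ∀ i, 0 < (P.loop i).length) :
    P.ChordFree R h := by
  classical
  have := Fintype.ofFinite G.Dart
  intro i left k l hk hl hadj
  wlog hkl : k ≤ l generalizing k l
  · exact (this l k hl hk hadj.symm (by omega)).symm
  have hlen := D.length i
  have hne : k ≠ l := by
    rintro rfl
    exact hadj.ne rfl
  -- The edge of the chord, as a dart from the level of the first vertex to that of the second.
  obtain ⟨γ, hγ1, hγ2⟩ : ∃ γ : P.Gap, P.region R γ = P.sideVertex R h i left k ∧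
      P.region R γ.rev = P.sideVertex R h i left l := by
    rw [LoopSystem.cutGraph, SimpleGraph.fromRel_adj] at hadj
    obtain ⟨-, h' | ⟨γ, h1, h2⟩⟩ := hadj
    · exact h'
    · exact ⟨γ.rev, h2, by rw [LoopSystem.Gap.rev_rev, h1]⟩
  obtain ⟨γk, hk1, hk2⟩ := D.sideVertex_lev (R := R) h i left hk
  obtain ⟨γl, hl1, hl2⟩ := D.sideVertex_lev (R := R) h i left hl
  rw [← T.lev_congr (D.region_lev S (hγ1.trans hk1))] at hk2
  rw [← T.lev_congr (D.region_lev S (hγ2.trans hl1))] at hl2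
  change T.lev γ.dart.symm = _ at hl2
  have hd1 := T.tree.down γ.dart trivial
  have hd2 := T.tree.down γ.dart.symm trivial
  rw [SimpleGraph.Dart.symm_symm] at hd2
  by_contra hcon
  rw [not_or] at hcon
  have hka : k ≤ T.lev (T.x i) := by
    by_contra hka
    rw [if_neg hka] at hk2
    rw [if_neg (by omega)] at hl2
    omega
  have hla : ¬ l ≤ T.lev (T.x i) := fun hla => by
    rw [if_pos hka] at hk2
    rw [if_pos hla] at hl2
    omega
  rw [if_pos hka] at hk2
  rw [if_neg hla] at hl2
  have hal' : ∀ d, al d → d.edge ≠ (T.x i).edge := fun d hd he => by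
    have := hal.ld_eq_zero d hd
    rw [← D.load, he, D.load_x] at this
    exact one_ne_zero this
  obtain ⟨z, hz1, hz2, hz3⟩ := R.exists_dual_cycle (hal.heavy i) fun d hd => hal' d hd.1
  have hC : ∀ d d', Structured.Linked R.faceNext SimpleGraph.Dart.symm (fun d => P.load d.edge = 0) d d' :=
    fun d d' => (hal.linked d d').mono fun d hd => by rw [D.load]; exact hal.ld_eq_zero d hd
  obtain ⟨η, hη⟩ := (P.euler_le R (D.cutGraph_connected i.pos hC) hC (d₀ := T.x i)
    (by rw [D.load_x]; exact one_ne_zero)).2 (D.cutsToDisk S hG i.pos hE hC) (fun ε => z ε.1) (by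
      funext f
      exact hz3 f)
  have hη' : ∀ γ : P.Gap, η (P.region R γ) + η (P.region R γ.rev) = z γ.dart.edge := fun γ => by
    rw [← P.coboundary_apply, hη]
    rfl
  have ht : ∀ y j, j < T.lev (T.tip y) → z (T.out y j).edge = 0 := by
    intro y j hj
    by_contra h0
    obtain h1 | ⟨d, h1, h2⟩ := hz2 _ h0
    · have h3 := T.par_symm_out hj
      obtain h4 | h4 := (SimpleGraph.dart_edge_eq_iff _ _).1 h1
      · exact T.x_symm_not_par i (by rw [← h4]; exact h3)
      · exact T.x_not_par i (by rw [h4, SimpleGraph.Dart.symm_symm] at h3; exact h3)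
    · have h3 := hal.ld_eq_zero d h1.1
      have h4 := T.ld_out_pos hj.le
      rw [ld, ← h2] at h4
      exact h4.ne' h3
  have h1 := hη' γ
  rw [hγ1, hγ2, D.sideVertex_jump h i left hη' hz1 ht hk, D.sideVertex_jump h i left hη' hz1 ht hl,
    if_pos hka, if_neg hla, add_zero, ← add_assoc, CharTwo.add_self_eq_zero, zero_add] at h1
  -- The endpoints of the chord have a smaller total level than the endpoints of `x i`.
  obtain h2 | ⟨d, ⟨-, h2⟩, h3⟩ := hz2 γ.dart.edge (by rw [← h1]; exact one_ne_zero)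
  · obtain h4 | h4 := (SimpleGraph.dart_edge_eq_iff _ _).1 h2
    · rw [h4] at hk2 hl2; omega
    · rw [h4] at hk2 hl2; rw [SimpleGraph.Dart.symm_symm] at hl2; omega
  · obtain h4 | h4 := (SimpleGraph.dart_edge_eq_iff _ _).1 h3
    · rw [h4] at h2; omega
    · rw [h4, SimpleGraph.Dart.symm_symm] at h2; omega

theorem isPolygonalSchema (hG : G.Connected) (hc : 0 < c)
    (hE : N + Nat.card R.Face + c = Nat.card G.edgeSet + 2)
    {al : G.Dart → Prop} (hal : T.Complement al) : P.IsPolygonalSchema R where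
  length_pos := D.length_pos
  nonCrossing := D.nonCrossing S
  cutsToDisk := by
    have hC : ∀ d d', Structured.Linked R.faceNext SimpleGraph.Dart.symm
        (fun d => P.load d.edge = 0) d d' :=
      fun d d' => (hal.linked d d').mono fun d hd => by rw [D.load]; exact hal.ld_eq_zero d hd
    have := D.cutsToDisk S hG hc hE hC
    exact ⟨D.cutGraph_connected hc hC, by omega⟩

end Drawn

end TreeLoops

namespace Structured

variable {α : Type*}

/-! ### Iterating over a list -/

/-- Runs `body` for each entry of array `q`; the number of entries is in register `n`, and the current
entry in register `22`. -/
def forEach (q n : ℕ) (body : Stmt) : Stmt :=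
  .ops [.const 20 0, .inc 21 n 0] ;;
  .loop 21 (.ops [.get 22 q 20] ;; body ;; .ops [.inc 20 20 1, .minus 21 n 20])

theorem wp_forEach {x : List ℕ} {V q n : ℕ} {body : Stmt} {code : α → ℕ} {l : List α} {σ : St}
    (Inv : ℕ → (ℕ → ℕ) → (ℕ → ℕ → ℕ) → List ℕ → Prop) (t : ℕ) (hn : n < 20)
    (hb : body.wr 20 = false ∧ body.wr n = false ∧ body.wa q = false)
    (hq : ∀ i (hi : i < l.length), σ.arr q i = code l[i]) (hlen : σ.reg n = l.length)
    (h0 : Inv 0 (fun r => σ.reg (26 + r)) σ.arr σ.out)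
    (hstep : ∀ j (hj : j < l.length) τ, Frame (forEach q n body) σ τ → τ.reg 20 = j →
      τ.reg 22 = code l[j] → Inv j (fun r => τ.reg (26 + r)) τ.arr τ.out →
      WP x V body (fun τ' => Inv (j + 1) (fun r => τ'.reg (26 + r)) τ'.arr τ'.out ∧
        τ'.time ≤ τ.time + t) τ) :
    WP x V (forEach q n body) (fun σ' => Inv l.length (fun r => σ'.reg (26 + r)) σ'.arr σ'.out ∧
      σ'.time ≤ σ.time + ((t + 4) * l.length + 3)) σ := by
  have hr' : ∀ r, 26 + r ≠ 20 ∧ 26 + r ≠ 21 ∧ 26 + r ≠ 22 := fun r => by omega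
  have hn' : n ≠ 20 ∧ n ≠ 21 ∧ n ≠ 22 := by omega
  refine WP.seq (WP.ops ?_)
  simp only [pre, Op.eval, Op.Fits, true_and]
  refine WP.loop (n := l.length) (fun m τ => ∃ j, j + m = l.length ∧ τ.reg 20 = j ∧ τ.reg 21 = m ∧
    Frame (forEach q n body) σ τ ∧
    Inv j (fun r => τ.reg (26 + r)) τ.arr τ.out ∧ τ.time ≤ σ.time + 2 + (t + 4) * j) ?_ ?_ ?_
  · refine ⟨0, by omega, ?_, ?_, ?_, ?_, ?_⟩
    · simp
    · simp [hn', hlen]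
    · refine ⟨fun r h => ?_, fun _ _ => rfl, fun _ => rfl⟩
      simp only [forEach, Stmt.wr, List.any_cons, List.any_nil, Op.wr, Bool.or_eq_false_iff, beq_eq_false_iff_ne] at h
      have h1 : r ≠ 20 := fun h' => by simp [h'] at h
      have h2 : r ≠ 21 := fun h' => by simp [h'] at h
      simp [h1, h2]
    · simpa [hr'] using h0
    · simp
  · rintro m τ hF ⟨j, hjm, h20, h21, hF', hI, ht⟩ hreg
    have hj : j < l.length := by omega
    have hqj : τ.arr q = σ.arr q := hF.arr q (by simp [Stmt.wa, Op.wa, hb])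
    have hnj : τ.reg n = l.length := by
      rw [hF'.reg n (by simp [forEach, Stmt.wr, Op.wr, hb]; omega), hlen]
    refine WP.seq (WP.ops ?_)
    simp only [pre, Op.eval, Op.Fits, true_and]
    refine WP.seq (WP.mono (hstep j hj _ ?_ ?_ ?_ ?_)
      fun τ' hFb ⟨hI', ht'⟩ => WP.ops ?_)
    · refine hF'.trans ⟨fun r h => ?_, fun _ _ => rfl, fun _ => rfl⟩
      simp only [forEach, Stmt.wr, List.any_cons, List.any_nil, Op.wr, Bool.or_eq_false_iff, beq_eq_false_iff_ne] at h
      have h1 : r ≠ 22 := fun h' => by simp [h'] at h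
      simp [h1, St.tick]
    · simp [St.tick, h20]
    · simp [St.tick, h20, hqj, hq j hj]
    · simpa [St.tick, hr'] using hI
    · have hb20 := hFb.reg 20 hb.1
      have hbn := hFb.reg n hb.2.1
      simp only [St.tick] at hb20 hbn ht'
      simp [h20] at hb20
      simp [hn', hnj] at hbn
      simp only [pre, Op.eval, Op.Fits, true_and]
      refine ⟨m - 1, by omega, j + 1, by omega, by simp [hb20], by simp [hn', hb20, hbn]; omega, ?_, ?_, ?_⟩
      · refine hF'.trans ⟨fun r h => ?_, fun k h => ?_, fun h => ?_⟩
        · simp only [forEach, Stmt.wr, List.any_cons, List.any_nil, Op.wr, Bool.or_eq_false_iff, beq_eq_false_iff_ne] at h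
          have h1 : r ≠ 22 := fun h' => by simp [h'] at h
          have h2 : r ≠ 20 := fun h' => by simp [h'] at h
          have h3 : r ≠ 21 := fun h' => by simp [h'] at h
          have := hFb.reg r h.2.2.1
          simp [h1, St.tick] at this
          simp [h2, h3, this]
        · simp only [forEach, Stmt.wa, List.any_cons, List.any_nil, Op.wa, Bool.or_eq_false_iff] at h
          exact hFb.arr k h.2.2.1
        · simp only [forEach, Stmt.wo, List.any_cons, List.any_nil, Op.wo, Bool.or_eq_false_iff] at h
          exact hFb.out h.2.2.1
      · simpa [hr'] using hI'
      · have : (t + 4) * (j + 1) = (t + 4) * j + t + 4 := by ring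
        omega
  · rintro m τ hF ⟨j, hjm, h20, h21, hF', hI, ht⟩ hreg
    obtain rfl : j = l.length := by omega
    refine ⟨hI, ?_⟩
    simp only [St.tick]
    omega

/-! ### Climbing a search tree -/

/-- Runs `body` for each crossing on the way from the dart in register `23` to the root of the search
tree in the arrays `k` and `k + 1`; the current crossing is in register `24`. -/
def climbDo (k : ℕ) (body : Stmt) : Stmt :=
  .ops [.get 25 (k + 1) 23] ;;
  .loop 25 (.ops [.get 24 k 23] ;; body ;; .ops [.get 23 5 24, .get 25 (k + 1) 23])

theorem wp_climbDo {x : List ℕ} {V k : ℕ} {body : Stmt} {code : α → ℕ} {σ : St} {π ι : α → α}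
    {al : α → Prop} {s : α} {ent : α → α} {lev : α → ℕ} (hS : SearchTree π ι al s ent lev)
    (Inv : List α → (ℕ → ℕ) → (ℕ → ℕ → ℕ) → List ℕ → Prop) (t : ℕ)
    (hb : body.wr 24 = false ∧ body.wa k = false ∧ body.wa (k + 1) = false ∧ body.wa 5 = false)
    (hE : ∀ d, σ.arr k (code d) = code (ent d)) (hL : ∀ d, σ.arr (k + 1) (code d) = lev d)
    (h5 : ∀ d, σ.arr 5 (code d) = code (ι d)) {d : α} (h23 : σ.reg 23 = code d)
    (h0 : Inv [] (fun r => σ.reg (26 + r)) σ.arr σ.out)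
    (hstep : ∀ l e, l ++ [e] <+: climb ι ent lev d → ∀ τ, Frame (climbDo k body) σ τ →
      τ.reg 24 = code e → Inv l (fun r => τ.reg (26 + r)) τ.arr τ.out →
      WP x V body (fun τ' => Inv (l ++ [e]) (fun r => τ'.reg (26 + r)) τ'.arr τ'.out ∧
        τ'.time ≤ τ.time + t) τ) :
    WP x V (climbDo k body) (fun σ' => Inv (climb ι ent lev d) (fun r => σ'.reg (26 + r)) σ'.arr σ'.out ∧
      σ'.time ≤ σ.time + ((t + 4) * lev d + 2)) σ := by
  have hr' : ∀ r, 26 + r ≠ 23 ∧ 26 + r ≠ 24 ∧ 26 + r ≠ 25 := fun r => by omega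
  refine WP.seq (WP.ops ?_)
  simp only [pre, Op.eval, Op.Fits, true_and]
  refine WP.loop (n := lev d) (fun m τ => ∃ l e, l ++ climb ι ent lev e = climb ι ent lev d ∧
    m = lev e ∧ τ.reg 23 = code e ∧ τ.reg 25 = m ∧ Frame (climbDo k body) σ τ ∧
    Inv l (fun r => τ.reg (26 + r)) τ.arr τ.out ∧ τ.time ≤ σ.time + 1 + (t + 4) * l.length) ?_ ?_ ?_
  · refine ⟨[], d, rfl, rfl, ?_, ?_, ?_, ?_, ?_⟩
    · simp [h23]
    · simp [h23, hL]
    · refine ⟨fun r h => ?_, fun _ _ => rfl, fun _ => rfl⟩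
      simp only [climbDo, Stmt.wr, List.any_cons, List.any_nil, Op.wr, Bool.or_eq_false_iff, beq_eq_false_iff_ne] at h
      have h1 : r ≠ 25 := fun h' => by simp [h'] at h
      simp [h1]
    · simpa [hr'] using h0
    · simp
  · rintro m τ hF ⟨l, e, hle, hm, hτ, h25, hF', hI, ht⟩ hreg
    have hk : τ.arr k = σ.arr k := hF.arr k (by simp [Stmt.wa, Op.wa, hb])
    have hlev : lev e ≠ 0 := by omega
    rw [hS.climb_of_ne_zero hlev] at hle
    refine WP.seq (WP.ops ?_)
    simp only [pre, Op.eval, Op.Fits, true_and]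
    refine WP.seq (WP.mono (hstep l (ent e) ⟨_, by rw [List.append_assoc]; exact hle⟩ _ ?_ ?_ ?_)
      fun τ' hFb ⟨hI', ht'⟩ => WP.ops ?_)
    · refine hF'.trans ⟨fun r h => ?_, fun _ _ => rfl, fun _ => rfl⟩
      simp only [climbDo, Stmt.wr, List.any_cons, List.any_nil, Op.wr, Bool.or_eq_false_iff, beq_eq_false_iff_ne] at h
      have h1 : r ≠ 24 := fun h' => by simp [h'] at h
      simp [h1, St.tick]
    · simp [St.tick, hτ, hk, hE]
    · simpa [St.tick, hr'] using hI
    · have hb24 := hFb.reg 24 hb.1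
      have hbk := (hFb.arr (k + 1) hb.2.2.1).trans
        (hF.arr (k + 1) (by simp [Stmt.wa, Op.wa, hb]) : τ.arr (k + 1) = σ.arr (k + 1))
      have hb5 := (hFb.arr 5 hb.2.2.2).trans
        (hF.arr 5 (by simp [Stmt.wa, Op.wa, hb]) : τ.arr 5 = σ.arr 5)
      simp only [St.tick] at hb24 ht'
      simp [hτ, hk, hE] at hb24
      simp only [pre, Op.eval, Op.Fits, true_and]
      have hlu := hS.lev_up hlev
      refine ⟨lev (ι (ent e)), by omega, l ++ [ent e], ι (ent e), by rw [List.append_assoc]; exact hle,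
        rfl, by simp [hb24, hb5, h5], by simp [hb24, hb5, h5, hbk, hL], ?_, ?_, ?_⟩
      · refine hF'.trans ⟨fun r h => ?_, fun k h => ?_, fun h => ?_⟩
        · simp only [climbDo, Stmt.wr, List.any_cons, List.any_nil, Op.wr, Bool.or_eq_false_iff, beq_eq_false_iff_ne] at h
          have h1 : r ≠ 23 := fun h' => by simp [h'] at h
          have h2 : r ≠ 24 := fun h' => by simp [h'] at h
          have h3 : r ≠ 25 := fun h' => by simp [h'] at h
          have := hFb.reg r h.2.2.1
          simp [h2, St.tick] at this
          simp [h1, h3, this]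
        · simp only [climbDo, Stmt.wa, List.any_cons, List.any_nil, Op.wa, Bool.or_eq_false_iff] at h
          exact hFb.arr k h.2.2.1
        · simp only [climbDo, Stmt.wo, List.any_cons, List.any_nil, Op.wo, Bool.or_eq_false_iff] at h
          exact hFb.out h.2.2.1
      · simpa [hr'] using hI'
      · simp only [List.length_append, List.length_singleton]
        have : (t + 4) * (l.length + 1) = (t + 4) * l.length + t + 4 := by ring
        omega
  · rintro m τ hF ⟨l, e, hle, hm, hτ, h25, hF', hI, ht⟩ hreg
    rw [SearchTree.climb_of_eq_zero (by omega), List.append_nil] at hle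
    subst hle
    refine ⟨hI, ?_⟩
    simp only [St.tick]
    rw [SearchTree.length_climb] at ht
    omega

end Structured

namespace Structured

variable {α : Type*}

/-! ### The cotree and the edges outside of both trees -/

/-- Marks in array `12` the darts outside of the tree in array `11`, and computes in array `13` the
total level of the endpoints of each dart. -/
def weigh : Stmt :=
  forEach 23 5 (.ops [.get 26 11 22, .const 27 1, .minus 26 27 26, .put 12 22 26, .get 26 9 22,
    .get 27 5 22, .get 27 9 27, .plus 26 26 27, .put 13 22 26])

theorem wp_weigh {x : List ℕ} {V : ℕ} {code : α → ℕ} (hcode : Function.Injective code) {l : List α}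
    (hl : ∀ d, d ∈ l) {σ : St} {ι : α → α} {lev : α → ℕ}
    (hq : ∀ i (hi : i < l.length), σ.arr 23 i = code l[i]) (hlen : σ.reg 5 = l.length)
    (h5 : ∀ d, σ.arr 5 (code d) = code (ι d)) (hL : ∀ d, σ.arr 9 (code d) = lev d)
    (hV : ∀ d, lev d + lev (ι d) ≤ V) :
    WP x V weigh (fun σ' => (∀ d, σ'.arr 12 (code d) = 1 - σ.arr 11 (code d)) ∧
      (∀ d, σ'.arr 13 (code d) = lev d + lev (ι d)) ∧ σ'.time ≤ σ.time + (13 * l.length + 3)) σ := by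
  refine (wp_forEach (code := code) (l := l) (fun j _ a _ => (∀ d ∈ l.take j, a 12 (code d) = 1 - σ.arr 11 (code d)) ∧
    ∀ d ∈ l.take j, a 13 (code d) = lev d + lev (ι d)) 9 (by norm_num) ⟨rfl, rfl, rfl⟩ hq hlen
    (by simp) fun j hj τ hF h20 h22 ⟨hA, hW⟩ => WP.ops ?_).mono fun σ' _ ⟨⟨hA, hW⟩, ht⟩ => ?_
  · have h5' : τ.arr 5 = σ.arr 5 := hF.arr 5 rfl
    have h9' : τ.arr 9 = σ.arr 9 := hF.arr 9 rfl
    have h11' : τ.arr 11 = σ.arr 11 := hF.arr 11 rfl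
    simp only [pre, Op.eval, Op.Fits, true_and]
    simp [h22, h5', h9', h11', h5, hL]
    refine ⟨hV _, fun d hd => ?_, fun d hd => ?_⟩
    all_goals
      rw [Function.update_apply]
      split_ifs with he
      · rw [hcode he]
      · rw [List.take_succ_eq_append_getElem hj, List.mem_append, List.mem_singleton] at hd
        obtain hd | rfl := hd
        · first | exact hA d hd | exact hW d hd
        · exact absurd rfl he
  · rw [List.take_length] at hA hW
    exact ⟨fun d => hA d (hl d), fun d => hW d (hl d), by omega⟩

/-- Lists in array `19` one dart of each edge that is marked in array `12` and not in array `17`. Their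
number goes to register `6`. -/
def collect : Stmt :=
  .ops [.const 30 0] ;;
  forEach 23 5 (.ops [.get 26 12 22, .get 27 17 22, .minus 26 26 27] ;;
    .ifz 26 (.ops []) (.ops [.get 27 5 22, .minus 26 27 22] ;;
      .ifz 26 (.ops []) (.ops [.put 19 30 22, .inc 30 30 1]))) ;;
  .ops [.inc 6 30 0]

open Classical in
theorem wp_collect {x : List ℕ} {V : ℕ} {code : α → ℕ} {l : List α}
    {σ : St} {ι : α → α} {A al : α → Prop}
    (hq : ∀ i (hi : i < l.length), σ.arr 23 i = code l[i]) (hlen : σ.reg 5 = l.length)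
    (h5 : ∀ d, σ.arr 5 (code d) = code (ι d)) (hA : ∀ d, σ.arr 12 (code d) = if A d then 1 else 0)
    (hC : ∀ d, σ.arr 17 (code d) = if al d then 1 else 0) :
    WP x V collect (fun σ' => ∃ xs : List α,
      xs = l.filter (fun d => A d ∧ ¬ al d ∧ code d < code (ι d)) ∧ σ'.reg 6 = xs.length ∧
      (∀ i (hi : i < xs.length), σ'.arr 19 i = code xs[i]) ∧
      σ'.time ≤ σ.time + (14 * l.length + 5)) σ := by
  set q : α → Bool := fun d => decide (A d ∧ ¬ al d ∧ code d < code (ι d)) with hqd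
  refine WP.seq (WP.ops ?_)
  simp only [pre, Op.eval, Op.Fits, true_and]
  refine WP.seq (WP.mono (wp_forEach (n := 5) (code := code) (l := l) (fun j r a _ => r 4 = ((l.take j).filter q).length ∧
    ∀ i (hi : i < ((l.take j).filter q).length), a 19 i = code ((l.take j).filter q)[i]) 10 (by norm_num)
    ⟨rfl, rfl, rfl⟩ ?_ ?_ ?_ fun j hj τ hF h20 h22 ⟨h30, hX⟩ => WP.seq (WP.ops ?_))
    fun σ' _ ⟨⟨h30, hX⟩, ht⟩ => WP.ops ?_)
  · exact fun i hi => hq i hi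
  · simpa using hlen
  · simp
  · have h5' : τ.arr 5 = σ.arr 5 := hF.arr 5 rfl
    have h12' : τ.arr 12 = σ.arr 12 := hF.arr 12 rfl
    have h17' : τ.arr 17 = σ.arr 17 := hF.arr 17 rfl
    simp only at h30
    have key : ∀ (σ' : St), (∀ r, r ≠ 26 → r ≠ 27 → σ'.reg r = τ.reg r) → σ'.arr = τ.arr →
        q l[j] = false → σ'.time ≤ τ.time + 10 → (σ'.reg (26 + 4) = ((l.take (j + 1)).filter q).length ∧
        ∀ i (hi : i < ((l.take (j + 1)).filter q).length), σ'.arr 19 i = code ((l.take (j + 1)).filter q)[i]) ∧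
        σ'.time ≤ τ.time + 10 := by
      intro σ' hr ha hqj ht
      have : (l.take (j + 1)).filter q = (l.take j).filter q := by
        rw [List.take_succ_eq_append_getElem hj, List.filter_append]
        simp [hqj]
      rw [hr _ (by norm_num) (by norm_num), ha]
      simp only [this]
      exact ⟨⟨h30, hX⟩, ht⟩
    simp only [pre, Op.eval, Op.Fits, true_and]
    refine WP.ifz (fun h0 => WP.ops ?_) fun h0 => WP.seq (WP.ops ?_)
    · simp [h22, h12', h17', hA, hC] at h0
      refine key _ (fun r h1 h2 => by simp [St.tick, h1, h2]) rfl ?_ (by simp [St.tick])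
      simp only [hqd, decide_eq_false_iff_not]
      rintro ⟨h1, h2, -⟩
      simp [h1, h2] at h0
    · simp only [pre, Op.eval, Op.Fits, true_and]
      simp [h22, h12', h17', hA, hC] at h0
      refine WP.ifz (fun h1 => WP.ops ?_) fun h1 => WP.ops ?_
      · refine key _ (fun r h1 h2 => by simp [St.tick, h1, h2]) rfl ?_ (by simp [St.tick])
        simp [St.tick, h22, h5', h5] at h1
        simp only [hqd, decide_eq_false_iff_not]
        rintro ⟨-, -, h3⟩
        omega
      · simp [St.tick, h22, h5', h5] at h1
        have hqj : q l[j] = true := by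
          simp only [hqd, decide_eq_true_eq]
          by_cases h3 : A l[j] <;> by_cases h4 : al l[j] <;> simp [h3, h4] at h0 ⊢
          omega
        have hfil : (l.take (j + 1)).filter q = (l.take j).filter q ++ [l[j]] := by
          rw [List.take_succ_eq_append_getElem hj, List.filter_append]
          simp [hqj]
        simp only [pre, Op.eval, Op.Fits, true_and]
        refine ⟨⟨?_, fun i hi => ?_⟩, ?_⟩
        · simp [St.tick, hfil, h30]
        · simp only [hfil] at hi ⊢
          rw [List.length_append, List.length_singleton] at hi
          obtain h6 | h6 : i < ((l.take j).filter q).length ∨ i = ((l.take j).filter q).length := by omega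
          · rw [List.getElem_append_left h6, ← hX i h6]
            simp [St.tick, h30, h6.ne]
          · subst h6
            simp [St.tick, h30, h22]
        · simp [St.tick]
  · simp only [pre, Op.eval, Op.Fits, true_and]
    rw [List.take_length] at h30
    simp only [List.take_length] at hX
    simp only at h30
    refine ⟨_, rfl, by simpa using h30, fun i hi => hX i hi, ?_⟩
    simp at ht ⊢
    omega

end Structured

namespace Structured

variable {α : Type*}

/-! ### Improving the edges outside of both trees -/

/-- The exchange step for the dart in register `22`: a search from it over the faces, a climb from its
reverse that finds a crossing of minimal weight, and the exchange in array `17`. The dart that now is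
outside of the cotree goes to array `20`. -/
def exchange : Stmt :=
  .ops [.inc 10 22 0] ;; search 6 17 14 18 ;;
  .ops [.get 23 5 22, .inc 26 22 0, .get 27 13 22] ;;
  climbDo 14 (.ops [.get 28 13 24, .minus 29 27 28] ;;
    .ifz 29 (.ops []) (.ops [.inc 26 24 0, .inc 27 28 0])) ;;
  .ops [.const 28 1, .put 17 22 28, .get 29 5 22, .put 17 29 28, .const 28 0, .put 17 26 28,
    .get 29 5 26, .put 17 29 28, .put 20 20 26]

theorem SearchTree.lev_le_card [Finite α] {π ι : α → α} {al : α → Prop} {s : α} {ent : α → α}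
    {lev : α → ℕ} (hS : SearchTree π ι al s ent lev) (d : α) : lev d ≤ Nat.card α := by
  have := Fintype.ofFinite α
  rw [← SearchTree.length_climb (ι := ι) (ent := ent) (lev := lev) d, Nat.card_eq_fintype_card]
  exact (hS.nodup_climb d).length_le_card

open Classical in
/-- The time of an exchange step is linear in the size of the graph. -/
theorem wp_exchange [Finite α] {x : List ℕ} {V : ℕ} {π ι : α → α} (hπ : Function.Injective π)
    (hι : Function.Involutive ι) (hfix : ∀ d, ι d ≠ d) {code : α → ℕ}
    (hcode : Function.Injective code) (hpos : ∀ d, 1 ≤ code d) {A al : α → Prop} {w : α → ℕ}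
    (hw : ∀ d, w (ι d) = w d) {xs : List α} {j : ℕ} (hC : Cotree π ι A w al xs j)
    (hj : j < xs.length) {σ : St} (h22 : σ.reg 22 = code xs[j]) (hcard : Nat.card α ≤ σ.reg 2)
    (hlt : ∀ d, code d < σ.reg 2) (h6 : ∀ d, σ.arr 6 (code d) = code (π d))
    (h5 : ∀ d, σ.arr 5 (code d) = code (ι d)) (h13 : ∀ d, σ.arr 13 (code d) = w d)
    (h17 : ∀ d, σ.arr 17 (code d) = if al d then 1 else 0) :
    WP x V exchange (fun σ' => ∃ al' m, Cotree π ι A w al' (xs.set j m) (j + 1) ∧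
      (∀ d, σ'.arr 17 (code d) = if al' d then 1 else 0) ∧
      σ'.arr 20 = Function.update (σ.arr 20) (σ.reg 20) (code m) ∧
      σ'.time ≤ σ.time + (39 * σ.reg 2 + 35)) σ := by
  refine WP.seq (WP.ops ?_)
  simp only [pre, Op.eval, Op.Fits, true_and]
  refine WP.seq (WP.mono (wp_search (s := xs[j]) (al := al) hπ hι hcode hpos (by norm_num) (by norm_num)
    (by norm_num) (by norm_num) ?_ ?_ ?_ ?_ ?_ ?_)
    fun σ₁ hF₁ ⟨l, ent, lev, hP, hl, h12, hH, _, ht₁⟩ => ?_)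
  · simp [h22]
  · simpa using hcard
  · simpa using hlt
  · exact h6
  · exact h5
  · intro d
    by_cases hd : al d <;> simp [h17, hd]
  have hmem : ∀ d, d ∈ l := fun d => hP.mem_of_linked hπ hι hC.symm hl (hC.linked _ _)
  have hS := hP.searchTree hmem
  have r22 : σ₁.reg 22 = code xs[j] := by rw [hF₁.reg 22 rfl]; simpa using h22
  have r20 : σ₁.reg 20 = σ.reg 20 := by rw [hF₁.reg 20 rfl]; simp
  have a5 : σ₁.arr 5 = σ.arr 5 := hF₁.arr 5 rfl
  have a13 : σ₁.arr 13 = σ.arr 13 := hF₁.arr 13 rfl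
  have a17 : σ₁.arr 17 = σ.arr 17 := hF₁.arr 17 rfl
  have a20 : σ₁.arr 20 = σ.arr 20 := hF₁.arr 20 rfl
  simp only [ne_eq, Function.update_of_ne, Nat.reduceEqDiff, not_false_eq_true] at ht₁
  refine WP.seq (WP.ops ?_)
  simp only [pre, Op.eval, Op.Fits, true_and]
  refine WP.seq (WP.mono (wp_climbDo (code := code) (d := ι xs[j]) hS (fun l r _ _ => ∃ m,
    (m = xs[j] ∨ m ∈ l) ∧ w m ≤ w xs[j] ∧ (∀ e ∈ l, w m ≤ w e) ∧ r 0 = code m ∧ r 1 = w m) 5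
    ⟨rfl, rfl, rfl, rfl⟩ ?_ ?_ ?_ ?_ ?_ ?_) fun σ₂ hF₂ ⟨⟨m, hm, hmx, hmw, m26, m27⟩, ht₂⟩ => WP.ops ?_)
  · exact fun d => hH.ent d (hmem d)
  · exact fun d => hH.lev d (hmem d)
  · simpa [a5] using h5
  · simp [r22, a5, h5]
  · exact ⟨xs[j], Or.inl rfl, le_rfl, by simp, by simp [r22], by simp [r22, a13, h13]⟩
  · rintro l' e - τ hF h24 ⟨m, hm, hmx, hmw, m26, m27⟩
    have b13 : τ.arr 13 = σ.arr 13 := by rw [hF.arr 13 rfl, ← a13]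
    simp only [Nat.add_zero, Nat.reduceAdd] at m26 m27
    refine WP.seq (WP.ops ?_)
    simp only [pre, Op.eval, Op.Fits, true_and]
    refine WP.ifz (fun h0 => WP.ops ?_) fun h0 => WP.ops ?_
    · simp [h24, b13, h13, m27] at h0
      simp only [pre]
      refine ⟨⟨m, ?_, hmx, ?_, ?_, ?_⟩, ?_⟩
      · simp; tauto
      · simpa [or_imp, forall_and] using ⟨hmw, by omega⟩
      · simp [St.tick, m26]
      · simp [St.tick, m27]
      · simp [St.tick]
    · simp [h24, b13, h13, m27] at h0
      simp only [pre, Op.eval, Op.Fits, true_and]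
      refine ⟨⟨e, ?_, ?_, ?_, ?_, ?_⟩, ?_⟩
      · simp
      · omega
      · intro e' he'
        rw [List.mem_append, List.mem_singleton] at he'
        obtain he' | rfl := he'
        · have := hmw e' he'; omega
        · exact le_rfl
      · simp [St.tick, h24]
      · simp [St.tick, h24, b13, h13]
      · simp [St.tick]
  · have c5 : σ₂.arr 5 = σ.arr 5 := by rw [hF₂.arr 5 rfl]; exact a5
    have c17 : σ₂.arr 17 = σ.arr 17 := by rw [hF₂.arr 17 rfl]; exact a17
    have c20 : σ₂.arr 20 = σ.arr 20 := by rw [hF₂.arr 20 rfl]; exact a20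
    have s22 : σ₂.reg 22 = code xs[j] := by rw [hF₂.reg 22 rfl]; simpa using r22
    have s20 : σ₂.reg 20 = σ.reg 20 := by rw [hF₂.reg 20 rfl]; simpa using r20
    simp only [Nat.add_zero, Nat.reduceAdd] at m26 m27
    have hle := hS.lev_le_card (ι xs[j])
    simp only [pre, Op.eval, Op.Fits, true_and]
    refine ⟨_, m, hC.exchange hι hw hfix hj rfl hS hm hmx hmw, fun d => ?_, ?_, ?_⟩
    · have hup : ∀ (f : ℕ → ℕ) e v, Function.update f (code e) v (code d) =
          if d = e then v else f (code d) := fun f e v => by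
        rw [Function.update_apply, if_congr hcode.eq_iff rfl rfl]
      simp [s22, c5, c17, h5, m26, hup, h17]
      split_ifs <;> first | rfl | (exfalso; tauto)
    · simp [s20, c20, m26]
    · simp only at ht₂ ⊢
      omega

/-- The exchange step for each dart in array `19`. -/
def rounds : Stmt := forEach 19 6 exchange

open Classical in
/-- After the exchange steps for all listed edges, each of them is heavy. -/
theorem wp_rounds [Finite α] {x : List ℕ} {V : ℕ} {π ι : α → α} (hπ : Function.Injective π)
    (hι : Function.Involutive ι) (hfix : ∀ d, ι d ≠ d) {code : α → ℕ}
    (hcode : Function.Injective code) (hpos : ∀ d, 1 ≤ code d) {A al : α → Prop} {w : α → ℕ}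
    (hw : ∀ d, w (ι d) = w d) {xs : List α} (hC : Cotree π ι A w al xs 0)
    {σ : St} (h19 : ∀ i (hi : i < xs.length), σ.arr 19 i = code xs[i])
    (hr6 : σ.reg 6 = xs.length) (hcard : Nat.card α ≤ σ.reg 2)
    (hlt : ∀ d, code d < σ.reg 2) (h6 : ∀ d, σ.arr 6 (code d) = code (π d))
    (h5 : ∀ d, σ.arr 5 (code d) = code (ι d)) (h13 : ∀ d, σ.arr 13 (code d) = w d)
    (h17 : ∀ d, σ.arr 17 (code d) = if al d then 1 else 0) :
    WP x V rounds (fun σ' => ∃ al' ys, Cotree π ι A w al' ys ys.length ∧ ys.length = xs.length ∧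
      (∀ i (hi : i < ys.length), σ'.arr 20 i = code ys[i]) ∧
      σ'.time ≤ σ.time + ((39 * σ.reg 2 + 39) * xs.length + 3)) σ := by
  refine (wp_forEach (code := code) (l := xs) (fun j _ a _ => ∃ al ys, Cotree π ι A w al ys j ∧
    ys.length = xs.length ∧ (∀ d, a 17 (code d) = if al d then 1 else 0) ∧
    (∀ i (hi : i < ys.length), i < j → a 20 i = code ys[i]) ∧
    ∀ i (hi : i < ys.length) (hi' : i < xs.length), j ≤ i → ys[i] = xs[i]) (39 * σ.reg 2 + 35)
    (by norm_num) ⟨rfl, rfl, rfl⟩ h19 hr6 ⟨al, xs, hC, rfl, h17, by simp, by simp⟩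
    ?_).mono fun σ' _ ⟨⟨al', ys, hC', hlen, _, h20, _⟩, ht⟩ => ?_
  · rintro j hj τ hF h20 h22 ⟨al', ys, hC', hlen, a17, a20, hys⟩
    have r2 : τ.reg 2 = σ.reg 2 := hF.reg 2 rfl
    refine (wp_exchange hπ hι hfix hcode hpos hw hC' (by omega) ?_ (by rwa [r2]) (by simpa [r2] using hlt)
      ?_ ?_ ?_ a17).mono fun τ' _ ⟨al'', m, hC'', b17, b20, ht⟩ => ?_
    · rw [h22, hys j _ hj le_rfl]
    · rw [hF.arr 6 rfl]; exact h6
    · rw [hF.arr 5 rfl]; exact h5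
    · rw [hF.arr 13 rfl]; exact h13
    · refine ⟨⟨al'', _, hC'', by simpa using hlen, b17, fun i hi hij => ?_, fun i hi hi' hij => ?_⟩,
        by rw [r2] at ht; omega⟩
      · rw [b20, h20, List.getElem_set]
        split_ifs with h
        · subst h; simp
        · rw [Function.update_of_ne (Ne.symm h)]
          exact a20 i (by simpa using hi) (by omega)
      · rw [List.getElem_set_ne (by omega)]
        exact hys i _ hi' (by omega)
  · exact ⟨al', ys, hlen ▸ hC', hlen, fun i hi => h20 i hi (by omega), by omega⟩

end Structured

namespace Structured

variable {α : Type*}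

/-! ### Counting strands -/

/-- Counts one more strand along the dart in register `r` and along its reverse in array `21`. -/
def bump (r : ℕ) : Stmt :=
  .ops [.get 26 21 r, .inc 26 26 1, .put 21 r 26, .get 27 5 r, .get 26 21 27, .inc 26 26 1,
    .put 21 27 26]

open Classical in
/-- The number of elements of `l` that are `d` or the reverse of `d`. -/
noncomputable def strands (ι : α → α) (l : List α) (d : α) : ℕ :=
  l.countP fun e => e = d ∨ ι e = d

theorem wp_bump {x : List ℕ} {V r : ℕ} (hr : r ≠ 26 ∧ r ≠ 27) {ι : α → α} (hfix : ∀ d, ι d ≠ d)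
    {code : α → ℕ} (hcode : Function.Injective code) {l : List α} {σ : St}
    {e : α} (he : σ.reg r = code e) (h5 : ∀ d, σ.arr 5 (code d) = code (ι d))
    (h21 : ∀ d, σ.arr 21 (code d) = strands ι l d) :
    WP x V (bump r) (fun σ' => (∀ d, σ'.arr 21 (code d) = strands ι (l ++ [e]) d) ∧
      σ'.time = σ.time + 7) σ := by
  refine WP.ops ?_
  simp only [pre, Op.eval, Op.Fits, true_and]
  simp [hr, he, h5, h21]
  intro d
  have hne : code (ι e) ≠ code e := fun h => hfix e (hcode h)
  by_cases h1 : d = ι e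
  · subst h1
    have : e ≠ ι e := (hfix e).symm
    simp [strands, Function.update_of_ne hne, h21, this]
  · by_cases h2 : d = e
    · subst h2
      simp [strands, Function.update_of_ne hne.symm]
    · rw [Function.update_of_ne fun h => h1 (hcode h), Function.update_of_ne fun h => h2 (hcode h), h21]
      simp [strands, Ne.symm h1, Ne.symm h2]

/-- Counts in array `21` the strands of the loops through the darts in array `20`. -/
def loads : Stmt :=
  forEach 20 6 (bump 22 ;; .ops [.inc 23 22 0] ;; climbDo 8 (bump 24) ;; .ops [.get 23 5 22] ;;
    climbDo 8 (bump 24))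

theorem wp_loads [Finite α] {x : List ℕ} {V : ℕ} {π ι : α → α} {al : α → Prop} {s : α} {ent : α → α}
    {lev : α → ℕ} (hS : SearchTree π ι al s ent lev) (hfix : ∀ d, ι d ≠ d)
    {code : α → ℕ} (hcode : Function.Injective code) {ys : List α} {σ : St}
    (h20 : ∀ i (hi : i < ys.length), σ.arr 20 i = code ys[i]) (hr6 : σ.reg 6 = ys.length)
    (h5 : ∀ d, σ.arr 5 (code d) = code (ι d)) (hE : ∀ d, σ.arr 8 (code d) = code (ent d))
    (hL : ∀ d, σ.arr 9 (code d) = lev d) (h21 : ∀ d, σ.arr 21 (code d) = 0) :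
    WP x V loads (fun σ' => (∀ d, σ'.arr 21 (code d) =
        strands ι (ys.flatMap fun x => x :: (climb ι ent lev x ++ climb ι ent lev (ι x))) d) ∧
      σ'.time ≤ σ.time + ((22 * Nat.card α + 17) * ys.length + 3)) σ := by
  refine (wp_forEach (code := code) (l := ys) (fun j _ a _ => ∀ d, a 21 (code d) =
    strands ι ((ys.take j).flatMap fun x => x :: (climb ι ent lev x ++ climb ι ent lev (ι x))) d)
    (22 * Nat.card α + 13) (by norm_num) ⟨rfl, rfl, rfl⟩ h20 hr6 (by simpa [strands] using h21)
    ?_).mono fun σ' _ ⟨h, ht⟩ => ⟨by simpa using h, by omega⟩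
  intro j hj τ hF r20 r22 hI
  have a5 : τ.arr 5 = σ.arr 5 := hF.arr 5 rfl
  have a8 : τ.arr 8 = σ.arr 8 := hF.arr 8 rfl
  have a9 : τ.arr 9 = σ.arr 9 := hF.arr 9 rfl
  set L := (ys.take j).flatMap fun x => x :: (climb ι ent lev x ++ climb ι ent lev (ι x)) with hLdef
  refine WP.seq (WP.mono (wp_bump (by norm_num) hfix hcode r22 ?_ hI) fun σ₁ hF₁ ⟨h₁, ht₁⟩ =>
    WP.seq (WP.ops ?_))
  · rwa [a5]
  have r22₁ : σ₁.reg 22 = code ys[j] := by rw [hF₁.reg 22 rfl, r22]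
  have a5₁ : σ₁.arr 5 = σ.arr 5 := by rw [hF₁.arr 5 rfl, a5]
  have a8₁ : σ₁.arr 8 = σ.arr 8 := by rw [hF₁.arr 8 rfl, a8]
  have a9₁ : σ₁.arr 9 = σ.arr 9 := by rw [hF₁.arr 9 rfl, a9]
  have hle₁ := hS.lev_le_card ys[j]
  have hle₂ := hS.lev_le_card (ι ys[j])
  have climbs : ∀ (τ : St) d L, τ.reg 23 = code d → τ.arr 5 = σ.arr 5 → τ.arr 8 = σ.arr 8 →
      τ.arr 9 = σ.arr 9 → (∀ d, τ.arr 21 (code d) = strands ι L d) →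
      WP x V (climbDo 8 (bump 24)) (fun τ' => (∀ e, τ'.arr 21 (code e) =
        strands ι (L ++ climb ι ent lev d) e) ∧ τ'.time ≤ τ.time + (11 * lev d + 2)) τ := by
    intro τ d L r23 a5 a8 a9 hI
    refine wp_climbDo (code := code) hS (fun l _ a _ => ∀ d, a 21 (code d) = strands ι (L ++ l) d) 7
      ⟨rfl, rfl, rfl, rfl⟩ (by rwa [a8]) (by rwa [a9]) (by rwa [a5]) r23 (by simpa using hI) ?_
    intro l e _ τ₁ hF r24 hI
    refine (wp_bump (by norm_num) hfix hcode r24 (by rw [hF.arr 5 rfl, a5]; exact h5) hI).mono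
      fun σ' _ ⟨h, ht⟩ => ⟨by simpa using h, by omega⟩
  simp only [pre, Op.eval, Op.Fits, true_and]
  refine WP.seq (WP.mono (climbs _ ys[j] _ ?_ ?_ ?_ ?_ h₁) fun σ₂ hF₂ ⟨h₂, ht₂⟩ => WP.seq (WP.ops ?_))
  · simp [r22₁]
  · exact a5₁
  · exact a8₁
  · exact a9₁
  have r22₂ : σ₂.reg 22 = code ys[j] := by rw [hF₂.reg 22 rfl]; simpa using r22₁
  have a5₂ : σ₂.arr 5 = σ.arr 5 := by rw [hF₂.arr 5 rfl]; exact a5₁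
  simp only [pre, Op.eval, Op.Fits, true_and]
  refine WP.mono (climbs _ (ι ys[j]) _ ?_ ?_ ?_ ?_ h₂) fun σ₃ hF₃ ⟨h₃, ht₃⟩ => ⟨?_, ?_⟩
  · simp [r22₂, a5₂, h5]
  · exact a5₂
  · rw [hF₂.arr 8 rfl]; exact a8₁
  · rw [hF₂.arr 9 rfl]; exact a9₁
  · intro d
    rw [h₃, List.take_succ_eq_append_getElem hj, List.flatMap_append, ← hLdef]
    simp
  · simp only at ht₂ ht₃
    omega

/-! ### The first slots of the darts -/

/-- Computes in array `22` the first slot of each dart that does not lead to the parent: along the queue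
of the search in array `10`, a dart gets the slots that follow those of its predecessor, and after
the dart to the parent the slots continue with those of the dart from the parent. -/
def slots : Stmt :=
  .ops [.const 30 0] ;;
  forEach 10 5 (.ops [.get 26 12 22, .get 27 9 22, .get 28 5 22, .get 29 9 28, .minus 27 27 29,
      .minus 27 27 26] ;;
    .ifz 27 (.ops [.put 22 22 30, .get 26 21 22, .plus 30 30 26]) (.ops [.get 30 22 28]))

open Classical in
/-- The slot after the first `j` elements of the queue `l`. -/
noncomputable def slotAfter (ι : α → α) (Par : α → Prop) (ld lo : α → ℕ) (l : List α) : ℕ → ℕ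
  | 0 => 0
  | j + 1 => if h : j < l.length then
      if Par l[j] then lo (ι l[j]) else lo l[j] + ld l[j]
    else 0

open Classical in
/-- The numbers stay bounded because each dart adds at most the `M` strands along it. -/
theorem wp_slots {x : List ℕ} {V M : ℕ} {ι : α → α} {Par : α → Prop} {A : α → Prop}
    {lev : α → ℕ} {code : α → ℕ} (hcode : Function.Injective code) {l : List α}
    (hl : l.Nodup) (hpar : ∀ j (hj : j < l.length), Par l[j] → ∃ i, ∃ hi : i < j, l[i] = ι l[j])
    (hPar : ∀ d, lev d - lev (ι d) - (if A d then 1 else 0) = 0 ↔ ¬ Par d) {ld : α → ℕ}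
    (hM : ∀ d, ld d ≤ M) (hV : l.length * M ≤ V) {σ : St}
    (h10 : ∀ i (hi : i < l.length), σ.arr 10 i = code l[i]) (hr5 : σ.reg 5 = l.length)
    (h5 : ∀ d, σ.arr 5 (code d) = code (ι d)) (hL : ∀ d, σ.arr 9 (code d) = lev d)
    (h12 : ∀ d, σ.arr 12 (code d) = if A d then 1 else 0) (h21 : ∀ d, σ.arr 21 (code d) = ld d)
    (h22 : ∀ d, σ.arr 22 (code d) = 0) :
    WP x V slots (fun σ' => ∃ lo : α → ℕ, (∀ d, σ'.arr 22 (code d) = lo d) ∧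
      (∀ i (hi : i < l.length), ¬ Par l[i] → lo l[i] = slotAfter ι Par ld lo l i) ∧
      σ'.time ≤ σ.time + (14 * l.length + 4)) σ := by
  refine WP.seq (WP.ops ?_)
  simp only [pre, Op.eval, Op.Fits, true_and]
  refine WP.mono (wp_forEach (n := 5) (code := code) (l := l) (fun j r a _ => ∃ lo : α → ℕ,
    (∀ d, a 22 (code d) = lo d) ∧ r 4 = slotAfter ι Par ld lo l j ∧
    (∀ d, lo d ≤ j * M) ∧ r 4 ≤ j * M ∧
    ∀ i (hi : i < l.length), i < j → ¬ Par l[i] → lo l[i] = slotAfter ι Par ld lo l i) 10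
    (by norm_num) ⟨rfl, rfl, rfl⟩ ?_ ?_ ?_ ?_)
    fun σ' _ ⟨⟨lo, h1, _, _, _, h2⟩, ht⟩ => ⟨lo, h1, fun i hi => h2 i hi hi, ?_⟩
  · exact h10
  · simpa using hr5
  · exact ⟨fun _ => 0, h22, by simp [slotAfter], by simp, by simp, by simp⟩
  · rintro j hj τ hF - r22 ⟨lo, hlo, r30, hle, hle', hI⟩
    have a5 : τ.arr 5 = σ.arr 5 := hF.arr 5 rfl
    have a9 : τ.arr 9 = σ.arr 9 := hF.arr 9 rfl
    have a12 : τ.arr 12 = σ.arr 12 := hF.arr 12 rfl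
    have a21 : τ.arr 21 = σ.arr 21 := hF.arr 21 rfl
    have hjM : (j + 1) * M = j * M + M := by ring
    have hjV : (j + 1) * M ≤ V := (Nat.mul_le_mul_right M hj).trans hV
    have hMj := hM l[j]
    simp only [Nat.reduceAdd] at r30 hle'
    refine WP.seq (WP.ops ?_)
    simp only [pre, Op.eval, Op.Fits, true_and]
    refine WP.ifz (fun h0 => WP.ops ?_) fun h0 => WP.ops ?_
    · simp [r22, a5, a9, a12, h5, hL, h12] at h0
      rw [hPar] at h0
      simp only [pre, Op.eval, Op.Fits, true_and]
      refine ⟨?_, ⟨fun d => if d = l[j] then τ.reg 30 else lo d, fun d => ?_, ?_, fun d => ?_, ?_,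
        fun i hi hij hp => ?_⟩, ?_⟩
      · simp [St.tick, r22, a21, h21]
        omega
      · simp [St.tick, r22, Function.update_apply, hcode.eq_iff, hlo]
      · simp [St.tick, r22, a21, h21, slotAfter, hj, h0]
      · simp only
        split_ifs
        · omega
        · have := hle d; omega
      · simp [St.tick, r22, a21, h21]
        omega
      · have hslot : slotAfter ι Par ld (fun d => if d = l[j] then τ.reg 30 else lo d) l i =
            slotAfter ι Par ld lo l i := by
          cases i with
          | zero => rfl
          | succ i =>
            have hi' : i < l.length := by omega
            simp only [slotAfter, hi', dif_pos]
            split_ifs with h1 h2 h3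
            · obtain ⟨i', hi'', h⟩ := hpar i hi' h1
              rw [← h] at h2
              have := (List.Nodup.getElem_inj_iff hl).1 h2
              omega
            · rfl
            · have := (List.Nodup.getElem_inj_iff hl).1 h3
              omega
            · rfl
        rw [hslot]
        beta_reduce
        obtain hij | rfl := Nat.lt_succ_iff_lt_or_eq.1 hij
        · rw [if_neg fun h => by have := (List.Nodup.getElem_inj_iff hl).1 h; omega]
          exact hI i hi hij hp
        · rw [if_pos rfl, r30]
      · simp [St.tick]
    · simp [r22, a5, a9, a12, h5, hL, h12] at h0
      rw [← ne_eq, ne_eq, hPar, not_not] at h0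
      simp only [pre, Op.eval, Op.Fits, true_and]
      refine ⟨⟨lo, hlo, ?_, fun d => (hle d).trans (by omega), ?_, fun i hi hij hp => ?_⟩, ?_⟩
      · simp [St.tick, r22, a5, h5, hlo, slotAfter, hj, h0]
      · simp [St.tick, r22, a5, h5, hlo]
        have := hle (ι l[j])
        omega
      · obtain hij | rfl := Nat.lt_succ_iff_lt_or_eq.1 hij
        · exact hI i hi hij hp
        · exact absurd h0 hp
      · simp [St.tick]
  · simp only at ht
    omega

open Classical in
/-- The slots that the pass along the queue computes. -/
theorem slotAfter_spec {π ι : α → α} {al : α → Prop} {s : α} {l : List α} {ent : α → α} {lev : α → ℕ}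
    (hP : PartialSearch π ι al s l ent lev l.length) (hl : ∀ d, d ∈ l) {Par : α → Prop}
    (hPar : ∀ d, Par d ↔ ent d = d ∧ lev d ≠ 0) {ld lo : α → ℕ}
    (hlo : ∀ i (hi : i < l.length), ¬ Par l[i] → lo l[i] = slotAfter ι Par ld lo l i) :
    lo s = 0 ∧ (∀ d, ¬ Par d → π d ≠ ent d → lo (π d) = lo d + ld d) ∧
      ∀ d, Par d → π d ≠ d → lo (π d) = lo (ι d) := by
  have hS := hP.searchTree hl
  have hs : lev s = 0 := hS.lev_eq_zero_iff.2 hS.ent_root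
  have hne : 0 < l.length := List.length_pos_of_mem (hl s)
  have h0 : l[0] = s := hP.head _ (by rw [List.head?_eq_getElem?, List.getElem?_eq_getElem hne]; rfl)
  have hstep : ∀ d, π d ≠ ent d → lo (π d) = if Par d then lo (ι d) else lo d + ld d := by
    intro d hd
    obtain ⟨i, hi, rfl⟩ := List.mem_iff_getElem.1 (hl d)
    have hi' : i + 1 < l.length := by
      by_contra h
      refine hd (hP.last _ ?_)
      rw [List.getLast?_eq_getElem?, List.getElem?_eq_getElem (by omega)]
      simp [show l.length - 1 = i by omega]
    obtain ⟨h1, h2⟩ | h := List.isChain_iff_getElem.1 hP.order i hi'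
    · rw [← h1, hlo (i + 1) hi' fun h => h2 ((hPar _).1 h).1]
      simp [slotAfter, hi]
    · exact absurd h.2 hd
  refine ⟨?_, fun d h1 h2 => ?_, fun d h1 h2 => ?_⟩
  · have := hlo 0 hne fun h => ((hPar _).1 h).2 (by rw [h0, hs])
    rwa [h0] at this
  · rw [hstep d h2, if_neg h1]
  · rw [hstep d (by rwa [((hPar d).1 h1).1]), if_pos h1]

/-- A dart to the parent comes in the queue after its reverse. -/
theorem PartialSearch.exists_reverse_before {π ι : α → α} {al : α → Prop} {s : α} {l : List α}
    {ent : α → α} {lev : α → ℕ} (hP : PartialSearch π ι al s l ent lev l.length) (hl : ∀ d, d ∈ l)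
    {j : ℕ} (hj : j < l.length) (he : ent l[j] = l[j]) (h0 : lev l[j] ≠ 0) :
    ∃ i, ∃ hi : i < j, l[i] = ι l[j] := by
  have hS := hP.searchTree hl
  have := hP.parents (l.take j) l[j] (l.drop (j + 1)) (by simp) he fun h =>
    h0 (hS.lev_eq_zero_iff.2 (by rw [he, h]))
  obtain ⟨i, hi, h⟩ := List.mem_iff_getElem.1 this
  rw [List.length_take] at hi
  exact ⟨i, by omega, by simpa using h⟩

end Structured

namespace Structured

variable {α : Type*}

/-! ### Writing the loops -/

/-- The lane of the strand with rank `r` along the crossing `e` of the search tree. -/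
def crossingLane (ι : α → α) (src ld lo : α → ℕ) (r : ℕ) (e : α) : ℕ :=
  if src (ι e) < src e then r - lo (ι e) else ld (ι e) - 1 - (r - lo (ι e))

/-- Computes for the crossing in register `24` and the rank in register `27` the lane, in register `29`,
and the endpoints, in the registers `30` and `31`. -/
def strand : Stmt :=
  .ops [.get 28 5 24, .get 29 22 28, .minus 29 27 29, .get 30 3 28, .get 31 3 24, .minus 32 31 30] ;;
  .ifz 32 (.ops [.get 28 21 28, .const 32 1, .minus 28 28 32, .minus 29 28 29]) (.ops [])

/-- The arrays that the output is computed from. -/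
structure Arrays (code : α → ℕ) (ι : α → α) (src ld lo : α → ℕ) (a : ℕ → ℕ → ℕ) : Prop where
  sym : ∀ d, a 5 (code d) = code (ι d)
  src : ∀ d, a 3 (code d) = src d
  ld : ∀ d, a 21 (code d) = ld d
  lo : ∀ d, a 22 (code d) = lo d

theorem Arrays.congr {code : α → ℕ} {ι : α → α} {src ld lo : α → ℕ} {a b : ℕ → ℕ → ℕ}
    (h : Arrays code ι src ld lo a) (h5 : b 5 = a 5) (h3 : b 3 = a 3) (h21 : b 21 = a 21)
    (h22 : b 22 = a 22) : Arrays code ι src ld lo b :=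
  ⟨h5 ▸ h.sym, h3 ▸ h.src, h21 ▸ h.ld, h22 ▸ h.lo⟩

theorem wp_strand {x : List ℕ} {V r : ℕ} {ι : α → α} {code : α → ℕ} {src ld lo : α → ℕ} {σ : St} {e : α}
    (hA : Arrays code ι src ld lo σ.arr) (h24 : σ.reg 24 = code e) (h27 : σ.reg 27 = r) :
    WP x V strand (fun σ' => σ'.reg 29 = crossingLane ι src ld lo r e ∧ σ'.reg 30 = src (ι e) ∧
      σ'.reg 31 = src e ∧ σ'.time ≤ σ.time + 11) σ := by
  refine WP.seq (WP.ops ?_)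
  simp only [pre, Op.eval, Op.Fits, true_and]
  refine WP.ifz (fun h0 => WP.ops ?_) fun h0 => WP.ops ?_
  · simp [h24, hA.sym, hA.src] at h0
    simp only [pre, Op.eval, Op.Fits, true_and]
    simp [St.tick, h24, h27, hA.sym, hA.src, hA.ld, hA.lo, crossingLane, h0]
    intro h
    omega
  · simp [h24, hA.sym, hA.src] at h0
    simp only [pre]
    simp [St.tick, h24, h27, hA.sym, hA.src, hA.lo, crossingLane]
    intro h
    omega

/-- Writes the encoding of the loops. The first half of each loop runs against the climb, so that its
crossings are kept on a stack in array `24`. -/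
def output : Stmt :=
  .ops [.emit 6] ;;
  forEach 20 6 (
    .ops [.get 26 13 22, .inc 26 26 1, .emit 26, .inc 23 22 0, .const 33 0] ;;
    climbDo 8 (.ops [.put 24 33 24, .inc 33 33 1]) ;;
    .ops [.get 27 22 22, .const 34 1] ;;
    .loop 33 (.ops [.minus 33 33 34, .get 24 24 33] ;; strand ;; .ops [.emit 30, .emit 29]) ;;
    .ops [.get 26 3 22, .emit 26, .const 26 0, .emit 26, .get 23 5 22, .get 27 22 23] ;;
    climbDo 8 (strand ;; .ops [.emit 31, .emit 29]))

/-- The encoding of the loop through `x`. -/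
def loopCode (ι : α → α) (ent : α → α) (lev : α → ℕ) (src ld lo : α → ℕ) (x : α) : List ℕ :=
  (lev x + lev (ι x) + 1) ::
    ((climb ι ent lev x).reverse.flatMap (fun e => [src (ι e), crossingLane ι src ld lo (lo x) e]) ++
      [src x, 0] ++
      (climb ι ent lev (ι x)).flatMap fun e => [src e, crossingLane ι src ld lo (lo (ι x)) e])

theorem wp_output [Finite α] {x : List ℕ} {V : ℕ} {π ι : α → α} {al : α → Prop} {s : α} {ent : α → α}
    {lev : α → ℕ} (hS : SearchTree π ι al s ent lev) {code : α → ℕ} {src ld lo : α → ℕ}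
    {ys : List α} {σ : St} (hA : Arrays code ι src ld lo σ.arr)
    (h20 : ∀ i (hi : i < ys.length), σ.arr 20 i = code ys[i]) (hr6 : σ.reg 6 = ys.length)
    (hE : ∀ d, σ.arr 8 (code d) = code (ent d)) (hL : ∀ d, σ.arr 9 (code d) = lev d)
    (h13 : ∀ d, σ.arr 13 (code d) = lev d + lev (ι d)) (ho : σ.out = []) :
    WP x V output (fun σ' => σ'.out = ys.length :: ys.flatMap (loopCode ι ent lev src ld lo) ∧
      σ'.time ≤ σ.time + ((39 * Nat.card α + 22) * ys.length + 4)) σ := by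
  refine WP.seq (WP.ops ?_)
  simp only [pre, Op.eval, Op.Fits, true_and]
  refine WP.mono (wp_forEach (n := 6) (code := code) (l := ys) (fun j _ _ o => o = ys.length ::
    (ys.take j).flatMap (loopCode ι ent lev src ld lo)) (39 * Nat.card α + 18) (by norm_num)
    ⟨rfl, rfl, rfl⟩ h20 hr6 ?_ ?_) fun σ' _ ⟨h, ht⟩ => ⟨by simpa using h, ?_⟩
  · simp [ho, hr6]
  · rintro j hj τ hF - r22 hI
    have a5 : τ.arr 5 = σ.arr 5 := hF.arr 5 rfl
    have a8 : τ.arr 8 = σ.arr 8 := hF.arr 8 rfl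
    have a9 : τ.arr 9 = σ.arr 9 := hF.arr 9 rfl
    have a13 : τ.arr 13 = σ.arr 13 := hF.arr 13 rfl
    have hAτ : Arrays code ι src ld lo τ.arr :=
      hA.congr (hF.arr 5 rfl) (hF.arr 3 rfl) (hF.arr 21 rfl) (hF.arr 22 rfl)
    have hle₁ := hS.lev_le_card ys[j]
    have hle₂ := hS.lev_le_card (ι ys[j])
    refine WP.seq (WP.ops ?_)
    simp only [pre, Op.eval, Op.Fits, true_and]
    -- The crossings on the way from the root are pushed on the stack.
    refine WP.seq (WP.mono (wp_climbDo (code := code) (d := ys[j]) hS (fun l r a _ => r 7 = l.length ∧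
      ∀ i (hi : i < l.length), a 24 i = code l[i]) 2 ⟨rfl, rfl, rfl, rfl⟩ ?_ ?_ ?_ ?_ ?_ ?_)
      fun σ₁ hF₁ ⟨⟨r33₁, hst⟩, ht₁⟩ => WP.seq (WP.ops ?_))
    · simpa [a8] using hE
    · simpa [a9] using hL
    · simpa [a5] using hA.sym
    · simp [r22]
    · simp
    · rintro l e - τ' - h24 ⟨r33, hst⟩
      refine WP.ops ?_
      simp only [pre, Op.eval, Op.Fits, true_and]
      simp only [Nat.reduceAdd] at r33
      refine ⟨⟨by simp [r33], fun i hi => ?_⟩, by simp⟩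
      rw [List.length_append, List.length_singleton] at hi
      obtain h | h := Nat.lt_succ_iff_lt_or_eq.1 hi
      · simp [r33, h.ne, List.getElem_append_left h, hst i h]
      · subst h
        simp [r33, h24]
    simp only [Nat.reduceAdd] at r33₁
    have r22₁ : σ₁.reg 22 = code ys[j] := by rw [hF₁.reg 22 rfl]; simpa using r22
    have hA₁ : Arrays code ι src ld lo σ₁.arr :=
      hAτ.congr (hF₁.arr 5 rfl) (hF₁.arr 3 rfl) (hF₁.arr 21 rfl) (hF₁.arr 22 rfl)
    have a8₁ : σ₁.arr 8 = σ.arr 8 := by rw [hF₁.arr 8 rfl]; exact a8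
    have a9₁ : σ₁.arr 9 = σ.arr 9 := by rw [hF₁.arr 9 rfl]; exact a9
    have o₁ := hF₁.out rfl
    simp only [Function.update_self, r22, a13, h13, hI] at o₁
    simp only at ht₁
    simp only [pre, Op.eval, Op.Fits, true_and]
    set l := climb ι ent lev ys[j] with hl
    have hll : l.length = lev ys[j] := SearchTree.length_climb _
    -- The first half of the loop takes them from the stack.
    refine WP.seq (WP.mono (WP.loop (n := l.length) (fun n τ' => n ≤ l.length ∧ τ'.reg 33 = n ∧
      τ'.reg 34 = 1 ∧ τ'.reg 27 = lo ys[j] ∧ τ'.arr 24 = σ₁.arr 24 ∧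
      τ'.out = σ₁.out ++ (l.drop n).reverse.flatMap
        (fun e => [src (ι e), crossingLane ι src ld lo (lo ys[j]) e]) ∧
      τ'.time + 16 * n ≤ σ₁.time + 2 + 16 * l.length) (Q := fun τ' =>
      τ'.out = σ₁.out ++ l.reverse.flatMap
        (fun e => [src (ι e), crossingLane ι src ld lo (lo ys[j]) e]) ∧
      τ'.time ≤ σ₁.time + 3 + 16 * l.length) ?_ ?_ ?_) fun σ₂ hF₂ ⟨o₂, ht₂⟩ => WP.seq (WP.ops ?_))
    · exact ⟨le_rfl, by simp [r33₁], by simp, by simp [r22₁, hA₁.lo], rfl, by simp, by simp⟩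
    · rintro n τ' hF' ⟨hn, r33, r34, r27, a24, o, ht⟩ h0
      refine WP.seq (WP.ops ?_)
      simp only [pre, Op.eval, Op.Fits, true_and]
      obtain ⟨n, rfl⟩ : ∃ m, n = m + 1 := ⟨n - 1, by omega⟩
      refine WP.seq (WP.mono (wp_strand (e := l[n]) (r := lo ys[j]) (hA₁.congr (hF'.arr 5 rfl) (hF'.arr 3 rfl) (hF'.arr 21 rfl)
        (hF'.arr 22 rfl)) ?_ ?_) fun τ'' hF'' ⟨s29, s30, _, st⟩ => WP.ops ?_)
      · simp [St.tick, r33, r34, a24, hst n hn]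
      · simp [St.tick, r27]
      have o' := hF''.out rfl
      simp only [St.tick] at o' st
      simp only [pre, Op.eval, Op.Fits, true_and]
      refine ⟨n, by omega, by omega, ?_, ?_, ?_, ?_, ?_, ?_⟩
      · rw [hF''.reg 33 rfl]; simp [St.tick, r33, r34]
      · rw [hF''.reg 34 rfl]; simp [St.tick, r34]
      · rw [hF''.reg 27 rfl]; simp [St.tick, r27]
      · rw [hF''.arr 24 rfl]; simp [St.tick, a24]
      · rw [o', o, s29, s30, List.drop_eq_getElem_cons (show n < l.length by omega), List.reverse_cons,
          List.flatMap_append, List.flatMap_singleton]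
        simp
      · omega
    · rintro n τ' - ⟨-, r33, -, -, -, o, ht⟩ h0
      obtain rfl : n = 0 := by omega
      exact ⟨by simpa [St.tick] using o, by simp only [St.tick]; omega⟩
    have r22₂ : σ₂.reg 22 = code ys[j] := by rw [hF₂.reg 22 rfl]; simpa using r22₁
    have hA₂ : Arrays code ι src ld lo σ₂.arr :=
      hA₁.congr (hF₂.arr 5 rfl) (hF₂.arr 3 rfl) (hF₂.arr 21 rfl) (hF₂.arr 22 rfl)
    have a8₂ : σ₂.arr 8 = σ.arr 8 := by rw [hF₂.arr 8 rfl]; exact a8₁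
    have a9₂ : σ₂.arr 9 = σ.arr 9 := by rw [hF₂.arr 9 rfl]; exact a9₁
    simp only [pre, Op.eval, Op.Fits, true_and]
    refine WP.mono (wp_climbDo (code := code) (d := ι ys[j]) hS (fun l r a o => o = σ₂.out ++
      [src ys[j], 0] ++ l.flatMap (fun e => [src e, crossingLane ι src ld lo (lo (ι ys[j])) e])) 13
      ⟨rfl, rfl, rfl, rfl⟩ ?_ ?_ ?_ ?_ ?_ ?_) fun σ₃ _ ⟨o₃, ht₃⟩ => ?_
    · simpa [a8₂] using hE
    · simpa [a9₂] using hL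
    · exact hA₂.sym
    · simp [r22₂, hA₂.sym]
    · simp [r22₂, hA₂.src]
    · rintro l' e - τ' hF' h24 ho'
      refine WP.seq (WP.mono (wp_strand (e := e) (r := lo (ι ys[j])) (hA₂.congr (hF'.arr 5 rfl)
        (hF'.arr 3 rfl) (hF'.arr 21 rfl) (hF'.arr 22 rfl)) h24 ?_)
        fun τ'' hF'' ⟨s29, _, s31, st⟩ => WP.ops ?_)
      · rw [hF'.reg 27 rfl]; simp [r22₂, hA₂.sym, hA₂.lo]
      · simp only [pre, Op.eval, Op.Fits, true_and]
        refine ⟨?_, by omega⟩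
        rw [hF''.out rfl, ho', s29, s31]
        simp
    · refine ⟨?_, ?_⟩
      · rw [o₃, o₂, o₁, List.take_succ_eq_append_getElem hj, List.flatMap_append, List.flatMap_singleton]
        simp [loopCode, hl]
      · simp only at ht₃
        omega
  · rw [show 39 * Nat.card α + 18 + 4 = 39 * Nat.card α + 22 from rfl] at ht
    simp only at ht
    omega

end Structured

namespace TreeLoops

open Structured

variable {N : ℕ} {G : SimpleGraph (Fin N)} {R : RotationSystem G} {p : Fin N} {c : ℕ}
  (T : TreeLoops R p c) {lo : G.Dart → ℕ} (S : T.Slots lo)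

/-! ### The computed numbers and the system of loops -/

theorem countP_eq_card {β : Type*} (q : β → Prop) [DecidablePred q] (l : List β) :
    l.countP (fun b => q b) = (Finset.univ.filter fun k : Fin l.length => q l[k]).card := by
  induction l with
  | nil => simp
  | cons b l ih =>
    rw [Finset.card_filter] at ih ⊢
    rw [List.countP_cons, ih]
    simp only [List.length_cons]
    rw [Fin.sum_univ_succ]
    simp only [decide_eq_true_eq, add_comm]
    rfl

/-- The strands along an edge are those of the dart outside of the tree and of the crossings of the
two climbs, for each loop. -/
theorem strands_eq_ld (d : G.Dart) : strands SimpleGraph.Dart.symm ((List.ofFn T.x).flatMap fun x =>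
    x :: (Structured.climb SimpleGraph.Dart.symm T.ent T.lev x ++
      Structured.climb SimpleGraph.Dart.symm T.ent T.lev x.symm)) d = T.ld d := by
  classical
  have hq : ∀ e : G.Dart, (e = d ∨ e.symm = d) ↔ e.edge = d.edge := fun e => by
    rw [SimpleGraph.dart_edge_eq_iff, ← SimpleGraph.Dart.symm_involutive.eq_iff]
  have h1 : T.ld d = ∑ i, ((T.loop i).darts.countP fun e => e.edge = d.edge) := by
    rw [ld, LoopStep.load, Finset.card_filter, Fintype.sum_sigma]
    refine Finset.sum_congr rfl fun i _ => ?_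
    rw [← Finset.card_filter, countP_eq_card]
    refine Finset.card_equiv (finCongr (SimpleGraph.Walk.length_darts _).symm) fun k => ?_
    simp only [Finset.mem_filter, Finset.mem_univ, true_and]
    rfl
  rw [h1, strands, List.countP_flatMap, List.map_ofFn, List.sum_ofFn]
  refine Finset.sum_congr rfl fun i _ => ?_
  rw [darts_loop]
  simp only [Function.comp_apply, hq, List.countP_cons, List.countP_append, List.countP_reverse, List.countP_map]
  rw [add_assoc]
  congr 1
  refine List.countP_congr fun e _ => ?_
  simp [SimpleGraph.Dart.edge_symm]

theorem ld_le (d : G.Dart) : T.ld d ≤ 2 * c := by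
  classical
  wlog hd : ¬ T.Par d generalizing d
  · rw [← ld_symm]
    exact this _ (not_not.1 hd).symm_not
  rw [T.ld_eq_card hd]
  refine (Finset.card_le_univ _).trans ?_
  simp [mul_comm]

theorem map_step_loop (lo : G.Dart → ℕ) (i : Fin c) : (List.finRange (T.loop i).length).map (fun k =>
    (((LoopStep.dart (⟨i, k⟩ : LoopStep T.loop)).fst : ℕ),
      T.laneAt lo (T.out (T.wire ⟨i, k⟩) (T.depth ⟨i, k⟩)) (T.rank lo (T.wire ⟨i, k⟩))
        (T.ld (T.out (T.wire ⟨i, k⟩) (T.depth ⟨i, k⟩))))) =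
    (T.climb (T.x i)).reverse.map (fun e : G.Dart => ((e.symm.fst : ℕ), crossingLane SimpleGraph.Dart.symm
      (fun d : G.Dart => (d.fst : ℕ)) T.ld lo (lo (T.x i)) e)) ++ [(((T.x i).fst : ℕ), 0)] ++
    (T.climb (T.x i).symm).map (fun e : G.Dart => ((e.fst : ℕ), crossingLane SimpleGraph.Dart.symm
      (fun d : G.Dart => (d.fst : ℕ)) T.ld lo (lo (T.x i).symm) e)) := by
  have hlane : ∀ (e : G.Dart) r, crossingLane SimpleGraph.Dart.symm (fun d : G.Dart => (d.fst : ℕ)) T.ld lo r e =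
      T.laneAt lo e.symm r (T.ld e.symm) := fun e r => rfl
  refine List.ext_getElem ?_ fun k hk hk' => ?_
  · simp [length_climb, length_loop]; omega
  · rw [List.length_map, List.length_finRange] at hk
    have hl := hk.trans_eq (T.length_loop i)
    rw [List.getElem_map, List.getElem_finRange]
    simp only [Fin.cast_mk, List.append_assoc]
    obtain h | h | h := lt_trichotomy k (T.lev (T.x i))
    · have hw : T.wire ⟨i, ⟨k, hk⟩⟩ = (i, true) := congrArg _ (decide_eq_true h.le)
      have hd : T.depth ⟨i, ⟨k, hk⟩⟩ = k := if_pos h.le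
      rw [T.dart_step_le i _ h.le, hw, hd, List.getElem_append_left (by simpa [length_climb] using h),
        List.getElem_map, List.getElem_reverse, getElem_climb]
      have : T.out (i, true) k = (T.ent (T.up^[(T.climb (T.x i)).length - 1 - k] (T.x i))).symm := by
        rw [T.out_pred (by simpa [tip_true] using h)]
        simp only [up, length_climb, out, tip_true]
        congr 3
        omega
      simp only [this, hlane]
      rfl
    · subst h
      have hw : T.wire ⟨i, ⟨T.lev (T.x i), hk⟩⟩ = (i, true) := congrArg _ (decide_eq_true le_rfl)
      have hd : T.depth ⟨i, ⟨T.lev (T.x i), hk⟩⟩ = T.lev (T.x i) := if_pos le_rfl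
      have ho := T.out_top (i, true)
      have hld := T.ld_tip (i, true)
      rw [tip_true] at ho hld
      rw [T.dart_step_le i _ le_rfl, hw, hd, List.getElem_append_right (by simp [length_climb])]
      simp [length_climb, ho, hld, rank, tip_true, laneAt]
    · have hw : T.wire ⟨i, ⟨k, hk⟩⟩ = (i, false) := congrArg _ (decide_eq_false h.not_ge)
      have hd : T.depth ⟨i, ⟨k, hk⟩⟩ = T.lev (T.x i) + T.lev (T.x i).symm - k := if_neg h.not_ge
      rw [T.dart_step_ge i _ h.le, hw, hd, List.getElem_append_right (by simp [length_climb]; omega),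
        List.getElem_append_right (by simp [length_climb]; omega), List.getElem_map, getElem_climb]
      have : T.out (i, false) (T.lev (T.x i) + T.lev (T.x i).symm - k) =
          (T.ent (T.up^[k - T.lev (T.x i) - 1] (T.x i).symm)).symm := by
        rw [T.out_pred (by rw [tip_false]; omega)]
        simp only [up, out, tip_false]
        congr 3
        omega
      simp only [this, hlane, List.length_map, List.length_reverse, length_climb, List.length_singleton]
      rfl

theorem encode_system : (T.system S).encode = c :: (List.ofFn T.x).flatMap
    (loopCode SimpleGraph.Dart.symm T.ent T.lev (fun d : G.Dart => (d.fst : ℕ)) T.ld lo) := by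
  rw [LoopSystem.encode, List.ofFn_eq_map, List.flatMap_map]
  congr 2
  funext i
  have h := congrArg (List.flatMap fun q : ℕ × ℕ => [q.1, q.2]) (T.map_step_loop lo i)
  rw [List.flatMap_map, List.flatMap_append, List.flatMap_append, List.flatMap_map, List.flatMap_map] at h
  rw [loopCode]
  congr 1
  exact T.length_loop i

end TreeLoops

namespace Structured

variable {α : Type*} {π ι : α → α} {al : α → Prop} {s : α} {l : List α} {ent : α → α} {lev : α → ℕ}

/-! ### Counting crossings -/

/-- `d` is the crossing at which an orbit other than the first one was entered. -/
def Entrance (ent : α → α) (lev : α → ℕ) (d : α) : Prop := ent d = d ∧ lev d ≠ 0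

theorem crossed_iff (hS : SearchTree π ι al s ent lev) (hl : ∀ d, d ∈ l) (d : α) :
    Crossed ι s l ent d ↔ Entrance ent lev d ∨ Entrance ent lev (ι d) := by
  have : ∀ d, (d ∈ l ∧ ent d = d ∧ d ≠ s) ↔ Entrance ent lev d := fun d => by
    unfold Entrance
    rw [ne_eq, ne_eq, hS.lev_eq_zero_iff]
    exact ⟨fun h => ⟨h.2.1, by rw [h.2.1]; exact h.2.2⟩, fun h => ⟨hl d, h.1, by rw [← h.1]; exact h.2⟩⟩
  exact or_congr (this d) (this (ι d))

theorem SearchTree.card_crossed [Fintype α] [DecidablePred fun d => ent d = d]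
    [DecidablePred fun d => Entrance ent lev d ∨ Entrance ent lev (ι d)] (hS : SearchTree π ι al s ent lev)
    (hι : Function.Involutive ι) :
    (Finset.univ.filter fun d => Entrance ent lev d ∨ Entrance ent lev (ι d)).card + 2 =
      2 * (Finset.univ.filter fun d => ent d = d).card := by
  classical
  have h1 : (Finset.univ.filter fun d => Entrance ent lev d ∨ Entrance ent lev (ι d)) =
      (Finset.univ.filter (Entrance ent lev)).disjUnion
        ((Finset.univ.filter (Entrance ent lev)).map ⟨ι, hι.injective⟩) (by
          rw [Finset.disjoint_left]
          intro d hd hd'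
          rw [Finset.mem_map] at hd'
          obtain ⟨e, he, rfl⟩ := hd'
          rw [Finset.mem_filter] at hd he
          exact hS.ne_of_entrance hι hd.2.1 hd.2.2 he.2.1 he.2.2 rfl) := by
    ext d
    simp only [Finset.mem_filter, Finset.mem_univ, true_and, Finset.mem_disjUnion, Finset.mem_map,
      Function.Embedding.coeFn_mk]
    refine or_congr Iff.rfl ⟨fun h => ⟨ι d, h, hι d⟩, ?_⟩
    rintro ⟨e, he, rfl⟩
    rwa [hι]
  have h2 : (Finset.univ.filter fun d => ent d = d) =
      insert s (Finset.univ.filter (Entrance ent lev)) := by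
    ext d
    simp only [Finset.mem_filter, Finset.mem_univ, true_and, Finset.mem_insert, Entrance, ne_eq,
      hS.lev_eq_zero_iff]
    constructor
    · intro h
      by_cases hd : d = s
      · exact Or.inl hd
      · exact Or.inr ⟨h, by rwa [h]⟩
    · rintro (rfl | h)
      · exact hS.ent_root
      · exact h.1
  have h3 : s ∉ Finset.univ.filter (Entrance ent lev) := by
    simp only [Finset.mem_filter, Finset.mem_univ, true_and, Entrance, ne_eq, hS.lev_eq_zero_iff]
    exact fun h => h.2 h.1
  rw [h1, Finset.card_disjUnion, Finset.card_map, h2, Finset.card_insert_of_notMem h3]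
  ring

theorem Cotree.card [Fintype α] {A : α → Prop} [DecidablePred A] [DecidablePred al] {w : α → ℕ} {xs : List α} {j : ℕ}
    (hC : Cotree π ι A w al xs j) (hι : Function.Involutive ι) :
    (Finset.univ.filter A).card = (Finset.univ.filter al).card + 2 * xs.length := by
  classical
  have hmap : ∀ d, ι d ∈ xs ↔ d ∈ xs.map ι := fun d => by
    rw [List.mem_map]
    exact ⟨fun h => ⟨_, h, hι d⟩, by rintro ⟨e, he, rfl⟩; rwa [hι]⟩
  have hnd : (xs ++ xs.map ι).Nodup := by
    rw [List.nodup_append]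
    refine ⟨hC.nodup, hC.nodup.map hι.injective, fun a ha b hb h => ?_⟩
    subst h
    exact hC.inv_not_mem a ha ((hmap a).2 hb)
  have h1 : Finset.univ.filter A = (Finset.univ.filter al).disjUnion (xs ++ xs.map ι).toFinset (by
      rw [Finset.disjoint_left]
      intro d hd hd'
      rw [List.mem_toFinset, List.mem_append, ← hmap] at hd'
      rw [Finset.mem_filter] at hd
      obtain h | h := hd'
      · exact hC.not_mem _ h hd.2
      · exact hC.not_mem _ h ((hC.symm d).2 hd.2)) := by
    ext d
    simp only [Finset.mem_filter, Finset.mem_univ, true_and, Finset.mem_disjUnion, List.mem_toFinset,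
      List.mem_append, ← hmap]
    exact hC.cover d
  rw [h1, Finset.card_disjUnion, List.toFinset_card_of_nodup hnd, List.length_append, List.length_map]
  ring

/-- The crossings of a search through the elements of `A`, together with one direction of each of the
others. -/
theorem SearchTree.cotree {A : α → Prop} (hS : SearchTree π ι A s ent lev)
    (hι : Function.Involutive ι) (hA : ∀ d, A (ι d) ↔ A d) (hfix : ∀ d, ι d ≠ d) (w : α → ℕ)
    {code : α → ℕ} (hcode : Function.Injective code) {al : α → Prop}
    (hal : ∀ d, al d ↔ Entrance ent lev d ∨ Entrance ent lev (ι d)) {xs : List α} (hn : xs.Nodup)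
    (hxs : ∀ d, d ∈ xs ↔ A d ∧ ¬ al d ∧ code d < code (ι d)) : Cotree π ι A w al xs 0 := by
  have hsymm : ∀ d, al (ι d) ↔ al d := fun d => by rw [hal, hal, hι, or_comm]
  have halA : ∀ d, al d → A d := by
    intro d hd
    obtain h | h := (hal d).1 hd
    · exact (hA d).1 (hS.entrance_al h.1 h.2)
    · have := hS.entrance_al h.1 h.2
      rwa [hι] at this
  refine ⟨hsymm, fun d => ?_, fun d hd => ((hxs d).1 hd).2.1, hn, fun d hd hd' => ?_, fun d d' => ?_,
    fun i _ hi => absurd hi (Nat.not_lt_zero i)⟩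
  · rw [hxs, hxs, hA, hsymm, hι]
    have : code (ι d) ≠ code d := fun h => hfix d (hcode h)
    constructor
    · intro h
      by_cases h' : al d
      · exact Or.inl h'
      · obtain h'' | h'' := lt_or_gt_of_ne this
        · exact Or.inr (Or.inr ⟨h, h', h''⟩)
        · exact Or.inr (Or.inl ⟨h, h', h''⟩)
    · rintro (h | h | h)
      · exact halA d h
      · exact h.1
      · exact h.1
  · have h1 := ((hxs _).1 hd).2.2
    have h2 := ((hxs _).1 hd').2.2
    rw [hι] at h2
    omega
  · have : ∀ d, Linked π ι al d s := fun d =>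
      hS.linked_root fun e he => (hal e).2 (Or.inl ⟨(hS.mem_climb he).1, (hS.mem_climb he).2.1⟩)
    exact (this d).trans _ _ _ (this d').symm

end Structured

namespace TreeLoops

open Structured

variable {N : ℕ} {G : SimpleGraph (Fin N)} {R : RotationSystem G} {p : Fin N} {c : ℕ}
  (T : TreeLoops R p c)

/-! ### The complement of the tree links all faces -/

/-- The edges of the tree, as darts. -/
def InTree (d : G.Dart) : Prop := T.Par d ∨ T.Par d.symm

theorem inTree_symm (d : G.Dart) : T.InTree d.symm ↔ T.InTree d := by
  rw [InTree, InTree, SimpleGraph.Dart.symm_symm, or_comm]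

/-- The faces on the two sides of a dart of the tree are linked by going around the subtree below it. -/
theorem linked_par {e : G.Dart} (he : T.Par e) :
    Linked R.faceNext SimpleGraph.Dart.symm (fun d => ¬ T.InTree d) e e.symm := by
  have := Fintype.ofFinite G.Dart
  obtain ⟨B, hB⟩ : ∃ B, ∀ d, T.lev d ≤ B :=
    ⟨Finset.univ.sup T.lev, fun d => Finset.le_sup (Finset.mem_univ d)⟩
  obtain ⟨m, hm⟩ : ∃ m, B - T.lev e = m := ⟨_, rfl⟩
  induction m using Nat.strong_induction_on generalizing e with
  | _ m ih =>
    set L := Linked R.faceNext SimpleGraph.Dart.symm (fun d => ¬ T.InTree d) with hL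
    have hnext : ∀ d, L d.symm (R.next d) := fun d =>
      .rel _ _ (Or.inl (by rw [RotationSystem.faceNext, SimpleGraph.Dart.symm_symm]))
    have hother : ∀ d, d.fst = e.fst → d ≠ e → L d d.symm := by
      intro d hd hde
      by_cases h : T.InTree d
      · obtain h | h := h
        · exact absurd (h.1.symm.trans ((T.ent_congr hd).trans he.1)) hde
        · have h1 := T.lev_up h.2
          rw [up, h.1, SimpleGraph.Dart.symm_symm, T.lev_congr hd] at h1
          have h2 := hB d.symm
          have := ih _ (by omega) h rfl
          rw [SimpleGraph.Dart.symm_symm] at this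
          exact this.symm
      · exact .rel _ _ (Or.inr ⟨h, rfl⟩)
    have hgo : ∀ j, L e.symm e ∨ L e.symm (R.next^[j + 1] e) := by
      intro j
      induction j with
      | zero => exact Or.inr (hnext e)
      | succ j ihj =>
        obtain h | h := ihj
        · exact Or.inl h
        · by_cases hj : R.next^[j + 1] e = e
          · rw [hj] at h
            exact Or.inl h
          · refine Or.inr ?_
            rw [Function.iterate_succ_apply']
            exact (h.trans _ _ _ (hother _ (R.idx_iterate_next e (j + 1)).1 hj)).trans _ _ _ (hnext _)
    have hper := minimalPeriod_pos_of_injective R.next_injective e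
    obtain h | h := hgo (Function.minimalPeriod R.next e - 1)
    · exact h.symm
    · rw [Nat.sub_add_cancel hper, Function.iterate_minimalPeriod] at h
      exact h.symm

/-- The edges outside of the tree link all faces: darts at the same vertex and reversals are linked across
edges outside of the tree or around subtrees, and the graph is connected. -/
theorem linked_not_inTree (d d' : G.Dart) :
    Linked R.faceNext SimpleGraph.Dart.symm (fun d => ¬ T.InTree d) d d' := by
  have hs : ∀ d : G.Dart, Linked R.faceNext SimpleGraph.Dart.symm (fun d => ¬ T.InTree d) d d.symm := by
    intro d
    by_cases h : T.InTree d
    · obtain h | h := h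
      · exact T.linked_par h
      · have := T.linked_par h
        rw [SimpleGraph.Dart.symm_symm] at this
        exact this.symm
    · exact .rel _ _ (Or.inr ⟨h, rfl⟩)
  have hroot : ∀ d, Linked R.next SimpleGraph.Dart.symm (fun _ => True) d T.root := fun d =>
    T.tree.linked_root fun _ _ => trivial
  refine Linked.of_step (R := Linked R.faceNext SimpleGraph.Dart.symm (fun d => ¬ T.InTree d))
    (Relation.EqvGen.is_equivalence _) (fun a => ?_) (fun a _ => hs a)
    ((hroot d).trans _ _ _ (hroot d').symm)
  refine (hs a).trans _ _ _ (.rel _ _ (Or.inl ?_))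
  rw [RotationSystem.faceNext, SimpleGraph.Dart.symm_symm]

/-! ### The number of edges outside of both trees -/

/-- The tree enters each vertex once. -/
theorem card_ent [Fintype G.Dart] [DecidablePred fun d => T.ent d = d] (hG : G.Connected) :
    (Finset.univ.filter fun d => T.ent d = d).card = N := by
  classical
  refine le_antisymm ?_ ?_
  · refine le_of_le_of_eq ?_ ((Finset.card_univ (α := Fin N)).trans (Fintype.card_fin N))
    refine Finset.card_le_card_of_injOn (fun d => d.fst) (fun _ _ => Finset.mem_coe.2 (Finset.mem_univ _)) ?_
    intro d hd d' hd' h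
    simp only [Finset.coe_filter, Finset.mem_univ, true_and, Set.mem_ofPred_eq] at hd hd'
    rw [← hd, ← hd']
    exact T.ent_congr h
  · refine (T.card_vertex_le hG).trans ?_
    rw [Nat.card_eq_fintype_card, Fintype.card_subtype]
    refine Finset.card_lt_card (Finset.ssubset_iff_of_subset ?_ |>.2 ⟨T.root, ?_⟩)
    · intro d hd
      simp only [Finset.mem_filter, Finset.mem_univ, true_and] at hd ⊢
      exact hd.1
    · simp only [Finset.mem_filter, Finset.mem_univ, true_and]
      exact ⟨T.tree.ent_root, fun h => h.2 (T.tree.lev_eq_zero_iff.2 T.tree.ent_root)⟩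

/-- The search on the faces enters each face once. -/
theorem _root_.RotationSystem.card_ent_face [Fintype G.Dart] {A : G.Dart → Prop} {s : G.Dart}
    {ent : G.Dart → G.Dart} {lev : G.Dart → ℕ} [DecidablePred fun d => ent d = d]
    (hS : SearchTree R.faceNext SimpleGraph.Dart.symm A s ent lev) :
    (Finset.univ.filter fun d => ent d = d).card = Nat.card R.Face := by
  rw [← Fintype.card_subtype, ← Nat.card_eq_fintype_card]
  refine Nat.card_eq_of_bijective (fun d => R.face d.1) ⟨fun d d' h => ?_, fun f => ?_⟩
  · have h1 : ∀ d d', R.face d = R.face d' → ent d = ent d' := fun d d' h =>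
      congrArg (Quot.lift ent fun a b hab => by rw [hab]; exact (hS.ent_perm a).symm) h
    exact Subtype.ext (by rw [← d.2, ← d'.2]; exact h1 _ _ h)
  · obtain ⟨d, rfl⟩ := Quot.exists_rep f
    refine ⟨⟨ent d, hS.ent_ent d⟩, ?_⟩
    obtain ⟨j, hj⟩ := hS.orbit d
    have h1 : ∀ j d, R.face (R.faceNext^[j] d) = R.face d := by
      intro j d
      induction j with
      | zero => rfl
      | succ j ih => rw [Function.iterate_succ_apply', R.face_faceNext, ih]
    have := h1 j (ent d)
    rw [hj] at this
    exact this.symm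

/-- By Euler's formula, `2 * g` edges are neither in the tree nor in the cotree. -/
theorem length_outside (hG : G.Connected) {g : ℕ} (hg : R.HasGenus g) {s : G.Dart}
    {ent : G.Dart → G.Dart} {lev w : G.Dart → ℕ}
    (hS : SearchTree R.faceNext SimpleGraph.Dart.symm (fun d => ¬ T.InTree d) s ent lev)
    {xs : List G.Dart} {al : G.Dart → Prop} {j : ℕ}
    (hal : ∀ d, al d ↔ Entrance ent lev d ∨ Entrance ent lev d.symm)
    (hC : Cotree R.faceNext SimpleGraph.Dart.symm (fun d => ¬ T.InTree d) w al xs j) :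
    xs.length = 2 * g := by
  classical
  have := Fintype.ofFinite G.Dart
  have := Fintype.ofFinite G.edgeSet
  have h1 := hC.card SimpleGraph.Dart.symm_involutive
  have h2 := hS.card_crossed SimpleGraph.Dart.symm_involutive
  have h3 := T.tree.card_crossed SimpleGraph.Dart.symm_involutive
  rw [T.card_ent hG] at h3
  rw [RotationSystem.card_ent_face hS] at h2
  have h4 : (Finset.univ.filter fun d => Entrance T.ent T.lev d ∨ Entrance T.ent T.lev d.symm).card +
      (Finset.univ.filter fun d => ¬ T.InTree d).card = Fintype.card G.Dart := by
    convert Finset.card_filter_add_card_filter_not (s := Finset.univ)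
      fun d => Entrance T.ent T.lev d ∨ Entrance T.ent T.lev d.symm
    · exact Iff.rfl
    · exact Finset.card_univ.symm
  have h5 : (Finset.univ.filter al) =
      Finset.univ.filter fun d => Entrance ent lev d ∨ Entrance ent lev d.symm :=
    Finset.filter_congr fun d _ => hal d
  have h6 := G.dart_card_eq_twice_card_edges
  have h7 : Nat.card G.edgeSet = G.edgeFinset.card := by
    rw [Nat.card_eq_fintype_card, SimpleGraph.edgeFinset_card]
  have h8 : Fintype.card G.Dart = 2 * Nat.card G.edgeSet := by
    rw [h7]; convert h6
  rw [h5] at h1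
  unfold RotationSystem.HasGenus at hg
  omega

/-- The tree with the loops through the darts of a list. -/
def withLoops {c' : ℕ} (ys : List G.Dart) (hl : ys.length = c') (hn : ys.Nodup) (hi : ∀ d ∈ ys, d.symm ∉ ys)
    (hT : ∀ d ∈ ys, ¬ T.InTree d) : TreeLoops R p c' where
  root := T.root
  ent := T.ent
  lev := T.lev
  tree := T.tree
  root_fst := T.root_fst
  x i := ys[i]
  edge_inj i j h := by
    obtain h | h := (SimpleGraph.dart_edge_eq_iff _ _).1 h
    · exact Fin.ext ((List.Nodup.getElem_inj_iff hn).1 h)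
    · exact absurd (h ▸ List.getElem_mem _) (hi ys[j] (List.getElem_mem _))
  x_not_par i h := hT ys[i] (List.getElem_mem _) (Or.inl h)
  x_symm_not_par i h := hT ys[i] (List.getElem_mem _) (Or.inr h)

end TreeLoops

/-! ### Connected graphs -/

namespace RotationSystem

variable {N : ℕ} {G : SimpleGraph (Fin N)} (R : RotationSystem G)

theorem linked_of_connected (hG : G.Connected) (d d' : G.Dart) :
    Structured.Linked R.next SimpleGraph.Dart.symm (fun _ => True) d d' := by
  obtain ⟨W⟩ := hG.preconnected d.fst d'.fst
  suffices ∀ {u v : Fin N} (_ : G.Walk u v) (d d' : G.Dart), d.fst = u → d'.fst = v →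
      Structured.Linked R.next SimpleGraph.Dart.symm (fun _ => True) d d' from this W d d' rfl rfl
  intro u v W
  have hsame : ∀ d d' : G.Dart, d.fst = d'.fst →
      Structured.Linked R.next SimpleGraph.Dart.symm (fun _ => True) d d' := fun d d' h => by
    obtain ⟨j, rfl⟩ := R.exists_iterate_next h
    exact Structured.Linked.iterate _ j d
  induction W with
  | nil => exact fun d d' h h' => hsame d d' (h.trans h'.symm)
  | @cons u v w ha W ih =>
    intro d d' h h'
    refine (hsame d ⟨(u, v), ha⟩ h).trans _ _ _ (.trans _ _ _ (.rel _ _ (Or.inr ⟨trivial, rfl⟩))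
      (ih _ d' rfl h'))

end RotationSystem

namespace Structured

variable {N : ℕ} {G : SimpleGraph (Fin N)} {R : RotationSystem G} {p : Fin N}

/-! ### The computation on the parsed input -/

/-- The arrays that describe the rotation system are set up, and the other arrays are empty. The
darts are listed in `l`. -/
structure Parsed (R : RotationSystem G) (root : G.Dart) (code : G.Dart → ℕ) (l : List G.Dart) (σ : St) :
    Prop where
  code_injective : Function.Injective code
  code_pos : ∀ d, 1 ≤ code d
  code_lt : ∀ d, code d < σ.reg 2
  root : σ.reg 4 = code root
  mem : ∀ d, d ∈ l
  nodup : l.Nodup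
  list : ∀ i (hi : i < l.length), σ.arr 23 i = code l[i]
  length : σ.reg 5 = l.length
  src : ∀ d, σ.arr 3 (code d) = d.fst
  next : ∀ d, σ.arr 4 (code d) = code (R.next d)
  sym : ∀ d, σ.arr 5 (code d) = code d.symm
  face : ∀ d, σ.arr 6 (code d) = code (R.faceNext d)
  one : ∀ d, σ.arr 7 (code d) = 1
  zero : ∀ k, 8 ≤ k → k < 23 → ∀ i, σ.arr k i = 0
  out : σ.out = []

/-- The description of the rotation system is as before. -/
structure Keeps (σ τ : St) : Prop where
  a3 : τ.arr 3 = σ.arr 3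
  a5 : τ.arr 5 = σ.arr 5
  a6 : τ.arr 6 = σ.arr 6
  a23 : τ.arr 23 = σ.arr 23
  r2 : τ.reg 2 = σ.reg 2
  r4 : τ.reg 4 = σ.reg 4
  r5 : τ.reg 5 = σ.reg 5

theorem Keeps.frame {s : Stmt} {σ τ τ' : St} (h : Keeps σ τ) (hF : Frame s τ τ')
    (ha : s.wa 3 = false ∧ s.wa 5 = false ∧ s.wa 6 = false ∧ s.wa 23 = false)
    (hr : s.wr 2 = false ∧ s.wr 4 = false ∧ s.wr 5 = false) : Keeps σ τ' :=
  ⟨(hF.arr 3 ha.1).trans h.a3, (hF.arr 5 ha.2.1).trans h.a5, (hF.arr 6 ha.2.2.1).trans h.a6,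
    (hF.arr 23 ha.2.2.2).trans h.a23, (hF.reg 2 hr.1).trans h.r2, (hF.reg 4 hr.2.1).trans h.r4,
    (hF.reg 5 hr.2.2).trans h.r5⟩

theorem Keeps.root {σ τ : St} (h : Keeps σ τ) (t : ℕ) :
    Keeps σ ⟨Function.update τ.reg 10 (τ.reg 4 + 0), τ.arr, τ.out, t⟩ :=
  ⟨h.a3, h.a5, h.a6, h.a23, by simpa using h.r2, by simpa using h.r4, by simpa using h.r5⟩

/-- The computation after parsing: a tree of shortest paths, a search through the complementary edges
on the faces, the improvement of the remaining edges, and the loops through them. -/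
def core : Stmt :=
  .ops [.inc 10 4 0] ;; search 4 7 8 11 ;; weigh ;; .ops [.inc 10 4 0] ;; search 6 12 14 17 ;; collect ;;
    rounds ;; loads ;; slots ;; output

theorem wp_core {x : List ℕ} {V g : ℕ} (hG : G.Connected) (hg1 : 1 ≤ g) (hg : R.HasGenus g)
    {root : G.Dart} (hroot : root.fst = p) {code : G.Dart → ℕ} {l : List G.Dart} {σ : St}
    (hP : Parsed R root code l σ) (hV : 2 * σ.reg 2 ≤ V) (hV' : σ.reg 2 * (4 * g) ≤ V) :
    WP x V core (fun σ' => ∃ (P : LoopSystem G p (2 * g)) (h : P.IsPolygonalSchema R),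
      P.ChordFree R h.length_pos ∧ σ'.out = P.encode ∧ σ'.time ≤ σ.time + 600 * (g * σ.reg 2)) σ := by
  classical
  have := Fintype.ofFinite G.Dart
  have hι : Function.Involutive (SimpleGraph.Dart.symm : G.Dart → G.Dart) :=
    SimpleGraph.Dart.symm_involutive
  have hfix : ∀ d : G.Dart, d.symm ≠ d := SimpleGraph.Dart.symm_ne
  have hcode := hP.code_injective
  have hcard : Nat.card G.Dart ≤ σ.reg 2 := by
    rw [Nat.card_eq_fintype_card, ← Fintype.card_fin (σ.reg 2)]
    exact Fintype.card_le_of_injective (fun d => (⟨code d, hP.code_lt d⟩ : Fin (σ.reg 2)))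
      fun d d' h => hcode (congrArg Fin.val h)
  have hlen : ∀ {l : List G.Dart}, l.Nodup → (∀ d, d ∈ l) → l.length = Nat.card G.Dart := by
    intro l hn hm
    rw [Nat.card_eq_fintype_card, ← List.toFinset_card_of_nodup hn, ← Finset.card_univ]
    congr 1
    exact Finset.eq_univ_of_forall fun d => List.mem_toFinset.2 (hm d)
  have hl := hlen hP.nodup hP.mem
  -- The tree.
  refine WP.seq (WP.ops ?_)
  simp only [pre, Op.eval, Op.Fits, true_and]
  refine WP.seq (WP.mono (wp_search (s := root) (al := fun _ => True) R.next_injective hι hcode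
    hP.code_pos (by norm_num) (by norm_num) (by norm_num) (by norm_num) ?_ ?_ ?_ ?_ ?_ ?_)
    fun σ₁ hF₁ ⟨l₁, ent, lev, hS₁, hne₁, _, hH₁, hm₁, ht₁⟩ => ?_)
  · simp [hP.root]
  · simpa using hcard
  · simpa using hP.code_lt
  · exact hP.next
  · exact hP.sym
  · intro d
    simp [hP.one]
  have K₁ : Keeps σ σ₁ := (Keeps.root ⟨rfl, rfl, rfl, rfl, rfl, rfl, rfl⟩ _).frame hF₁ ⟨rfl, rfl, rfl, rfl⟩
    ⟨rfl, rfl, rfl⟩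
  simp only [ne_eq, Function.update_of_ne, Nat.reduceEqDiff, not_false_eq_true] at ht₁
  have hmem₁ : ∀ d, d ∈ l₁ := fun d => hS₁.mem_of_linked R.next_injective hι (fun _ => Iff.rfl) hne₁
    (R.linked_of_connected hG _ _)
  have hT := hS₁.searchTree hmem₁
  obtain ⟨T, rfl, rfl, rfl⟩ : ∃ T : TreeLoops R p 0, T.root = root ∧ T.ent = ent ∧ T.lev = lev :=
    ⟨⟨root, ent, lev, hT, hroot, Fin.elim0, fun i => i.elim0, fun i => i.elim0, fun i => i.elim0⟩,
      rfl, rfl, rfl⟩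
  have hlev := fun d => hT.lev_le_card d
  have a11 : ∀ d, σ₁.arr 11 (code d) = if T.InTree d then 1 else 0 := fun d => by
    rw [hm₁ d, if_congr (crossed_iff hT hmem₁ d) rfl rfl]
    exact if_congr Iff.rfl rfl (hP.zero 11 (by norm_num) (by norm_num) _)
  have a8 : ∀ d, σ₁.arr 8 (code d) = code (T.ent d) := fun d => hH₁.ent d (hmem₁ d)
  have a9 : ∀ d, σ₁.arr 9 (code d) = T.lev d := fun d => hH₁.lev d (hmem₁ d)
  have a10 : ∀ i (hi : i < l₁.length), σ₁.arr 10 i = code l₁[i] := hH₁.queue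
  have hl₁ := hlen hS₁.nodup hmem₁
  -- The weights.
  refine WP.seq (WP.mono (wp_weigh (ι := SimpleGraph.Dart.symm) (lev := T.lev) hcode hP.mem ?_ ?_ ?_ a9 ?_)
    fun σ₂ hF₂ ⟨h12, h13, ht₂⟩ => ?_)
  · rw [K₁.a23]; exact hP.list
  · rw [K₁.r5]; exact hP.length
  · rw [K₁.a5]; exact hP.sym
  · intro d
    have := hlev d
    have := hlev d.symm
    omega
  have K₂ := K₁.frame hF₂ ⟨rfl, rfl, rfl, rfl⟩ ⟨rfl, rfl, rfl⟩
  have a12 : ∀ d, σ₂.arr 12 (code d) = if ¬ T.InTree d then 1 else 0 := fun d => by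
    rw [h12, a11]
    by_cases h : T.InTree d <;> simp [h]
  -- The search through the complement of the tree.
  refine WP.seq (WP.ops ?_)
  simp only [pre, Op.eval, Op.Fits, true_and]
  refine WP.seq (WP.mono (wp_search (s := T.root) (al := fun d => ¬ T.InTree d) R.faceNext_injective hι
    hcode hP.code_pos (by norm_num) (by norm_num) (by norm_num) (by norm_num) ?_ ?_ ?_ ?_ ?_ ?_)
    fun σ₃ hF₃ ⟨l₂, ent₂, lev₂, hS₂, hne₂, _, _, hm₂, ht₃⟩ => ?_)
  · simp [K₂.r4, hP.root]
  · simpa [K₂.r2] using hcard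
  · simpa [K₂.r2] using hP.code_lt
  · simpa [K₂.a6] using hP.face
  · simpa [K₂.a5] using hP.sym
  · intro d
    by_cases h : T.InTree d <;> simp [a12, h]
  have K₃ : Keeps σ σ₃ := (K₂.root _).frame hF₃ ⟨rfl, rfl, rfl, rfl⟩ ⟨rfl, rfl, rfl⟩
  simp only [ne_eq, Function.update_of_ne, Nat.reduceEqDiff, not_false_eq_true, K₂.r2] at ht₃
  have hmem₂ : ∀ d, d ∈ l₂ := fun d => hS₂.mem_of_linked R.faceNext_injective hι
    (fun d => not_congr (T.inTree_symm d)) hne₂ (T.linked_not_inTree _ _)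
  have hT₂ := hS₂.searchTree hmem₂
  have hal := crossed_iff hT₂ hmem₂
  have a17 : ∀ d, σ₃.arr 17 (code d) = if Crossed SimpleGraph.Dart.symm T.root l₂ ent₂ d then 1 else 0 :=
    fun d => by
      rw [hm₂ d]
      refine if_congr Iff.rfl rfl ?_
      refine (congrFun (hF₂.arr 17 rfl) _).trans ((congrFun (hF₁.arr 17 rfl) _).trans ?_)
      exact hP.zero 17 (by norm_num) (by norm_num) _
  -- The edges outside of both trees.
  refine WP.seq (WP.mono (wp_collect (code := code) (l := l) (ι := SimpleGraph.Dart.symm)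
    (A := fun d => ¬ T.InTree d) (al := Crossed SimpleGraph.Dart.symm T.root l₂ ent₂) ?_ ?_ ?_ ?_ a17)
    fun σ₄ hF₄ ⟨xs, hxs, r6, a19, ht₄⟩ => ?_)
  · rw [K₃.a23]; exact hP.list
  · rw [K₃.r5]; exact hP.length
  · rw [K₃.a5]; exact hP.sym
  · intro d
    exact (congrFun (hF₃.arr 12 rfl) _).trans ((a12 d).trans (by split_ifs <;> rfl))
  have K₄ := K₃.frame hF₄ ⟨rfl, rfl, rfl, rfl⟩ ⟨rfl, rfl, rfl⟩
  have hC := hT₂.cotree hι (fun d => not_congr (T.inTree_symm d)) hfix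
    (fun d => T.lev d + T.lev d.symm) hcode hal (xs := xs) (by rw [hxs]; exact hP.nodup.filter _)
    fun d => by rw [hxs, List.mem_filter]; simp [hP.mem]
  have hxlen := T.length_outside hG hg hT₂ hal hC
  -- The improvement of these edges.
  refine WP.seq (WP.mono (wp_rounds R.faceNext_injective hι hfix hcode hP.code_pos
    (fun d => by rw [SimpleGraph.Dart.symm_symm, add_comm]) hC a19 r6 ?_ ?_ ?_ ?_ ?_ ?_)
    fun σ₅ hF₅ ⟨al, ys, hC', hylen, a20, ht₅⟩ => ?_)
  · rwa [K₄.r2]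
  · rw [K₄.r2]; exact hP.code_lt
  · rw [K₄.a6]; exact hP.face
  · rw [K₄.a5]; exact hP.sym
  · intro d
    exact (congrFun (hF₄.arr 13 rfl) _).trans ((congrFun (hF₃.arr 13 rfl) _).trans (h13 d))
  · intro d
    exact (congrFun (hF₄.arr 17 rfl) _).trans (a17 d)
  have K₅ := K₄.frame hF₅ ⟨rfl, rfl, rfl, rfl⟩ ⟨rfl, rfl, rfl⟩
  rw [K₄.r2, hxlen] at ht₅
  rw [hxlen] at hylen
  have r6₅ : σ₅.reg 6 = ys.length := by rw [hF₅.reg 6 rfl, r6, hylen, hxlen]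
  have carry : ∀ k, weigh.wa k = false → (search 6 12 14 17).wa k = false → collect.wa k = false →
      rounds.wa k = false → σ₅.arr k = σ₁.arr k := fun k h₂ h₃ h₄ h₅ =>
    (hF₅.arr k h₅).trans ((hF₄.arr k h₄).trans ((hF₃.arr k h₃).trans (hF₂.arr k h₂)))
  have carry₀ : ∀ k, (search 4 7 8 11).wa k = false → σ₁.arr k = σ.arr k := fun k h => hF₁.arr k h
  -- The loops.
  set T' := T.withLoops ys hylen hC'.nodup hC'.inv_not_mem
    (fun d hd => (hC'.cover d).2 (Or.inr (Or.inl hd))) with hT'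
  have hofFn : List.ofFn T'.x = ys := by
    refine List.ext_getElem (by simp [hylen]) fun i h h' => ?_
    rw [List.getElem_ofFn]
    rfl
  refine WP.seq (WP.mono (wp_loads (ι := SimpleGraph.Dart.symm) hT hfix hcode a20 r6₅ ?_ ?_ ?_ ?_)
    fun σ₆ hF₆ ⟨a21, ht₆⟩ => ?_)
  · rw [K₅.a5]; exact hP.sym
  · rw [carry 8 rfl rfl rfl rfl]; exact a8
  · rw [carry 9 rfl rfl rfl rfl]; exact a9
  · intro d
    rw [carry 21 rfl rfl rfl rfl, carry₀ 21 rfl]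
    exact hP.zero 21 (by norm_num) (by norm_num) _
  have K₆ := K₅.frame hF₆ ⟨rfl, rfl, rfl, rfl⟩ ⟨rfl, rfl, rfl⟩
  rw [← hofFn] at a21
  have a21' : ∀ d, σ₆.arr 21 (code d) = T'.ld d := fun d => (a21 d).trans (T'.strands_eq_ld d)
  -- The slots.
  refine WP.seq (WP.mono (wp_slots (ι := SimpleGraph.Dart.symm) (Par := T.Par) (A := fun d => ¬ T.InTree d)
    (lev := T.lev) (M := 4 * g) hcode hS₁.nodup ?_ ?_ (ld := T'.ld) ?_ ?_ ?_ ?_ ?_ ?_ ?_ a21' ?_)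
    fun σ₇ hF₇ ⟨lo, a22, hlo, ht₇⟩ => ?_)
  · exact fun j hj h => hS₁.exists_reverse_before hmem₁ hj h.1 h.2
  · intro d
    have h1 := hT.down d trivial
    have h2 := hT.down d.symm trivial
    rw [SimpleGraph.Dart.symm_symm] at h2
    by_cases h : T.Par d
    · have h3 := T.lev_up h.2
      rw [TreeLoops.up, h.1] at h3
      have h4 : T.InTree d := Or.inl h
      simp [h, h4]
      omega
    · by_cases h' : T.Par d.symm
      · have h3 := T.lev_up h'.2
        rw [TreeLoops.up, h'.1, SimpleGraph.Dart.symm_symm] at h3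
        simp [h]
        omega
      · have h4 : ¬ T.InTree d := not_or.2 ⟨h, h'⟩
        simp [h, h4]
        omega
  · intro d
    have := T'.ld_le d
    omega
  · rw [hl₁]
    exact (Nat.mul_le_mul_right _ hcard).trans hV'
  · rw [hF₆.arr 10 rfl, carry 10 rfl rfl rfl rfl]; exact a10
  · rw [K₆.r5, hP.length, hl, hl₁]
  · rw [K₆.a5]; exact hP.sym
  · rw [hF₆.arr 9 rfl, carry 9 rfl rfl rfl rfl]; exact a9
  · intro d
    rw [hF₆.arr 12 rfl, hF₅.arr 12 rfl, hF₄.arr 12 rfl]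
    exact (congrFun (hF₃.arr 12 rfl) _).trans ((a12 d).trans (by split_ifs <;> rfl))
  · intro d
    rw [hF₆.arr 22 rfl, carry 22 rfl rfl rfl rfl, carry₀ 22 rfl]
    exact hP.zero 22 (by norm_num) (by norm_num) _
  have K₇ := K₆.frame hF₇ ⟨rfl, rfl, rfl, rfl⟩ ⟨rfl, rfl, rfl⟩
  obtain ⟨hs₁, hs₂, hs₃⟩ := slotAfter_spec hS₁ hmem₁ (fun d => Iff.rfl) hlo
  have S : T'.Slots lo := ⟨hs₁, hs₂, hs₃⟩
  -- The output.
  refine WP.mono (wp_output (src := fun d => (d.fst : ℕ)) (ld := T'.ld) (lo := lo) hT ⟨?_, ?_, ?_, a22⟩ (ys := ys)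
    ?_ ?_ ?_ ?_ ?_ ?_) fun σ₈ hF₈ ⟨ho, ht₈⟩ => ?_
  · rw [K₇.a5]; exact hP.sym
  · rw [K₇.a3]; exact hP.src
  · rw [hF₇.arr 21 rfl]; exact a21'
  · rw [hF₇.arr 20 rfl, hF₆.arr 20 rfl]; exact a20
  · rw [hF₇.reg 6 rfl, hF₆.reg 6 rfl, r6₅]
  · rw [hF₇.arr 8 rfl, hF₆.arr 8 rfl, carry 8 rfl rfl rfl rfl]; exact a8
  · rw [hF₇.arr 9 rfl, hF₆.arr 9 rfl, carry 9 rfl rfl rfl rfl]; exact a9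
  · intro d
    rw [hF₇.arr 13 rfl, hF₆.arr 13 rfl, hF₅.arr 13 rfl]
    exact (congrFun (hF₄.arr 13 rfl) _).trans ((congrFun (hF₃.arr 13 rfl) _).trans (h13 d))
  · rw [hF₇.out rfl, hF₆.out rfl, hF₅.out rfl, hF₄.out rfl, hF₃.out rfl]
    exact (hF₂.out rfl).trans ((hF₁.out rfl).trans hP.out)
  have hE : N + Nat.card R.Face + 2 * g = Nat.card G.edgeSet + 2 := by
    unfold RotationSystem.HasGenus at hg
    omega
  have hCompl : T'.Complement al := by
    refine ⟨fun d hd => ?_, hC'.linked, fun i => ?_⟩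
    · by_contra h0
      have hA := (hC'.cover d).2 (Or.inl hd)
      obtain h | h | ⟨⟨i, b⟩, h⟩ := T'.eq_or_par_of_ld_ne_zero h0
      · exact hA (Or.inl h)
      · exact hA (Or.inr h)
      · have hi : T'.x i ∈ ys := List.getElem_mem _
        cases b
        · rw [h, TreeLoops.tip_false, hC'.symm] at hd
          exact hC'.not_mem _ hi hd
        · rw [h, TreeLoops.tip_true] at hd
          exact hC'.not_mem _ hi hd
    · exact hC'.heavy i (by rw [hylen]; exact i.2) (by rw [hylen]; exact i.2)
  have D := T'.drawn_system S
  refine ⟨T'.system S, D.isPolygonalSchema S hG (by omega) hE hCompl, D.chordFree S hG hE hCompl _, ?_, ?_⟩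
  · rw [ho, T'.encode_system S, hofFn, hylen]
    rfl
  · rw [hylen] at ht₆ ht₈
    rw [hl] at ht₂ ht₄
    rw [hl₁] at ht₇
    have e1 : (39 * σ.reg 2 + 39) * (2 * g) = 78 * (g * σ.reg 2) + 78 * g := by ring
    have e2 : (22 * Nat.card G.Dart + 17) * (2 * g) = 44 * (g * Nat.card G.Dart) + 34 * g := by ring
    have e3 : (39 * Nat.card G.Dart + 22) * (2 * g) = 78 * (g * Nat.card G.Dart) + 44 * g := by ring
    have e4 : g * Nat.card G.Dart ≤ g * σ.reg 2 := Nat.mul_le_mul_left g hcard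
    have e5 : 1 ≤ σ.reg 2 := (Nat.zero_lt_of_lt (hP.code_lt T.root))
    have e6 : g ≤ g * σ.reg 2 := Nat.le_mul_of_pos_right g e5
    have e7 : σ.reg 2 ≤ g * σ.reg 2 := Nat.le_mul_of_pos_left _ hg1
    omega

end Structured

namespace RotationSystem

variable {N : ℕ} {G : SimpleGraph (Fin N)} (R : RotationSystem G)

/-! ### Positions in the encoding of a rotation system -/

/-- The part of the encoding that describes one vertex. -/
def block (v : Fin N) : List ℕ := (R.nbrs v).length :: (R.nbrs v).map Fin.val

/-- The position of the part of the encoding that describes the vertex `v`. -/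
def off (v : ℕ) : ℕ := 1 + (((List.finRange N).take v).flatMap R.block).length

/-- The position in the encoding at which the target of a dart stands. These positions serve as the
numbers of the darts. -/
def code (d : G.Dart) : ℕ := R.off d.fst + 1 + R.idx d

theorem encode_eq (v : Fin N) : R.encode = (N :: ((List.finRange N).take v).flatMap R.block) ++
    (R.block v ++ ((List.finRange N).drop (v + 1)).flatMap R.block) := by
  have h : (v : ℕ) < (List.finRange N).length := by simp
  have h1 : List.finRange N = (List.finRange N).take v ++ v :: (List.finRange N).drop (v + 1) := by
    conv_lhs => rw [← List.take_append_drop v (List.finRange N), List.drop_eq_getElem_cons h]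
    simp
  change N :: (List.finRange N).flatMap R.block = _
  conv_lhs => rw [h1]
  rw [List.flatMap_append, List.flatMap_cons]
  rfl

theorem off_zero : R.off 0 = 1 := rfl

theorem off_succ (v : Fin N) : R.off (v + 1) = R.off v + 1 + (R.nbrs v).length := by
  have h : (v : ℕ) < (List.finRange N).length := by simp
  rw [off, List.take_succ_eq_append_getElem h, List.flatMap_append, List.length_append, off]
  simp [block]
  omega

theorem off_mono {u v : ℕ} (h : u ≤ v) : R.off u ≤ R.off v := by
  have h1 : (List.finRange N).take u = ((List.finRange N).take v).take u := by
    rw [List.take_take, Nat.min_eq_left h]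
  rw [off, off, h1]
  conv_rhs => rw [← List.take_append_drop u ((List.finRange N).take v)]
  rw [List.flatMap_append, List.length_append]
  omega

theorem off_last : R.off N = R.encode.length := by
  rw [off, List.take_of_length_le (by simp), encode, List.length_cons, add_comm]
  rfl

theorem code_lt_off {d : G.Dart} {v : ℕ} (h : (d.fst : ℕ) < v) : R.code d < R.off v := by
  have h1 := R.off_mono (show (d.fst : ℕ) + 1 ≤ v from h)
  rw [R.off_succ] at h1
  have := R.idx_lt d
  unfold code
  omega

theorem off_lt_code {d : G.Dart} {v : ℕ} (h : v ≤ d.fst) : R.off v < R.code d := by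
  have := R.off_mono h
  unfold code
  omega

theorem code_lt_iff {d : G.Dart} {v : Fin N} {i : ℕ} (hi : i ≤ (R.nbrs v).length) :
    R.code d < R.off v + 1 + i ↔ d.fst < v ∨ d.fst = v ∧ R.idx d < i := by
  obtain h | rfl | h := lt_trichotomy d.fst v
  · have := R.code_lt_off (v := v) h
    simp only [h, true_or, iff_true]
    omega
  · unfold code
    simp
  · have h1 := R.off_lt_code (v := v + 1) h
    rw [R.off_succ] at h1
    simp only [h.not_gt, h.ne', false_and, or_false, iff_false]
    omega

theorem code_injective : Function.Injective R.code := by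
  intro d d' h
  have hf : d.fst = d'.fst := by
    obtain h' | h' | h' := lt_trichotomy d.fst d'.fst
    · have := R.code_lt_off (v := d'.fst) h'
      have := R.off_lt_code (d := d') le_rfl
      omega
    · exact h'
    · have := R.code_lt_off (v := d.fst) h'
      have := R.off_lt_code (d := d) le_rfl
      omega
  refine R.ext_idx hf ?_
  unfold code at h
  rw [hf] at h
  omega

theorem code_pos (d : G.Dart) : 1 ≤ R.code d := by unfold code; omega

theorem code_lt_length (d : G.Dart) : R.code d < R.encode.length := by
  rw [← off_last]
  exact R.code_lt_off d.fst.2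

theorem getD_encode {t : List ℕ} (v : Fin N) (j : ℕ) (hj : j < (R.block v).length) :
    (R.encode ++ t).getD (R.off v + j) 0 = (R.block v)[j] := by
  have h : R.off v = (N :: ((List.finRange N).take v).flatMap R.block).length := by
    rw [off, List.length_cons, add_comm]
  rw [R.encode_eq v, List.append_assoc, h, List.getD_append_right _ _ _ _ (Nat.le_add_right _ _),
    Nat.add_sub_cancel_left, List.append_assoc, List.getD_append _ _ _ _ hj, List.getD_eq_getElem _ _ hj]

theorem getD_off {t : List ℕ} (v : Fin N) : (R.encode ++ t).getD (R.off v) 0 = (R.nbrs v).length :=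
  R.getD_encode v 0 (by simp [block])

theorem getD_nbr {t : List ℕ} (v : Fin N) {i : ℕ} (hi : i < (R.nbrs v).length) :
    (R.encode ++ t).getD (R.off v + 1 + i) 0 = (R.nbrs v)[i] := by
  rw [Nat.add_assoc, Nat.add_comm 1, R.getD_encode v (i + 1) (by simpa [block] using hi)]
  simp [block]

theorem getD_code {t : List ℕ} (d : G.Dart) : (R.encode ++ t).getD (R.code d) 0 = d.snd := by
  rw [code, R.getD_nbr _ (R.idx_lt d), R.nbrs_idx]

theorem getD_last {p : ℕ} {t : List ℕ} : (R.encode ++ p :: t).getD R.encode.length 0 = p := by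
  rw [List.getD_append_right _ _ _ _ le_rfl, Nat.sub_self, List.getD_cons_zero]

/-- The dart to the neighbour with index `i`. -/
def dartAt (v : Fin N) (i : ℕ) (hi : i < (R.nbrs v).length) : G.Dart :=
  ⟨(v, (R.nbrs v)[i]), (R.mem_iff _ _).1 (List.getElem_mem hi)⟩

theorem idx_dartAt (v : Fin N) (i : ℕ) (hi : i < (R.nbrs v).length) : R.idx (R.dartAt v i hi) = i :=
  (R.nodup v).idxOf_getElem i hi

theorem code_dartAt (v : Fin N) (i : ℕ) (hi : i < (R.nbrs v).length) :
    R.code (R.dartAt v i hi) = R.off v + 1 + i := by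
  rw [code, idx_dartAt]
  rfl

theorem code_next (d : G.Dart) : R.code (R.next d) =
    if R.idx d + 1 < (R.nbrs d.fst).length then R.code d + 1 else R.off d.fst + 1 := by
  rw [code, idx_next, next_fst, code]
  have := R.idx_lt d
  split_ifs with h
  · rw [Nat.mod_eq_of_lt h]
    omega
  · rw [show R.idx d + 1 = (R.nbrs d.fst).length by omega, Nat.mod_self]

theorem length_nbrs_le (v : Fin N) : (R.nbrs v).length ≤ N := by
  simpa using (R.nodup v).length_le_card

end RotationSystem

namespace Structured

variable {N : ℕ} {G : SimpleGraph (Fin N)} {R : RotationSystem G} {p : Fin N}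

/-! ### Parsing -/

/-- Reads one neighbour of the vertex in register `11`: the adjacency table in array `2` gives the
numbers of the darts, array `3` their origins, array `4` their successors, and array `23` lists
them. -/
def scanDart : Stmt :=
  .ops [.inp 16 10, .put 3 10 11, .plus 17 13 16, .put 2 17 10, .put 23 5 10, .inc 5 5 1,
    .const 18 1, .put 7 10 18, .inc 16 10 1, .put 4 10 16, .inc 10 10 1, .minus 14 14 18]

/-- Reads the neighbours of the vertex in register `11`. Array `0` gives the number of its first dart,
and array `1` the beginning of its row in the adjacency table. -/
def scanVertex : Stmt :=
  .ops [.inp 14 10, .inc 10 10 1, .put 0 11 10, .put 1 11 13, .inc 15 10 0] ;; .loop 14 scanDart ;;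
  .ops [.const 18 1, .minus 17 10 18, .put 4 17 15, .inc 11 11 1, .plus 13 13 1, .minus 12 12 18]

/-- The first pass over the input. -/
def scan : Stmt := .ops [.inp 1 10, .const 10 1, .inc 12 1 0] ;; .loop 12 scanVertex

/-- The arrays after the first `i` darts of vertex `v`. The successor of the last dart of a vertex is
corrected only when the vertex is finished, so that `next'` differs from `next`. -/
structure Scanned (R : RotationSystem G) (v i : ℕ) (σ : St) : Prop where
  first : ∀ u : Fin N, (u : ℕ) < v → σ.arr 0 u = R.off u + 1
  row : ∀ u : Fin N, (u : ℕ) < v → σ.arr 1 u = u * N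
  table : ∀ d : G.Dart, R.code d < R.off v + 1 + i → σ.arr 2 (d.fst * N + d.snd) = R.code d
  src : ∀ d : G.Dart, R.code d < R.off v + 1 + i → σ.arr 3 (R.code d) = d.fst
  one : ∀ d : G.Dart, R.code d < R.off v + 1 + i → σ.arr 7 (R.code d) = 1
  next : ∀ d : G.Dart, (d.fst : ℕ) < v → σ.arr 4 (R.code d) = R.code (R.next d)
  next' : ∀ d : G.Dart, (d.fst : ℕ) = v → R.idx d < i → σ.arr 4 (R.code d) = R.code d + 1
  list : ∃ l : List G.Dart, l.Nodup ∧ (∀ d, d ∈ l ↔ R.code d < R.off v + 1 + i) ∧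
    σ.reg 5 = l.length ∧ ∀ j (hj : j < l.length), σ.arr 23 j = R.code l[j]

/-- A dart is determined by its entry in the adjacency table. -/
theorem table_inj {d d' : G.Dart} (h : (d.fst : ℕ) * N + d.snd = d'.fst * N + d'.snd) : d = d' := by
  have h1 : ∀ e : G.Dart, ((e.fst : ℕ) * N + e.snd) / N = e.fst := fun e => by
    rw [Nat.add_comm, Nat.add_mul_div_right _ _ e.fst.pos, Nat.div_eq_of_lt e.snd.2, Nat.zero_add]
  have h2 : ∀ e : G.Dart, ((e.fst : ℕ) * N + e.snd) % N = e.snd := fun e => by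
    rw [Nat.mul_comm, Nat.mul_add_mod, Nat.mod_eq_of_lt e.snd.2]
  have h3 := h1 d
  have h4 := h2 d
  rw [h, h1] at h3
  rw [h, h2] at h4
  exact SimpleGraph.Dart.ext _ _ (Prod.ext (Fin.ext h3.symm) (Fin.ext h4.symm))

variable {v : Fin N} {i : ℕ} {σ σ' : St}

theorem Scanned.step (h : Scanned R v i σ) (hi : i < (R.nbrs v).length)
    (h0 : σ'.arr 0 = σ.arr 0) (h1 : σ'.arr 1 = σ.arr 1)
    (h2 : σ'.arr 2 = Function.update (σ.arr 2) (v * N + (R.nbrs v)[i]) (R.off v + 1 + i))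
    (h3 : σ'.arr 3 = Function.update (σ.arr 3) (R.off v + 1 + i) v)
    (h4 : σ'.arr 4 = Function.update (σ.arr 4) (R.off v + 1 + i) (R.off v + 1 + i + 1))
    (h7 : σ'.arr 7 = Function.update (σ.arr 7) (R.off v + 1 + i) 1)
    (h23 : σ'.arr 23 = Function.update (σ.arr 23) (σ.reg 5) (R.off v + 1 + i))
    (h5 : σ'.reg 5 = σ.reg 5 + 1) : Scanned R v (i + 1) σ' := by
  have hd := R.code_dartAt v i hi
  have hcase : ∀ d, R.code d < R.off v + 1 + (i + 1) ↔
      R.code d < R.off v + 1 + i ∨ d = R.dartAt v i hi := fun d => by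
    rw [← R.code_injective.eq_iff, hd]
    omega
  have hne : ∀ d, R.code d < R.off v + 1 + i → d ≠ R.dartAt v i hi := by
    rintro d hlt rfl
    omega
  refine ⟨h0 ▸ h.first, h1 ▸ h.row, fun d hlt => ?_, fun d hlt => ?_, fun d hlt => ?_, fun d hlt => ?_,
    fun d hv hlt => ?_, ?_⟩
  · rw [h2]
    obtain hlt | rfl := (hcase d).1 hlt
    · exact (Function.update_of_ne (fun he => hne d hlt (table_inj (d' := R.dartAt v i hi) he)) _ _).trans
        (h.table d hlt)
    · exact (Function.update_self _ _ _).trans hd.symm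
  · rw [h3]
    obtain hlt | rfl := (hcase d).1 hlt
    · rw [Function.update_of_ne hlt.ne]
      exact h.src d hlt
    · rw [hd]
      exact Function.update_self _ _ _
  · rw [h7]
    obtain hlt | rfl := (hcase d).1 hlt
    · rw [Function.update_of_ne hlt.ne]
      exact h.one d hlt
    · rw [hd]
      exact Function.update_self _ _ _
  · rw [h4, Function.update_of_ne (((R.code_lt_iff hi.le).2 (Or.inl hlt)).ne)]
    exact h.next d hlt
  · rw [h4]
    obtain hlt' | rfl := (hcase d).1 ((R.code_lt_iff hi).2 (Or.inr ⟨Fin.ext hv, hlt⟩))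
    · rw [Function.update_of_ne hlt'.ne]
      obtain h' | h' := (R.code_lt_iff hi.le).1 hlt'
      · exact absurd hv (ne_of_lt h')
      · exact h.next' d hv h'.2
    · rw [hd]
      exact Function.update_self _ _ _
  · obtain ⟨l, hn, hm, hr, hl⟩ := h.list
    refine ⟨l ++ [R.dartAt v i hi], ?_, fun d => ?_, ?_, fun j hj => ?_⟩
    · rw [List.nodup_append]
      refine ⟨hn, List.nodup_singleton _, fun a ha b hb => ?_⟩
      rw [List.mem_singleton] at hb
      rw [hb]
      exact hne a ((hm a).1 ha)
    · rw [hcase, List.mem_append, List.mem_singleton, hm]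
    · rw [h5, hr, List.length_append, List.length_singleton]
    · rw [List.length_append, List.length_singleton] at hj
      rw [h23, hr]
      obtain hj | rfl := Nat.lt_succ_iff_lt_or_eq.1 hj
      · rw [Function.update_of_ne hj.ne, hl j hj, List.getElem_append_left hj]
      · rw [Function.update_self, List.getElem_concat_length rfl, hd]

theorem Scanned.finish (h : Scanned R v (R.nbrs v).length σ)
    (h0 : σ'.arr 0 = σ.arr 0) (h1 : σ'.arr 1 = σ.arr 1) (h0' : σ.arr 0 v = R.off v + 1)
    (h1' : σ.arr 1 v = v * N) (h2 : σ'.arr 2 = σ.arr 2) (h3 : σ'.arr 3 = σ.arr 3)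
    (h4 : σ'.arr 4 = Function.update (σ.arr 4) (R.off v + (R.nbrs v).length) (R.off v + 1))
    (h7 : σ'.arr 7 = σ.arr 7) (h23 : σ'.arr 23 = σ.arr 23)
    (h5 : σ'.reg 5 = σ.reg 5) : Scanned R (v + 1) 0 σ' := by
  have hcase : ∀ d, R.code d < R.off (v + 1) + 1 + 0 ↔ R.code d < R.off v + 1 + (R.nbrs v).length := by
    intro d
    rw [← R.off_succ]
    obtain hd | hd := Nat.lt_or_ge d.fst (v + 1)
    · have := R.code_lt_off hd
      omega
    · have := R.off_lt_code hd
      omega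
  have hlt : ∀ u : Fin N, (u : ℕ) < v + 1 → (u : ℕ) < v ∨ u = v := fun u hu => by
    rw [Fin.ext_iff]
    omega
  refine ⟨fun u hu => ?_, fun u hu => ?_, fun d hd => ?_, fun d hd => ?_, fun d hd => ?_, fun d hd => ?_,
    fun d _ hd => absurd hd (Nat.not_lt_zero _), ?_⟩
  · rw [h0]
    obtain hu | rfl := hlt u hu
    · exact h.first u hu
    · exact h0'
  · rw [h1]
    obtain hu | rfl := hlt u hu
    · exact h.row u hu
    · exact h1'
  · rw [h2]
    exact h.table d ((hcase d).1 hd)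
  · rw [h3]
    exact h.src d ((hcase d).1 hd)
  · rw [h7]
    exact h.one d ((hcase d).1 hd)
  · rw [h4]
    obtain hd | hd := hlt d.fst hd
    · have := R.code_lt_off hd
      rw [Function.update_of_ne (by omega)]
      exact h.next d hd
    · have h6 := R.idx_lt d
      have h8 := h.next' d (congrArg Fin.val hd) (hd ▸ h6)
      rw [R.code_next]
      rw [hd] at h6 ⊢
      split_ifs with h9
      · rw [Function.update_of_ne, h8]
        rw [RotationSystem.code, hd]
        omega
      · rw [RotationSystem.code, hd, show R.off v + 1 + R.idx d = R.off v + (R.nbrs v).length by omega,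
          Function.update_self]
  · obtain ⟨l, hn, hm, hr, hl⟩ := h.list
    exact ⟨l, hn, fun d => (hm d).trans (hcase d).symm, h5.trans hr, fun j hj => h23 ▸ hl j hj⟩

theorem wp_scan {V : ℕ} {t : List ℕ} (hV : N * N + N ≤ V) :
    WP (R.encode ++ t) V scan (fun σ => Scanned R N 0 σ ∧ σ.reg 10 = R.encode.length ∧
      σ.time ≤ 4 + 16 * R.encode.length) St.init := by
  have hx0 : (R.encode ++ t).getD 0 0 = N := rfl
  refine WP.seq (WP.ops ?_)
  simp only [pre, Op.eval, Op.Fits, true_and]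
  refine ⟨?_, ?_⟩
  · simp only [St.init]
    rw [hx0]
    omega
  refine WP.loop (n := N) (fun n τ => ∃ v, v + n = N ∧ τ.reg 12 = n ∧ τ.reg 1 = N ∧ τ.reg 11 = v ∧
    τ.reg 13 = v * N ∧ τ.reg 10 = R.off v ∧ Scanned R v 0 τ ∧ τ.time ≤ 3 + 16 * R.off v) ?_ ?_ ?_
  · refine ⟨0, Nat.zero_add N, ?_, ?_, ?_, ?_, ?_, ?_, ?_⟩
    · simp [St.init, -List.getD_eq_getElem?_getD, hx0]
    · simp [St.init, -List.getD_eq_getElem?_getD, hx0]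
    · simp [St.init]
    · simp [St.init]
    · simp [R.off_zero]
    · have hno : ∀ d : G.Dart, ¬ R.code d < R.off 0 + 1 + 0 := fun d h => by
        have := R.off_lt_code (Nat.zero_le d.fst)
        omega
      exact ⟨fun u hu => absurd hu (Nat.not_lt_zero _), fun u hu => absurd hu (Nat.not_lt_zero _),
        fun d h => absurd h (hno d), fun d h => absurd h (hno d), fun d h => absurd h (hno d),
        fun d h => absurd h (Nat.not_lt_zero _), fun d _ h => absurd h (Nat.not_lt_zero _), [],
        List.nodup_nil, fun d => by simpa using hno d, by simp [St.init], by simp⟩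
    · simp [St.init, R.off_zero]
  · rintro n τ - ⟨v, hvn, r12, r1, r11, r13, r10, hS, ht⟩ h0
    have hv : v < N := by omega
    obtain ⟨v, rfl⟩ : ∃ u : Fin N, (u : ℕ) = v := ⟨⟨v, hv⟩, rfl⟩
    have hdeg := R.length_nbrs_le v
    have hrow : (v : ℕ) * N + N ≤ N * N := by
      have := Nat.mul_le_mul_right N (show (v : ℕ) + 1 ≤ N from hv)
      rw [Nat.add_mul, Nat.one_mul] at this
      exact this
    refine WP.seq (WP.ops ?_)
    simp only [pre, Op.eval, Op.Fits, true_and]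
    refine ⟨?_, ?_⟩
    · simp only [St.tick, r10, R.getD_off]
      omega
    refine WP.seq (WP.mono (WP.loop (n := (R.nbrs v).length) (fun m τ' => ∃ i, i + m = (R.nbrs v).length ∧
      τ'.reg 14 = m ∧ τ'.reg 10 = R.off v + 1 + i ∧ Scanned R v i τ' ∧
      τ'.time ≤ τ.time + 6 + 13 * i) (Q := fun τ' => τ'.reg 10 = R.off v + 1 + (R.nbrs v).length ∧
      Scanned R v (R.nbrs v).length τ' ∧ τ'.time ≤ τ.time + 7 + 13 * (R.nbrs v).length) ?_ ?_ ?_)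
      fun τ₂ hF₂ ⟨r10₂, hS₂, ht₂⟩ => WP.ops ?_)
    · refine ⟨0, Nat.zero_add _, ?_, ?_, ?_, ?_⟩
      · simp [St.tick, r10, -List.getD_eq_getElem?_getD, R.getD_off]
      · simp [St.tick, r10]
      · refine ⟨fun u hu => ?_, fun u hu => ?_, hS.table, hS.src, hS.one, hS.next, hS.next', ?_⟩
        · simpa [St.tick, r11, Function.update_of_ne hu.ne] using hS.first u hu
        · simpa [St.tick, r11, Function.update_of_ne hu.ne] using hS.row u hu
        · simpa [St.tick] using hS.list
      · simp [St.tick]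
    · rintro m τ' hF ⟨i, him, r14', r10', hS', ht'⟩ h0'
      have hi : i < (R.nbrs v).length := by omega
      have r11' : τ'.reg 11 = v := by rw [hF.reg 11 rfl]; simpa [St.tick] using r11
      have r13' : τ'.reg 13 = v * N := by rw [hF.reg 13 rfl]; simpa [St.tick] using r13
      have hw := ((R.nbrs v)[i]).2
      have hget := R.getD_nbr (t := t) v hi
      refine WP.ops ?_
      simp only [pre, Op.eval, Op.Fits, true_and]
      refine ⟨?_, ?_, m - 1, by omega, i + 1, by omega, ?_, ?_, hS'.step hi ?_ ?_ ?_ ?_ ?_ ?_ ?_ ?_, ?_⟩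
      · simp only [St.tick, r10', hget]
        omega
      · simp [St.tick, r10', -List.getD_eq_getElem?_getD, hget, r13']
        omega
      · simp [St.tick, r14']
      · simp [St.tick, r10']
        omega
      · simp [St.tick]
      · simp [St.tick]
      · simp [St.tick, r10', -List.getD_eq_getElem?_getD, hget, r13']
      · simp [St.tick, r10', r11']
      · simp [St.tick, r10']
      · simp [St.tick, r10']
      · simp [St.tick, r10']
      · simp [St.tick]
      · simp [St.tick]
        omega
    · rintro m τ' - ⟨i, him, r14', r10', hS', ht'⟩ h0'
      obtain rfl : i = (R.nbrs v).length := by omega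
      exact ⟨r10', ⟨hS'.first, hS'.row, hS'.table, hS'.src, hS'.one, hS'.next, hS'.next', hS'.list⟩,
        by simp only [St.tick]; omega⟩
    · have r11₂ : τ₂.reg 11 = v := by rw [hF₂.reg 11 rfl]; simpa [St.tick] using r11
      have r13₂ : τ₂.reg 13 = v * N := by rw [hF₂.reg 13 rfl]; simpa [St.tick] using r13
      have r12₂ : τ₂.reg 12 = n := by rw [hF₂.reg 12 rfl]; simpa [St.tick] using r12
      have r1₂ : τ₂.reg 1 = N := by rw [hF₂.reg 1 rfl]; simpa [St.tick] using r1
      have r15₂ : τ₂.reg 15 = R.off v + 1 := by rw [hF₂.reg 15 rfl]; simp [St.tick, r10]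
      have a0₂ : τ₂.arr 0 v = R.off v + 1 := by rw [hF₂.arr 0 rfl]; simp [St.tick, r10, r11]
      have a1₂ : τ₂.arr 1 v = v * N := by rw [hF₂.arr 1 rfl]; simp [St.tick, r13, r11]
      have hoff := R.off_succ v
      simp only [pre, Op.eval, Op.Fits, true_and]
      refine ⟨?_, n - 1, by omega, v + 1, by omega, ?_, ?_, ?_, ?_, ?_,
        hS₂.finish ?_ ?_ a0₂ a1₂ ?_ ?_ ?_ ?_ ?_ ?_, ?_⟩
      · simp [r13₂, r1₂]
        omega
      · simp [r12₂]
      · simp [r1₂]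
      · simp [r11₂]
      · simp [r13₂, r1₂]
        ring
      · simp [r10₂, hoff]
      · simp
      · simp
      · simp
      · simp
      · simp [r10₂, r15₂, show R.off v + 1 + (R.nbrs v).length - 1 = R.off v + (R.nbrs v).length by omega]
      · simp
      · simp
      · simp
      · rw [hoff]
        omega
  · rintro n τ - ⟨v, hvn, r12, r1, r11, r13, r10, hS, ht⟩ h0
    obtain rfl : v = N := by omega
    exact ⟨⟨hS.first, hS.row, hS.table, hS.src, hS.one, hS.next, hS.next', hS.list⟩,
      r10.trans R.off_last, by simp only [St.tick]; rw [← R.off_last]; omega⟩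

end Structured

namespace RotationSystem

/-! ### The size of the input -/

variable {N : ℕ} {G : SimpleGraph (Fin N)} (R : RotationSystem G)

theorem length_encode : R.encode.length = 1 + N + 2 * Nat.card G.edgeSet := by
  classical
  have h : ∀ v, (R.nbrs v).length = G.degree v := fun v => by
    rw [← List.toFinset_card_of_nodup (R.nodup v), ← G.card_neighborFinset_eq_degree]
    congr 1
    ext w
    rw [List.mem_toFinset, R.mem_iff, SimpleGraph.mem_neighborFinset]
  have h2 : Nat.card G.edgeSet = G.edgeFinset.card := by
    rw [Nat.card_eq_fintype_card, SimpleGraph.edgeFinset_card]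
  rw [h2, ← G.sum_degrees_eq_twice_card_edges, encode, List.length_cons, List.length_flatMap]
  have h3 : ((List.finRange N).map fun v => ((R.nbrs v).length :: (R.nbrs v).map Fin.val).length) =
      (List.finRange N).map fun v => G.degree v + 1 :=
    List.map_congr_left fun v _ => by rw [List.length_cons, List.length_map, h]
  rw [h3, ← List.sum_toFinset _ (List.nodup_finRange N), List.toFinset_finRange, Finset.sum_add_distrib]
  simp
  omega

variable {R} {g : ℕ}

theorem HasGenus.two_mul_le (hg : R.HasGenus g) (hg1 : 1 ≤ g) (p : Fin N) :
    2 * g ≤ Nat.card G.edgeSet + 1 ∧ 1 ≤ Nat.card G.edgeSet := by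
  have hN := p.pos
  unfold HasGenus at hg
  omega

/-- A connected graph with an edge has no isolated vertex. -/
theorem exists_dart (hG : G.Connected) (hg : R.HasGenus g) (hg1 : 1 ≤ g) (p : Fin N) :
    0 < (R.nbrs p).length := by
  obtain ⟨-, h⟩ := hg.two_mul_le hg1 p
  have : Nonempty G.edgeSet := (Nat.card_pos_iff.1 h).1
  obtain ⟨⟨e, he⟩⟩ := this
  induction e with
  | h u v =>
    have hne : u ≠ v := G.ne_of_adj he
    obtain ⟨w, hw⟩ : ∃ w, w ≠ p := by
      by_contra! hc
      exact hne ((hc u).trans (hc v).symm)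
    obtain ⟨q⟩ := hG.preconnected p w
    cases q with
    | nil => exact absurd rfl hw
    | cons hadj _ => exact List.length_pos_of_mem ((R.mem_iff _ _).2 hadj)

end RotationSystem

namespace Structured

variable {N : ℕ} {G : SimpleGraph (Fin N)} {R : RotationSystem G} {p : Fin N}

/-! ### The algorithm -/

/-- For each dart, the numbers of its reversal and of the next dart around its face. -/
def link : Stmt :=
  forEach 23 5 (.ops [.inp 26 22, .get 27 1 26, .get 28 3 22, .plus 27 27 28, .get 28 2 27,
    .put 5 22 28, .get 29 4 28, .put 6 22 29])

/-- Reads the rotation system and the base point. -/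
def parse : Stmt := scan ;; .ops [.inc 2 10 0, .inp 3 10, .get 4 0 3] ;; link

/-- The part `t` of the input that follows the base point plays no role. -/
theorem wp_parse (h0 : 0 < (R.nbrs p).length) {V : ℕ} {t : List ℕ} (hV : N * N + N ≤ V) :
    WP (R.encode ++ (p : ℕ) :: t) V parse (fun σ => (∃ l, Parsed R (R.dartAt p 0 h0) R.code l σ) ∧
      σ.reg 2 = R.encode.length ∧ σ.time ≤ 10 + 28 * R.encode.length) St.init := by
  have hinit : WP (R.encode ++ (p : ℕ) :: t) V parse (fun σ => ((∃ l : List G.Dart, l.Nodup ∧ (∀ d, d ∈ l) ∧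
      σ.reg 5 = l.length ∧ (∀ j (hj : j < l.length), σ.arr 23 j = R.code l[j]) ∧
      ∀ d, (σ.arr 5 (R.code d) = R.code d.symm ∧ σ.arr 6 (R.code d) = R.code (R.faceNext d))) ∧
      σ.reg 4 = R.code (R.dartAt p 0 h0) ∧ (∀ d : G.Dart, σ.arr 3 (R.code d) = d.fst) ∧
      (∀ d, σ.arr 4 (R.code d) = R.code (R.next d)) ∧ ∀ d, σ.arr 7 (R.code d) = 1) ∧
      σ.reg 2 = R.encode.length ∧ σ.time ≤ 10 + 28 * R.encode.length) St.init := by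
    refine WP.seq (WP.mono (wp_scan hV) fun σ₁ _ ⟨hS, h10, ht⟩ => WP.seq (WP.ops ?_))
    have hcode : ∀ d : G.Dart, R.code d < R.off N + 1 + 0 := fun d => by
      have := R.code_lt_off d.fst.2
      omega
    obtain ⟨l, hn, hm, hr, hl⟩ := hS.list
    have hmem : ∀ d, d ∈ l := fun d => (hm d).2 (hcode d)
    have hlen : l.length ≤ R.encode.length := by
      have : (l.map R.code).toFinset ⊆ Finset.range R.encode.length := fun c hc => by
        obtain ⟨d, -, rfl⟩ := List.mem_map.1 (List.mem_toFinset.1 hc)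
        exact Finset.mem_range.2 (R.code_lt_length d)
      have := Finset.card_le_card this
      rwa [List.toFinset_card_of_nodup (hn.map R.code_injective), List.length_map,
        Finset.card_range] at this
    have hp := p.2
    simp only [pre, Op.eval, Op.Fits, true_and]
    refine ⟨?_, ?_⟩
    · simp only [ne_eq, Nat.reduceEqDiff, not_false_eq_true, Function.update_of_ne, h10,
        R.getD_last]
      omega
    refine WP.mono (wp_forEach (l := l) (code := R.code) (fun j _ a _ => ∀ d ∈ l.take j,
      a 5 (R.code d) = R.code d.symm ∧ a 6 (R.code d) = R.code (R.faceNext d)) 8 (by norm_num)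
      ⟨rfl, rfl, rfl⟩ ?_ ?_ ?_ ?_) fun σ' hF ⟨hI, ht'⟩ => ?_
    · simpa using hl
    · simpa using hr
    · simp
    · intro j hj τ hF _ h22 hI
      have f1 := hF.arr 1 rfl
      have f2 := hF.arr 2 rfl
      have f3 := hF.arr 3 rfl
      have f4 := hF.arr 4 rfl
      simp only at f1 f2 f3 f4
      set d := l[j] with hd
      have g1 : τ.arr 1 d.snd = d.snd * N := by rw [f1]; exact hS.row d.snd d.snd.2
      have g3 : τ.arr 3 (R.code d) = d.fst := by rw [f3]; exact hS.src d (hcode d)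
      have g2 : τ.arr 2 (d.snd * N + d.fst) = R.code d.symm := by
        rw [f2]; exact hS.table d.symm (hcode _)
      have g4 : τ.arr 4 (R.code d.symm) = R.code (R.faceNext d) := by
        rw [f4]; exact hS.next d.symm d.snd.2
      have gx : (R.encode ++ (p : ℕ) :: t).getD (R.code d) 0 = d.snd := R.getD_code d
      have hlt1 := d.snd.2
      have hlt2 := d.fst.2
      have hrow : (d.snd : ℕ) * N + N ≤ N * N := by
        have := Nat.mul_le_mul_right N (show (d.snd : ℕ) + 1 ≤ N from hlt1)
        rwa [Nat.add_mul, Nat.one_mul] at this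
      refine WP.ops ?_
      simp only [pre, Op.eval, Op.Fits, true_and]
      refine ⟨?_, ?_, ?_, ?_⟩
      · rw [h22, gx]
        omega
      · simp [h22, -List.getD_eq_getElem?_getD, gx, g1, g3]
        omega
      · rw [List.take_succ_eq_append_getElem hj, ← hd]
        intro e he
        rw [List.mem_append, List.mem_singleton] at he
        by_cases hed : e = d
        · subst hed
          simp [h22, -List.getD_eq_getElem?_getD, gx, g1, g2, g3, g4]
        · have hne := R.code_injective.ne hed
          simpa [h22, -List.getD_eq_getElem?_getD, gx, g1, g2, g3, g4, St.tick, hne] using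
            hI e (he.resolve_right hed)
      · simp
    · rw [List.take_length] at hI
      refine ⟨⟨⟨l, hn, hmem, ?_, ?_, fun d => hI d (hmem d)⟩, ?_, ?_, ?_, ?_⟩, ?_, ?_⟩
      · rw [hF.reg 5 rfl]
        simpa using hr
      · rw [hF.arr 23 rfl]
        simpa using hl
      · rw [hF.reg 4 rfl, R.code_dartAt]
        simp [h10, -List.getD_eq_getElem?_getD, R.getD_last, hS.first p p.2]
      · intro d
        rw [hF.arr 3 rfl]
        exact hS.src d (hcode d)
      · intro d
        rw [hF.arr 4 rfl]
        exact hS.next d d.fst.2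
      · intro d
        rw [hF.arr 7 rfl]
        exact hS.one d (hcode d)
      · rw [hF.reg 2 rfl]
        simp [h10]
      · simp only at ht'
        omega
  refine hinit.mono fun σ hF ⟨⟨⟨l, hn, hm, h5, h23, hd⟩, h4, a3, a4, a7⟩, h2, ht⟩ => ⟨⟨l, ?_⟩, h2, ht⟩
  refine ⟨R.code_injective, R.code_pos, fun d => h2 ▸ R.code_lt_length d, h4, hm, hn, h23, h5, a3, a4,
    fun d => (hd d).1, fun d => (hd d).2, a7, fun k hk hk' i => ?_, hF.out rfl⟩
  have : parse.wa k = false := by interval_cases k <;> rfl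
  rw [hF.arr k this]
  rfl

/-- The algorithm. Darts are numbered by their positions in the input. The arrays contain
* `0`, `1`, `2`: for each vertex its first dart and the beginning of its row in the adjacency table, and
  this table;
* `3`, `4`, `5`, `6`, `7`: for each dart its origin, the next dart around the origin, its reverse, the next
  dart around its face, and `1`;
* `8`, `9`, `10`, `11`: the entrances, the levels and the queue of the search for the spanning tree, and
  marks on its edges;
* `12`, `13`: marks on the edges outside of the tree, and the total level of the endpoints of each edge;
* `14`, `15`, `16`: the entrances, the levels and the queue of the current search over the faces;
* `17`: marks on the edges of the cotree (array `18` takes the marks of the later searches, which are not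
  needed);
* `19`, `20`: the edges outside of both trees, before and after the exchanges;
* `21`, `22`: for each dart the number of strands along it and the first of their numbers;
* `23`, `24`: the list of all darts, and a stack.

The registers `1` to `6` contain the number of vertices, the length of the description of the rotation
system, the base point, its first dart, the number of darts, and the number of loops. -/
def schema : Stmt := parse ;; core

/-- The algorithm does not use the polygonal schema in the input: `t` is arbitrary. -/
theorem computes_schema {g : ℕ} (hG : G.Connected) (hg1 : 1 ≤ g) (hg : R.HasGenus g) (t : List ℕ) :
    ∃ (P : LoopSystem G p (2 * g)) (h : P.IsPolygonalSchema R), P.ChordFree R h.length_pos ∧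
      RAM.Computes (schema.code 0) (R.encode ++ (p : ℕ) :: t) P.encode
        (8 * (10 + 28 * R.encode.length + 600 * (g * R.encode.length)))
        (32 * (4 * (R.encode.length * R.encode.length) + 2 * R.encode.length +
          64 * (10 + 28 * R.encode.length + 600 * (g * R.encode.length) + 1)) + 32) := by
  have hlen := R.length_encode
  obtain ⟨hg2, -⟩ := hg.two_mul_le hg1 p
  obtain ⟨L, hL⟩ : ∃ L, L = R.encode.length := ⟨_, rfl⟩
  have hNL : N * N + N ≤ L * L := by
    have : N + 1 ≤ L := by omega
    calc N * N + N = N * (N + 1) := by ring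
      _ ≤ L * L := Nat.mul_le_mul (by omega) this
  have hgL : L * (4 * g) ≤ 4 * (L * L) := by
    calc L * (4 * g) ≤ L * (4 * L) := Nat.mul_le_mul_left _ (by omega)
      _ = _ := by ring
  obtain ⟨P, hP, hc, σ', hx⟩ : ∃ (P : LoopSystem G p (2 * g)) (h : P.IsPolygonalSchema R),
      P.ChordFree R h.length_pos ∧ WP (R.encode ++ (p : ℕ) :: t) (4 * (L * L) + 2 * L) schema
        (fun σ => σ.out = P.encode ∧ σ.time ≤ 10 + 28 * L + 600 * (g * L)) St.init := by
    have h : WP (R.encode ++ (p : ℕ) :: t) (4 * (L * L) + 2 * L) schema (fun σ =>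
        ∃ (P : LoopSystem G p (2 * g)) (h : P.IsPolygonalSchema R), P.ChordFree R h.length_pos ∧
          σ.out = P.encode ∧ σ.time ≤ 10 + 28 * L + 600 * (g * L)) St.init := by
      refine WP.seq (WP.mono (wp_parse (R.exists_dart hG hg hg1 p) (by omega))
        fun σ _ ⟨⟨l, hl⟩, h2, ht⟩ => ?_)
      refine WP.mono (wp_core hG hg1 hg (root := R.dartAt p 0 _) rfl hl ?_ ?_)
        fun σ' _ ⟨P, h, hc, ho, ht'⟩ => ⟨P, h, hc, ho, ?_⟩
      · rw [h2, ← hL]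
        omega
      · rw [h2, ← hL]
        omega
      · rw [h2, ← hL] at ht'
        rw [← hL] at ht
        omega
    obtain ⟨σ', hx, P, h, hc, ho⟩ := h
    exact ⟨P, h, hc, σ', hx, ho⟩
  refine ⟨P, hP, hc, ?_⟩
  rw [← hL]
  exact computes_of_WP (cm := 64) (by decide) ⟨σ', hx⟩

end Structured

/-! ### The time bound -/

theorem RAM.Computes.mono {prog : Program} {x y : List ℕ} {T T' W W' : ℕ} (h : Computes prog x y T W)
    (hT : T ≤ T') (hW : W ≤ W') : Computes prog x y T' W' := by
  obtain ⟨t, ht, hp, ho, hb⟩ := h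
  exact ⟨t, ht.trans hT, hp, ho, fun s hs r => ⟨(hb s hs r).1.trans hW, (hb s hs r).2.trans hW⟩⟩

theorem theorem1 :
    ∃ (prog : RAM.Program) (C D : ℕ),
      ∀ (N g : ℕ) (G : SimpleGraph (Fin N)) (R : RotationSystem G) (p : Fin N),
        G.Connected → 1 ≤ g → R.HasGenus g →
        ∀ P : LoopSystem G p (2 * g), P.IsCanonicalSchema R →
          ∃ (P' : LoopSystem G p (2 * g)) (hP' : P'.IsPolygonalSchema R),
            P'.ChordFree R hP'.length_pos ∧
            RAM.Computes prog (R.encode ++ (p : ℕ) :: P.encode) P'.encode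
              (C * (g * R.size))
              (((R.encode ++ (p : ℕ) :: P.encode).length + 2) ^ D) := by
  -- The time is `8 * 638` times `g` times the length of the description of the rotation system, which is at
  -- most `3` times the size.
  refine ⟨Structured.schema.code 0, 8 * 638 * 3, 22, fun N g G R p hG hg1 hg P _ => ?_⟩
  obtain ⟨P', h, hc, hR⟩ := Structured.computes_schema (p := p) hG hg1 hg P.encode
  refine ⟨P', h, hc, hR.mono ?_ ?_⟩
  · have h1 : R.encode.length ≤ 3 * R.size := by
      rw [R.length_encode, RotationSystem.size]
      have := p.pos
      omega
    have h2 : g * R.encode.length ≤ 3 * (g * R.size) := by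
      calc g * R.encode.length ≤ g * (3 * R.size) := Nat.mul_le_mul_left _ h1
        _ = _ := by ring
    have h3 : R.encode.length ≤ g * R.encode.length := Nat.le_mul_of_pos_left _ hg1
    have h4 : 1 ≤ R.encode.length := by
      rw [R.length_encode]
      omega
    omega
  · obtain ⟨hg2, -⟩ := hg.two_mul_le hg1 p
    have hl := R.length_encode
    obtain ⟨L, hL⟩ : ∃ L, L = R.encode.length := ⟨_, rfl⟩
    rw [← hL] at hl ⊢
    have h1 : g ≤ L := by omega
    have h2 : g * L ≤ L * L := Nat.mul_le_mul_right _ h1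
    calc _ ≤ 2 ^ 20 * ((L + 2) * (L + 2)) := by nlinarith
      _ ≤ (L + 2) ^ 20 * ((L + 2) * (L + 2)) :=
        Nat.mul_le_mul_right _ (Nat.pow_le_pow_left (by omega) _)
      _ = (L + 2) ^ 22 := by ring
      _ ≤ _ := Nat.pow_le_pow_left (by rw [List.length_append, ← hL]; omega) _
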